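/- **Setting.** Let $\varphi_0:\mathbb R\to[0,1]$ be smooth with $\varphi_0=1$ on $[-1,1]$ and $\varphi_0=0$ for $|\xi|\ge 2$; put $\varphi_j(\xi)=\varphi_0(2^{-j}\xi)-\varphi_0(2^{-j+1}\xi)$ for $j\ge1$, and for tempered distributions on $\mathbb R$ let $S_jf=\mathcal F^{-1}(\varphi_j\hat f)$, $S_{<n}=\sum_{0\le k<n}S_k$, $S_{\ge n}=\sum_{k\ge \max(n,0)}S_k=1-S_{<n}$. For each $l\ge0$ let $\mathcal Q_l$ be a partition of $\mathbb R$ into intervals of length $2^l$, and for each $j\ge0$ let $1=\sum_{Q\in\mathcal Q_{2j}}\chi_Q^2$ be a smooth square partition of unity with $\chi_Q\sim1$ on $Q$ and $\operatorname{supp}\chi_Q\subset B(Q,\tfrac12)$. For a norm $U$ put $\|u\|_{l^2_{2j}U}^2=\sum_{Q\in\mathcal Q_{2j}}\|\chi_Qu\|_U^2$. For functions on $[0,1]\times\mathbb R$ let $$\|u\|_X=\sup_{l\ge0}\sup_{Q\in\mathcal Q_l}2^{-l/2}\|u\|_{L^2([0,1]\times Q)},\qquad \|u\|_{X_j}=2^j\|u\|_X+\|u\|_{L^\infty_tL^2_x},$$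 $$\|f\|_Y=\inf\Big\{\sum_k|c_k|:\ f=\sum_kc_ka_k,\ a_k\text{ atoms}\Big\},\qquad \|f\|_{Y_j}=\inf_{f=f_1+f_2}\big(2^{-j}\|f_1\|_Y+\|f_2\|_{L^1_tL^2_x}\big),$$ where $a$ is an atom if for some $l\ge0$ and $Q\in\mathcal Q_l$ it is supported in $[0,1]\times Q$ and $\|a\|_{L^2}\le2^{-l/2}$. Finally, for $s\in\mathbb R$, $$\|f\|_{l^2H^s}^2=\sum_{j\ge0}2^{2js}\|S_jf\|_{l^2_{2j}L^2}^2,\quad \|u\|_{l^2X^s}^2=\sum_{j\ge0}2^{2js}\|S_ju\|_{l^2_{2j}X_j}^2,\quad \|f\|_{l^2Y^s}^2=\sum_{j\ge0}2^{2js}\|S_jf\|_{l^2_{2j}Y_j}^2 ,$$ the first for tempered distributions on $\mathbb R$, the other two for functions $u$, $f$ of $t\in[0,1]$ with values in tempered distributions on $\mathbb R$. A product $uv$ is the limit of $S_{<N}u\,S_{<N}v$ as $N\to\infty$ in the sense of tempered distributions on $\mathbb R$ (for almost every $t$, if there is a time variable). $A\lesssim B$ means $A\le CB$, where $C$ depends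 only on $\varphi_0$, the partitions and the exponents $s,\alpha,\beta,\sigma\in\mathbb R$, but not on $j$ or on the functions. **Proposition.** If the norms on the right-hand sides are finite, the following products exist and the following estimates hold. a) For $s>\tfrac12$, $$\|uv\|_{l^2H^s}\lesssim\|u\|_{l^2H^s}\|v\|_{l^2H^s},\qquad \|uv\|_{l^2X^s}\lesssim\|u\|_{l^2X^s}\|v\|_{l^2X^s},$$ and in the second case $uv\in C([0,1],H^s)$ (after a modification on a null set of times) if $u,v\in C([0,1],H^s)$. b) For $\alpha+\beta>s+\tfrac12$, $\alpha,\beta\ge s-1$ and $\alpha+\beta\ge0$ (the last condition is automatic if $s\ge0$), $$\|uv\|_{l^2Y^s}\lesssim\|u\|_{l^2X^\alpha}\|v\|_{l^2X^\beta}.$$ c) For $\alpha+\beta>s+\tfrac12$ and all $j\ge0$, $$\|S_{<j-4}u\,S_jv\|_{l^2Y^s}\lesssim\|u\|_{l^2X^\alpha}\|S_jv\|_{l^2X^\beta}\quad\text{if }\beta\ge s-1,$$ $$\|S_j(S_{\ge j-4}u\,S_{\ge j-4}v)\|_{l^2Y^s}\lesssim2^{(s+\frac12-\alpha-\beta)j}\|u\|_{l^2X^\alpha}\|v\|_{l^2X^\beta}\quad\text{if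 }\alpha,\beta\ge0.$$ d) For $s\ge0$, $\sigma>\tfrac12$ and all $j\ge0$, $$\|S_{<j-4}u\,S_jv\|_{l^2H^s}\lesssim\|u\|_{l^2H^\sigma}\|S_jv\|_{l^2H^s},$$ $$\|S_{<j-4}u\,S_jv\|_{l^2X^s}\lesssim\|u\|_{l^2X^\sigma}\|S_jv\|_{l^2X^s},$$ $$\|S_j(S_{\ge j-4}u\,S_{\ge j-4}v)\|_{l^2X^s}\lesssim2^{(s+\frac12-2\sigma)j}\|u\|_{l^2X^\sigma}\|v\|_{l^2X^\sigma}$$ (in particular with the factor $2^{-j/2}$ when $s\le2\sigma-1$), $$\|S_{<j-4}u\,S_jv\|_{l^2Y^s}\lesssim\|u\|_{l^2X^\sigma}\|S_jv\|_{l^2Y^s}.$$ -/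

import Mathlib

open MeasureTheory Filter Topology
open scoped ENNReal SchwartzMap

noncomputable section

namespace BilinearKdV

/-! ### Littlewood-Paley decomposition in the space variable -/

/-- `φ₀ : ℝ → [0,1]` is smooth, equal to `1` on `[-1,1]` and to `0` for `|ξ| ≥ 2`. -/
structure IsCutoff (φ₀ : ℝ → ℝ) : Prop where
  smooth : ContDiff ℝ (⊤ : ℕ∞) φ₀
  mem_Icc : ∀ ξ, φ₀ ξ ∈ Set.Icc (0 : ℝ) 1
  eq_one : ∀ ξ, |ξ| ≤ 1 → φ₀ ξ = 1
  eq_zero : ∀ ξ, 2 ≤ |ξ| → φ₀ ξ = 0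

/-- The symbols `φ_j` of the Littlewood-Paley projections:
`φ_j(ξ) = φ₀(2^{-j} ξ) - φ₀(2^{-j+1} ξ)` for `j > 0`. -/
def lpSymbol (φ₀ : ℝ → ℝ) : ℕ → ℝ → ℝ
  | 0 => φ₀
  | j + 1 => fun ξ => φ₀ (ξ / 2 ^ (j + 1)) - φ₀ (ξ / 2 ^ j)

/-- `S_j f = 𝓕⁻¹ (φ_j 𝓕 f)` on tempered distributions on `ℝ`. -/
def lpProj (φ₀ : ℝ → ℝ) (j : ℕ) : 𝓢'(ℝ, ℂ) →L[ℂ] 𝓢'(ℝ, ℂ) :=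
  TemperedDistribution.fourierMultiplierCLM ℂ (fun ξ => (lpSymbol φ₀ j ξ : ℂ))

/-- `S_{<n} f = ∑_{k<n} S_k f`. -/
def lpLT (φ₀ : ℝ → ℝ) (n : ℕ) (f : 𝓢'(ℝ, ℂ)) : 𝓢'(ℝ, ℂ) :=
  ∑ k ∈ Finset.range n, lpProj φ₀ k f

/-- `S_{≥n} f = ∑_{k≥n} S_k f`, that is `f - S_{<n} f`, as `∑_k S_k f = f`. -/
def lpGE (φ₀ : ℝ → ℝ) (n : ℕ) (f : 𝓢'(ℝ, ℂ)) : 𝓢'(ℝ, ℂ) :=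
  f - lpLT φ₀ n f

/-! ### Distributions given by functions, and products -/

/-- The tempered distribution `f` on `ℝ` is given by the function `g`. -/
def IsRepr (f : 𝓢'(ℝ, ℂ)) (g : ℝ → ℂ) : Prop :=
  ∀ ψ : 𝓢(ℝ, ℂ), Integrable (fun x => g x * ψ x) ∧ f ψ = ∫ x, g x * ψ x

/-- `w` is the product `f g`: the functions `S_{<N} f` and `S_{<N} g` are multiplied pointwise
and `S_{<N} f · S_{<N} g → w` in the sense of tempered distributions as `N → ∞`.
For band-limited distributions, and for functions in `L²`, this is the pointwise product. -/
def IsProduct (φ₀ : ℝ → ℝ) (f g w : 𝓢'(ℝ, ℂ)) : Prop :=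
  ∃ F G : ℕ → ℝ → ℂ,
    (∀ N, IsRepr (lpLT φ₀ N f) (F N)) ∧ (∀ N, IsRepr (lpLT φ₀ N g) (G N)) ∧
    ∀ ψ : 𝓢(ℝ, ℂ), (∀ N, Integrable (fun x => F N x * G N x * ψ x)) ∧
      Tendsto (fun N => ∫ x, F N x * G N x * ψ x) atTop (𝓝 (w ψ))

/-- Lebesgue measure on the time interval `[0,1]`. -/
def timeMeasure : Measure ℝ := volume.restrict (Set.Icc 0 1)

/-- Lebesgue measure on `[0,1] × ℝ`; points are `(t, x)`. -/
def stMeasure : Measure (ℝ × ℝ) := timeMeasure.prod volume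

/-- The time-dependent tempered distribution `u` is given on `[0,1] × ℝ` by the (measurable)
function `g`. -/
def IsReprST (u : ℝ → 𝓢'(ℝ, ℂ)) (g : ℝ × ℝ → ℂ) : Prop :=
  AEStronglyMeasurable g stMeasure ∧ ∀ᵐ t ∂timeMeasure, IsRepr (u t) (fun x => g (t, x))

/-- `w = u v` on `[0,1] × ℝ`. -/
def IsProductST (φ₀ : ℝ → ℝ) (u v w : ℝ → 𝓢'(ℝ, ℂ)) : Prop :=
  ∀ᵐ t ∂timeMeasure, IsProduct φ₀ (u t) (v t) (w t)

/-! ### Spatial partitions -/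

/-- The `m`-th interval of the partition of `ℝ` into intervals of length `2^l` which has an
endpoint at `c`. -/
def gridInterval (c : ℝ) (l : ℕ) (m : ℤ) : Set ℝ :=
  Set.Ico (c + m * 2 ^ l) (c + (m + 1) * 2 ^ l)

/-- For every `l`, a partition `𝒬_l` of `ℝ` into intervals `Q` of length `2^l` and, for every `j`,
a smooth square partition of unity `1 = ∑_{Q ∈ 𝒬_{2j}} χ_Q²` with `χ_Q ∼ 1` on `Q` and
`supp χ_Q ⊂ B(Q, 1/2)`. Here `χ j m` is the function belonging to the `m`-th interval
of `𝒬_{2j}`. -/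
structure SpacePartition where
  base : ℕ → ℝ
  χ : ℕ → ℤ → ℝ → ℝ
  smooth : ∀ j m, ContDiff ℝ (⊤ : ℕ∞) (χ j m)
  sum_sq : ∀ j x, HasSum (fun m => χ j m x ^ 2) 1
  supp : ∀ j m,
    tsupport (χ j m) ⊆ Metric.thickening (1 / 2) (gridInterval (base (2 * j)) (2 * j) m)
  lower : ∃ c > 0, ∀ j m, ∀ x ∈ gridInterval (base (2 * j)) (2 * j) m, c ≤ χ j m x

/-- The `m`-th interval of `𝒬_l`. -/
def SpacePartition.Q (P : SpacePartition) (l : ℕ) (m : ℤ) : Set ℝ := gridInterval (P.base l) l m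

/-! ### Norms of functions on `[0,1] × ℝ` -/

/-- The norm of `L^∞_t L²_x`. -/
def normLinfL2 (g : ℝ × ℝ → ℂ) : ℝ≥0∞ :=
  essSup (fun t => eLpNorm (fun x => g (t, x)) 2 volume) timeMeasure

/-- The norm of `L¹_t L²_x`. -/
def normL1L2 (g : ℝ × ℝ → ℂ) : ℝ≥0∞ :=
  ∫⁻ t, eLpNorm (fun x => g (t, x)) 2 volume ∂timeMeasure

/-- The local energy norm `‖g‖_X = sup_l sup_{Q ∈ 𝒬_l} 2^{-l/2} ‖g‖_{L²([0,1] × Q)}`. -/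
def normX (P : SpacePartition) (g : ℝ × ℝ → ℂ) : ℝ≥0∞ :=
  ⨆ (l : ℕ) (m : ℤ), (2 : ℝ≥0∞) ^ (-(l : ℝ) / 2) *
    eLpNorm g 2 (timeMeasure.prod (volume.restrict (P.Q l m)))

/-- `‖g‖_{X_j} = 2^j ‖g‖_X + ‖g‖_{L^∞_t L²_x}`. -/
def normXj (P : SpacePartition) (j : ℕ) (g : ℝ × ℝ → ℂ) : ℝ≥0∞ :=
  2 ^ j * normX P g + normLinfL2 g

/-- Atoms of `Y`: supported in `[0,1] × Q` with `Q ∈ 𝒬_l`, of `L²` norm at most `2^{-l/2}`. -/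
def IsAtom (P : SpacePartition) (a : ℝ × ℝ → ℂ) : Prop :=
  AEStronglyMeasurable a stMeasure ∧ ∃ (l : ℕ) (m : ℤ),
    (∀ p, p ∉ Set.Icc (0 : ℝ) 1 ×ˢ P.Q l m → a p = 0) ∧
    eLpNorm a 2 stMeasure ≤ (2 : ℝ≥0∞) ^ (-(l : ℝ) / 2)

/-- The atomic norm `‖f‖_Y = inf {∑ |c_k| : f = ∑ c_k a_k, a_k atoms}`. If `∑ |c_k| < ∞` then
`∑ c_k a_k` converges absolutely, both in `L²([0,1] × ℝ)` and almost everywhere. -/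
def normY (P : SpacePartition) (f : ℝ × ℝ → ℂ) : ℝ≥0∞ :=
  ⨅ (c : ℕ → ℂ) (a : ℕ → ℝ × ℝ → ℂ)
    (_ : (∀ k, IsAtom P (a k)) ∧ ∀ᵐ p ∂stMeasure, HasSum (fun k => c k * a k p) (f p)),
    ∑' k, ‖c k‖ₑ

/-- `‖f‖_{Y_j} = inf_{f = f₁ + f₂} (2^{-j} ‖f₁‖_Y + ‖f₂‖_{L¹_t L²_x})`. -/
def normYj (P : SpacePartition) (j : ℕ) (f : ℝ × ℝ → ℂ) : ℝ≥0∞ :=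
  ⨅ (f₁ : ℝ × ℝ → ℂ) (f₂ : ℝ × ℝ → ℂ)
    (_ : AEStronglyMeasurable f₁ stMeasure ∧ AEStronglyMeasurable f₂ stMeasure ∧
      f =ᵐ[stMeasure] f₁ + f₂),
    (2 : ℝ≥0∞) ^ (-(j : ℝ)) * normY P f₁ + normL1L2 f₂

/-- `‖g‖_{l²_{2j} U} = (∑_{Q ∈ 𝒬_{2j}} ‖χ_Q g‖_U²)^{1/2}` for functions on `[0,1] × ℝ`. -/
def l2Sum (P : SpacePartition) (j : ℕ) (normU : (ℝ × ℝ → ℂ) → ℝ≥0∞) (g : ℝ × ℝ → ℂ) : ℝ≥0∞ :=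
  (∑' m : ℤ, normU (fun p => (P.χ j m p.2 : ℂ) * g p) ^ 2) ^ (1 / 2 : ℝ)

/-- The norm of the function on `[0,1] × ℝ` giving `u`; it is `∞` if there is none. Two functions
giving `u` agree almost everywhere. -/
def normST (N : (ℝ × ℝ → ℂ) → ℝ≥0∞) (u : ℝ → 𝓢'(ℝ, ℂ)) : ℝ≥0∞ :=
  ⨅ (g : ℝ × ℝ → ℂ) (_ : IsReprST u g), N g

/-! ### The norms of `l²H^s`, `l²X^s` and `l²Y^s` -/

/-- `‖f‖_{l²_{2j} L²}` for a distribution on `ℝ`; it is `∞` if `f` is not given by a function. -/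
def l2SumL2 (P : SpacePartition) (j : ℕ) (f : 𝓢'(ℝ, ℂ)) : ℝ≥0∞ :=
  ⨅ (g : ℝ → ℂ) (_ : IsRepr f g),
    (∑' m : ℤ, eLpNorm (fun x => (P.χ j m x : ℂ) * g x) 2 volume ^ 2) ^ (1 / 2 : ℝ)

/-- `‖f‖_{l²H^s} = (∑_j 2^{2js} ‖S_j f‖²_{l²_{2j} L²})^{1/2}`. -/
def l2H (φ₀ : ℝ → ℝ) (P : SpacePartition) (s : ℝ) (f : 𝓢'(ℝ, ℂ)) : ℝ≥0∞ :=
  (∑' j : ℕ, (2 : ℝ≥0∞) ^ (2 * j * s) * l2SumL2 P j (lpProj φ₀ j f) ^ 2) ^ (1 / 2 : ℝ)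

/-- `‖u‖_{l²X^s} = (∑_j 2^{2js} ‖S_j u‖²_{l²_{2j} X_j})^{1/2}`. -/
def l2X (φ₀ : ℝ → ℝ) (P : SpacePartition) (s : ℝ) (u : ℝ → 𝓢'(ℝ, ℂ)) : ℝ≥0∞ :=
  (∑' j : ℕ, (2 : ℝ≥0∞) ^ (2 * j * s) *
    normST (l2Sum P j (normXj P j)) (fun t => lpProj φ₀ j (u t)) ^ 2) ^ (1 / 2 : ℝ)

/-- `‖f‖_{l²Y^s} = (∑_j 2^{2js} ‖S_j f‖²_{l²_{2j} Y_j})^{1/2}`. -/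
def l2Y (φ₀ : ℝ → ℝ) (P : SpacePartition) (s : ℝ) (f : ℝ → 𝓢'(ℝ, ℂ)) : ℝ≥0∞ :=
  (∑' j : ℕ, (2 : ℝ≥0∞) ^ (2 * j * s) *
    normST (l2Sum P j (normYj P j)) (fun t => lpProj φ₀ j (f t)) ^ 2) ^ (1 / 2 : ℝ)

/-- `u ∈ C([0,1], H^s)`, with `H^s` normed by `l²H^s`. -/
def ContinuousInH (φ₀ : ℝ → ℝ) (P : SpacePartition) (s : ℝ) (u : ℝ → 𝓢'(ℝ, ℂ)) : Prop :=
  ∀ t₀ ∈ Set.Icc (0 : ℝ) 1, l2H φ₀ P s (u t₀) < ∞ ∧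
    Tendsto (fun t => l2H φ₀ P s (u t - u t₀)) (𝓝[Set.Icc 0 1] t₀) (𝓝 0)

end BilinearKdV

end

open BilinearKdV

open MeasureTheory Filter Topology
open scoped ENNReal SchwartzMap FourierTransform

namespace BilinearKdV

/-! ### Square roots, Cauchy-Schwarz, Minkowski and Schur in `ℝ≥0∞` -/

/-! The proof is a paraproduct decomposition. With `u = ∑ S_a u` and `v = ∑ S_b v`, the frequencies
of `S_a u S_b v` lie in the sum of two dyadic annuli. Hence `S_k (S_a u S_b v) = 0` unless one
frequency is much the larger and comparable to `2^k`, or both are comparable and `2^k` is at most of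
their size; this is `Contrib`, proved in `symbols_eq_zero_of_not_contrib`. Each estimate then
follows from a bound for one pair of blocks together with a summation over the contributing pairs.

Smooth cut-offs and projections are removed by working with absolute values only. A `LatNorm` is a
monotone, countably subadditive, homogeneous functional of `[0,∞]`-valued functions that is bounded
under convolution in `x` with every integrable nonnegative kernel. The norms of the blocks are
equivalent to such functionals (`exists_normPair_X`, `exists_normPair_Y`). For `X` the functional is
the square root of one that is subadditive in `|u|²`; for `Y` atoms are replaced by decompositions
that merely dominate `|f|`. The kernel of `S_k` is at most a constant times `kap k`, whose mass is
at most `4`, so `S_k` is harmless.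

The bounds for a pair with frequencies `2^a`, `2^b` and output `2^k` are as follows. A low factor is
bounded by Bernstein's inequality at the cost `2^(b/2)` (`LatNorm.cv_kap_mul_le`). For comparable
frequencies, Cauchy-Schwarz inside the convolution costs `2^(k/2)` (`quad_cv_mul_le`), and in `X`
the passage from intervals of length `4^a` to the shorter intervals of length `4^k` costs a further
`2^(a-k)` (`NX_scale`); in `Y` one uses `L¹ L²` instead (`NYb_le_NH`). The smoothing in `Y` comes
from `NYb_lowHigh`: for `b` below `a`, the product is cut into intervals of length `4^b`, on which
the low factor has square summable bounds. The pieces are multiples of atoms, and the total factor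
is `2^(3b/2 - a)`.

The strict inequalities on the exponents leave a factor `2^(-δ n)`, where `n` is the index of the
lowest of the three frequencies. This factor and Schur's test sum all interactions
(`tsum_interaction_sq_le`).

The product exists because `∑ ∫ S_a u S_b v 𝓕η` converges absolutely. Comparable frequencies are
summable by Cauchy-Schwarz when `α + β ≥ 0`. For separated frequencies the product has no
frequencies below `2^(max a b - 4)`, so the rapid decay of `η` applies (`tsum_bandWeight_ne_top`).
The sum is a distribution whose projection `S_k` only sees contributing pairs
(`BddBlocks.isRepr_lpProj`).

The estimates in `l²H^s` are those in `L^∞ L²` for functions constant in time. Continuity of the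
product follows from uniqueness of products and the identity `uv - u₀v₀ = (u - u₀)v + u₀(v - v₀)`.
-/

theorem rpow_half_sq (x : ℝ≥0∞) : (x ^ (1 / 2 : ℝ)) ^ 2 = x := by
  rw [← ENNReal.rpow_natCast, ← ENNReal.rpow_mul]; norm_num

theorem sq_rpow_half (x : ℝ≥0∞) : (x ^ 2) ^ (1 / 2 : ℝ) = x := by
  rw [← ENNReal.rpow_natCast, ← ENNReal.rpow_mul]; norm_num

theorem le_of_sq_le_sq {x y : ℝ≥0∞} (h : x ^ 2 ≤ y ^ 2) : x ≤ y := by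
  have := ENNReal.rpow_le_rpow h (show (0 : ℝ) ≤ 1 / 2 by norm_num)
  rwa [sq_rpow_half, sq_rpow_half] at this

theorem rpow_half_le_iff {x y : ℝ≥0∞} : x ^ (1 / 2 : ℝ) ≤ y ↔ x ≤ y ^ 2 := by
  constructor
  · intro h
    rw [← rpow_half_sq x]
    gcongr
  · intro h
    rw [← sq_rpow_half y]
    gcongr

theorem add_sq_le_two (x y : ℝ≥0∞) : (x + y) ^ 2 ≤ 2 * (x ^ 2 + y ^ 2) := by
  rcases eq_or_ne x ⊤ with rfl | hx
  · simp
  rcases eq_or_ne y ⊤ with rfl | hy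
  · simp
  lift x to NNReal using hx
  lift y to NNReal using hy
  norm_cast
  exact add_sq_le

variable {α : Type*} [MeasurableSpace α] {μ : Measure α}

theorem lintegral_mul_sq_le {f g : α → ℝ≥0∞} (hf : AEMeasurable f μ) (hg : AEMeasurable g μ) :
    (∫⁻ a, f a * g a ∂μ) ^ 2 ≤ (∫⁻ a, f a ^ 2 ∂μ) * ∫⁻ a, g a ^ 2 ∂μ := by
  have h := ENNReal.lintegral_mul_le_Lp_mul_Lq μ Real.HolderConjugate.two_two hf hg
  have h2 : (∫⁻ a, f a * g a ∂μ) ^ 2 ≤ ((∫⁻ a, f a ^ (2 : ℝ) ∂μ) ^ (1 / 2 : ℝ) *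
      (∫⁻ a, g a ^ (2 : ℝ) ∂μ) ^ (1 / 2 : ℝ)) ^ 2 := by
    gcongr
    exact h
  rw [mul_pow, rpow_half_sq, rpow_half_sq] at h2
  simpa [ENNReal.rpow_two] using h2

theorem lintegral_weight_mul_sq_le {w f : α → ℝ≥0∞} (hw : AEMeasurable w μ)
    (hf : AEMeasurable f μ) :
    (∫⁻ a, w a * f a ∂μ) ^ 2 ≤ (∫⁻ a, w a ∂μ) * ∫⁻ a, w a * f a ^ 2 ∂μ := by
  have h := lintegral_mul_sq_le (hw.pow_const (1 / 2 : ℝ))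
    ((hw.pow_const (1 / 2 : ℝ)).mul hf)
  have e : ∀ x : ℝ≥0∞, x ^ (1 / 2 : ℝ) * x ^ (1 / 2 : ℝ) = x := fun x => by
    rw [← sq, rpow_half_sq]
  simpa only [Pi.mul_apply, ← mul_assoc, mul_pow, e, rpow_half_sq] using h

theorem tsum_weight_mul_sq_le {ι : Type*} (w f : ι → ℝ≥0∞) :
    (∑' i, w i * f i) ^ 2 ≤ (∑' i, w i) * ∑' i, w i * f i ^ 2 := by
  let _ : MeasurableSpace ι := ⊤
  have := lintegral_weight_mul_sq_le (μ := Measure.count) (w := w) (f := f)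
    measurable_from_top.aemeasurable measurable_from_top.aemeasurable
  simpa [lintegral_count] using this

theorem tsum_mul_sq_le {ι : Type*} (f g : ι → ℝ≥0∞) :
    (∑' i, f i * g i) ^ 2 ≤ (∑' i, f i ^ 2) * ∑' i, g i ^ 2 := by
  let _ : MeasurableSpace ι := ⊤
  have := lintegral_mul_sq_le (μ := Measure.count) (f := f) (g := g)
    measurable_from_top.aemeasurable measurable_from_top.aemeasurable
  simpa [lintegral_count] using this

theorem tsum_sq_le_weighted {ι : Type*} (q g : ι → ℝ≥0∞) (h0 : ∀ i, q i ≠ 0)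
    (ht : ∀ i, q i ≠ ⊤) :
    (∑' i, g i) ^ 2 ≤ (∑' i, q i) * ∑' i, (q i)⁻¹ * g i ^ 2 := by
  have h := tsum_weight_mul_sq_le q (fun i => (q i)⁻¹ * g i)
  have e1 : ∀ i, q i * ((q i)⁻¹ * g i) = g i := fun i => by
    rw [← mul_assoc, ENNReal.mul_inv_cancel (h0 i) (ht i), one_mul]
  have e2 : ∀ i, q i * ((q i)⁻¹ * g i) ^ 2 = (q i)⁻¹ * g i ^ 2 := fun i => by
    rw [sq, ← mul_assoc, e1, sq]; ring
  simpa only [e1, e2] using h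

/-- The square of a sum is the infimum over weights of the weighted square sums. The optimal weight
is `q = x`; a summable perturbation `δ` keeps it positive. It reduces triangle inequalities for
square roots to subadditivity of what stands under the root. -/
theorem le_sq_tsum_of_weighted {ι : Type*} [Countable ι] (A : ℝ≥0∞) (x : ι → ℝ≥0∞)
    (h : ∀ q : ι → ℝ≥0∞, (∀ i, q i ≠ 0) → (∀ i, q i ≠ ⊤) → ∑' i, q i ≠ ⊤ →
      A ≤ (∑' i, q i) * ∑' i, (q i)⁻¹ * x i ^ 2) :
    A ≤ (∑' i, x i) ^ 2 := by
  rcases eq_or_ne (∑' i, x i) ⊤ with hS | hS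
  · rw [hS]; simp
  rw [← rpow_half_le_iff]
  refine ENNReal.le_of_forall_pos_le_add fun ε hε _ => ?_
  obtain ⟨δ, hδ, hδs⟩ := ENNReal.exists_pos_sum_of_countable (ε := ε)
    (by exact_mod_cast hε.ne') ι
  rw [rpow_half_le_iff]
  have hx : ∀ i, x i ≠ ⊤ := fun i => ENNReal.ne_top_of_tsum_ne_top hS i
  have hq0 : ∀ i, x i + δ i ≠ 0 := fun i => by
    have : (δ i : ℝ≥0∞) ≠ 0 := by exact_mod_cast (hδ i).ne'
    simp [(hδ i).ne']
  have hsum : ∑' i, (x i + (δ i : ℝ≥0∞)) ≤ (∑' i, x i) + ε := by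
    rw [ENNReal.tsum_add]
    gcongr
  refine (h (fun i => x i + δ i) hq0 (fun i => by simp [hx i])
    (ne_top_of_le_ne_top (by simp [hS]) hsum)).trans ?_
  have hle : ∀ i, (x i + (δ i : ℝ≥0∞))⁻¹ * x i ^ 2 ≤ x i + δ i := fun i => by
    calc (x i + (δ i : ℝ≥0∞))⁻¹ * x i ^ 2
        ≤ (x i + (δ i : ℝ≥0∞))⁻¹ * (x i + δ i) ^ 2 := by gcongr; exact le_self_add
      _ = x i + δ i := by
        rw [sq, ← mul_assoc, ENNReal.inv_mul_cancel (hq0 i) (by simp [hx i]), one_mul]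
  rw [sq]
  gcongr
  exact (ENNReal.tsum_le_tsum hle).trans hsum

/-- Schur's test: Cauchy-Schwarz with the weight `w i` in the inner sum uses the row bound, and the
exchange of sums uses the column bound. -/
theorem schur_sq {ι κ : Type*} (w : ι → κ → ℝ≥0∞) (x : κ → ℝ≥0∞) {A B : ℝ≥0∞}
    (hA : ∀ i, ∑' j, w i j ≤ A) (hB : ∀ j, ∑' i, w i j ≤ B) :
    ∑' i, (∑' j, w i j * x j) ^ 2 ≤ A * B * ∑' j, x j ^ 2 := by
  calc ∑' i, (∑' j, w i j * x j) ^ 2 ≤ ∑' i, A * ∑' j, w i j * x j ^ 2 := by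
        refine ENNReal.tsum_le_tsum fun i => (tsum_weight_mul_sq_le _ _).trans ?_
        gcongr
        exact hA i
    _ = A * ∑' j, (∑' i, w i j) * x j ^ 2 := by
        rw [ENNReal.tsum_mul_left, ENNReal.tsum_comm]
        simp_rw [ENNReal.tsum_mul_right]
    _ ≤ A * ∑' j, B * x j ^ 2 := by
        gcongr with j
        exact hB j
    _ = _ := by rw [ENNReal.tsum_mul_left, mul_assoc]

theorem schur_one {ι κ : Type*} (w : ι → κ → ℝ≥0∞) (x : κ → ℝ≥0∞) {B : ℝ≥0∞}
    (hB : ∀ j, ∑' i, w i j ≤ B) :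
    ∑' i, ∑' j, w i j * x j ≤ B * ∑' j, x j := by
  rw [ENNReal.tsum_comm, ← ENNReal.tsum_mul_left]
  refine ENNReal.tsum_le_tsum fun j => ?_
  rw [ENNReal.tsum_mul_right]
  gcongr
  exact hB j

theorem schur_bilin {ι κ : Type*} (w : ι → κ → ℝ≥0∞) (x : ι → ℝ≥0∞) (y : κ → ℝ≥0∞)
    {A B : ℝ≥0∞} (hA : ∀ i, ∑' j, w i j ≤ A) (hB : ∀ j, ∑' i, w i j ≤ B) :
    (∑' i, ∑' j, w i j * (x i * y j)) ^ 2 ≤ A * B * (∑' i, x i ^ 2) * ∑' j, y j ^ 2 := by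
  have e : ∀ i, ∑' j, w i j * (x i * y j) = x i * ∑' j, w i j * y j := fun i => by
    rw [← ENNReal.tsum_mul_left]
    exact tsum_congr fun j => by ring
  simp_rw [e]
  calc _ ≤ (∑' i, x i ^ 2) * ∑' i, (∑' j, w i j * y j) ^ 2 := tsum_mul_sq_le _ _
    _ ≤ (∑' i, x i ^ 2) * (A * B * ∑' j, y j ^ 2) := by
      gcongr
      exact schur_sq w y hA hB
    _ = _ := by ring

/-- Minkowski's inequality in `L²`: the weighted Cauchy-Schwarz inequality is applied pointwise and
integrated, and the weights are optimised afterwards. -/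
theorem lintegral_tsum_sq_le {ι : Type*} [Countable ι] {F : ι → α → ℝ≥0∞}
    (hF : ∀ i, AEMeasurable (F i) μ) :
    ∫⁻ a, (∑' i, F i a) ^ 2 ∂μ ≤ (∑' i, (∫⁻ a, F i a ^ 2 ∂μ) ^ (1 / 2 : ℝ)) ^ 2 := by
  refine le_sq_tsum_of_weighted _ _ fun q h0 ht _ => ?_
  calc ∫⁻ a, (∑' i, F i a) ^ 2 ∂μ
      ≤ ∫⁻ a, (∑' i, q i) * ∑' i, (q i)⁻¹ * F i a ^ 2 ∂μ :=
        lintegral_mono fun a => tsum_sq_le_weighted q _ h0 ht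
    _ = (∑' i, q i) * ∑' i, (q i)⁻¹ * ∫⁻ a, F i a ^ 2 ∂μ := by
        have hm : ∀ i, AEMeasurable (fun a => (q i)⁻¹ * F i a ^ 2) μ := fun i =>
          ((hF i).pow_const 2).const_mul _
        rw [lintegral_const_mul'' _ (AEMeasurable.tsum hm), lintegral_tsum hm]
        congr 1
        exact tsum_congr fun i => lintegral_const_mul'' _ ((hF i).pow_const 2)
    _ = _ := by simp_rw [rpow_half_sq]

theorem tsum_tsum_sq_le {ι κ : Type*} [Countable ι] (F : ι → κ → ℝ≥0∞) :
    ∑' a, (∑' i, F i a) ^ 2 ≤ (∑' i, (∑' a, F i a ^ 2) ^ (1 / 2 : ℝ)) ^ 2 := by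
  let _ : MeasurableSpace κ := ⊤
  have := lintegral_tsum_sq_le (μ := Measure.count) (F := F)
    (fun i => measurable_from_top.aemeasurable)
  simpa [lintegral_count] using this

/-! ### Powers of two -/

/-- `2 ^ x` in `ℝ≥0∞`. -/
noncomputable def p2 (x : ℝ) : ℝ≥0∞ := (2 : ℝ≥0∞) ^ x

theorem p2_add (x y : ℝ) : p2 (x + y) = p2 x * p2 y :=
  ENNReal.rpow_add _ _ (by norm_num) (by norm_num)

theorem p2_zero : p2 0 = 1 := ENNReal.rpow_zero

theorem p2_ne_top (x : ℝ) : p2 x ≠ ⊤ := by simp [p2]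

theorem p2_ne_zero (x : ℝ) : p2 x ≠ 0 := by simp [p2]

theorem p2_mono {x y : ℝ} (h : x ≤ y) : p2 x ≤ p2 y :=
  ENNReal.rpow_le_rpow_of_exponent_le (by norm_num) h

theorem one_le_p2 {x : ℝ} (h : 0 ≤ x) : 1 ≤ p2 x := p2_zero ▸ p2_mono h

theorem p2_sq (x : ℝ) : p2 x ^ 2 = p2 (2 * x) := by rw [sq, ← p2_add]; ring_nf

theorem p2_natCast (n : ℕ) : p2 n = 2 ^ n := ENNReal.rpow_natCast _ _

theorem p2_eq_ofReal (x : ℝ) : p2 x = ENNReal.ofReal ((2 : ℝ) ^ x) := by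
  rw [p2, ← ENNReal.ofReal_rpow_of_pos (by norm_num)]; simp

theorem ofReal_two_pow (n : ℕ) : ENNReal.ofReal (2 ^ n) = p2 n := by
  rw [p2_natCast, ENNReal.ofReal_pow (by norm_num)]; simp

theorem p2_mul_neg (x : ℝ) : p2 x * p2 (-x) = 1 := by rw [← p2_add]; simp [p2_zero]

/-! ### The kernels `2 ^ k / (1 + (2 ^ k x) ^ 2)` -/

/-- The kernel `2 ^ k / (1 + (2 ^ k x) ^ 2)`, which dominates the kernels of the
Littlewood-Paley projections. -/
noncomputable def kap (k : ℕ) (x : ℝ) : ℝ≥0∞ := ENNReal.ofReal (2 ^ k * (1 + (2 ^ k * x) ^ 2)⁻¹)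

theorem measurable_kap (k : ℕ) : Measurable (kap k) := by
  unfold kap; fun_prop

theorem lintegral_kap_le (k : ℕ) : ∫⁻ x, kap k x ≤ 4 := by
  have hi : Integrable (fun x : ℝ => (1 + (2 ^ k * x) ^ 2)⁻¹) :=
    integrable_inv_one_add_sq.comp_mul_left' (by positivity)
  unfold kap
  rw [← ofReal_integral_eq_lintegral_ofReal (hi.const_mul _)
    (ae_of_all _ fun x => by positivity), integral_const_mul,
    Measure.integral_comp_mul_left (fun x : ℝ => (1 + x ^ 2)⁻¹), integral_univ_inv_one_add_sq]
  have h2 : (0 : ℝ) < 2 ^ k := by positivity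
  rw [abs_of_pos (by positivity), smul_eq_mul, ← mul_assoc, mul_inv_cancel₀ h2.ne', one_mul]
  refine ENNReal.ofReal_le_of_le_toReal ?_
  simpa using Real.pi_le_four

theorem kap_le (k : ℕ) (x : ℝ) : kap k x ≤ p2 k := by
  rw [← ofReal_two_pow]
  refine ENNReal.ofReal_le_ofReal (mul_le_of_le_one_right (by positivity) ?_)
  exact inv_le_one_of_one_le₀ (by nlinarith [sq_nonneg (2 ^ k * x)])

/-- The square root of this bound is the factor `2^(k/2)` in all uses of Bernstein's inequality. -/
theorem lintegral_kap_sq_le (k : ℕ) : ∫⁻ x, kap k x ^ 2 ≤ 4 * p2 k := by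
  calc ∫⁻ x, kap k x ^ 2 ≤ ∫⁻ x, p2 k * kap k x := by
        refine lintegral_mono fun x => ?_
        rw [sq]
        gcongr
        exact kap_le k x
    _ = p2 k * ∫⁻ x, kap k x := lintegral_const_mul _ (measurable_kap k)
    _ ≤ p2 k * 4 := by gcongr; exact lintegral_kap_le k
    _ = _ := mul_comm _ _

/-- Since `L ≥ 1`, the two inequalities give `|n| ≤ |x| + 1`, so `1 + n² ≤ 3 (1 + x²)`. Interactions
between intervals with index difference `n` thus have summable tails, uniformly in `L`. -/
theorem kap_le_of_int (k : ℕ) (x L : ℝ) (n : ℤ) (hL : 1 ≤ L) (h1 : (n - 1) * L < x)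
    (h2 : x < (n + 1) * L) :
    kap k x ≤ 3 * p2 k * ENNReal.ofReal ((1 + (n : ℝ) ^ 2)⁻¹) := by
  have hk : (1 : ℝ) ≤ 2 ^ k := one_le_pow₀ (by norm_num)
  have hn : (n : ℝ) ^ 2 ≤ 2 * x ^ 2 + 2 := by
    have h3 : |(n : ℝ)| ≤ |x| + 1 := by
      rcases le_or_gt 0 n with h0 | h0
      · have h0' : (0 : ℝ) ≤ n := by exact_mod_cast h0
        rw [abs_of_nonneg h0']
        rcases le_or_gt (n : ℝ) 1 with h | h
        · linarith [abs_nonneg x]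
        · have := le_abs_self x
          nlinarith
      · have h0' : (n : ℝ) < 0 := by exact_mod_cast h0
        rw [abs_of_neg h0']
        rcases le_or_gt (-1) (n : ℝ) with h | h
        · linarith [abs_nonneg x]
        · have := neg_abs_le x
          nlinarith
    have h4 : (n : ℝ) ^ 2 ≤ (|x| + 1) ^ 2 := by
      rw [← sq_abs (n : ℝ)]; gcongr
    nlinarith [sq_abs x, sq_nonneg (|x| - 1)]
  have h5 : 1 + (n : ℝ) ^ 2 ≤ 3 * (1 + (2 ^ k * x) ^ 2) := by
    have : x ^ 2 ≤ (2 ^ k * x) ^ 2 := by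
      rw [mul_pow]
      exact le_mul_of_one_le_left (sq_nonneg x) (one_le_pow₀ hk)
    linarith [sq_nonneg x]
  rw [← ofReal_two_pow, show (3 : ℝ≥0∞) = ENNReal.ofReal 3 by norm_num,
    ← ENNReal.ofReal_mul (by norm_num), ← ENNReal.ofReal_mul (by positivity)]
  refine ENNReal.ofReal_le_ofReal ?_
  have h6 : (1 + (2 ^ k * x) ^ 2)⁻¹ ≤ 3 * (1 + (n : ℝ) ^ 2)⁻¹ := by
    rw [inv_le_comm₀ (by positivity) (by positivity)]
    rw [mul_inv, inv_inv]
    linarith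
  calc (2 : ℝ) ^ k * (1 + (2 ^ k * x) ^ 2)⁻¹ ≤ 2 ^ k * (3 * (1 + (n : ℝ) ^ 2)⁻¹) := by gcongr
    _ = _ := by ring

/-- `∑_n 1 / (1 + n²)`. -/
noncomputable def sumInv : ℝ≥0∞ := ∑' n : ℤ, ENNReal.ofReal ((1 + (n : ℝ) ^ 2)⁻¹)

theorem sumInv_ne_top : sumInv ≠ ⊤ := by
  have hs : Summable fun n : ℤ => (1 + (n : ℝ) ^ 2)⁻¹ := by
    refine Summable.of_norm_bounded_eventually
      (Real.summable_one_div_int_pow.mpr (one_lt_two : 1 < 2)) ?_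
    filter_upwards [(Set.finite_singleton (0 : ℤ)).compl_mem_cofinite] with n hn
    have : (n : ℝ) ≠ 0 := by exact_mod_cast hn
    rw [Real.norm_of_nonneg (by positivity), one_div]
    gcongr
    linarith
  rw [sumInv, ← ENNReal.ofReal_tsum_of_nonneg (fun n => by positivity) hs]
  exact ENNReal.ofReal_ne_top

/-! ### Grids of intervals -/

variable (P : SpacePartition)

theorem mem_Q_iff (l : ℕ) (m : ℤ) (x : ℝ) :
    x ∈ P.Q l m ↔ ⌊(x - P.base l) / 2 ^ l⌋ = m := by
  have h2 : (0 : ℝ) < 2 ^ l := by positivity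
  rw [SpacePartition.Q, gridInterval, Set.mem_Ico, Int.floor_eq_iff, le_div_iff₀ h2,
    div_lt_iff₀ h2]
  constructor <;> rintro ⟨h, h'⟩ <;> constructor <;> linarith

theorem measurableSet_Q (l : ℕ) (m : ℤ) : MeasurableSet (P.Q l m) := measurableSet_Ico

theorem tsum_indicator_Q (l : ℕ) (x : ℝ) :
    ∑' m : ℤ, (P.Q l m).indicator (1 : ℝ → ℝ≥0∞) x = 1 := by
  rw [tsum_eq_single ⌊(x - P.base l) / 2 ^ l⌋]
  · rw [Set.indicator_of_mem ((mem_Q_iff P l _ x).2 rfl)]; rfl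
  · intro m hm
    exact Set.indicator_of_notMem (fun h => hm ((mem_Q_iff P l m x).1 h).symm) _

/-- The differences of points of two intervals of length `2 ^ l` with index difference `n`. -/
def diffInterval (l : ℕ) (n : ℤ) : Set ℝ := Set.Ioo ((n - 1) * 2 ^ l) ((n + 1) * 2 ^ l)

theorem measurableSet_diffInterval (l : ℕ) (n : ℤ) : MeasurableSet (diffInterval l n) :=
  measurableSet_Ioo

theorem sub_mem_diffInterval {l : ℕ} {m m' : ℤ} {x y : ℝ} (hx : x ∈ P.Q l m)
    (hy : y ∈ P.Q l m') : x - y ∈ diffInterval l (m - m') := by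
  simp only [SpacePartition.Q, gridInterval, Set.mem_Ico, diffInterval, Set.mem_Ioo] at *
  push_cast
  constructor <;> nlinarith

/-- These open intervals have length `2 · 2^l` and consecutive ones are shifted by `2^l`, so no
point lies in more than two. -/
theorem tsum_indicator_diffInterval_le (l : ℕ) (z : ℝ) :
    ∑' n : ℤ, (diffInterval l n).indicator (1 : ℝ → ℝ≥0∞) z ≤ 2 := by
  have h2 : (0 : ℝ) < 2 ^ l := by positivity
  set f : ℤ := ⌊z / 2 ^ l⌋
  have hle : ∀ n : ℤ, (diffInterval l n).indicator (1 : ℝ → ℝ≥0∞) z ≤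
      (if n = f then 1 else 0) + (if n = f + 1 then 1 else 0) := by
    intro n
    by_cases hz : z ∈ diffInterval l n
    · obtain ⟨h3, h4⟩ := hz
      rw [← lt_div_iff₀ h2] at h3
      rw [← div_lt_iff₀ h2] at h4
      have hf1 : n - 1 ≤ f := by
        refine Int.le_floor.2 ?_
        push_cast
        exact h3.le
      have hf2 : f < n + 1 := Int.floor_lt.2 (by push_cast; exact h4)
      have : n = f ∨ n = f + 1 := by omega
      refine (Set.indicator_le_self _ _ _).trans ?_
      rcases this with h | h <;> simp [h]
    · rw [Set.indicator_of_notMem hz]; exact zero_le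
  refine (ENNReal.tsum_le_tsum hle).trans ?_
  rw [ENNReal.tsum_add, tsum_ite_eq, tsum_ite_eq]
  norm_num

open Classical in
/-- `1` if the `m`-th interval of length `2 ^ l` meets the `m'`-th one of length `2 ^ l'`, and
`0` otherwise. -/
noncomputable def meets (l l' : ℕ) (m m' : ℤ) : ℝ≥0∞ :=
  if (P.Q l m ∩ P.Q l' m').Nonempty then 1 else 0

theorem meets_comm (l l' : ℕ) (m m' : ℤ) : meets P l l' m m' = meets P l' l m' m := by
  unfold meets; rw [Set.inter_comm]

/-- The grids of different levels need not be nested, because `base` is arbitrary. The summand `2`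
pays for the intervals which overlap only partly at the two ends. -/
theorem tsum_meets_le (l l' : ℕ) (m' : ℤ) :
    ∑' m, meets P l l' m m' ≤ p2 (l' - l) + 2 := by
  have h2 : (0 : ℝ) < 2 ^ l := by positivity
  set x : ℝ := (P.base l' + m' * 2 ^ l' - P.base l) / 2 ^ l with hx
  have hx' : P.base l' + m' * 2 ^ l' - P.base l = x * 2 ^ l := by rw [hx]; field_simp
  set r : ℝ := 2 ^ l' / 2 ^ l with hr
  have hr' : (2 : ℝ) ^ l' = r * 2 ^ l := by rw [hr]; field_simp
  have hr0 : 0 < r := by positivity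
  have hsupp : ∀ m ∉ Finset.Icc ⌊x⌋ (⌈x + r⌉ - 1), meets P l l' m m' = 0 := by
    intro m hm
    unfold meets
    rw [if_neg]
    rintro ⟨y, ⟨h3, h4⟩, ⟨h5, h6⟩⟩
    apply hm
    have h7 : x - 1 < m := by nlinarith
    have h8 : (m : ℝ) < x + r := by nlinarith
    rw [Finset.mem_Icc]
    constructor
    · have h9 : (⌊x⌋ : ℝ) < m + 1 := (Int.floor_le x).trans_lt (by linarith)
      have : ⌊x⌋ < m + 1 := by exact_mod_cast h9
      omega
    · have h9 : m < ⌈x + r⌉ := Int.lt_ceil.2 h8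
      omega
  rw [tsum_eq_sum hsupp]
  calc ∑ m ∈ Finset.Icc ⌊x⌋ (⌈x + r⌉ - 1), meets P l l' m m'
      ≤ ∑ m ∈ Finset.Icc ⌊x⌋ (⌈x + r⌉ - 1), 1 := by
        refine Finset.sum_le_sum fun m _ => ?_
        unfold meets; split_ifs <;> simp
    _ = ENNReal.ofReal (((⌈x + r⌉ - ⌊x⌋ : ℤ) : ℝ)) := by
        have h0 : ⌊x⌋ ≤ ⌈x + r⌉ := by
          have h1 := Int.floor_le x
          have h3 := Int.le_ceil (x + r)
          have : (⌊x⌋ : ℝ) ≤ ⌈x + r⌉ := by linarith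
          exact_mod_cast this
        rw [Finset.sum_const, Int.card_Icc, nsmul_eq_mul, mul_one,
          show ⌈x + r⌉ - 1 + 1 - ⌊x⌋ = ⌈x + r⌉ - ⌊x⌋ by ring]
        obtain ⟨n, hn⟩ := Int.eq_ofNat_of_zero_le (sub_nonneg.2 h0)
        rw [hn]; simp
    _ ≤ ENNReal.ofReal (r + 2) := by
        refine ENNReal.ofReal_le_ofReal ?_
        push_cast
        linarith [Int.lt_floor_add_one x, Int.ceil_lt_add_one (x + r)]
    _ = p2 (l' - l) + 2 := by
        rw [ENNReal.ofReal_add hr0.le (by norm_num), p2_eq_ofReal,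
          Real.rpow_sub (by norm_num)]
        simp [hr]

/-! ### Functions on `[0,1] × ℝ` with values in `[0,∞]` -/

instance : IsProbabilityMeasure timeMeasure := ⟨by simp [timeMeasure]⟩

/-- Restriction to the `m`-th interval of length `2 ^ l`. -/
noncomputable def cut (l : ℕ) (m : ℤ) (G : ℝ × ℝ → ℝ≥0∞) : ℝ × ℝ → ℝ≥0∞ :=
  fun p => (P.Q l m).indicator 1 p.2 * G p

@[fun_prop]
theorem measurable_indicator_Q (l : ℕ) (m : ℤ) :
    Measurable ((P.Q l m).indicator (1 : ℝ → ℝ≥0∞)) :=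
  measurable_one.indicator (measurableSet_Q P l m)

@[fun_prop]
theorem measurable_cut (l : ℕ) (m : ℤ) {G : ℝ × ℝ → ℝ≥0∞} (hG : Measurable G) :
    Measurable (cut P l m G) := by
  unfold cut; fun_prop

theorem tsum_cut (l : ℕ) (G : ℝ × ℝ → ℝ≥0∞) (p : ℝ × ℝ) : ∑' m, cut P l m G p = G p := by
  simp only [cut]
  rw [ENNReal.tsum_mul_right, tsum_indicator_Q, one_mul]

theorem cut_le (l : ℕ) (m : ℤ) (G : ℝ × ℝ → ℝ≥0∞) (p : ℝ × ℝ) : cut P l m G p ≤ G p := by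
  refine mul_le_of_le_one_left zero_le ?_
  exact Set.indicator_le_self _ _ _

/-- Convolution in the space variable. -/
noncomputable def cv (κ : ℝ → ℝ≥0∞) (G : ℝ × ℝ → ℝ≥0∞) : ℝ × ℝ → ℝ≥0∞ :=
  fun p => ∫⁻ y, κ (p.2 - y) * G (p.1, y)

@[fun_prop]
theorem measurable_cv {κ : ℝ → ℝ≥0∞} {G : ℝ × ℝ → ℝ≥0∞} (hκ : Measurable κ)
    (hG : Measurable G) : Measurable (cv κ G) := by
  unfold cv
  refine Measurable.lintegral_prod_right' (f := fun q : (ℝ × ℝ) × ℝ =>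
    κ (q.1.2 - q.2) * G (q.1.1, q.2)) ?_
  fun_prop

theorem lintegral_comp_sub (κ : ℝ → ℝ≥0∞) (x : ℝ) : ∫⁻ y, κ (x - y) = ∫⁻ y, κ y :=
  lintegral_sub_left_eq_self κ x

theorem cv_tsum {ι : Type*} [Countable ι] {κ : ℝ → ℝ≥0∞} {G : ι → ℝ × ℝ → ℝ≥0∞}
    (hκ : Measurable κ) (hG : ∀ i, Measurable (G i)) (p : ℝ × ℝ) :
    cv κ (fun p => ∑' i, G i p) p = ∑' i, cv κ (G i) p := by
  unfold cv
  rw [← lintegral_tsum (fun i => by have := hG i; fun_prop)]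
  exact lintegral_congr fun y => ENNReal.tsum_mul_left.symm

theorem cv_sq_le {κ : ℝ → ℝ≥0∞} {G : ℝ × ℝ → ℝ≥0∞} (hκ : Measurable κ)
    (hG : Measurable G) (p : ℝ × ℝ) :
    cv κ G p ^ 2 ≤ (∫⁻ y, κ y) * cv κ (fun p => G p ^ 2) p := by
  unfold cv
  refine (lintegral_weight_mul_sq_le (by fun_prop) (by fun_prop)).trans ?_
  rw [lintegral_comp_sub]

/-- Here the kernel stays with one factor and the other is integrated over the whole line. The cost
is the `L²` norm of the kernel, hence depends on the output frequency and not on the frequencies of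
the factors. -/
theorem cv_mul_sq_le {κ : ℝ → ℝ≥0∞} {G H : ℝ × ℝ → ℝ≥0∞} (hκ : Measurable κ)
    (hG : Measurable G) (hH : Measurable H) (p : ℝ × ℝ) :
    cv κ (fun p => G p * H p) p ^ 2 ≤
      cv (fun x => κ x ^ 2) (fun p => G p ^ 2) p * ∫⁻ y, H (p.1, y) ^ 2 := by
  unfold cv
  have := lintegral_mul_sq_le (μ := volume) (f := fun y => κ (p.2 - y) * G (p.1, y))
    (g := fun y => H (p.1, y)) (by fun_prop) (by fun_prop)
  simpa only [mul_assoc, mul_pow] using this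

theorem ae_ae_of_ae_st {p : ℝ × ℝ → Prop} (h : ∀ᵐ z ∂stMeasure, p z) :
    ∀ᵐ t ∂timeMeasure, ∀ᵐ x, p (t, x) := Measure.ae_ae_of_ae_prod h

theorem ae_st_of_ae_time {p : ℝ → Prop} (h : ∀ᵐ t ∂timeMeasure, p t) :
    ∀ᵐ z ∂stMeasure, p z.1 :=
  (Measure.quasiMeasurePreserving_fst (μ := timeMeasure) (ν := (volume : Measure ℝ))).ae h

theorem cv_mono_ae {κ : ℝ → ℝ≥0∞} {G H : ℝ × ℝ → ℝ≥0∞} (h : ∀ᵐ z ∂stMeasure, G z ≤ H z) :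
    ∀ᵐ z ∂stMeasure, cv κ G z ≤ cv κ H z := by
  refine (ae_st_of_ae_time (ae_ae_of_ae_st h)).mono fun z hz => ?_
  refine lintegral_mono_ae (hz.mono fun y hy => ?_)
  gcongr

theorem lintegral_cv {κ : ℝ → ℝ≥0∞} {G : ℝ × ℝ → ℝ≥0∞} (hκ : Measurable κ)
    (hG : Measurable G) (t : ℝ) :
    ∫⁻ x, cv κ G (t, x) = (∫⁻ y, κ y) * ∫⁻ y, G (t, y) := by
  unfold cv
  rw [lintegral_lintegral_swap (by fun_prop), ← lintegral_const_mul _ (by fun_prop)]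
  refine lintegral_congr fun y => ?_
  change ∫⁻ x, κ (x - y) * G (t, y) = _
  rw [lintegral_mul_const _ (by fun_prop), lintegral_sub_right_eq_self κ y]

/-- Mass travels from the interval `m'` to the interval `m` only through the part of `κ` on the set
of differences. Since these parts of `κ` have total mass at most `2 ∫ κ`, convolution acts on
sequences of local norms as a matrix to which Schur's test applies, without any decay assumption on
`κ`. -/
theorem cut_cv_le {κ : ℝ → ℝ≥0∞} {G : ℝ × ℝ → ℝ≥0∞} (hκ : Measurable κ)
    (hG : Measurable G) (l : ℕ) (m : ℤ) (p : ℝ × ℝ) :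
    cut P l m (cv κ G) p ≤
      ∑' m', cv ((diffInterval l (m - m')).indicator κ) (cut P l m' G) p := by
  by_cases hp : p.2 ∈ P.Q l m
  · have hm : ∀ m', Measurable fun y =>
        (diffInterval l (m - m')).indicator κ (p.2 - y) * cut P l m' G (p.1, y) := fun m' => by
      have := hκ.indicator (measurableSet_diffInterval l (m - m'))
      fun_prop
    refine (cut_le P l m _ p).trans ?_
    unfold cv
    rw [← lintegral_tsum (fun m' => (hm m').aemeasurable)]
    refine lintegral_mono fun y => ?_
    rw [← tsum_cut P l G (p.1, y), ← ENNReal.tsum_mul_left]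
    refine ENNReal.tsum_le_tsum fun m' => ?_
    by_cases hy : y ∈ P.Q l m'
    · rw [Set.indicator_of_mem (sub_mem_diffInterval P hp hy)]
    · simp [cut, Set.indicator_of_notMem hy]
  · simp [cut, Set.indicator_of_notMem hp]

theorem tsum_lintegral_diffInterval {κ : ℝ → ℝ≥0∞} (hκ : Measurable κ) (l : ℕ) :
    ∑' n, ∫⁻ x, (diffInterval l n).indicator κ x ≤ 2 * ∫⁻ x, κ x := by
  rw [← lintegral_tsum fun n =>
    (hκ.indicator (measurableSet_diffInterval l n)).aemeasurable, ← lintegral_const_mul _ hκ]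
  refine lintegral_mono fun x => ?_
  have e : ∀ n, (diffInterval l n).indicator κ x = (diffInterval l n).indicator 1 x * κ x :=
    fun n => by by_cases h : x ∈ diffInterval l n <;> simp [h]
  simp_rw [e]
  rw [ENNReal.tsum_mul_right]
  gcongr
  exact tsum_indicator_diffInterval_le l x

theorem tsum_lintegral_diffInterval_left {κ : ℝ → ℝ≥0∞} (hκ : Measurable κ) (l : ℕ) (m' : ℤ) :
    ∑' m, ∫⁻ x, (diffInterval l (m - m')).indicator κ x ≤ 2 * ∫⁻ x, κ x := by
  refine le_trans (le_of_eq ?_) (tsum_lintegral_diffInterval hκ l)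
  exact (Equiv.subRight m').tsum_eq (fun n => ∫⁻ x, (diffInterval l n).indicator κ x)

theorem tsum_lintegral_diffInterval_right {κ : ℝ → ℝ≥0∞} (hκ : Measurable κ) (l : ℕ) (m : ℤ) :
    ∑' m', ∫⁻ x, (diffInterval l (m - m')).indicator κ x ≤ 2 * ∫⁻ x, κ x := by
  refine le_trans (le_of_eq ?_) (tsum_lintegral_diffInterval hκ l)
  exact (Equiv.subLeft m).tsum_eq (fun n => ∫⁻ x, (diffInterval l n).indicator κ x)

variable (P : SpacePartition)

/-! ### Lattice norms -/

/-- Monotone, countably subadditive and homogeneous functionals which are bounded under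
convolution in the space variable. -/
structure LatNorm (V : (ℝ × ℝ → ℝ≥0∞) → ℝ≥0∞) (A : ℝ≥0∞) : Prop where
  mono : ∀ {G H}, Measurable G → Measurable H → (∀ᵐ p ∂stMeasure, G p ≤ H p) → V G ≤ V H
  sum : ∀ {ι : Type} [Countable ι] (G : ι → ℝ × ℝ → ℝ≥0∞), (∀ i, Measurable (G i)) →
    V (fun p => ∑' i, G i p) ≤ ∑' i, V (G i)
  smul : ∀ {c : ℝ≥0∞} {G}, c ≠ ⊤ → Measurable G → V (fun p => c * G p) ≤ c * V G
  conv : ∀ {κ G}, Measurable κ → ∫⁻ y, κ y ≠ ⊤ → Measurable G → V (cv κ G) ≤ A * (∫⁻ y, κ y) * V G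

namespace LatNorm

variable {V : (ℝ × ℝ → ℝ≥0∞) → ℝ≥0∞} {A : ℝ≥0∞} (hV : LatNorm V A)
include hV

theorem zero : V (fun _ => 0) = 0 := by
  have := hV.smul (c := 0) (G := fun _ => 0) (by simp) measurable_const
  simpa using this

theorem add {G H : ℝ × ℝ → ℝ≥0∞} (hG : Measurable G) (hH : Measurable H) :
    V (fun p => G p + H p) ≤ V G + V H := by
  have := hV.sum (fun b : Bool => if b then G else H) (by intro b; cases b <;> simpa)
  simpa [tsum_bool, add_comm] using this

theorem mono_tsum {ι : Type} [Countable ι] {G : ℝ × ℝ → ℝ≥0∞} {H : ι → ℝ × ℝ → ℝ≥0∞}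
    (hG : Measurable G) (hH : ∀ i, Measurable (H i))
    (h : ∀ᵐ p ∂stMeasure, G p ≤ ∑' i, H i p) : V G ≤ ∑' i, V (H i) :=
  (hV.mono hG (by fun_prop) h).trans (hV.sum H hH)

theorem cut_mono {G H : ℝ × ℝ → ℝ≥0∞} (hG : Measurable G) (hH : Measurable H)
    (h : ∀ᵐ p ∂stMeasure, G p ≤ H p) (l : ℕ) (m : ℤ) :
    V (cut P l m G) ≤ V (cut P l m H) :=
  hV.mono (by fun_prop) (by fun_prop) (h.mono fun p hp => by unfold cut; gcongr)

theorem cut_cv_le {κ : ℝ → ℝ≥0∞} {G : ℝ × ℝ → ℝ≥0∞} (hκ : Measurable κ)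
    (hκ' : ∫⁻ y, κ y ≠ ⊤) (hG : Measurable G) (l : ℕ) (m : ℤ) :
    V (cut P l m (cv κ G)) ≤
      ∑' m', A * (∫⁻ x, (diffInterval l (m - m')).indicator κ x) * V (cut P l m' G) := by
  have hi : ∀ m', Measurable ((diffInterval l (m - m')).indicator κ) :=
    fun m' => hκ.indicator (measurableSet_diffInterval _ _)
  refine (hV.mono_tsum (by fun_prop)
    (H := fun m' => cv ((diffInterval l (m - m')).indicator κ) (cut P l m' G))
    (fun m' => by have := hi m'; fun_prop)
    (ae_of_all _ fun p => BilinearKdV.cut_cv_le P hκ hG l m p)).trans ?_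
  exact ENNReal.tsum_le_tsum fun m' => hV.conv (hi m')
    (ne_top_of_le_ne_top hκ' (lintegral_mono (Set.indicator_le_self' fun _ _ => zero_le)))
    (by fun_prop)

theorem tsum_cut_cv_le {κ : ℝ → ℝ≥0∞} {G : ℝ × ℝ → ℝ≥0∞} (hκ : Measurable κ)
    (hκ' : ∫⁻ y, κ y ≠ ⊤) (hG : Measurable G) (l : ℕ) :
    ∑' m, V (cut P l m (cv κ G)) ≤ 2 * A * (∫⁻ x, κ x) * ∑' m, V (cut P l m G) := by
  refine (ENNReal.tsum_le_tsum fun m => hV.cut_cv_le P hκ hκ' hG l m).trans ?_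
  refine schur_one _ _ fun m' => ?_
  rw [ENNReal.tsum_mul_left, mul_comm 2 A, mul_assoc]
  gcongr
  exact tsum_lintegral_diffInterval_left hκ l m'

theorem tsum_cut_cv_sq_le {κ : ℝ → ℝ≥0∞} {G : ℝ × ℝ → ℝ≥0∞} (hκ : Measurable κ)
    (hκ' : ∫⁻ y, κ y ≠ ⊤) (hG : Measurable G) (l : ℕ) :
    ∑' m, V (cut P l m (cv κ G)) ^ 2 ≤
      (2 * A * ∫⁻ x, κ x) ^ 2 * ∑' m, V (cut P l m G) ^ 2 := by
  refine (ENNReal.tsum_le_tsum fun m => pow_le_pow_left₀ zero_le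
    (hV.cut_cv_le P hκ hκ' hG l m) 2).trans ?_
  rw [sq (2 * A * _)]
  refine schur_sq _ _ (fun m => ?_) fun m' => ?_
  · rw [ENNReal.tsum_mul_left, mul_comm 2 A, mul_assoc]
    gcongr
    exact tsum_lintegral_diffInterval_right hκ l m
  · rw [ENNReal.tsum_mul_left, mul_comm 2 A, mul_assoc]
    gcongr
    exact tsum_lintegral_diffInterval_left hκ l m'

theorem cut_le_meets {G : ℝ × ℝ → ℝ≥0∞} (hG : Measurable G) (l l' : ℕ) (m : ℤ) :
    V (cut P l m G) ≤ ∑' m', meets P l l' m m' * V (cut P l' m' G) := by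
  refine (hV.mono_tsum (by fun_prop)
    (H := fun m' p => meets P l l' m m' * cut P l' m' G p) (fun m' => by fun_prop)
    (ae_of_all _ fun p => ?_)).trans (ENNReal.tsum_le_tsum fun m' => hV.smul (by unfold meets; split_ifs <;> simp) (by fun_prop))
  by_cases hp : p.2 ∈ P.Q l m
  · refine (cut_le P l m G p).trans ?_
    rw [← tsum_cut P l' G p]
    refine ENNReal.tsum_le_tsum fun m' => ?_
    by_cases hp' : p.2 ∈ P.Q l' m'
    · unfold meets
      rw [if_pos ⟨p.2, hp, hp'⟩, one_mul]
    · simp [cut, Set.indicator_of_notMem hp']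
  · simp [cut, Set.indicator_of_notMem hp]

/-- An interval of length `2^l'` is counted once for each interval of length `2^l` that it meets, so
there is a loss only when passing to shorter intervals. -/
theorem tsum_cut_scale {G : ℝ × ℝ → ℝ≥0∞} (hG : Measurable G) (l l' : ℕ) :
    ∑' m, V (cut P l m G) ≤ (p2 (l' - l) + 2) * ∑' m, V (cut P l' m G) :=
  (ENNReal.tsum_le_tsum fun m => hV.cut_le_meets P hG l l' m).trans
    (schur_one _ _ fun m' => tsum_meets_le P l l' m')

theorem tsum_cut_sq_scale {G : ℝ × ℝ → ℝ≥0∞} (hG : Measurable G) (l l' : ℕ) :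
    ∑' m, V (cut P l m G) ^ 2 ≤
      (p2 (l - l') + 2) * (p2 (l' - l) + 2) * ∑' m, V (cut P l' m G) ^ 2 := by
  refine (ENNReal.tsum_le_tsum fun m => pow_le_pow_left₀ zero_le
    (hV.cut_le_meets P hG l l' m) 2).trans (schur_sq _ _ (fun m => ?_)
      fun m' => tsum_meets_le P l l' m')
  simp_rw [meets_comm P l l']
  exact tsum_meets_le P l' l m

theorem tsum_le_sum (G : ℝ × ℝ → ℝ≥0∞) (hG : Measurable G) (l : ℕ) :
    V G ≤ ∑' m, V (cut P l m G) :=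
  hV.mono_tsum hG (fun m => by fun_prop) (ae_of_all _ fun p => (tsum_cut P l G p).ge)

end LatNorm

/-! ### The functionals behind `X`, `L^∞ L²`, `Y` and `L¹ L²` -/

/-- The square of the norm of `X`, as a functional of `|u|²`. -/
noncomputable def VX (H : ℝ × ℝ → ℝ≥0∞) : ℝ≥0∞ :=
  ⨆ (l : ℕ) (m : ℤ), p2 (-l) * ∫⁻ p, cut P l m H p ∂stMeasure

/-- The square of the norm of `L^∞ L²`, as a functional of `|u|²`. -/
noncomputable def VI (H : ℝ × ℝ → ℝ≥0∞) : ℝ≥0∞ := essSup (fun t => ∫⁻ x, H (t, x)) timeMeasure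

/-- The norm of `L²([0,1] × ℝ)`. -/
noncomputable def n2 (F : ℝ × ℝ → ℝ≥0∞) : ℝ≥0∞ := (∫⁻ p, F p ^ 2 ∂stMeasure) ^ (1 / 2 : ℝ)

/-- `G` is dominated by `∑_{l,m} F_{l,m}`, where `F_{l,m}` vanishes off the `m`-th interval of
length `2 ^ l`. -/
structure IsDecomp (G : ℝ × ℝ → ℝ≥0∞) (F : ℕ × ℤ → ℝ × ℝ → ℝ≥0∞) : Prop where
  meas : ∀ i, Measurable (F i)
  supp : ∀ i p, p.2 ∉ P.Q i.1 i.2 → F i p = 0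
  le : ∀ᵐ p ∂stMeasure, G p ≤ ∑' i, F i p

/-- The norm of `Y`, as a functional of `|u|`. -/
noncomputable def NY (G : ℝ × ℝ → ℝ≥0∞) : ℝ≥0∞ :=
  ⨅ F : {F // IsDecomp P G F}, ∑' i, p2 (i.1 / 2) * n2 (F.1 i)

/-- The norm of `L¹ L²`. -/
noncomputable def NL (G : ℝ × ℝ → ℝ≥0∞) : ℝ≥0∞ :=
  ∫⁻ t, (∫⁻ x, G (t, x) ^ 2) ^ (1 / 2 : ℝ) ∂timeMeasure

/-- The norm of `Y_j`, up to equivalence, as a functional of `|u|`. -/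
noncomputable def NYj (j : ℕ) (G : ℝ × ℝ → ℝ≥0∞) : ℝ≥0∞ :=
  ⨅ F : {F : (ℝ × ℝ → ℝ≥0∞) × (ℝ × ℝ → ℝ≥0∞) // Measurable F.1 ∧ Measurable F.2 ∧
    ∀ᵐ p ∂stMeasure, G p ≤ F.1 p + F.2 p}, p2 (-j) * NY P F.1.1 + NL F.1.2

theorem lintegral_st {F : ℝ × ℝ → ℝ≥0∞} (hF : Measurable F) :
    ∫⁻ p, F p ∂stMeasure = ∫⁻ t, (∫⁻ x, F (t, x)) ∂timeMeasure :=
  lintegral_prod _ hF.aemeasurable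

theorem lintegral_cv_st {κ : ℝ → ℝ≥0∞} {G : ℝ × ℝ → ℝ≥0∞} (hκ : Measurable κ)
    (hG : Measurable G) :
    ∫⁻ p, cv κ G p ∂stMeasure = (∫⁻ y, κ y) * ∫⁻ p, G p ∂stMeasure := by
  rw [lintegral_st (by fun_prop), lintegral_st hG, ← lintegral_const_mul _ (by fun_prop)]
  exact lintegral_congr fun t => lintegral_cv hκ hG t

theorem n2_mono {F G : ℝ × ℝ → ℝ≥0∞} (h : ∀ᵐ p ∂stMeasure, F p ≤ G p) : n2 F ≤ n2 G := by
  unfold n2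
  refine ENNReal.rpow_le_rpow (lintegral_mono_ae (h.mono fun p hp => ?_)) (by norm_num)
  gcongr

theorem n2_tsum_le {ι : Type*} [Countable ι] (F : ι → ℝ × ℝ → ℝ≥0∞) (hF : ∀ i, Measurable (F i)) :
    n2 (fun p => ∑' i, F i p) ≤ ∑' i, n2 (F i) := by
  unfold n2
  rw [rpow_half_le_iff]
  exact lintegral_tsum_sq_le fun i => (hF i).aemeasurable

theorem n2_const_mul (c : ℝ≥0∞) {F : ℝ × ℝ → ℝ≥0∞} (hF : Measurable F) :
    n2 (fun p => c * F p) = c * n2 F := by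
  unfold n2
  simp_rw [mul_pow]
  rw [lintegral_const_mul _ (by fun_prop), ENNReal.mul_rpow_of_nonneg _ _ (by norm_num),
    sq_rpow_half]

theorem n2_cv_le {κ : ℝ → ℝ≥0∞} {G : ℝ × ℝ → ℝ≥0∞} (hκ : Measurable κ)
    (hG : Measurable G) : n2 (cv κ G) ≤ (∫⁻ y, κ y) * n2 G := by
  unfold n2
  rw [rpow_half_le_iff, mul_pow, rpow_half_sq]
  refine (lintegral_mono fun p => cv_sq_le hκ hG p).trans ?_
  rw [lintegral_const_mul _ (by fun_prop), lintegral_cv_st hκ (by fun_prop), sq, mul_assoc]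

/-- For the convolution bound one fixes the length `2^l`: the local mass on one interval is
dominated by a combination of local masses on intervals of the same length, with coefficients of sum
at most `2 ∫ κ`. The supremum is therefore preserved up to the factor `2`. -/
theorem latNorm_VX : LatNorm (VX P) 2 where
  mono {G H} hG hH h := by
    unfold VX
    refine iSup_mono fun l => iSup_mono fun m => ?_
    gcongr 1
    refine lintegral_mono_ae (h.mono fun p hp => ?_)
    unfold cut
    gcongr
  sum {ι} _ G hG := by
    unfold VX
    refine iSup_le fun l => iSup_le fun m => ?_
    have e : ∀ p, cut P l m (fun p => ∑' i, G i p) p = ∑' i, cut P l m (G i) p :=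
      fun p => ENNReal.tsum_mul_left.symm
    simp_rw [e]
    rw [lintegral_tsum fun i => by have := hG i; fun_prop, ← ENNReal.tsum_mul_left]
    exact ENNReal.tsum_le_tsum fun i =>
      le_iSup₂ (f := fun l m => p2 (-(l : ℕ)) * ∫⁻ p, cut P l m (G i) p ∂stMeasure) l m
  smul {c G} hc hG := by
    unfold VX
    refine iSup_le fun l => iSup_le fun m => ?_
    have e : ∀ p, cut P l m (fun p => c * G p) p = c * cut P l m G p :=
      fun p => mul_left_comm _ _ _
    simp_rw [e]
    rw [lintegral_const_mul _ (by fun_prop), mul_left_comm]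
    gcongr
    exact le_iSup₂ (f := fun l m => p2 (-(l : ℕ)) * ∫⁻ p, cut P l m G p ∂stMeasure) l m
  conv {κ G} hκ hκ' hG := by
    refine iSup_le fun l => iSup_le fun m => ?_
    have hi : ∀ m', Measurable ((diffInterval l (m - m')).indicator κ) :=
      fun m' => hκ.indicator (measurableSet_diffInterval _ _)
    calc p2 (-l) * ∫⁻ p, cut P l m (cv κ G) p ∂stMeasure
        ≤ p2 (-l) * ∫⁻ p, ∑' m', cv ((diffInterval l (m - m')).indicator κ)
            (cut P l m' G) p ∂stMeasure := by
          gcongr with p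
          exact BilinearKdV.cut_cv_le P hκ hG l m p
      _ = ∑' m', (∫⁻ x, (diffInterval l (m - m')).indicator κ x) *
            (p2 (-l) * ∫⁻ p, cut P l m' G p ∂stMeasure) := by
          rw [lintegral_tsum fun m' => by have := hi m'; fun_prop, ← ENNReal.tsum_mul_left]
          refine tsum_congr fun m' => ?_
          rw [lintegral_cv_st (hi m') (by fun_prop), mul_left_comm]
      _ ≤ ∑' m', (∫⁻ x, (diffInterval l (m - m')).indicator κ x) * VX P G := by
          gcongr with m'
          exact le_iSup₂ (f := fun l m => p2 (-(l : ℕ)) * ∫⁻ p, cut P l m G p ∂stMeasure) l m'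
      _ ≤ _ := by
          rw [ENNReal.tsum_mul_right]
          gcongr
          exact tsum_lintegral_diffInterval_right hκ l m

theorem latNorm_VI : LatNorm VI 1 where
  mono {G H} hG hH h := by
    refine essSup_mono_ae ((ae_ae_of_ae_st h).mono fun t ht => ?_)
    exact lintegral_mono_ae ht
  sum {ι} _ G hG := by
    refine essSup_le_of_ae_le _ ?_
    have : ∀ᵐ t ∂timeMeasure, ∀ i, ∫⁻ x, G i (t, x) ≤ VI (G i) :=
      ae_all_iff.2 fun i => ENNReal.ae_le_essSup _
    refine this.mono fun t ht => ?_
    change ∫⁻ x, ∑' i, G i (t, x) ≤ _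
    rw [lintegral_tsum fun i => by have := hG i; fun_prop]
    exact ENNReal.tsum_le_tsum ht
  smul {c G} hc hG := by
    refine essSup_le_of_ae_le _ ((ENNReal.ae_le_essSup fun t => ∫⁻ x, G (t, x)).mono
      fun t ht => ?_)
    change ∫⁻ x, c * G (t, x) ≤ c * VI G
    rw [lintegral_const_mul _ (by fun_prop)]
    gcongr
    exact ht
  conv {κ G} hκ hκ' hG := by
    refine essSup_le_of_ae_le _ ((ENNReal.ae_le_essSup fun t => ∫⁻ x, G (t, x)).mono
      fun t ht => ?_)
    change ∫⁻ x, cv κ G (t, x) ≤ 1 * (∫⁻ y, κ y) * VI G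
    rw [lintegral_cv hκ hG, one_mul]
    gcongr
    exact ht

variable {P} in
theorem IsDecomp.NY_le {G : ℝ × ℝ → ℝ≥0∞} {F : ℕ × ℤ → ℝ × ℝ → ℝ≥0∞} (h : IsDecomp P G F) :
    NY P G ≤ ∑' i, p2 (i.1 / 2) * n2 (F i) :=
  iInf_le (fun F : {F // IsDecomp P G F} => ∑' i, p2 (i.1 / 2) * n2 (F.1 i)) ⟨F, h⟩

theorem NY_le_of_supp {F : ℝ × ℝ → ℝ≥0∞} (hF : Measurable F) (l : ℕ) (m : ℤ)
    (h : ∀ p, p.2 ∉ P.Q l m → F p = 0) : NY P F ≤ p2 (l / 2) * n2 F := by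
  classical
  have hd : IsDecomp P F (fun i => if i = (l, m) then F else 0) := by
    refine ⟨fun i => ?_, ?_, ae_of_all _ fun p => ?_⟩
    · split_ifs <;> fun_prop
    · rintro ⟨l', m'⟩ p hp
      split_ifs with hi
      · obtain ⟨rfl, rfl⟩ := Prod.mk.inj hi
        exact h p hp
      · rfl
    · rw [tsum_eq_single (l, m)]
      · simp
      · intro i hi; simp [hi]
  refine hd.NY_le.trans ?_
  rw [tsum_eq_single (l, m)]
  · simp
  · intro i hi; simp [hi, n2]

theorem NY_mono {G H : ℝ × ℝ → ℝ≥0∞} (h : ∀ᵐ p ∂stMeasure, G p ≤ H p) : NY P G ≤ NY P H := by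
  refine le_iInf fun F => IsDecomp.NY_le ⟨F.2.meas, F.2.supp, ?_⟩
  filter_upwards [h, F.2.le] with p h1 h2 using h1.trans h2

/-- Nearly optimal decompositions of the summands are added interval by interval, which gives a
decomposition indexed by the same pairs `(l, m)`; Minkowski's inequality in `L²` bounds the new
pieces. -/
theorem NY_sum {ι : Type*} [Countable ι] (G : ι → ℝ × ℝ → ℝ≥0∞) :
    NY P (fun p => ∑' i, G i p) ≤ ∑' i, NY P (G i) := by
  refine ENNReal.le_of_forall_pos_le_add fun ε hε hfin => ?_
  obtain ⟨δ, hδ, hδs⟩ := ENNReal.exists_pos_sum_of_countable (ε := ε)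
    (by exact_mod_cast hε.ne') ι
  have hex : ∀ i, ∃ F : {F // IsDecomp P (G i) F},
      ∑' j, p2 (j.1 / 2) * n2 (F.1 j) < NY P (G i) + δ i := fun i =>
    iInf_lt_iff.1 (ENNReal.lt_add_right
      (ENNReal.ne_top_of_tsum_ne_top hfin.ne i) (by simpa using (hδ i).ne'))
  choose F hlt using hex
  have hm : ∀ i j, Measurable ((F i).1 j) := fun i => (F i).2.meas
  have hd : IsDecomp P (fun p => ∑' i, G i p) (fun j p => ∑' i, (F i).1 j p) := by
    refine ⟨fun j => ?_, fun j p hp => ?_, ?_⟩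
    · have := fun i => hm i j
      fun_prop
    · simp [fun i => (F i).2.supp j p hp]
    · filter_upwards [ae_all_iff.2 fun i => (F i).2.le] with p hp
      rw [ENNReal.tsum_comm]
      exact ENNReal.tsum_le_tsum hp
  refine hd.NY_le.trans ?_
  calc ∑' j : ℕ × ℤ, p2 (j.1 / 2) * n2 (fun p => ∑' i, (F i).1 j p)
      ≤ ∑' j : ℕ × ℤ, p2 (j.1 / 2) * ∑' i, n2 ((F i).1 j) := by
        gcongr with j
        exact n2_tsum_le _ fun i => hm i j
    _ = ∑' i, ∑' j : ℕ × ℤ, p2 (j.1 / 2) * n2 ((F i).1 j) := by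
        simp_rw [← ENNReal.tsum_mul_left]
        exact ENNReal.tsum_comm
    _ ≤ ∑' i, (NY P (G i) + δ i) := ENNReal.tsum_le_tsum fun i => (hlt i).le
    _ ≤ _ := by
        rw [ENNReal.tsum_add]
        gcongr

/-- Cutting at unit length is enough. This makes the infimum in `NY` one over a nonempty set, so
that it commutes with multiplication by a constant, including the constant `0`. -/
theorem exists_isDecomp {G : ℝ × ℝ → ℝ≥0∞} (hG : Measurable G) : ∃ F, IsDecomp P G F := by
  classical
  refine ⟨fun i => if i.1 = 0 then cut P i.1 i.2 G else 0, fun i => ?_, fun i p hp => ?_,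
    ae_of_all _ fun p => ?_⟩
  · split_ifs <;> fun_prop
  · split_ifs
    · simp [cut, Set.indicator_of_notMem hp]
    · rfl
  · rw [← tsum_cut P 0 G p]
    have hinj : Function.Injective fun m : ℤ => ((0, m) : ℕ × ℤ) := fun m m' h => by
      simpa using h
    refine le_trans (le_of_eq ?_) (ENNReal.tsum_comp_le_tsum_of_injective hinj
      fun i => (if i.1 = 0 then cut P i.1 i.2 G else 0) p)
    simp

theorem le_mul_NY {G : ℝ × ℝ → ℝ≥0∞} (hG : Measurable G) {X c : ℝ≥0∞} (hc : c ≠ ⊤)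
    (h : ∀ F, IsDecomp P G F → X ≤ c * ∑' i, p2 (i.1 / 2) * n2 (F i)) : X ≤ c * NY P G := by
  obtain ⟨F₀, hF₀⟩ := exists_isDecomp P hG
  unfold NY
  rw [ENNReal.mul_iInf' (fun h => absurd h hc) (fun _ => ⟨⟨F₀, hF₀⟩⟩)]
  exact le_iInf fun F => h F.1 F.2

theorem latNorm_NY : LatNorm (NY P) 2 where
  mono _ _ h := NY_mono P h
  sum G _ := NY_sum P G
  smul {c G} hc hG := by
    refine le_mul_NY P hG hc fun F hF => ?_
    have hd : IsDecomp P (fun p => c * G p) (fun i p => c * F i p) := by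
      refine ⟨fun i => (hF.meas i).const_mul c, fun i p hp => by simp [hF.supp i p hp], ?_⟩
      filter_upwards [hF.le] with p hp
      rw [ENNReal.tsum_mul_left]
      gcongr
    refine hd.NY_le.trans (le_of_eq ?_)
    rw [← ENNReal.tsum_mul_left]
    refine tsum_congr fun i => ?_
    rw [n2_const_mul c (hF.meas i), mul_left_comm]
  conv {κ G} hκ hκ' hG := by
    refine le_mul_NY P hG (by finiteness) fun F hF => ?_
    have hm := hF.meas
    have h1 : NY P (cv κ G) ≤ ∑' i, NY P (cv κ (F i)) := by
      refine le_trans (NY_mono P ?_) (NY_sum P _)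
      filter_upwards [cv_mono_ae (κ := κ) hF.le] with p hp
      rwa [cv_tsum hκ hF.meas] at hp
    refine h1.trans ?_
    rw [← ENNReal.tsum_mul_left]
    refine ENNReal.tsum_le_tsum fun i => ?_
    -- The function `κ * F_i` is no longer supported in the interval of `F_i`. It is cut along the
    -- same grid, where the piece `m` only sees the part of `κ` on `diffInterval` and again carries
    -- the weight `2^(l/2)`.
    have hi : ∀ m, Measurable ((diffInterval i.1 (m - i.2)).indicator κ) :=
      fun m => hκ.indicator (measurableSet_diffInterval _ _)
    have hle : ∀ m p, cut P i.1 m (cv κ (F i)) p ≤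
        cv ((diffInterval i.1 (m - i.2)).indicator κ) (F i) p := fun m p => by
      refine (BilinearKdV.cut_cv_le P hκ (hm i) i.1 m p).trans (le_of_eq ?_)
      have e : ∀ m' q, m' ≠ i.2 → cut P i.1 m' (F i) q = 0 := fun m' q hm' => by
        by_cases hq : q.2 ∈ P.Q i.1 m'
        · rw [cut, hF.supp i q, mul_zero]
          intro hq'
          exact hm' (((mem_Q_iff P _ _ _).1 hq).symm.trans ((mem_Q_iff P _ _ _).1 hq'))
        · simp [cut, Set.indicator_of_notMem hq]
      have e' : ∀ q, cut P i.1 i.2 (F i) q = F i q := fun q => by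
        by_cases hq : q.2 ∈ P.Q i.1 i.2
        · simp [cut, hq]
        · rw [hF.supp i q hq, cut, hF.supp i q hq, mul_zero]
      rw [tsum_eq_single i.2]
      · unfold cv
        simp_rw [e']
      · intro m' hm'
        unfold cv
        simp_rw [e m' _ hm']
        simp
    calc NY P (cv κ (F i)) ≤ ∑' m, NY P (cut P i.1 m (cv κ (F i))) := by
          refine le_trans (NY_mono P (ae_of_all _ fun p => ?_)) (NY_sum P _)
          rw [tsum_cut]
      _ ≤ ∑' m, p2 (i.1 / 2) *
            ((∫⁻ x, (diffInterval i.1 (m - i.2)).indicator κ x) * n2 (F i)) := by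
          refine ENNReal.tsum_le_tsum fun m => ?_
          have := hm i
          refine (NY_le_of_supp P (by fun_prop) i.1 m fun p hp => ?_).trans ?_
          · simp [cut, Set.indicator_of_notMem hp]
          · gcongr
            exact (n2_mono (ae_of_all _ (hle m))).trans (n2_cv_le (hi m) (hm i))
      _ ≤ _ := by
          rw [ENNReal.tsum_mul_left, ENNReal.tsum_mul_right, mul_left_comm]
          gcongr
          exact tsum_lintegral_diffInterval_left hκ i.1 i.2

theorem latNorm_NL : LatNorm NL 1 where
  mono {G H} hG hH h := by
    refine lintegral_mono_ae ((ae_ae_of_ae_st h).mono fun t ht => ?_)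
    refine ENNReal.rpow_le_rpow (lintegral_mono_ae (ht.mono fun x hx => ?_)) (by norm_num)
    gcongr
  sum {ι} _ G hG := by
    unfold NL
    rw [← lintegral_tsum fun i => by have := hG i; fun_prop]
    refine lintegral_mono fun t => ?_
    dsimp only
    rw [rpow_half_le_iff]
    exact lintegral_tsum_sq_le fun i => by have := hG i; fun_prop
  smul {c G} hc hG := by
    unfold NL
    rw [← lintegral_const_mul _ (by fun_prop)]
    refine lintegral_mono fun t => ?_
    simp_rw [mul_pow]
    rw [lintegral_const_mul _ (by fun_prop), ENNReal.mul_rpow_of_nonneg _ _ (by norm_num),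
      sq_rpow_half]
  conv {κ G} hκ hκ' hG := by
    unfold NL
    rw [← lintegral_const_mul _ (by fun_prop)]
    refine lintegral_mono fun t => ?_
    dsimp only
    rw [rpow_half_le_iff, mul_pow, rpow_half_sq, one_mul]
    refine (lintegral_mono fun x => cv_sq_le hκ hG (t, x)).trans ?_
    rw [lintegral_const_mul _ (by fun_prop), lintegral_cv hκ (by fun_prop), sq, mul_assoc]

theorem NYj_le (j : ℕ) {G F₁ F₂ : ℝ × ℝ → ℝ≥0∞} (h₁ : Measurable F₁) (h₂ : Measurable F₂)
    (h : ∀ᵐ p ∂stMeasure, G p ≤ F₁ p + F₂ p) : NYj P j G ≤ p2 (-j) * NY P F₁ + NL F₂ :=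
  iInf_le (fun F : {F : (ℝ × ℝ → ℝ≥0∞) × (ℝ × ℝ → ℝ≥0∞) // Measurable F.1 ∧ Measurable F.2 ∧
    ∀ᵐ p ∂stMeasure, G p ≤ F.1 p + F.2 p} => p2 (-j) * NY P F.1.1 + NL F.1.2) ⟨(F₁, F₂), h₁, h₂, h⟩

theorem le_mul_NYj (j : ℕ) {G : ℝ × ℝ → ℝ≥0∞} (hG : Measurable G) {X c : ℝ≥0∞} (hc : c ≠ ⊤)
    (h : ∀ F₁ F₂, Measurable F₁ → Measurable F₂ → (∀ᵐ p ∂stMeasure, G p ≤ F₁ p + F₂ p) →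
      X ≤ c * (p2 (-j) * NY P F₁ + NL F₂)) : X ≤ c * NYj P j G := by
  unfold NYj
  rw [ENNReal.mul_iInf' (fun h => absurd h hc)
    (fun _ => ⟨⟨(G, fun _ => 0), hG, measurable_const, by simp⟩⟩)]
  exact le_iInf fun F => h F.1.1 F.1.2 F.2.1 F.2.2.1 F.2.2.2

theorem latNorm_NYj (j : ℕ) : LatNorm (NYj P j) 2 where
  mono {G H} hG hH h := by
    have := le_mul_NYj P j hH (X := NYj P j G) (c := 1) (by simp) fun F₁ F₂ h₁ h₂ hF => by
      rw [one_mul]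
      refine NYj_le P j h₁ h₂ ?_
      filter_upwards [h, hF] with p h3 h4 using h3.trans h4
    rwa [one_mul] at this
  sum {ι} _ G hG := by
    refine ENNReal.le_of_forall_pos_le_add fun ε hε hfin => ?_
    obtain ⟨δ, hδ, hδs⟩ := ENNReal.exists_pos_sum_of_countable (ε := ε)
      (by exact_mod_cast hε.ne') ι
    have hex := fun i => iInf_lt_iff.1 (show NYj P j (G i) < NYj P j (G i) + δ i from
      ENNReal.lt_add_right
        (ENNReal.ne_top_of_tsum_ne_top hfin.ne i) (by simpa using (hδ i).ne'))
    choose F hlt using hex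
    have h1 : ∀ i, Measurable (F i).1.1 := fun i => (F i).2.1
    have h2 : ∀ i, Measurable (F i).1.2 := fun i => (F i).2.2.1
    refine (NYj_le P j (F₁ := fun p => ∑' i, (F i).1.1 p) (F₂ := fun p => ∑' i, (F i).1.2 p)
      (by fun_prop) (by fun_prop) ?_).trans ?_
    · filter_upwards [ae_all_iff.2 fun i => (F i).2.2.2] with p hp
      rw [← ENNReal.tsum_add]
      exact ENNReal.tsum_le_tsum hp
    · calc _ ≤ p2 (-j) * ∑' i, NY P (F i).1.1 + ∑' i, NL (F i).1.2 := by
            gcongr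
            · exact NY_sum P _
            · exact latNorm_NL.sum _ h2
        _ = ∑' i, (p2 (-j) * NY P (F i).1.1 + NL (F i).1.2) := by
            rw [ENNReal.tsum_add, ENNReal.tsum_mul_left]
        _ ≤ ∑' i, (NYj P j (G i) + δ i) := ENNReal.tsum_le_tsum fun i => (hlt i).le
        _ ≤ _ := by
            rw [ENNReal.tsum_add]
            gcongr
  smul {c G} hc hG := by
    refine le_mul_NYj P j hG hc fun F₁ F₂ h₁ h₂ hF => ?_
    refine (NYj_le P j (h₁.const_mul c) (h₂.const_mul c) ?_).trans ?_
    · filter_upwards [hF] with p hp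
      rw [← mul_add]
      gcongr
    · rw [mul_add, mul_left_comm]
      gcongr
      · exact (latNorm_NY P).smul hc h₁
      · exact latNorm_NL.smul hc h₂
  conv {κ G} hκ hκ' hG := by
    refine le_mul_NYj P j hG (by finiteness) fun F₁ F₂ h₁ h₂ hF => ?_
    refine (NYj_le P j (measurable_cv hκ h₁) (measurable_cv hκ h₂) ?_).trans ?_
    · filter_upwards [cv_mono_ae (κ := κ) hF] with p hp
      refine hp.trans (le_of_eq ?_)
      unfold cv
      rw [← lintegral_add_left (by fun_prop)]
      exact lintegral_congr fun y => mul_add _ _ _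
    · rw [mul_add, mul_left_comm]
      gcongr
      · exact (latNorm_NY P).conv hκ hκ' h₁
      · refine (latNorm_NL.conv hκ hκ' h₂).trans ?_
        gcongr
        norm_num

variable (P : SpacePartition)

/-! ### The norms of one frequency block -/

/-- The `l¹` sum of `V` over the intervals of length `2 ^ l`. -/
noncomputable def l1cut (l : ℕ) (V : (ℝ × ℝ → ℝ≥0∞) → ℝ≥0∞) (H : ℝ × ℝ → ℝ≥0∞) : ℝ≥0∞ :=
  ∑' m, V (cut P l m H)

/-- The `l²` sum of `V` over the intervals of length `2 ^ l`. -/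
noncomputable def l2cut (l : ℕ) (V : (ℝ × ℝ → ℝ≥0∞) → ℝ≥0∞) (H : ℝ × ℝ → ℝ≥0∞) : ℝ≥0∞ :=
  (∑' m, V (cut P l m H) ^ 2) ^ (1 / 2 : ℝ)

/-- The norm with the square `Z(G²)`. -/
noncomputable def quad (Z : (ℝ × ℝ → ℝ≥0∞) → ℝ≥0∞) (G : ℝ × ℝ → ℝ≥0∞) : ℝ≥0∞ :=
  Z (fun p => G p ^ 2) ^ (1 / 2 : ℝ)

theorem quad_sq (Z : (ℝ × ℝ → ℝ≥0∞) → ℝ≥0∞) (G : ℝ × ℝ → ℝ≥0∞) :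
    quad Z G ^ 2 = Z (fun p => G p ^ 2) := rpow_half_sq _

theorem l2cut_sq (l : ℕ) (V : (ℝ × ℝ → ℝ≥0∞) → ℝ≥0∞) (H : ℝ × ℝ → ℝ≥0∞) :
    l2cut P l V H ^ 2 = ∑' m, V (cut P l m H) ^ 2 := rpow_half_sq _

theorem cut_tsum {ι : Type*} (l : ℕ) (m : ℤ) (G : ι → ℝ × ℝ → ℝ≥0∞) :
    cut P l m (fun p => ∑' i, G i p) = fun p => ∑' i, cut P l m (G i) p := by
  funext p
  exact ENNReal.tsum_mul_left.symm

theorem cut_const_mul (l : ℕ) (m : ℤ) (c : ℝ≥0∞) (G : ℝ × ℝ → ℝ≥0∞) :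
    cut P l m (fun p => c * G p) = fun p => c * cut P l m G p := by
  funext p
  exact mul_left_comm _ _ _

theorem cut_sq (l : ℕ) (m : ℤ) (G : ℝ × ℝ → ℝ≥0∞) (p : ℝ × ℝ) :
    cut P l m G p ^ 2 = cut P l m (fun p => G p ^ 2) p := by
  unfold cut
  by_cases h : p.2 ∈ P.Q l m <;> simp [h]

namespace LatNorm

variable {V V' : (ℝ × ℝ → ℝ≥0∞) → ℝ≥0∞} {A : ℝ≥0∞}

theorem l1cut (hV : LatNorm V A) (l : ℕ) : LatNorm (l1cut P l V) (2 * A) where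
  mono hG hH h := ENNReal.tsum_le_tsum fun m => hV.cut_mono P hG hH h l m
  sum {ι} _ G hG := by
    unfold BilinearKdV.l1cut
    rw [ENNReal.tsum_comm]
    refine ENNReal.tsum_le_tsum fun m => ?_
    rw [cut_tsum]
    exact hV.sum _ fun i => by have := hG i; fun_prop
  smul {c G} hc hG := by
    unfold BilinearKdV.l1cut
    rw [← ENNReal.tsum_mul_left]
    refine ENNReal.tsum_le_tsum fun m => ?_
    rw [cut_const_mul]
    exact hV.smul hc (by fun_prop)
  conv hκ hκ' hG := hV.tsum_cut_cv_le P hκ hκ' hG l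

theorem l2cut (hV : LatNorm V A) (l : ℕ) : LatNorm (l2cut P l V) (2 * A) where
  mono hG hH h := by
    refine ENNReal.rpow_le_rpow (ENNReal.tsum_le_tsum fun m => ?_) (by norm_num)
    gcongr
    exact hV.cut_mono P hG hH h l m
  sum {ι} _ G hG := by
    unfold BilinearKdV.l2cut
    rw [rpow_half_le_iff]
    refine le_trans (ENNReal.tsum_le_tsum fun m => ?_)
      (tsum_tsum_sq_le fun i m => V (cut P l m (G i)))
    rw [cut_tsum]
    gcongr
    exact hV.sum _ fun i => by have := hG i; fun_prop
  smul {c G} hc hG := by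
    unfold BilinearKdV.l2cut
    rw [rpow_half_le_iff, mul_pow, rpow_half_sq, ← ENNReal.tsum_mul_left]
    refine ENNReal.tsum_le_tsum fun m => ?_
    rw [cut_const_mul, ← mul_pow]
    gcongr
    exact hV.smul hc (by fun_prop)
  conv hκ hκ' hG := by
    unfold BilinearKdV.l2cut
    rw [rpow_half_le_iff, mul_pow, rpow_half_sq]
    exact hV.tsum_cut_cv_sq_le P hκ hκ' hG l

/-- Although `V` acts on squares, its square root satisfies the triangle inequality: the square of a
sum is dominated pointwise by a weighted sum of squares, subadditivity of `V` applies to that, and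
the weights are optimised. For the convolution, Cauchy-Schwarz gives the constant `A` under the
root, and `1 ≤ A` allows it to be replaced by `A²`. -/
theorem quad (hV : LatNorm V A) (hA : 1 ≤ A) : LatNorm (quad V) A where
  mono hG hH h := by
    refine ENNReal.rpow_le_rpow (hV.mono (by fun_prop) (by fun_prop)
      (h.mono fun p hp => ?_)) (by norm_num)
    gcongr
  sum {ι} _ G hG := by
    unfold BilinearKdV.quad
    rw [rpow_half_le_iff]
    refine le_sq_tsum_of_weighted _ _ fun q h0 ht hq => ?_
    simp_rw [rpow_half_sq]
    calc V (fun p => (∑' i, G i p) ^ 2)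
        ≤ V (fun p => (∑' i, q i) * ∑' i, (q i)⁻¹ * G i p ^ 2) :=
          hV.mono (by fun_prop) (by have := hG; fun_prop)
            (ae_of_all _ fun p => tsum_sq_le_weighted q _ h0 ht)
      _ ≤ (∑' i, q i) * V (fun p => ∑' i, (q i)⁻¹ * G i p ^ 2) :=
          hV.smul hq (by fun_prop)
      _ ≤ (∑' i, q i) * ∑' i, (q i)⁻¹ * V (fun p => G i p ^ 2) := by
          gcongr
          refine (hV.sum _ fun i => by have := hG i; fun_prop).trans ?_
          exact ENNReal.tsum_le_tsum fun i => hV.smul (by simpa using h0 i)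
            (by have := hG i; fun_prop)
  smul {c G} hc hG := by
    unfold BilinearKdV.quad
    rw [rpow_half_le_iff, mul_pow, rpow_half_sq]
    simp_rw [mul_pow]
    exact hV.smul (by finiteness) (by fun_prop)
  conv {κ G} hκ hκ' hG := by
    unfold BilinearKdV.quad
    rw [rpow_half_le_iff, mul_pow, rpow_half_sq]
    calc V (fun p => cv κ G p ^ 2) ≤ V (fun p => (∫⁻ y, κ y) * cv κ (fun p => G p ^ 2) p) :=
          hV.mono (by fun_prop) (by fun_prop) (ae_of_all _ fun p => cv_sq_le hκ hG p)
      _ ≤ (∫⁻ y, κ y) * (A * (∫⁻ y, κ y) * V (fun p => G p ^ 2)) := by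
          refine (hV.smul hκ' (by fun_prop)).trans ?_
          gcongr
          exact hV.conv hκ hκ' (by fun_prop)
      _ = A * (∫⁻ y, κ y) ^ 2 * V (fun p => G p ^ 2) := by ring
      _ ≤ _ := by
          rw [mul_pow]
          gcongr
          exact le_self_pow hA (by norm_num)

theorem add_norm (hV : LatNorm V A) (hV' : LatNorm V' A) : LatNorm (fun G => V G + V' G) A where
  mono hG hH h := add_le_add (hV.mono hG hH h) (hV'.mono hG hH h)
  sum G hG := (add_le_add (hV.sum G hG) (hV'.sum G hG)).trans_eq ENNReal.tsum_add.symm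
  smul hc hG := (add_le_add (hV.smul hc hG) (hV'.smul hc hG)).trans_eq (mul_add _ _ _).symm
  conv hκ hκ' hG := (add_le_add (hV.conv hκ hκ' hG) (hV'.conv hκ hκ' hG)).trans_eq
    (mul_add _ _ _).symm

theorem const_mul (hV : LatNorm V A) (a : ℝ≥0∞) : LatNorm (fun G => a * V G) A where
  mono hG hH h := by gcongr; exact hV.mono hG hH h
  sum G hG := by
    rw [ENNReal.tsum_mul_left]
    gcongr
    exact hV.sum G hG
  smul {c G} hc hG := by
    rw [mul_left_comm]
    gcongr
    exact hV.smul hc hG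
  conv {κ G} hκ hκ' hG := by
    rw [mul_left_comm]
    gcongr
    exact hV.conv hκ hκ' hG

theorem mono_const (hV : LatNorm V A) {B : ℝ≥0∞} (h : A ≤ B) : LatNorm V B where
  mono := hV.mono
  sum := hV.sum
  smul := hV.smul
  conv {κ G} hκ hκ' hG := (hV.conv hκ hκ' hG).trans (by gcongr)

/-- Multiplication by a bounded function, followed by a convolution. -/
theorem cv_mul_le (hV : LatNorm V A) {κ : ℝ → ℝ≥0∞} {G H : ℝ × ℝ → ℝ≥0∞} (hκ : Measurable κ)
    (hκ' : ∫⁻ y, κ y ≠ ⊤) (hG : Measurable G) (hH : Measurable H) {M : ℝ≥0∞} (hM : M ≠ ⊤)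
    (h : ∀ᵐ p ∂stMeasure, H p ≤ M) :
    V (cv κ fun p => G p * H p) ≤ A * (∫⁻ y, κ y) * M * V G := by
  refine (hV.conv hκ hκ' (by fun_prop)).trans ?_
  rw [mul_assoc _ M]
  gcongr
  refine (hV.mono (by fun_prop) (hG.const_mul M) ?_).trans (hV.smul hM hG)
  filter_upwards [h] with p hp
  rw [mul_comm]
  gcongr

end LatNorm

/-- `4 ^ k` times the square of the norm of `X` plus the square of the norm of `L^∞ L²`. -/
noncomputable def VXI (k : ℕ) (H : ℝ × ℝ → ℝ≥0∞) : ℝ≥0∞ := p2 (2 * k) * VX P H + VI H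

/-- The norm of `L^∞ L²`, as a functional of `|u|`. -/
noncomputable def NH : (ℝ × ℝ → ℝ≥0∞) → ℝ≥0∞ := quad VI

/-- The norm of `l²_{2k} X_k`, up to equivalence, as a functional of `|u|`. -/
noncomputable def NX (k : ℕ) : (ℝ × ℝ → ℝ≥0∞) → ℝ≥0∞ := quad (l1cut P (2 * k) (VXI P k))

/-- The norm of `l²_{2k} Y_k`, up to equivalence, as a functional of `|u|`. -/
noncomputable def NYb (k : ℕ) : (ℝ × ℝ → ℝ≥0∞) → ℝ≥0∞ := l2cut P (2 * k) (NYj P k)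

theorem latNorm_VXI (k : ℕ) : LatNorm (VXI P k) 2 :=
  ((latNorm_VX P).const_mul _).add_norm (latNorm_VI.mono_const (by norm_num))

theorem latNorm_NH : LatNorm NH 4 := (latNorm_VI.quad le_rfl).mono_const (by norm_num)

theorem latNorm_NX (k : ℕ) : LatNorm (NX P k) 4 :=
  (((latNorm_VXI P k).l1cut P (2 * k)).quad (by norm_num)).mono_const (by norm_num)

theorem latNorm_NYb (k : ℕ) : LatNorm (NYb P k) 4 :=
  ((latNorm_NYj P k).l2cut P (2 * k)).mono_const (by norm_num)

theorem NH_le_NX (k : ℕ) {G : ℝ × ℝ → ℝ≥0∞} (hG : Measurable G) : NH G ≤ NX P k G := by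
  refine ENNReal.rpow_le_rpow ?_ (by norm_num)
  refine (latNorm_VI.tsum_le_sum P _ (by fun_prop) (2 * k)).trans ?_
  exact ENNReal.tsum_le_tsum fun m => le_add_self

theorem ae_lintegral_sq_le_NH (G : ℝ × ℝ → ℝ≥0∞) :
    ∀ᵐ t ∂timeMeasure, ∫⁻ x, G (t, x) ^ 2 ≤ NH G ^ 2 := by
  rw [NH, quad_sq]
  exact ENNReal.ae_le_essSup fun t => ∫⁻ x, G (t, x) ^ 2

theorem l1cut_VX_le (k : ℕ) {G : ℝ × ℝ → ℝ≥0∞} :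
    ∑' m, VX P (cut P (2 * k) m fun p => G p ^ 2) ≤ p2 (-(2 * k)) * NX P k G ^ 2 := by
  rw [NX, quad_sq, l1cut, ← ENNReal.tsum_mul_left]
  refine ENNReal.tsum_le_tsum fun m => ?_
  rw [VXI, mul_add, ← mul_assoc, ← p2_add, neg_add_cancel, p2_zero, one_mul]
  exact le_self_add

theorem l1cut_VI_le (k : ℕ) {G : ℝ × ℝ → ℝ≥0∞} :
    ∑' m, VI (cut P (2 * k) m fun p => G p ^ 2) ≤ NX P k G ^ 2 := by
  rw [NX, quad_sq]
  exact ENNReal.tsum_le_tsum fun m => le_add_self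

/-! ### Change of the frequency in the norms of a block -/

theorem p2_add_two_le {x y : ℝ} (h : x ≤ y) (h0 : 0 ≤ y) : p2 x + 2 ≤ p2 (y + 2) := by
  have h1 : (1 : ℝ≥0∞) ≤ p2 y := one_le_p2 h0
  calc p2 x + 2 ≤ p2 y + 2 * p2 y := add_le_add (p2_mono h) (by simpa using mul_le_mul_right h1 2)
    _ = 3 * p2 y := by ring
    _ ≤ 4 * p2 y := by gcongr; norm_num
    _ = p2 (y + 2) := by
      rw [p2_add, mul_comm, show (2 : ℝ) = (2 : ℕ) by norm_num, p2_natCast]; norm_num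

/-- An interval of length `4^a` meets about `4^(a-k)` intervals of length `4^k`; the root of this is
the loss `2^(a-k)`. Under the root the counting costs `2^16` and the comparison of `4^k` with `4^a`
costs `2^14`, as `k` may exceed `a` by `7`. -/
theorem NX_scale {k a : ℕ} (h : k ≤ a + 7) {G : ℝ × ℝ → ℝ≥0∞} (hG : Measurable G) :
    NX P k G ≤ p2 15 * p2 (a - k) * NX P a G := by
  have hk : (k : ℝ) ≤ a + 7 := by exact_mod_cast h
  refine le_of_sq_le_sq ?_
  rw [mul_pow, NX, NX, quad_sq, quad_sq, ← p2_add, p2_sq]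
  refine ((latNorm_VXI P k).tsum_cut_scale P (by fun_prop) (2 * k) (2 * a)).trans ?_
  calc (p2 ((2 * a : ℕ) - (2 * k : ℕ)) + 2) * ∑' m, VXI P k (cut P (2 * a) m fun p => G p ^ 2)
      ≤ p2 (2 * a - 2 * k + 14 + 2) *
          ∑' m, p2 14 * VXI P a (cut P (2 * a) m fun p => G p ^ 2) := by
        push_cast
        gcongr with m
        · exact p2_add_two_le (by linarith) (by linarith)
        · unfold VXI
          rw [mul_add, ← mul_assoc, ← p2_add]
          gcongr
          · exact p2_mono (by linarith)
          · exact le_mul_of_one_le_left zero_le (one_le_p2 (by norm_num))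
    _ = _ := by
        rw [ENNReal.tsum_mul_left, ← mul_assoc, ← p2_add, l1cut]
        ring_nf

theorem NYb_scale {k a : ℕ} (h : k ≤ a + 3) (h' : a ≤ k + 3) {G : ℝ × ℝ → ℝ≥0∞}
    (hG : Measurable G) : NYb P k G ≤ p2 11 * NYb P a G := by
  have hk : (k : ℝ) ≤ a + 3 := by exact_mod_cast h
  have ha : (a : ℝ) ≤ k + 3 := by exact_mod_cast h'
  have hj : ∀ H, Measurable H → NYj P k H ≤ p2 3 * NYj P a H := fun H hH => by
    refine le_mul_NYj P a hH (p2_ne_top _) fun F₁ F₂ h₁ h₂ hF => ?_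
    refine (NYj_le P k h₁ h₂ hF).trans ?_
    rw [mul_add, ← mul_assoc, ← p2_add]
    gcongr
    · exact p2_mono (by linarith)
    · exact le_mul_of_one_le_left zero_le (one_le_p2 (by norm_num))
  refine le_of_sq_le_sq ?_
  rw [mul_pow, NYb, NYb, l2cut_sq, l2cut_sq]
  refine ((latNorm_NYj P k).tsum_cut_sq_scale P hG (2 * k) (2 * a)).trans ?_
  calc _ ≤ p2 (6 + 2) * p2 (6 + 2) * ∑' m, p2 3 ^ 2 * NYj P a (cut P (2 * a) m G) ^ 2 := by
        push_cast
        gcongr with m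
        · exact p2_add_two_le (by linarith) (by norm_num)
        · exact p2_add_two_le (by linarith) (by norm_num)
        · rw [← mul_pow]
          gcongr
          exact hj _ (by fun_prop)
    _ = _ := by
        rw [ENNReal.tsum_mul_left, ← mul_assoc, p2_sq, p2_sq, ← p2_add, ← p2_add]
        norm_num

theorem lintegral_kap_ne_top (k : ℕ) : ∫⁻ y, kap k y ≠ ⊤ :=
  ne_top_of_le_ne_top (by simp) (lintegral_kap_le k)

/-! ### Bilinear estimates for one pair of blocks -/

/-- Bernstein's inequality: a function dominated by its average at scale `2 ^ (-b)` is bounded. -/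
theorem ae_le_of_le_cv {b : ℕ} {G : ℝ × ℝ → ℝ≥0∞} (hG : Measurable G) {c : ℝ≥0∞}
    (h : ∀ᵐ p ∂stMeasure, G p ≤ c * cv (kap b) G p) :
    ∀ᵐ p ∂stMeasure, G p ≤ c * (2 * p2 (b / 2) * NH G) := by
  filter_upwards [h, ae_st_of_ae_time (ae_lintegral_sq_le_NH G)] with p hp ht
  refine hp.trans ?_
  gcongr
  refine le_of_sq_le_sq ?_
  have h1 := cv_mul_sq_le (measurable_kap b) (G := fun _ => 1) measurable_const hG p
  simp only [one_mul, one_pow] at h1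
  refine h1.trans ?_
  have h2 : cv (fun x => kap b x ^ 2) (fun _ => 1) p ≤ 4 * p2 b := by
    unfold cv
    simp only [mul_one]
    rw [lintegral_comp_sub (fun x => kap b x ^ 2)]
    exact lintegral_kap_sq_le b
  rw [mul_pow, mul_pow, p2_sq, mul_div_cancel₀ _ (two_ne_zero' ℝ)]
  refine (mul_le_mul' h2 ht).trans (le_of_eq ?_)
  norm_num

/-- High-high interactions in norms based on `L²`. -/
theorem quad_cv_mul_le {Z : (ℝ × ℝ → ℝ≥0∞) → ℝ≥0∞} {A : ℝ≥0∞} (hZ : LatNorm Z A)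
    {κ : ℝ → ℝ≥0∞} (hκ : Measurable κ) (hκ' : ∫⁻ y, κ y ^ 2 ≠ ⊤) {G H : ℝ × ℝ → ℝ≥0∞}
    (hG : Measurable G) (hH : Measurable H) (hfin : NH H ≠ ⊤) :
    quad Z (cv κ fun p => G p * H p) ≤
      (A * ∫⁻ y, κ y ^ 2) ^ (1 / 2 : ℝ) * quad Z G * NH H := by
  refine le_of_sq_le_sq ?_
  rw [mul_pow, mul_pow, rpow_half_sq, quad_sq, quad_sq]
  calc Z (fun p => cv κ (fun p => G p * H p) p ^ 2)
      ≤ Z (fun p => NH H ^ 2 * cv (fun x => κ x ^ 2) (fun p => G p ^ 2) p) := by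
        refine hZ.mono (by fun_prop) (by fun_prop) ?_
        filter_upwards [ae_st_of_ae_time (ae_lintegral_sq_le_NH H)] with p ht
        refine (cv_mul_sq_le hκ hG hH p).trans ?_
        rw [mul_comm]
        gcongr
    _ ≤ NH H ^ 2 * (A * (∫⁻ y, κ y ^ 2) * Z (fun p => G p ^ 2)) := by
        refine (hZ.smul (by finiteness) (by fun_prop)).trans ?_
        gcongr
        exact hZ.conv (by fun_prop) hκ' (by fun_prop)
    _ = _ := by ring

theorem quad_cv_kap_mul_le {Z : (ℝ × ℝ → ℝ≥0∞) → ℝ≥0∞} (hZ : LatNorm Z 4) (k : ℕ)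
    {G H : ℝ × ℝ → ℝ≥0∞} (hG : Measurable G) (hH : Measurable H) (hfin : NH H ≠ ⊤) :
    quad Z (cv (kap k) fun p => G p * H p) ≤ 4 * p2 (k / 2) * quad Z G * NH H := by
  refine (quad_cv_mul_le hZ (measurable_kap k) (ne_top_of_le_ne_top
    (ENNReal.mul_ne_top (by simp) (p2_ne_top k)) (lintegral_kap_sq_le k)) hG hH hfin).trans ?_
  gcongr
  rw [rpow_half_le_iff, mul_pow, p2_sq, mul_div_cancel₀ _ (two_ne_zero' ℝ)]
  refine (mul_le_mul_right (lintegral_kap_sq_le k) _).trans (le_of_eq ?_)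
  rw [← mul_assoc]; norm_num

/-- The factor `2^(k/2)` is the `L²` norm of the kernel at the output frequency. The remaining
`2^(a-k)` comes from measuring a function of frequency `2^a` on the shorter intervals belonging to
`2^k`. -/
theorem NX_highHigh {k a : ℕ} (h : k ≤ a + 7) {G H : ℝ × ℝ → ℝ≥0∞} (hG : Measurable G)
    (hH : Measurable H) (hfin : NH H ≠ ⊤) :
    NX P k (cv (kap k) fun p => G p * H p) ≤ p2 17 * p2 (k / 2 + (a - k)) * NX P a G * NH H := by
  refine (quad_cv_kap_mul_le (((latNorm_VXI P k).l1cut P (2 * k)).mono_const (by norm_num))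
    k hG hH hfin).trans ?_
  refine mul_le_mul_left ((mul_le_mul_right (NX_scale P h hG) _).trans (le_of_eq ?_)) _
  rw [show (4 : ℝ≥0∞) = p2 2 by rw [show (2 : ℝ) = (2 : ℕ) by norm_num, p2_natCast]; norm_num,
    p2_add (k / 2), show (17 : ℝ) = 2 + 15 by norm_num, p2_add 2]
  ring

theorem NH_highHigh (k : ℕ) {G H : ℝ × ℝ → ℝ≥0∞} (hG : Measurable G)
    (hH : Measurable H) (hfin : NH H ≠ ⊤) :
    NH (cv (kap k) fun p => G p * H p) ≤ 4 * p2 (k / 2) * NH G * NH H :=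
  quad_cv_kap_mul_le (latNorm_VI.mono_const (by norm_num)) k hG hH hfin

theorem NL_sq_le {F : ℝ × ℝ → ℝ≥0∞} (hF : Measurable F) :
    NL F ^ 2 ≤ ∫⁻ p, F p ^ 2 ∂stMeasure := by
  have h := lintegral_mul_sq_le (μ := timeMeasure) (f := fun _ => 1)
    (g := fun t => (∫⁻ x, F (t, x) ^ 2) ^ (1 / 2 : ℝ)) (by fun_prop) (by fun_prop)
  simp only [one_mul, one_pow, rpow_half_sq, lintegral_const, measure_univ] at h
  rw [lintegral_st (by fun_prop)]
  exact h

/-- Everything is placed in the `L¹ L²` part of `Y_k`. As the time interval has length `1`, the `L¹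
L²` norm is at most the `L²` norm, and the squares of the latter add up over disjoint intervals. -/
theorem NYb_le_NH (k : ℕ) {F : ℝ × ℝ → ℝ≥0∞} (hF : Measurable F) : NYb P k F ≤ NH F := by
  refine le_of_sq_le_sq ?_
  rw [NYb, l2cut_sq]
  calc ∑' m, NYj P k (cut P (2 * k) m F) ^ 2
      ≤ ∑' m, ∫⁻ p, cut P (2 * k) m F p ^ 2 ∂stMeasure := by
        refine ENNReal.tsum_le_tsum fun m => ?_
        refine le_trans ?_ (NL_sq_le (by fun_prop))
        gcongr
        refine (NYj_le P k (F₁ := fun _ => 0) (F₂ := cut P (2 * k) m F) measurable_const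
          (by fun_prop)
          (ae_of_all _ fun p => by simp)).trans ?_
        rw [(latNorm_NY P).zero, mul_zero, zero_add]
    _ = ∫⁻ p, F p ^ 2 ∂stMeasure := by
        rw [← lintegral_tsum fun m => by fun_prop]
        refine lintegral_congr fun p => ?_
        simp_rw [cut_sq]
        exact tsum_cut P _ _ p
    _ ≤ NH F ^ 2 := by
        rw [lintegral_st (by fun_prop)]
        refine (lintegral_mono_ae (ae_lintegral_sq_le_NH F)).trans ?_
        simp

theorem NYb_highHigh (k : ℕ) {G H : ℝ × ℝ → ℝ≥0∞} (hG : Measurable G)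
    (hH : Measurable H) (hfin : NH H ≠ ⊤) :
    NYb P k (cv (kap k) fun p => G p * H p) ≤ 4 * p2 (k / 2) * NH G * NH H :=
  (NYb_le_NH P k (measurable_cv (measurable_kap k) (by fun_prop))).trans
    (NH_highHigh k hG hH hfin)


/-- On an interval `r` of length `4^b` the product has `L²` norm at most `2^b V^(1/2) s_r^(1/2)`,
where the first two factors bound `G` through its local energy at that scale. The weight of an atom
is another `2^b`. Cauchy-Schwarz over the roughly `4^(k-b)` intervals meeting the large one gives
`2^(k-b)`, hence `2^(b+k)` in total. -/
theorem NY_lowHigh {b k : ℕ} (hbk : b ≤ k) (m : ℤ) {G H : ℝ × ℝ → ℝ≥0∞} (hG : Measurable G)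
    (hH : Measurable H) (s : ℤ → ℝ≥0∞)
    (hs : ∀ r, ∀ᵐ p ∂stMeasure, p.2 ∈ P.Q (2 * b) r → H p ^ 2 ≤ s r) :
    NY P (cut P (2 * k) m fun p => G p * H p) ^ 2 ≤
      p2 (2 * b + 2 * k + 2) * VX P (cut P (2 * k) m fun p => G p ^ 2) * ∑' r, s r := by
  set V := VX P (cut P (2 * k) m fun p => G p ^ 2)
  have h1 : ∀ r, NY P (cut P (2 * b) r (cut P (2 * k) m fun p => G p * H p)) ≤
      p2 (2 * b) * V ^ (1 / 2 : ℝ) * (meets P (2 * b) (2 * k) r m * s r ^ (1 / 2 : ℝ)) := fun r => by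
    by_cases hne : (P.Q (2 * b) r ∩ P.Q (2 * k) m).Nonempty
    · rw [meets, if_pos hne, one_mul]
      refine (NY_le_of_supp P (by fun_prop) (2 * b) r fun p hp => ?_).trans ?_
      · simp [cut, Set.indicator_of_notMem hp]
      have e : p2 (((2 * b : ℕ) : ℝ) / 2) = p2 b := by push_cast; ring_nf
      rw [e, show (2 * b : ℝ) = b + b by ring, p2_add, mul_assoc, mul_assoc]
      gcongr
      unfold n2
      rw [rpow_half_le_iff, mul_pow, mul_pow, rpow_half_sq, rpow_half_sq, p2_sq]
      calc ∫⁻ p, cut P (2 * b) r (cut P (2 * k) m fun p => G p * H p) p ^ 2 ∂stMeasure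
          ≤ ∫⁻ p, s r * cut P (2 * b) r (cut P (2 * k) m fun p => G p ^ 2) p ∂stMeasure := by
            refine lintegral_mono_ae ?_
            filter_upwards [hs r] with p hp
            by_cases h : p.2 ∈ P.Q (2 * b) r
            · by_cases h' : p.2 ∈ P.Q (2 * k) m
              · simp only [cut, Set.indicator_of_mem h, Set.indicator_of_mem h', Pi.one_apply,
                  one_mul, mul_pow]
                rw [mul_comm]
                gcongr
                exact hp h
              · simp [cut, Set.indicator_of_notMem h']
            · simp [cut, Set.indicator_of_notMem h]
        _ = s r * ∫⁻ p, cut P (2 * b) r (cut P (2 * k) m fun p => G p ^ 2) p ∂stMeasure :=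
            lintegral_const_mul _ (by fun_prop)
        _ ≤ s r * (p2 (2 * b) * V) := by
            gcongr
            have h3 : p2 (-(2 * b : ℕ)) * ∫⁻ p, cut P (2 * b) r
                (cut P (2 * k) m fun p => G p ^ 2) p ∂stMeasure ≤ V :=
              le_iSup₂ (f := fun l r => p2 (-(l : ℕ)) * ∫⁻ p, cut P l r
                (cut P (2 * k) m fun p => G p ^ 2) p ∂stMeasure) (2 * b) r
            calc _ = p2 (2 * b) * (p2 (-(2 * b : ℕ)) * ∫⁻ p, cut P (2 * b) r
                (cut P (2 * k) m fun p => G p ^ 2) p ∂stMeasure) := by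
                  rw [← mul_assoc]
                  push_cast
                  rw [p2_mul_neg, one_mul]
              _ ≤ _ := by gcongr
        _ = _ := by ring
    · have e : (cut P (2 * b) r (cut P (2 * k) m fun p => G p * H p)) = fun _ => 0 := by
        funext p
        by_cases h : p.2 ∈ P.Q (2 * b) r
        · have h' : p.2 ∉ P.Q (2 * k) m := fun h' => hne ⟨_, h, h'⟩
          simp [cut, Set.indicator_of_notMem h']
        · simp [cut, Set.indicator_of_notMem h]
      rw [e, (latNorm_NY P).zero]
      exact zero_le
  have hm : ∀ r, meets P (2 * b) (2 * k) r m ^ 2 = meets P (2 * b) (2 * k) r m := fun r => by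
    unfold meets; split_ifs <;> simp
  have hb : (b : ℝ) ≤ k := by exact_mod_cast hbk
  calc NY P (cut P (2 * k) m fun p => G p * H p) ^ 2
      ≤ (∑' r, p2 (2 * b) * V ^ (1 / 2 : ℝ) *
          (meets P (2 * b) (2 * k) r m * s r ^ (1 / 2 : ℝ))) ^ 2 := by
        gcongr
        refine ((latNorm_NY P).tsum_le_sum P _ (by fun_prop) (2 * b)).trans ?_
        exact ENNReal.tsum_le_tsum h1
    _ ≤ p2 (4 * b) * V * ((∑' r, meets P (2 * b) (2 * k) r m) * ∑' r, s r) := by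
        rw [ENNReal.tsum_mul_left, mul_pow, mul_pow, rpow_half_sq, p2_sq]
        gcongr
        · exact p2_mono (by linarith)
        · refine (tsum_mul_sq_le _ _).trans ?_
          simp_rw [hm, rpow_half_sq]
          exact le_rfl
    _ ≤ p2 (4 * b) * V * (p2 (2 * k - 2 * b + 2) * ∑' r, s r) := by
        gcongr
        refine (tsum_meets_le P (2 * b) (2 * k) m).trans ?_
        push_cast
        exact p2_add_two_le le_rfl (by linarith)
    _ = p2 (4 * b) * p2 (2 * k - 2 * b + 2) * V * ∑' r, s r := by ring
    _ = _ := by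
        rw [← p2_add]
        ring_nf

/-- A function dominated by its average at scale `2 ^ (-b)` is bounded on intervals, with
square summable bounds. -/
theorem exists_local_bound {b : ℕ} {H : ℝ × ℝ → ℝ≥0∞} (hH : Measurable H) {c : ℝ≥0∞}
    (h : ∀ᵐ p ∂stMeasure, H p ≤ c * cv (kap b) H p) :
    ∃ s : ℤ → ℝ≥0∞, (∀ r, ∀ᵐ p ∂stMeasure, p.2 ∈ P.Q (2 * b) r → H p ^ 2 ≤ s r) ∧
      ∑' r, s r ≤ 12 * c ^ 2 * p2 b * sumInv * NX P b H ^ 2 := by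
  set w : ℤ → ℝ≥0∞ := fun n => ENNReal.ofReal ((1 + (n : ℝ) ^ 2)⁻¹)
  set v : ℤ → ℝ≥0∞ := fun r => VI (cut P (2 * b) r fun p => H p ^ 2)
  -- The bound on the interval `r` averages the local masses `v r'` of `H²` with the tails of the
  -- kernel. The constant `12` is `4`, the mass of `kap b` from Cauchy-Schwarz, times `3` from
  -- `kap_le_of_int`.
  refine ⟨fun r => 12 * c ^ 2 * p2 b * ∑' r', w (r - r') * v r', fun r => ?_, ?_⟩
  · have hv : ∀ᵐ t ∂timeMeasure, ∀ r', ∫⁻ x, cut P (2 * b) r' (fun p => H p ^ 2) (t, x) ≤ v r' :=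
      ae_all_iff.2 fun r' =>
        ENNReal.ae_le_essSup fun t => ∫⁻ x, cut P (2 * b) r' (fun p => H p ^ 2) (t, x)
    filter_upwards [h, ae_st_of_ae_time hv] with p hp ht hpr
    calc H p ^ 2 ≤ (c * cv (kap b) H p) ^ 2 := by gcongr
      _ ≤ c ^ 2 * (4 * cv (kap b) (fun p => H p ^ 2) p) := by
          rw [mul_pow]
          gcongr
          refine (cv_sq_le (measurable_kap b) hH p).trans ?_
          gcongr
          exact lintegral_kap_le b
      _ ≤ c ^ 2 * (4 * ∑' r', 3 * p2 b * (w (r - r') * v r')) := by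
          gcongr
          have e : ∀ y, kap b (p.2 - y) * H (p.1, y) ^ 2 =
              ∑' r', kap b (p.2 - y) * cut P (2 * b) r' (fun p => H p ^ 2) (p.1, y) := fun y => by
            rw [ENNReal.tsum_mul_left, tsum_cut]
          have hmk := measurable_kap b
          unfold cv
          simp_rw [e]
          rw [lintegral_tsum fun r' => by fun_prop]
          refine ENNReal.tsum_le_tsum fun r' => ?_
          calc ∫⁻ y, kap b (p.2 - y) * cut P (2 * b) r' (fun p => H p ^ 2) (p.1, y)
              ≤ ∫⁻ y, 3 * p2 b * w (r - r') * cut P (2 * b) r' (fun p => H p ^ 2) (p.1, y) := by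
                refine lintegral_mono fun y => ?_
                by_cases hy : y ∈ P.Q (2 * b) r'
                · gcongr
                  obtain ⟨h3, h4⟩ := sub_mem_diffInterval P hpr hy
                  exact kap_le_of_int b _ (2 ^ (2 * b)) _ (one_le_pow₀ (by norm_num)) h3 h4
                · simp [cut, Set.indicator_of_notMem hy]
            _ ≤ 3 * p2 b * w (r - r') * v r' := by
                rw [lintegral_const_mul _ (by fun_prop)]
                gcongr
                exact ht r'
            _ = _ := by ring
      _ = _ := by
          rw [ENNReal.tsum_mul_left]
          ring
  · rw [ENNReal.tsum_mul_left, mul_assoc _ sumInv]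
    gcongr
    refine (schur_one (fun r r' => w (r - r')) v (B := sumInv) fun r' => ?_).trans ?_
    · exact le_of_eq ((Equiv.subRight r').tsum_eq w)
    · gcongr
      exact l1cut_VI_le P b

/-- Everything goes into the atomic part of `Y_k`, which has the weight `2^(-k)`. With the factor
`2^(b+k)` of `NY_lowHigh`, the gain `2^(-a)` of the local energy of `G`, and `2^(b/2)` from the
bounds for `H` this makes `2^(3b/2 - a)`. -/
theorem NYb_lowHigh {a b k : ℕ} (hbk : b ≤ k) (hak : a ≤ k + 3) (hka : k ≤ a + 3)
    {G H : ℝ × ℝ → ℝ≥0∞}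
    (hG : Measurable G) (hH : Measurable H) {c : ℝ≥0∞}
    (h : ∀ᵐ p ∂stMeasure, H p ≤ c * cv (kap b) H p) :
    NYb P k (cv (kap k) fun p => G p * H p) ≤
      (p2 22 * c ^ 2 * sumInv) ^ (1 / 2 : ℝ) * p2 (3 / 2 * b - a) * NX P a G * NX P b H := by
  obtain ⟨s, hs, hsum⟩ := exists_local_bound P hH h
  have ha : (a : ℝ) ≤ k + 3 := by exact_mod_cast hak
  have hk : (k : ℝ) ≤ a + 3 := by exact_mod_cast hka
  refine le_of_sq_le_sq ?_
  rw [mul_pow, mul_pow, mul_pow, rpow_half_sq, p2_sq]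
  have h1 : NYb P k (cv (kap k) fun p => G p * H p) ≤ 16 * NYb P k fun p => G p * H p := by
    refine ((latNorm_NYb P k).conv (measurable_kap k) (lintegral_kap_ne_top k)
      (by fun_prop)).trans ?_
    gcongr
    refine (mul_le_mul_right (lintegral_kap_le k) 4).trans (by norm_num)
  have h2 : (NYb P k fun p => G p * H p) ^ 2 ≤
      p2 (2 * b + 2) * (∑' m, VX P (cut P (2 * k) m fun p => G p ^ 2)) * ∑' r, s r := by
    rw [NYb, l2cut_sq, ← ENNReal.tsum_mul_left (a := p2 (2 * b + 2)),
      ← ENNReal.tsum_mul_right (a := ∑' r, s r)]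
    refine ENNReal.tsum_le_tsum fun m => ?_
    have h3 : NYj P k (cut P (2 * k) m fun p => G p * H p) ≤
        p2 (-k) * NY P (cut P (2 * k) m fun p => G p * H p) := by
      refine (NYj_le P k (F₁ := cut P (2 * k) m fun p => G p * H p) (F₂ := fun _ => 0)
        (by fun_prop) measurable_const (ae_of_all _ fun p => by simp)).trans ?_
      rw [latNorm_NL.zero, add_zero]
    calc _ ≤ (p2 (-k) * NY P (cut P (2 * k) m fun p => G p * H p)) ^ 2 := by gcongr
      _ ≤ p2 (2 * -k) * (p2 (2 * b + 2 * k + 2) *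
          VX P (cut P (2 * k) m fun p => G p ^ 2) * ∑' r, s r) := by
        rw [mul_pow, p2_sq]
        gcongr
        exact NY_lowHigh P hbk m hG hH s hs
      _ = _ := by
        rw [← mul_assoc, ← mul_assoc, ← p2_add]
        ring_nf
  have h3 : ∑' m, VX P (cut P (2 * k) m fun p => G p ^ 2) ≤
      p2 8 * (p2 (-(2 * a)) * NX P a G ^ 2) := by
    refine ((latNorm_VX P).tsum_cut_scale P (by fun_prop) (2 * k) (2 * a)).trans ?_
    gcongr
    · push_cast
      exact (p2_add_two_le (y := 6) (by linarith) (by norm_num)).trans_eq (by norm_num)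
    · exact l1cut_VX_le P a
  calc _ ≤ (16 * NYb P k fun p => G p * H p) ^ 2 := by gcongr
    _ ≤ 16 ^ 2 * (p2 (2 * b + 2) * (p2 8 * (p2 (-(2 * a)) * NX P a G ^ 2)) *
          (12 * c ^ 2 * p2 b * sumInv * NX P b H ^ 2)) := by
        rw [mul_pow]
        gcongr
        exact h2.trans (by gcongr)
    _ ≤ p2 8 * (p2 (2 * b + 2) * (p2 8 * (p2 (-(2 * a)) * NX P a G ^ 2)) *
          (p2 4 * c ^ 2 * p2 b * sumInv * NX P b H ^ 2)) := by
        gcongr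
        · rw [show (8 : ℝ) = (8 : ℕ) by norm_num, p2_natCast]; norm_num
        · rw [show (4 : ℝ) = (4 : ℕ) by norm_num, p2_natCast]; norm_num
    -- The constant `2^22` collects `2^8 = 16²` from the outer convolution, `2^2` from counting
    -- small intervals, `2^8` from comparing the grids of `k` and `a`, and `2^4 ≥ 12` from the local
    -- bounds.
    _ = p2 8 * p2 (2 * b + 2) * p2 8 * p2 (-(2 * a)) * p2 4 * p2 b *
          c ^ 2 * sumInv * NX P a G ^ 2 * NX P b H ^ 2 := by ring
    _ = p2 22 * p2 (2 * (3 / 2 * b - a)) * c ^ 2 * sumInv * NX P a G ^ 2 * NX P b H ^ 2 := by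
        rw [← p2_add, ← p2_add, ← p2_add, ← p2_add, ← p2_add, ← p2_add]
        ring_nf
    _ = _ := by ring

/-! ### Littlewood-Paley symbols -/

section Symbols

variable {φ₀ : ℝ → ℝ} (hφ : IsCutoff φ₀)
include hφ

omit hφ in
theorem sum_lpSymbol (n : ℕ) (ξ : ℝ) :
    ∑ k ∈ Finset.range (n + 1), lpSymbol φ₀ k ξ = φ₀ (ξ / 2 ^ n) := by
  induction n with
  | zero => simp [lpSymbol]
  | succ n ih => rw [Finset.sum_range_succ, ih]; simp [lpSymbol]

theorem cutoff_eq_one {n : ℕ} {ξ : ℝ} (h : |ξ| ≤ 2 ^ n) : φ₀ (ξ / 2 ^ n) = 1 := by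
  refine hφ.eq_one _ ?_
  rw [abs_div, abs_of_pos (by positivity : (0 : ℝ) < 2 ^ n)]
  exact div_le_one_of_le₀ h (by positivity)

theorem cutoff_eq_zero {n : ℕ} {ξ : ℝ} (h : 2 ^ (n + 1) ≤ |ξ|) : φ₀ (ξ / 2 ^ n) = 0 := by
  refine hφ.eq_zero _ ?_
  rw [abs_div, abs_of_pos (by positivity : (0 : ℝ) < 2 ^ n), le_div_iff₀ (by positivity)]
  rw [pow_succ] at h
  linarith

theorem lpSymbol_eq_zero_of_ge {k : ℕ} {ξ : ℝ} (h : 2 ^ (k + 1) ≤ |ξ|) : lpSymbol φ₀ k ξ = 0 := by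
  cases k with
  | zero =>
    have := cutoff_eq_zero hφ (n := 0) h
    simpa [lpSymbol] using this
  | succ k =>
    simp only [lpSymbol]
    rw [cutoff_eq_zero hφ h, cutoff_eq_zero hφ, sub_zero]
    exact (pow_le_pow_right₀ (by norm_num) (by omega)).trans h

theorem lpSymbol_eq_zero_of_le {k : ℕ} {ξ : ℝ} (h : |ξ| ≤ 2 ^ k) :
    lpSymbol φ₀ (k + 1) ξ = 0 := by
  simp only [lpSymbol]
  rw [cutoff_eq_one hφ h, cutoff_eq_one hφ, sub_self]
  exact h.trans (pow_le_pow_right₀ (by norm_num) (by omega))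

theorem contDiff_lpSymbol (k : ℕ) : ContDiff ℝ (⊤ : ℕ∞) (lpSymbol φ₀ k) := by
  have := hφ.smooth
  cases k with
  | zero => exact this
  | succ k =>
    exact (this.comp (contDiff_id.div_const _)).sub (this.comp (contDiff_id.div_const _))

theorem lpSymbol_mul_eq_zero {k l : ℕ} (h : l + 2 ≤ k) (ξ : ℝ) :
    lpSymbol φ₀ k ξ * lpSymbol φ₀ l ξ = 0 := by
  obtain ⟨k, rfl⟩ : ∃ n, k = n + 1 := ⟨k - 1, by omega⟩
  rcases le_total |ξ| (2 ^ k) with h' | h'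
  · rw [lpSymbol_eq_zero_of_le hφ h', zero_mul]
  · rw [lpSymbol_eq_zero_of_ge hφ (k := l), mul_zero]
    exact (pow_le_pow_right₀ (by norm_num) (by omega)).trans h'

theorem contDiff_ofReal_lpSymbol (k : ℕ) :
    ContDiff ℝ (⊤ : ℕ∞) (fun ξ => (lpSymbol φ₀ k ξ : ℂ)) :=
  Complex.ofRealCLM.contDiff.comp (contDiff_lpSymbol hφ k)

theorem hasCompactSupport_lpSymbol (k : ℕ) :
    HasCompactSupport (fun ξ => (lpSymbol φ₀ k ξ : ℂ)) := by
  refine HasCompactSupport.intro (isCompact_closedBall (0 : ℝ) (2 ^ (k + 1))) fun ξ hξ => ?_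
  rw [mem_closedBall_zero_iff, Real.norm_eq_abs, not_le] at hξ
  simp [lpSymbol_eq_zero_of_ge hφ hξ.le]

/-- The symbol of `S_k` as a Schwartz function. -/
noncomputable def symS (k : ℕ) : 𝓢(ℝ, ℂ) :=
  (hasCompactSupport_lpSymbol hφ k).toSchwartzMap (contDiff_ofReal_lpSymbol hφ k)

theorem coe_symS (k : ℕ) : ⇑(symS hφ k) = fun ξ => (lpSymbol φ₀ k ξ : ℂ) := rfl

/-- The sum of the symbols of `S_k` over `|k - a| ≤ 1`. -/
noncomputable def fatS (a : ℕ) : 𝓢(ℝ, ℂ) := ∑ k ∈ Finset.Icc (a - 1) (a + 1), symS hφ k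

theorem fatS_apply (a : ℕ) (ξ : ℝ) :
    fatS hφ a ξ = ∑ k ∈ Finset.Icc (a - 1) (a + 1), (lpSymbol φ₀ k ξ : ℂ) := by
  simp only [fatS, _root_.sum_apply, coe_symS]

/-- On the support of the symbol `a` the full sum up to `a + 1` is `1`, and its terms below `a - 1`
vanish there. For `a = 0` the truncated subtraction makes the range start at `0`, as it should. -/
theorem sum_Icc_lpSymbol_mul (a : ℕ) (ξ : ℝ) :
    ∑ k ∈ Finset.Icc (a - 1) (a + 1), lpSymbol φ₀ k ξ * lpSymbol φ₀ a ξ = lpSymbol φ₀ a ξ := by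
  have h1 : ∑ k ∈ Finset.range (a + 1 + 1), lpSymbol φ₀ k ξ * lpSymbol φ₀ a ξ =
      lpSymbol φ₀ a ξ := by
    rw [← Finset.sum_mul _ _ (lpSymbol φ₀ a ξ), sum_lpSymbol]
    rcases le_total |ξ| (2 ^ (a + 1)) with h | h
    · rw [cutoff_eq_one hφ h, one_mul]
    · rw [lpSymbol_eq_zero_of_ge hφ h, mul_zero]
  refine Eq.trans (Finset.sum_subset ?_ ?_) h1
  · intro k hk
    simp only [Finset.mem_Icc, Finset.mem_range] at *; omega
  · intro k hk hk'
    simp only [Finset.mem_Icc, Finset.mem_range, not_and, not_le] at *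
    rw [mul_comm]
    exact lpSymbol_mul_eq_zero hφ (by by_contra; omega) ξ

theorem fatS_eq_zero_of_ge {a : ℕ} {ξ : ℝ} (h : 2 ^ (a + 2) ≤ |ξ|) : fatS hφ a ξ = 0 := by
  rw [fatS_apply]
  refine Finset.sum_eq_zero fun k hk => ?_
  rw [Finset.mem_Icc] at hk
  rw [lpSymbol_eq_zero_of_ge hφ, Complex.ofReal_zero]
  exact (pow_le_pow_right₀ (by norm_num) (by omega)).trans h

theorem fatS_eq_zero_of_le {a : ℕ} {ξ : ℝ} (h : |ξ| ≤ 2 ^ a) : fatS hφ (a + 2) ξ = 0 := by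
  rw [fatS_apply]
  refine Finset.sum_eq_zero fun k hk => ?_
  rw [Finset.mem_Icc] at hk
  obtain ⟨k, rfl⟩ : ∃ n, k = n + 1 := ⟨k - 1, by omega⟩
  rw [lpSymbol_eq_zero_of_le hφ, Complex.ofReal_zero]
  exact h.trans (pow_le_pow_right₀ (by norm_num) (by omega))

theorem hasTemperateGrowth_lpSymbol (k : ℕ) :
    (fun ξ => (lpSymbol φ₀ k ξ : ℂ)).HasTemperateGrowth :=
  (hasCompactSupport_lpSymbol hφ k).hasTemperateGrowth (contDiff_ofReal_lpSymbol hφ k)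

theorem lpProj_lpProj (k l : ℕ) (f : 𝓢'(ℝ, ℂ)) : lpProj φ₀ k (lpProj φ₀ l f) =
    TemperedDistribution.fourierMultiplierCLM ℂ
      (fun ξ => ((lpSymbol φ₀ k ξ * lpSymbol φ₀ l ξ : ℝ) : ℂ)) f := by
  rw [lpProj, lpProj, TemperedDistribution.fourierMultiplierCLM_fourierMultiplierCLM_apply
    (hasTemperateGrowth_lpSymbol hφ l) (hasTemperateGrowth_lpSymbol hφ k)]
  congr 2
  funext ξ
  simp [mul_comm]

theorem lpProj_lpProj_eq_zero {k l : ℕ} (h : l + 2 ≤ k) (f : 𝓢'(ℝ, ℂ)) :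
    lpProj φ₀ k (lpProj φ₀ l f) = 0 := by
  rw [lpProj_lpProj hφ]
  simp_rw [lpSymbol_mul_eq_zero hφ h]
  rw [TemperedDistribution.fourierMultiplierCLM_const]
  simp

theorem lpProj_comm (k l : ℕ) (f : 𝓢'(ℝ, ℂ)) :
    lpProj φ₀ k (lpProj φ₀ l f) = lpProj φ₀ l (lpProj φ₀ k f) := by
  rw [lpProj_lpProj hφ, lpProj_lpProj hφ]
  simp_rw [mul_comm]

theorem lpProj_lpProj_eq_zero' {k l : ℕ} (h : k + 2 ≤ l) (f : 𝓢'(ℝ, ℂ)) :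
    lpProj φ₀ k (lpProj φ₀ l f) = 0 := by
  rw [lpProj_comm hφ, lpProj_lpProj_eq_zero hφ h]

theorem fatS_multiplier_lpProj (a : ℕ) (f : 𝓢'(ℝ, ℂ)) :
    TemperedDistribution.fourierMultiplierCLM ℂ (fatS hφ a) (lpProj φ₀ a f) = lpProj φ₀ a f := by
  rw [lpProj, TemperedDistribution.fourierMultiplierCLM_fourierMultiplierCLM_apply
    (hasTemperateGrowth_lpSymbol hφ a) (SchwartzMap.hasTemperateGrowth _)]
  congr 2
  funext ξ
  rw [Pi.mul_apply, fatS_apply, mul_comm, Finset.sum_mul]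
  exact_mod_cast sum_Icc_lpSymbol_mul hφ a ξ

theorem sum_Icc_lpProj_lpProj (a : ℕ) (f : 𝓢'(ℝ, ℂ)) :
    ∑ k ∈ Finset.Icc (a - 1) (a + 1), lpProj φ₀ k (lpProj φ₀ a f) = lpProj φ₀ a f := by
  conv_rhs => rw [← fatS_multiplier_lpProj hφ]
  have e : ⇑(fatS hφ a) = fun ξ => ∑ k ∈ Finset.Icc (a - 1) (a + 1), (lpSymbol φ₀ k ξ : ℂ) :=
    funext fun ξ => fatS_apply hφ a ξ
  rw [e, TemperedDistribution.fourierMultiplierCLM_sum ℂ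
    fun k _ => hasTemperateGrowth_lpSymbol hφ k]
  simp [lpProj]

theorem lpLT_lpProj {N a : ℕ} (h : a + 2 ≤ N) (f : 𝓢'(ℝ, ℂ)) :
    lpLT φ₀ N (lpProj φ₀ a f) = lpProj φ₀ a f := by
  conv_rhs => rw [← sum_Icc_lpProj_lpProj hφ]
  refine (Finset.sum_subset (fun k hk => ?_) fun k hk hk' => ?_).symm
  · simp only [Finset.mem_Icc, Finset.mem_range] at *; omega
  · simp only [Finset.mem_Icc, Finset.mem_range, not_and, not_le] at *
    rcases le_total k a with h' | h'
    · exact lpProj_lpProj_eq_zero' hφ (by by_contra; omega) f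
    · exact lpProj_lpProj_eq_zero hφ (by by_contra; omega) f

theorem lpLT_lpLT {N n : ℕ} (h : n + 1 ≤ N) (f : 𝓢'(ℝ, ℂ)) :
    lpLT φ₀ N (lpLT φ₀ n f) = lpLT φ₀ n f := by
  have e : lpLT φ₀ N (lpLT φ₀ n f) = ∑ a ∈ Finset.range n, lpLT φ₀ N (lpProj φ₀ a f) := by
    simp only [lpLT, map_sum]
    exact Finset.sum_comm
  rw [e]
  refine Finset.sum_congr rfl fun a ha => ?_
  rw [Finset.mem_range] at ha
  exact lpLT_lpProj hφ (by omega) f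

end Symbols

/-! ### Representation by functions -/

theorem schwartz_decay_kap (ψ : 𝓢(ℝ, ℂ)) (n : ℕ) :
    ∃ C : NNReal, ∀ x, (1 + ‖x‖) ^ n * ‖ψ x‖ ≤ C := by
  refine ⟨⟨2 ^ n * ((Finset.Iic (n, 0)).sup fun m => SchwartzMap.seminorm ℂ m.1 m.2) ψ,
    mul_nonneg (by positivity) (apply_nonneg _ _)⟩, fun x => ?_⟩
  have h := SchwartzMap.one_add_le_sup_seminorm_apply (𝕜 := ℂ) (m := (n, 0)) (k := n) (n := 0)
    le_rfl le_rfl ψ x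
  rw [norm_iteratedFDeriv_zero] at h
  exact h

theorem one_add_sq_le (x : ℝ) : 1 + x ^ 2 ≤ (1 + ‖x‖) ^ 2 := by
  rw [Real.norm_eq_abs]
  nlinarith [sq_abs x, abs_nonneg x]

theorem kap_zero (x : ℝ) : kap 0 x = ENNReal.ofReal ((1 + x ^ 2)⁻¹) := by simp [kap]

theorem enorm_le_mul_kap {ψ : ℝ → ℂ} {C : NNReal} (h : ∀ x, (1 + ‖x‖) ^ 2 * ‖ψ x‖ ≤ C) (x : ℝ) :
    ‖ψ x‖ₑ ≤ C * kap 0 x := by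
  rw [kap_zero, ← ofReal_norm, ← ENNReal.ofReal_coe_nnreal,
    ← ENNReal.ofReal_mul C.coe_nonneg]
  refine ENNReal.ofReal_le_ofReal ?_
  rw [← div_eq_mul_inv, le_div_iff₀ (by positivity), mul_comm]
  exact (mul_le_mul_of_nonneg_right (one_add_sq_le x) (norm_nonneg _)).trans (h x)

theorem schwartz_enorm_le (ψ : 𝓢(ℝ, ℂ)) : ∃ C : NNReal, ∀ x, ‖ψ x‖ₑ ≤ C * kap 0 x := by
  obtain ⟨C, hC⟩ := schwartz_decay_kap ψ 2
  exact ⟨C, enorm_le_mul_kap hC⟩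

/-- Measurable functions which are integrable with respect to the weight `1 / (1 + x²)`. -/
structure W1 (g : ℝ → ℂ) : Prop where
  meas : AEStronglyMeasurable g volume
  fin : ∫⁻ x, ‖g x‖ₑ * kap 0 x ≠ ⊤

theorem W1.aemeasurable {g : ℝ → ℂ} (hg : W1 g) :
    AEMeasurable (fun x => ‖g x‖ₑ * kap 0 x) volume :=
  hg.meas.enorm.mul (measurable_kap 0).aemeasurable

theorem W1.lintegral_mul_ne_top {g : ℝ → ℂ} (hg : W1 g) (ψ : 𝓢(ℝ, ℂ)) :
    ∫⁻ x, ‖g x‖ₑ * ‖ψ x‖ₑ ≠ ⊤ := by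
  obtain ⟨C, hC⟩ := schwartz_enorm_le ψ
  refine ne_top_of_le_ne_top (ENNReal.mul_ne_top (ENNReal.coe_ne_top (r := C)) hg.fin) ?_
  rw [← lintegral_const_mul'' _ hg.aemeasurable]
  refine lintegral_mono fun x => ?_
  rw [mul_left_comm]
  gcongr
  exact hC x

theorem W1.integrable_mul {g : ℝ → ℂ} (hg : W1 g) (ψ : 𝓢(ℝ, ℂ)) :
    Integrable (fun x => g x * ψ x) := by
  refine ⟨hg.meas.mul ψ.continuous.aestronglyMeasurable, ?_⟩
  rw [hasFiniteIntegral_iff_enorm]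
  simpa only [enorm_mul] using (hg.lintegral_mul_ne_top ψ).lt_top

theorem W1.add {g h : ℝ → ℂ} (hg : W1 g) (hh : W1 h) : W1 (fun x => g x + h x) := by
  refine ⟨hg.meas.add hh.meas, ne_top_of_le_ne_top (ENNReal.add_ne_top.2 ⟨hg.fin, hh.fin⟩) ?_⟩
  rw [← lintegral_add_left' hg.aemeasurable]
  refine lintegral_mono fun x => ?_
  rw [← add_mul]
  gcongr
  exact enorm_add_le _ _

theorem W1.zero : W1 (fun _ => 0) := ⟨aestronglyMeasurable_const, by simp⟩

theorem W1.sum {ι : Type*} {g : ι → ℝ → ℂ} {s : Finset ι} (hg : ∀ i ∈ s, W1 (g i)) :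
    W1 (fun x => ∑ i ∈ s, g i x) := by
  classical
  induction s using Finset.induction_on with
  | empty => simpa using W1.zero
  | insert i s hi ih =>
    simp_rw [Finset.sum_insert hi]
    exact (hg i (Finset.mem_insert_self _ _)).add
      (ih fun j hj => hg j (Finset.mem_insert_of_mem hj))

theorem W1.bdd_mul {g F : ℝ → ℂ} (hg : W1 g) (hF : AEStronglyMeasurable F volume) {C : NNReal}
    (h : ∀ᵐ x, ‖F x‖ₑ ≤ C) : W1 (fun x => F x * g x) := by
  refine ⟨hF.mul hg.meas, ne_top_of_le_ne_top
    (ENNReal.mul_ne_top (ENNReal.coe_ne_top (r := C)) hg.fin) ?_⟩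
  rw [← lintegral_const_mul'' _ hg.aemeasurable]
  refine lintegral_mono_ae (h.mono fun x hx => ?_)
  rw [enorm_mul, mul_assoc]
  gcongr

theorem W1.of_sq {g : ℝ → ℂ} (hg : AEStronglyMeasurable g volume)
    (h : ∫⁻ x, ‖g x‖ₑ ^ 2 ≠ ⊤) : W1 g := by
  refine ⟨hg, fun htop => ?_⟩
  have h1 := lintegral_mul_sq_le hg.enorm (measurable_kap 0).aemeasurable
  rw [htop] at h1
  have h2 : ∫⁻ x, kap 0 x ^ 2 ≠ ⊤ := ne_top_of_le_ne_top
    (ENNReal.mul_ne_top (by simp) (p2_ne_top _)) (lintegral_kap_sq_le 0)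
  exact ENNReal.mul_ne_top h h2 (top_le_iff.1 (by simpa using h1))

/-- Convolution on `ℝ`. -/
noncomputable def cvC (K g : ℝ → ℂ) (x : ℝ) : ℂ := ∫ y, K (x - y) * g y

/-- Peetre's inequality: a polynomial weight at `y` is moved to `x` at the cost of powers of `1 + |x
- y|`, which Schwartz kernels absorb. -/
theorem one_add_sq_peetre (x y : ℝ) : 1 + y ^ 2 ≤ 2 * (1 + ‖x - y‖) ^ 2 * (1 + x ^ 2) := by
  have h1 := one_add_sq_le (x - y)
  have h2 : 1 + y ^ 2 ≤ 2 * (1 + (x - y) ^ 2) * (1 + x ^ 2) := by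
    nlinarith [sq_nonneg ((x - y) * x), sq_nonneg (x - y + x), sq_nonneg (2 * x - y)]
  refine h2.trans ?_
  gcongr

theorem lintegral_schwartz_cv_le (K ψ : 𝓢(ℝ, ℂ)) :
    ∃ C : NNReal, ∀ y, ∫⁻ x, ‖K (x - y)‖ₑ * ‖ψ x‖ₑ ≤ C * kap 0 y := by
  obtain ⟨A, hA⟩ := schwartz_decay_kap K 2
  obtain ⟨B, hB⟩ := schwartz_decay_kap ψ 4
  refine ⟨2 * A * B * 4, fun y => ?_⟩
  calc ∫⁻ x, ‖K (x - y)‖ₑ * ‖ψ x‖ₑ ≤ ∫⁻ x, (2 * A * B : NNReal) * kap 0 y * kap 0 x := by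
        refine lintegral_mono fun x => ?_
        rw [kap_zero, kap_zero, ← ofReal_norm, ← ofReal_norm,
          ← ENNReal.ofReal_coe_nnreal, ← ENNReal.ofReal_mul (by positivity),
          ← ENNReal.ofReal_mul (by positivity), ← ENNReal.ofReal_mul (by positivity)]
        refine ENNReal.ofReal_le_ofReal ?_
        have h1 := one_add_sq_peetre x y
        have h2 := one_add_sq_le x
        have h3 := hA (x - y)
        have h4 := hB x
        have h5 : 0 < 1 + y ^ 2 := by positivity
        have h6 : 0 < 1 + x ^ 2 := by positivity
        rw [← div_eq_mul_inv, ← div_eq_mul_inv, div_div, le_div_iff₀ (by positivity)]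
        calc ‖K (x - y)‖ * ‖ψ x‖ * ((1 + y ^ 2) * (1 + x ^ 2))
            ≤ ‖K (x - y)‖ * ‖ψ x‖ * ((2 * (1 + ‖x - y‖) ^ 2 * (1 + x ^ 2)) * (1 + x ^ 2)) := by
              gcongr
          _ = 2 * ((1 + ‖x - y‖) ^ 2 * ‖K (x - y)‖) * ((1 + x ^ 2) ^ 2 * ‖ψ x‖) := by ring
          _ ≤ 2 * A * (((1 + ‖x‖) ^ 2) ^ 2 * ‖ψ x‖) := by gcongr
          _ = 2 * A * ((1 + ‖x‖) ^ 4 * ‖ψ x‖) := by ring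
          _ ≤ 2 * A * B := by gcongr
          _ = _ := by push_cast; ring
    _ = (2 * A * B : NNReal) * kap 0 y * ∫⁻ x, kap 0 x := lintegral_const_mul _ (measurable_kap 0)
    _ ≤ (2 * A * B : NNReal) * kap 0 y * 4 := by gcongr; exact lintegral_kap_le 0
    _ = _ := by push_cast; ring

/-- Absolute integrability of `K(x - y) g(y) ψ(x)`. -/
theorem W1.integrable_prod {g : ℝ → ℂ} (hg : W1 g) (K ψ : 𝓢(ℝ, ℂ)) :
    Integrable (fun p : ℝ × ℝ => K (p.1 - p.2) * g p.2 * ψ p.1) (volume.prod volume) := by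
  have hK : Continuous fun p : ℝ × ℝ => K (p.1 - p.2) := K.continuous.comp (by fun_prop)
  have hψ : Continuous fun p : ℝ × ℝ => ψ p.1 := ψ.continuous.comp (by fun_prop)
  have hm : AEStronglyMeasurable (fun p : ℝ × ℝ => K (p.1 - p.2) * g p.2 * ψ p.1)
      (volume.prod volume) :=
    (hK.aestronglyMeasurable.mul hg.meas.comp_snd).mul hψ.aestronglyMeasurable
  refine ⟨hm, ?_⟩
  rw [hasFiniteIntegral_iff_enorm, lintegral_prod_symm _ hm.enorm]
  obtain ⟨C, hC⟩ := lintegral_schwartz_cv_le K ψ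
  have hKm : Measurable fun x => ‖K x‖ₑ := K.continuous.measurable.enorm
  have hψm : Measurable fun x => ‖ψ x‖ₑ := ψ.continuous.measurable.enorm
  calc ∫⁻ y, ∫⁻ x, ‖K (x - y) * g y * ψ x‖ₑ
      ≤ ∫⁻ y, C * (‖g y‖ₑ * kap 0 y) := by
        refine lintegral_mono fun y => ?_
        simp_rw [enorm_mul]
        have e : ∀ x, ‖K (x - y)‖ₑ * ‖g y‖ₑ * ‖ψ x‖ₑ = ‖g y‖ₑ * (‖K (x - y)‖ₑ * ‖ψ x‖ₑ) :=
          fun x => by ring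
        simp_rw [e]
        rw [lintegral_const_mul _ (by fun_prop), mul_left_comm]
        gcongr
        exact hC y
    _ = C * ∫⁻ y, ‖g y‖ₑ * kap 0 y :=
        lintegral_const_mul'' _ hg.aemeasurable
    _ < ⊤ := (ENNReal.mul_ne_top (by simp) hg.fin).lt_top

theorem W1.integrable_cvC_mul {g : ℝ → ℂ} (hg : W1 g) (K ψ : 𝓢(ℝ, ℂ)) :
    Integrable (fun x => cvC K g x * ψ x) := by
  refine (hg.integrable_prod K ψ).integral_prod_left.congr (ae_of_all _ fun x => ?_)
  simp only [cvC]
  rw [integral_mul_const]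

theorem W1.integral_cvC_mul {g : ℝ → ℂ} (hg : W1 g) (K ψ : 𝓢(ℝ, ℂ)) :
    ∫ x, cvC K g x * ψ x = ∫ y, g y * ∫ x, K (x - y) * ψ x := by
  have h := integral_integral_swap (f := fun x y => K (x - y) * g y * ψ x)
    (hg.integrable_prod K ψ)
  calc ∫ x, cvC K g x * ψ x = ∫ x, ∫ y, K (x - y) * g y * ψ x := by
        refine integral_congr_ae (ae_of_all _ fun x => ?_)
        simp only [cvC]
        rw [integral_mul_const]
    _ = _ := by
        rw [h]
        refine integral_congr_ae (ae_of_all _ fun y => ?_)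
        dsimp only
        rw [← integral_const_mul]
        refine integral_congr_ae (ae_of_all _ fun x => ?_)
        dsimp only
        ring

theorem aestronglyMeasurable_cvC {K g : ℝ → ℂ} (hK : Continuous K)
    (hg : AEStronglyMeasurable g volume) : AEStronglyMeasurable (cvC K g) volume := by
  have hm : AEStronglyMeasurable (fun p : ℝ × ℝ => K (p.1 - p.2) * g p.2) (volume.prod volume) :=
    (hK.comp (by fun_prop : Continuous fun p : ℝ × ℝ => p.1 - p.2)).aestronglyMeasurable.mul
      hg.comp_snd
  exact hm.integral_prod_right'

theorem enorm_cvC_le (K g : ℝ → ℂ) (x : ℝ) : ‖cvC K g x‖ₑ ≤ ∫⁻ y, ‖K (x - y)‖ₑ * ‖g y‖ₑ := by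
  refine (enorm_integral_le_lintegral_enorm _).trans (le_of_eq ?_)
  simp_rw [enorm_mul]

/-- Peetre's inequality moves the weight from `x` to `y` under the integral; two of the four powers
of decay of `K` pay for this and the other two make the kernel integrable. -/
theorem W1.convolution {g : ℝ → ℂ} (hg : W1 g) (K : 𝓢(ℝ, ℂ)) : W1 (cvC K g) := by
  refine ⟨aestronglyMeasurable_cvC K.continuous hg.meas, ?_⟩
  obtain ⟨A, hA⟩ := schwartz_decay_kap K 4
  have hKm : Measurable fun x => ‖K x‖ₑ := K.continuous.measurable.enorm
  have hb : ∀ x y, ‖K (x - y)‖ₑ * kap 0 x ≤ 2 * A * kap 0 (x - y) * kap 0 y := fun x y => by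
    rw [kap_zero, kap_zero, kap_zero, ← ofReal_norm,
      ← ENNReal.ofReal_coe_nnreal, ← ENNReal.ofReal_mul (by positivity),
      show (2 : ℝ≥0∞) = ENNReal.ofReal 2 by norm_num, ← ENNReal.ofReal_mul (by positivity),
      ← ENNReal.ofReal_mul (by positivity), ← ENNReal.ofReal_mul (by positivity)]
    refine ENNReal.ofReal_le_ofReal ?_
    have h1 := one_add_sq_peetre x y
    have h2 := one_add_sq_le (x - y)
    have h3 := hA (x - y)
    have h5 : 0 < 1 + y ^ 2 := by positivity
    have h6 : 0 < 1 + x ^ 2 := by positivity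
    have h7 : 0 < 1 + (x - y) ^ 2 := by positivity
    rw [← div_eq_mul_inv, ← div_eq_mul_inv, ← div_eq_mul_inv, div_div, div_le_div_iff₀ h6
      (by positivity)]
    calc ‖K (x - y)‖ * ((1 + (x - y) ^ 2) * (1 + y ^ 2))
        ≤ ‖K (x - y)‖ * ((1 + ‖x - y‖) ^ 2 * (2 * (1 + ‖x - y‖) ^ 2 * (1 + x ^ 2))) := by gcongr
      _ = 2 * ((1 + ‖x - y‖) ^ 4 * ‖K (x - y)‖) * (1 + x ^ 2) := by ring
      _ ≤ 2 * A * (1 + x ^ 2) := by gcongr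
  have hmk := measurable_kap 0
  have hgm := hg.meas.enorm
  have hKx : ∀ x, Measurable fun y => ‖K (x - y)‖ₑ := fun x =>
    hKm.comp (measurable_const.sub measurable_id)
  refine ne_top_of_le_ne_top (b := 2 * A * 4 * ∫⁻ y, ‖g y‖ₑ * kap 0 y)
    (ENNReal.mul_ne_top (by finiteness) hg.fin) ?_
  calc ∫⁻ x, ‖cvC K g x‖ₑ * kap 0 x
      ≤ ∫⁻ x, ∫⁻ y, 2 * A * kap 0 (x - y) * (‖g y‖ₑ * kap 0 y) := by
        refine lintegral_mono fun x => ?_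
        refine (mul_le_mul_left (enorm_cvC_le K g x) _).trans ?_
        have hm : AEMeasurable (fun y => ‖K (x - y)‖ₑ * ‖g y‖ₑ) volume :=
          (hKx x).aemeasurable.mul hgm
        rw [← lintegral_mul_const'' _ hm]
        refine lintegral_mono fun y => ?_
        calc _ = (‖K (x - y)‖ₑ * kap 0 x) * ‖g y‖ₑ := by ring
          _ ≤ (2 * A * kap 0 (x - y) * kap 0 y) * ‖g y‖ₑ := mul_le_mul_left (hb x y) _
          _ = _ := by ring
    _ = ∫⁻ y, ∫⁻ x, 2 * A * kap 0 (x - y) * (‖g y‖ₑ * kap 0 y) := by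
        refine lintegral_lintegral_swap ?_
        have h1 : AEMeasurable (fun p : ℝ × ℝ => ‖g p.2‖ₑ * kap 0 p.2) (volume.prod volume) :=
          (hgm.mul hmk.aemeasurable).comp_snd
        exact (by fun_prop : Measurable fun p : ℝ × ℝ =>
          2 * (A : ℝ≥0∞) * kap 0 (p.1 - p.2)).aemeasurable.mul h1
    _ ≤ ∫⁻ y, 2 * A * 4 * (‖g y‖ₑ * kap 0 y) := by
        refine lintegral_mono fun y => ?_
        dsimp only
        rw [lintegral_mul_const _ (by fun_prop), lintegral_const_mul _ (by fun_prop),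
          lintegral_sub_right_eq_self (kap 0) y]
        gcongr
        exact lintegral_kap_le 0
    _ = _ := lintegral_const_mul'' _ hg.aemeasurable

/-- Representation by `g` includes integrability of `g` against every Schwartz function, and a bump
function equal to `1` near a point turns this into integrability of `g` itself there. -/
theorem IsRepr.locallyIntegrable {f : 𝓢'(ℝ, ℂ)} {g : ℝ → ℂ} (hg : IsRepr f g) :
    LocallyIntegrable g := by
  intro x
  let b : ContDiffBump x := ⟨1, 2, by norm_num, by norm_num⟩
  have hc : HasCompactSupport (fun y => ((b y : ℝ) : ℂ)) :=
    b.hasCompactSupport.comp_left (g := fun r : ℝ => (r : ℂ)) rfl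
  have hs : ContDiff ℝ (⊤ : ℕ∞) (fun y => ((b y : ℝ) : ℂ)) :=
    Complex.ofRealCLM.contDiff.comp b.contDiff
  refine ⟨Metric.ball x 1, Metric.ball_mem_nhds x one_pos, ?_⟩
  have hi := (hg (hc.toSchwartzMap hs)).1.integrableOn (s := Metric.ball x 1)
  refine hi.congr_fun (fun y hy => ?_) measurableSet_ball
  have hb : b y = 1 := b.one_of_mem_closedBall (Metric.ball_subset_closedBall hy)
  change g y * ((b y : ℝ) : ℂ) = g y
  rw [hb]; simp

theorem IsRepr.ae_eq {f : 𝓢'(ℝ, ℂ)} {g h : ℝ → ℂ} (hg : IsRepr f g) (hh : IsRepr f h) :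
    g =ᵐ[volume] h := by
  have hloc : LocallyIntegrable (fun x => g x - h x) :=
    hg.locallyIntegrable.sub hh.locallyIntegrable
  have := ae_eq_zero_of_integral_contDiff_smul_eq_zero hloc fun ψ hψ hc => by
    have hc' : HasCompactSupport (fun y => ((ψ y : ℝ) : ℂ)) :=
      hc.comp_left (g := fun r : ℝ => (r : ℂ)) rfl
    have hs : ContDiff ℝ (⊤ : ℕ∞) (fun y => ((ψ y : ℝ) : ℂ)) :=
      Complex.ofRealCLM.contDiff.comp hψ
    obtain ⟨h1, h2⟩ := hg (hc'.toSchwartzMap hs)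
    obtain ⟨h3, h4⟩ := hh (hc'.toSchwartzMap hs)
    have : ∫ x, (g x * hc'.toSchwartzMap hs x - h x * hc'.toSchwartzMap hs x) = 0 := by
      rw [integral_sub h1 h3, ← h2, ← h4, sub_self]
    rw [← this]
    refine integral_congr_ae (ae_of_all _ fun x => ?_)
    change ψ x • (g x - h x) = g x * ((ψ x : ℝ) : ℂ) - h x * ((ψ x : ℝ) : ℂ)
    rw [Complex.real_smul]
    ring
  exact this.mono fun x hx => sub_eq_zero.1 hx

theorem IsRepr.congr {f : 𝓢'(ℝ, ℂ)} {g h : ℝ → ℂ} (hg : IsRepr f g) (e : g =ᵐ[volume] h) :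
    IsRepr f h := fun ψ => by
  have e' : (fun x => g x * ψ x) =ᵐ[volume] fun x => h x * ψ x := e.mono fun x hx => by
    dsimp only; rw [hx]
  exact ⟨(hg ψ).1.congr e', (hg ψ).2.trans (integral_congr_ae e')⟩

theorem IsRepr.zero : IsRepr 0 (fun _ => 0) := fun ψ => by simp

theorem IsRepr.add {f f' : 𝓢'(ℝ, ℂ)} {g g' : ℝ → ℂ} (h : IsRepr f g) (h' : IsRepr f' g') :
    IsRepr (f + f') (fun x => g x + g' x) := fun ψ => by
  obtain ⟨h1, h2⟩ := h ψ
  obtain ⟨h3, h4⟩ := h' ψ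
  have e : ∀ x, (g x + g' x) * ψ x = g x * ψ x + g' x * ψ x := fun x => add_mul _ _ _
  simp_rw [e]
  refine ⟨h1.add h3, ?_⟩
  rw [integral_add h1 h3, ← h2, ← h4]
  rfl

theorem IsRepr.neg {f : 𝓢'(ℝ, ℂ)} {g : ℝ → ℂ} (h : IsRepr f g) :
    IsRepr (-f) (fun x => -g x) := fun ψ => by
  obtain ⟨h1, h2⟩ := h ψ
  simp_rw [neg_mul]
  refine ⟨h1.neg, ?_⟩
  rw [integral_neg, ← h2]
  rfl

theorem IsRepr.sub {f f' : 𝓢'(ℝ, ℂ)} {g g' : ℝ → ℂ} (h : IsRepr f g) (h' : IsRepr f' g') :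
    IsRepr (f - f') (fun x => g x - g' x) := by
  simpa only [sub_eq_add_neg] using h.add h'.neg

theorem IsRepr.sum {ι : Type*} {s : Finset ι} {f : ι → 𝓢'(ℝ, ℂ)} {g : ι → ℝ → ℂ}
    (h : ∀ i ∈ s, IsRepr (f i) (g i)) : IsRepr (∑ i ∈ s, f i) (fun x => ∑ i ∈ s, g i x) := by
  classical
  induction s using Finset.induction_on with
  | empty => simpa using IsRepr.zero
  | insert i s hi ih =>
    simp_rw [Finset.sum_insert hi]
    exact (h i (Finset.mem_insert_self _ _)).add
      (ih fun j hj => h j (Finset.mem_insert_of_mem hj))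

/-! ### Fourier multipliers as convolutions -/

theorem schwartz_fourierInv_apply (m : 𝓢(ℝ, ℂ)) (x : ℝ) :
    (𝓕⁻ m : 𝓢(ℝ, ℂ)) x = ∫ ξ, Complex.exp ((2 * Real.pi * (ξ * x) : ℝ) * Complex.I) * m ξ := by
  rw [SchwartzMap.fourierInv_coe, Real.fourierInv_eq']
  simp [mul_comm]

theorem schwartz_fourier_apply (m : 𝓢(ℝ, ℂ)) (x : ℝ) :
    (𝓕 m : 𝓢(ℝ, ℂ)) x =
      ∫ ξ, Complex.exp ((-(2 * Real.pi * (ξ * x)) : ℝ) * Complex.I) * m ξ := by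
  rw [SchwartzMap.fourier_coe, Real.fourier_eq']
  simp [mul_comm]

theorem norm_exp_real_mul_I (x : ℝ) : ‖Complex.exp ((x : ℂ) * Complex.I)‖ = 1 :=
  Complex.norm_exp_ofReal_mul_I x

/-- The transpose of a Fourier multiplier is convolution with the reflected kernel, by Fubini's
theorem. Moved to the other side, it identifies multipliers on distributions given by functions with
honest convolutions. -/
theorem fourier_mul_fourierInv (m ψ : 𝓢(ℝ, ℂ)) (y : ℝ) :
    (𝓕 (SchwartzMap.smulLeftCLM ℂ m (𝓕⁻ ψ : 𝓢(ℝ, ℂ))) : 𝓢(ℝ, ℂ)) y =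
      ∫ x, (𝓕⁻ m : 𝓢(ℝ, ℂ)) (x - y) * ψ x := by
  rw [schwartz_fourier_apply]
  simp_rw [SchwartzMap.smulLeftCLM_apply_apply (SchwartzMap.hasTemperateGrowth m),
    schwartz_fourierInv_apply]
  have hint : Integrable (Function.uncurry fun ξ x : ℝ =>
      Complex.exp ((2 * Real.pi * (ξ * (x - y)) : ℝ) * Complex.I) * (m ξ * ψ x))
      (volume.prod volume) := by
    refine (m.integrable.mul_prod ψ.integrable).bdd_mul (c := 1) ?_ (ae_of_all _ fun p => ?_)
    · exact (by fun_prop : Continuous fun p : ℝ × ℝ =>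
        Complex.exp ((2 * Real.pi * (p.1 * (p.2 - y)) : ℝ) * Complex.I)).aestronglyMeasurable
    · exact (norm_exp_real_mul_I _).le
  calc _ = ∫ ξ : ℝ, ∫ x : ℝ, Complex.exp ((2 * Real.pi * (ξ * (x - y)) : ℝ) * Complex.I) *
        (m ξ * ψ x) := by
        refine integral_congr_ae (ae_of_all _ fun ξ => ?_)
        dsimp only
        rw [smul_eq_mul, ← integral_const_mul, ← integral_const_mul]
        refine integral_congr_ae (ae_of_all _ fun x => ?_)
        dsimp only
        have : Complex.exp ((2 * Real.pi * (ξ * (x - y)) : ℝ) * Complex.I) =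
            Complex.exp ((-(2 * Real.pi * (ξ * y)) : ℝ) * Complex.I) *
            Complex.exp ((2 * Real.pi * (x * ξ) : ℝ) * Complex.I) := by
          rw [← Complex.exp_add]
          congr 1
          push_cast
          ring
        rw [this]
        ring
    _ = _ := by
        rw [integral_integral_swap hint]
        refine integral_congr_ae (ae_of_all _ fun x => ?_)
        dsimp only
        rw [← integral_mul_const]
        refine integral_congr_ae (ae_of_all _ fun ξ => ?_)
        dsimp only
        ring

theorem W1.integral_multiplier {g : ℝ → ℂ} (hg : W1 g) (m ψ : 𝓢(ℝ, ℂ)) :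
    ∫ y, g y * (𝓕 (SchwartzMap.smulLeftCLM ℂ m (𝓕⁻ ψ : 𝓢(ℝ, ℂ))) : 𝓢(ℝ, ℂ)) y =
      ∫ x, cvC (𝓕⁻ m : 𝓢(ℝ, ℂ)) g x * ψ x := by
  simp_rw [fourier_mul_fourierInv]
  exact (hg.integral_cvC_mul _ ψ).symm

theorem IsRepr.multiplier {f : 𝓢'(ℝ, ℂ)} {g : ℝ → ℂ} (hf : IsRepr f g) (hg : W1 g)
    (m : 𝓢(ℝ, ℂ)) :
    IsRepr (TemperedDistribution.fourierMultiplierCLM ℂ m f) (cvC (𝓕⁻ m : 𝓢(ℝ, ℂ)) g) :=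
  fun ψ => by
    refine ⟨hg.integrable_cvC_mul _ ψ, ?_⟩
    rw [TemperedDistribution.fourierMultiplierCLM_apply_apply, (hf _).2, hg.integral_multiplier]

/-! ### The convolution kernels of the Littlewood-Paley projections -/

theorem kap_scale (n : ℕ) (x : ℝ) : kap n x = p2 n * kap 0 (2 ^ n * x) := by
  rw [kap_zero, kap, ENNReal.ofReal_mul (by positivity), ofReal_two_pow]

theorem kap_le_kap_succ (k : ℕ) (x : ℝ) : kap k x ≤ 2 * kap (k + 1) x := by
  unfold kap
  rw [show (2 : ℝ≥0∞) = ENNReal.ofReal 2 by norm_num, ← ENNReal.ofReal_mul (by norm_num)]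
  refine ENNReal.ofReal_le_ofReal ?_
  rw [← div_eq_mul_inv, ← div_eq_mul_inv, mul_div_assoc', div_le_div_iff₀ (by positivity)
    (by positivity), pow_succ (2 : ℝ) k]
  nlinarith [(by positivity : (0 : ℝ) < 2 ^ k),
    mul_nonneg (by positivity : (0 : ℝ) ≤ 2 ^ k) (sq_nonneg (2 ^ k * x))]

theorem kap_succ_le_kap (k : ℕ) (x : ℝ) : kap (k + 1) x ≤ 2 * kap k x := by
  unfold kap
  rw [show (2 : ℝ≥0∞) = ENNReal.ofReal 2 by norm_num, ← ENNReal.ofReal_mul (by norm_num)]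
  refine ENNReal.ofReal_le_ofReal ?_
  rw [← div_eq_mul_inv, ← div_eq_mul_inv, mul_div_assoc', div_le_div_iff₀ (by positivity)
    (by positivity), pow_succ (2 : ℝ) k]
  nlinarith [(by positivity : (0 : ℝ) < 2 ^ k),
    mul_nonneg (by positivity : (0 : ℝ) ≤ 2 ^ k) (sq_nonneg (2 ^ k * x))]

section Kernels

variable {φ₀ : ℝ → ℝ} (hφ : IsCutoff φ₀)
include hφ

theorem hasCompactSupport_cutoff (n : ℕ) :
    HasCompactSupport (fun ξ => ((φ₀ (ξ / 2 ^ n) : ℝ) : ℂ)) := by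
  refine HasCompactSupport.intro (isCompact_closedBall (0 : ℝ) (2 ^ (n + 1))) fun ξ hξ => ?_
  rw [mem_closedBall_zero_iff, Real.norm_eq_abs, not_le] at hξ
  simp [cutoff_eq_zero hφ hξ.le]

theorem contDiff_cutoff (n : ℕ) :
    ContDiff ℝ (⊤ : ℕ∞) (fun ξ => ((φ₀ (ξ / 2 ^ n) : ℝ) : ℂ)) :=
  Complex.ofRealCLM.contDiff.comp (hφ.smooth.comp (contDiff_id.div_const _))

/-- The symbol `φ₀(2^{-n} ξ)` as a Schwartz function. -/
noncomputable def lowS (n : ℕ) : 𝓢(ℝ, ℂ) :=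
  (hasCompactSupport_cutoff hφ n).toSchwartzMap (contDiff_cutoff hφ n)

theorem lowS_apply (n : ℕ) (ξ : ℝ) : lowS hφ n ξ = ((φ₀ (ξ / 2 ^ n) : ℝ) : ℂ) := rfl

theorem symS_zero : symS hφ 0 = lowS hφ 0 := by
  ext ξ; rw [lowS_apply, coe_symS]; simp [lpSymbol]

theorem symS_succ (k : ℕ) : symS hφ (k + 1) = lowS hφ (k + 1) - lowS hφ k := by
  ext ξ; rw [_root_.sub_apply, lowS_apply, lowS_apply, coe_symS]; simp [lpSymbol]

/-- All kernels are rescalings of a single Schwartz function, so one constant serves all frequencies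
in the kernel bounds. -/
theorem fourierInv_lowS (n : ℕ) (x : ℝ) :
    (𝓕⁻ (lowS hφ n) : 𝓢(ℝ, ℂ)) x = 2 ^ n * (𝓕⁻ (lowS hφ 0) : 𝓢(ℝ, ℂ)) (2 ^ n * x) := by
  rw [schwartz_fourierInv_apply, schwartz_fourierInv_apply]
  have h := Measure.integral_comp_div (fun ξ : ℝ =>
    Complex.exp ((2 * Real.pi * (ξ * (2 ^ n * x)) : ℝ) * Complex.I) * lowS hφ 0 ξ) (2 ^ n : ℝ)
  rw [abs_of_pos (by positivity : (0 : ℝ) < 2 ^ n), Complex.real_smul] at h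
  push_cast at h ⊢
  rw [← h]
  refine integral_congr_ae (ae_of_all _ fun ξ => ?_)
  simp only [lowS_apply, pow_zero, div_one]
  congr 2
  field_simp

theorem exists_lowS_kernel_bound :
    ∃ C : NNReal, ∀ n x, ‖(𝓕⁻ (lowS hφ n) : 𝓢(ℝ, ℂ)) x‖ₑ ≤ C * kap n x := by
  obtain ⟨C, hC⟩ := schwartz_enorm_le (𝓕⁻ (lowS hφ 0) : 𝓢(ℝ, ℂ))
  refine ⟨C, fun n x => ?_⟩
  rw [fourierInv_lowS, enorm_mul, kap_scale, enorm_pow, p2_natCast, mul_left_comm]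
  gcongr
  · rw [← ofReal_norm]; norm_num
  · exact hC _

theorem exists_symS_kernel_bound :
    ∃ C : NNReal, ∀ k x, ‖(𝓕⁻ (symS hφ k) : 𝓢(ℝ, ℂ)) x‖ₑ ≤ C * kap k x := by
  obtain ⟨C, hC⟩ := exists_lowS_kernel_bound hφ
  refine ⟨C * 3, fun k x => ?_⟩
  cases k with
  | zero =>
    rw [symS_zero]
    refine (hC 0 x).trans ?_
    gcongr
    exact le_mul_of_one_le_right (zero_le) (by norm_num)
  | succ k =>
    rw [symS_succ, sub_eq_add_neg, FourierTransform.fourierInv_add, FourierTransform.fourierInv_neg]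
    rw [_root_.add_apply, _root_.neg_apply]
    refine (enorm_add_le _ _).trans ?_
    rw [enorm_neg]
    calc _ ≤ C * kap (k + 1) x + C * kap k x := add_le_add (hC _ _) (hC _ _)
      _ ≤ C * kap (k + 1) x + C * (2 * kap (k + 1) x) := by gcongr; exact kap_le_kap_succ k x
      _ = _ := by push_cast; ring

theorem exists_fatS_kernel_bound :
    ∃ C : NNReal, ∀ a x, ‖(𝓕⁻ (fatS hφ a) : 𝓢(ℝ, ℂ)) x‖ₑ ≤ C * kap a x := by
  obtain ⟨C, hC⟩ := exists_symS_kernel_bound hφ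
  refine ⟨6 * C, fun a x => ?_⟩
  have e : (𝓕⁻ (fatS hφ a) : 𝓢(ℝ, ℂ)) =
      ∑ k ∈ Finset.Icc (a - 1) (a + 1), (𝓕⁻ (symS hφ k) : 𝓢(ℝ, ℂ)) :=
    map_sum (FourierTransform.fourierInvCLM ℂ 𝓢(ℝ, ℂ)) _ _
  rw [e, _root_.sum_apply]
  refine (enorm_sum_le _ _).trans ?_
  calc _ ≤ ∑ k ∈ Finset.Icc (a - 1) (a + 1), C * (2 * kap a x) := by
        refine Finset.sum_le_sum fun k hk => (hC k x).trans ?_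
        rw [Finset.mem_Icc] at hk
        gcongr
        rcases (by omega : k = a ∨ k = a + 1 ∨ k + 1 = a) with rfl | rfl | rfl
        · exact le_mul_of_one_le_left (zero_le) (by norm_num)
        · exact kap_succ_le_kap _ _
        · exact kap_le_kap_succ _ _
    _ ≤ 3 • (C * (2 * kap a x)) := by
        rw [Finset.sum_const]
        refine nsmul_le_nsmul_left (zero_le) ?_
        simp only [Nat.card_Icc]; omega
    _ = _ := by rw [nsmul_eq_mul]; push_cast; ring

/-- The multiplier `fatS` equals `1` on the support of the symbol of `S_a`. The resulting identity
encodes the frequency localisation of a function without speaking of its Fourier transform. -/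
theorem IsRepr.self_reproducing {a : ℕ} {f : 𝓢'(ℝ, ℂ)} {u : ℝ → ℂ}
    (h : IsRepr (lpProj φ₀ a f) u) (hu : W1 u) :
    u =ᵐ[volume] cvC (𝓕⁻ (fatS hφ a) : 𝓢(ℝ, ℂ)) u := by
  have h' := h.multiplier hu (fatS hφ a)
  rw [fatS_multiplier_lpProj] at h'
  exact h.ae_eq h'

theorem IsRepr.lpProj {f : 𝓢'(ℝ, ℂ)} {u : ℝ → ℂ} (h : IsRepr f u) (hu : W1 u) (k : ℕ) :
    IsRepr (lpProj φ₀ k f) (cvC (𝓕⁻ (symS hφ k) : 𝓢(ℝ, ℂ)) u) :=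
  h.multiplier hu (symS hφ k)

end Kernels

/-! ### Frequency localization of products -/

/-- Essentially bounded functions. -/
def Bdd (u : ℝ → ℂ) : Prop := ∃ C : NNReal, ∀ᵐ x, ‖u x‖ₑ ≤ C

/-- This is the Fourier side of multiplying a translated kernel by `𝓕 η`: at the frequency `ζ` only
values of `η` at `ξ + ζ` with `ξ` in the support of `m` occur. -/
theorem fourierInv_shift_mul (m η : 𝓢(ℝ, ℂ)) (y ζ : ℝ) :
    ∫ x, Complex.exp ((2 * Real.pi * (x * ζ) : ℝ) * Complex.I) *
      ((𝓕⁻ m : 𝓢(ℝ, ℂ)) (x - y) * (𝓕 η : 𝓢(ℝ, ℂ)) x) =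
    ∫ ξ, Complex.exp ((-(2 * Real.pi * (ξ * y)) : ℝ) * Complex.I) * (m ξ * η (ξ + ζ)) := by
  simp_rw [schwartz_fourierInv_apply m]
  have hint : Integrable (Function.uncurry fun x ξ : ℝ =>
      Complex.exp ((2 * Real.pi * (x * ζ + ξ * (x - y)) : ℝ) * Complex.I) *
        ((𝓕 η : 𝓢(ℝ, ℂ)) x * m ξ)) (volume.prod volume) := by
    refine ((𝓕 η : 𝓢(ℝ, ℂ)).integrable.mul_prod m.integrable).bdd_mul (c := 1) ?_
      (ae_of_all _ fun p => ?_)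
    · exact (by fun_prop : Continuous fun p : ℝ × ℝ =>
        Complex.exp ((2 * Real.pi * (p.1 * ζ + p.2 * (p.1 - y)) : ℝ) *
          Complex.I)).aestronglyMeasurable
    · exact (norm_exp_real_mul_I _).le
  calc _ = ∫ x : ℝ, ∫ ξ : ℝ, Complex.exp ((2 * Real.pi * (x * ζ + ξ * (x - y)) : ℝ) * Complex.I) *
        ((𝓕 η : 𝓢(ℝ, ℂ)) x * m ξ) := by
        refine integral_congr_ae (ae_of_all _ fun x => ?_)
        dsimp only
        rw [← integral_mul_const, ← integral_const_mul]
        refine integral_congr_ae (ae_of_all _ fun ξ => ?_)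
        dsimp only
        have : Complex.exp ((2 * Real.pi * (x * ζ + ξ * (x - y)) : ℝ) * Complex.I) =
            Complex.exp ((2 * Real.pi * (x * ζ) : ℝ) * Complex.I) *
            Complex.exp ((2 * Real.pi * (ξ * (x - y)) : ℝ) * Complex.I) := by
          rw [← Complex.exp_add]; congr 1; push_cast; ring
        rw [this]; ring
    _ = _ := by
        rw [integral_integral_swap hint]
        refine integral_congr_ae (ae_of_all _ fun ξ => ?_)
        dsimp only
        have hη : η (ξ + ζ) = ∫ x, Complex.exp ((2 * Real.pi * (x * (ξ + ζ)) : ℝ) * Complex.I) *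
            (𝓕 η : 𝓢(ℝ, ℂ)) x := by
          rw [← schwartz_fourierInv_apply, FourierTransform.fourierInv_fourier_eq]
        rw [hη, ← integral_const_mul, ← integral_const_mul]
        refine integral_congr_ae (ae_of_all _ fun x => ?_)
        dsimp only
        have : Complex.exp ((2 * Real.pi * (x * ζ + ξ * (x - y)) : ℝ) * Complex.I) =
            Complex.exp ((-(2 * Real.pi * (ξ * y)) : ℝ) * Complex.I) *
            Complex.exp ((2 * Real.pi * (x * (ξ + ζ)) : ℝ) * Complex.I) := by
          rw [← Complex.exp_add]; congr 1; push_cast; ring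
        rw [this]; ring

/-- As `v` is reproduced by `mB`, only the frequencies `ζ` in the support of `mB` of the test
function `θ` matter. There its inverse transform is an integral of `mA ξ η (ξ + ζ)`, which the
hypothesis makes zero. -/
theorem integral_shift_kernel_mul_eq_zero {v : ℝ → ℂ} (hv : W1 v) {mA mB η : 𝓢(ℝ, ℂ)}
    (hv' : v =ᵐ[volume] cvC (𝓕⁻ mB : 𝓢(ℝ, ℂ)) v)
    (h : ∀ ξ ζ, mA ξ * mB ζ * η (ξ + ζ) = 0) (y : ℝ) :
    ∫ x, (𝓕⁻ mA : 𝓢(ℝ, ℂ)) (x - y) * (v x * (𝓕 η : 𝓢(ℝ, ℂ)) x) = 0 := by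
  let KA : 𝓢(ℝ, ℂ) := SchwartzMap.compSubConstCLM ℂ y (𝓕⁻ mA : 𝓢(ℝ, ℂ))
  let θ : 𝓢(ℝ, ℂ) := SchwartzMap.smulLeftCLM ℂ KA (𝓕 η : 𝓢(ℝ, ℂ))
  have hθ : ∀ x, θ x = (𝓕⁻ mA : 𝓢(ℝ, ℂ)) (x - y) * (𝓕 η : 𝓢(ℝ, ℂ)) x := fun x => by
    simp only [θ]
    rw [SchwartzMap.smulLeftCLM_apply_apply (SchwartzMap.hasTemperateGrowth KA)]
    rfl
  have h0 : SchwartzMap.smulLeftCLM ℂ mB (𝓕⁻ θ : 𝓢(ℝ, ℂ)) = 0 := by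
    ext ζ
    rw [SchwartzMap.smulLeftCLM_apply_apply (SchwartzMap.hasTemperateGrowth mB),
      schwartz_fourierInv_apply]
    simp_rw [hθ]
    rw [fourierInv_shift_mul, smul_eq_mul, ← integral_const_mul]
    refine integral_eq_zero_of_ae (ae_of_all _ fun ξ => ?_)
    have := h ξ ζ
    simp only [Pi.zero_apply]
    linear_combination Complex.exp ((-(2 * Real.pi * (ξ * y)) : ℝ) * Complex.I) * this
  calc _ = ∫ x, v x * θ x := by
        refine integral_congr_ae (ae_of_all _ fun x => ?_)
        dsimp only
        rw [hθ]; ring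
    _ = ∫ x, cvC (𝓕⁻ mB : 𝓢(ℝ, ℂ)) v x * θ x :=
        integral_congr_ae (hv'.mono fun x hx => by dsimp only; rw [← hx])
    _ = 0 := by
        rw [← hv.integral_multiplier, h0, FourierTransform.fourier_zero]
        simp

/-- The product of two functions with frequencies in the supports of `mA` and `mB` has its
frequencies in the sum of the supports. -/
theorem integral_mul_fourier_eq_zero {u v : ℝ → ℂ} (hu : W1 u) (hub : Bdd u) (hv : W1 v)
    {mA mB η : 𝓢(ℝ, ℂ)}
    (hu' : u =ᵐ[volume] cvC (𝓕⁻ mA : 𝓢(ℝ, ℂ)) u) (hv' : v =ᵐ[volume] cvC (𝓕⁻ mB : 𝓢(ℝ, ℂ)) v)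
    (h : ∀ ξ ζ, mA ξ * mB ζ * η (ξ + ζ) = 0) :
    ∫ x, u x * v x * (𝓕 η : 𝓢(ℝ, ℂ)) x = 0 := by
  have hi := hv.integrable_mul (𝓕 η : 𝓢(ℝ, ℂ))
  obtain ⟨C, hC⟩ := hub
  let K : 𝓢(ℝ, ℂ) := 𝓕⁻ mA
  -- Absolute integrability uses the boundedness of `u` and the integrability of `K`, so that `v`
  -- only has to be integrable against Schwartz functions.
  have hint : Integrable (Function.uncurry fun x y : ℝ =>
      K (x - y) * u y * (v x * (𝓕 η : 𝓢(ℝ, ℂ)) x)) (volume.prod volume) := by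
    have hm : AEStronglyMeasurable (Function.uncurry fun x y : ℝ =>
        K (x - y) * u y * (v x * (𝓕 η : 𝓢(ℝ, ℂ)) x)) (volume.prod volume) :=
      (((K.continuous.comp (by fun_prop : Continuous fun p : ℝ × ℝ =>
        p.1 - p.2)).aestronglyMeasurable).mul hu.meas.comp_snd).mul hi.1.comp_fst
    refine ⟨hm, ?_⟩
    rw [hasFiniteIntegral_iff_enorm, lintegral_prod _ hm.enorm]
    have hKm : Measurable fun x => ‖K x‖ₑ := K.continuous.measurable.enorm
    calc _ ≤ ∫⁻ x, ‖v x * (𝓕 η : 𝓢(ℝ, ℂ)) x‖ₑ * (C * ∫⁻ y, ‖K y‖ₑ) := by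
          refine lintegral_mono fun x => ?_
          simp only [Function.uncurry]
          calc _ ≤ ∫⁻ y, ‖K (x - y)‖ₑ * (C * ‖v x * (𝓕 η : 𝓢(ℝ, ℂ)) x‖ₑ) := by
                refine lintegral_mono_ae (hC.mono fun y hy => ?_)
                rw [enorm_mul, enorm_mul, mul_assoc]
                gcongr
            _ = (∫⁻ y, ‖K (x - y)‖ₑ) * (C * ‖v x * (𝓕 η : 𝓢(ℝ, ℂ)) x‖ₑ) :=
                lintegral_mul_const _ (hKm.comp (measurable_const.sub measurable_id))
            _ = _ := by rw [lintegral_comp_sub (fun y => ‖K y‖ₑ)]; ring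
      _ = (∫⁻ x, ‖v x * (𝓕 η : 𝓢(ℝ, ℂ)) x‖ₑ) * (C * ∫⁻ y, ‖K y‖ₑ) :=
          lintegral_mul_const'' _ hi.1.enorm
      _ < ⊤ := by
          refine (ENNReal.mul_ne_top hi.2.ne (ENNReal.mul_ne_top (by simp) ?_)).lt_top
          exact K.integrable.2.ne
  calc _ = ∫ x, cvC K u x * (v x * (𝓕 η : 𝓢(ℝ, ℂ)) x) :=
        integral_congr_ae (hu'.mono fun x hx => by
          change u x * v x * _ = cvC K u x * (v x * _)
          rw [show cvC K u x = u x from hx.symm, mul_assoc])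
    _ = ∫ x, ∫ y, K (x - y) * u y * (v x * (𝓕 η : 𝓢(ℝ, ℂ)) x) := by
        refine integral_congr_ae (ae_of_all _ fun x => ?_)
        simp only [cvC]
        rw [integral_mul_const]
    _ = 0 := by
        rw [integral_integral_swap hint]
        refine integral_eq_zero_of_ae (ae_of_all _ fun y => ?_)
        have := integral_shift_kernel_mul_eq_zero hv hv' h y
        simp only [Pi.zero_apply]
        calc _ = ∫ x, u y * (K (x - y) * (v x * (𝓕 η : 𝓢(ℝ, ℂ)) x)) := by
              refine integral_congr_ae (ae_of_all _ fun x => ?_)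
              dsimp only; ring
          _ = 0 := by rw [integral_const_mul, this, mul_zero]

/-! ### Interaction of frequencies -/

section Frequencies

variable {φ₀ : ℝ → ℝ} (hφ : IsCutoff φ₀)
include hφ

theorem abs_lt_of_fatS_ne_zero {a : ℕ} {ξ : ℝ} (h : fatS hφ a ξ ≠ 0) : |ξ| < 2 ^ (a + 2) :=
  not_le.1 fun h' => h (fatS_eq_zero_of_ge hφ h')

theorem lt_abs_of_fatS_ne_zero {a : ℕ} {ξ : ℝ} (h : fatS hφ (a + 2) ξ ≠ 0) : 2 ^ a < |ξ| :=
  not_le.1 fun h' => h (fatS_eq_zero_of_le hφ h')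

theorem abs_lt_of_symS_ne_zero {k : ℕ} {ξ : ℝ} (h : symS hφ k ξ ≠ 0) : |ξ| < 2 ^ (k + 1) :=
  not_le.1 fun h' => h (by rw [coe_symS]; simp [lpSymbol_eq_zero_of_ge hφ h'])

theorem lt_abs_of_symS_ne_zero {k : ℕ} {ξ : ℝ} (h : symS hφ (k + 1) ξ ≠ 0) : 2 ^ k < |ξ| :=
  not_le.1 fun h' => h (by rw [coe_symS]; simp [lpSymbol_eq_zero_of_le hφ h'])

theorem abs_lt_of_lowS_ne_zero {n : ℕ} {ξ : ℝ} (h : lowS hφ n ξ ≠ 0) : |ξ| < 2 ^ (n + 1) :=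
  not_le.1 fun h' => h (by rw [lowS_apply]; simp [cutoff_eq_zero hφ h'])

/-- Here `2^(c+1) < |ξ| < 2^(c+5)` and `|ζ| < 2^(b+2) ≤ 2^c`, so the larger frequency survives in
the sum. The shift by `3` leaves room for the three symbols contained in `fatS`. -/
theorem high_low_freq {b c : ℕ} {ξ ζ : ℝ} (h : b + 2 ≤ c) (hξ : fatS hφ (c + 3) ξ ≠ 0)
    (hζ : fatS hφ b ζ ≠ 0) : 2 ^ c < |ξ + ζ| ∧ |ξ + ζ| < 2 ^ (c + 6) := by
  have h1 := abs_lt_of_fatS_ne_zero hφ hξ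
  have h2 := lt_abs_of_fatS_ne_zero hφ (a := c + 1) hξ
  have h3 := (abs_lt_of_fatS_ne_zero hφ hζ).trans_le
    (pow_le_pow_right₀ (by norm_num : (1 : ℝ) ≤ 2) h)
  have h4 := abs_add_le ξ ζ
  have h5 := abs_sub_abs_le_abs_sub ξ (-ζ)
  rw [abs_neg, sub_neg_eq_add] at h5
  have h6 : (0 : ℝ) < 2 ^ c := by positivity
  rw [show c + 3 + 2 = c + 5 by rfl] at h1
  rw [pow_succ] at h2
  rw [pow_add] at h1
  rw [pow_add]
  constructor <;> linarith

/-- The frequencies `2 ^ a` and `2 ^ b` interact to the frequency `2 ^ k`. -/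
def Contrib (k : ℕ) (p : ℕ × ℕ) : Prop :=
  (p.2 + 5 ≤ p.1 ∧ p.1 ≤ k + 3 ∧ k ≤ p.1 + 3) ∨ (p.1 + 5 ≤ p.2 ∧ p.2 ≤ k + 3 ∧ k ≤ p.2 + 3) ∨
    (p.1 ≤ p.2 + 4 ∧ p.2 ≤ p.1 + 4 ∧ k ≤ p.1 + 7 ∧ k ≤ p.2 + 7)

omit hφ in
theorem lt_of_two_pow_lt {m n : ℕ} (h : (2 : ℝ) ^ m < 2 ^ n) : m < n :=
  (pow_lt_pow_iff_right₀ (by norm_num)).1 h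

theorem high_low_contrib {a b k : ℕ} {ξ ζ : ℝ} (h : b + 5 ≤ a) (hξ : fatS hφ a ξ ≠ 0)
    (hζ : fatS hφ b ζ ≠ 0) (hk : symS hφ k (ξ + ζ) ≠ 0) : a ≤ k + 3 ∧ k ≤ a + 3 := by
  obtain ⟨c, rfl⟩ : ∃ c, a = c + 3 := ⟨a - 3, by omega⟩
  obtain ⟨h1, h2⟩ := high_low_freq hφ (by omega) hξ hζ
  have h3 := lt_of_two_pow_lt (h1.trans (abs_lt_of_symS_ne_zero hφ hk))
  refine ⟨by omega, ?_⟩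
  cases k with
  | zero => omega
  | succ k =>
    have h4 := lt_of_two_pow_lt ((lt_abs_of_symS_ne_zero hφ hk).trans h2)
    omega

/-- If the frequencies are far apart, the sum is comparable to the larger one. Otherwise it is only
bounded from above, since the high frequencies may cancel; this is why `Contrib` has no lower bound
for `k` in its last case. -/
theorem symbols_eq_zero_of_not_contrib {k a b : ℕ} (h : ¬ Contrib k (a, b)) (ξ ζ : ℝ) :
    fatS hφ a ξ * fatS hφ b ζ * symS hφ k (ξ + ζ) = 0 := by
  by_contra h0
  obtain ⟨h1, hk⟩ := mul_ne_zero_iff.1 h0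
  obtain ⟨hξ, hζ⟩ := mul_ne_zero_iff.1 h1
  refine h ?_
  unfold Contrib
  dsimp only
  by_cases hab : b + 5 ≤ a
  · exact Or.inl ⟨hab, high_low_contrib hφ hab hξ hζ hk⟩
  by_cases hba : a + 5 ≤ b
  · exact Or.inr (Or.inl ⟨hba, high_low_contrib hφ hba hζ hξ (by rwa [add_comm])⟩)
  refine Or.inr (Or.inr ⟨by omega, by omega, ?_⟩)
  cases k with
  | zero => omega
  | succ k =>
    have e1 := abs_lt_of_fatS_ne_zero hφ hξ
    have e2 := abs_lt_of_fatS_ne_zero hφ hζ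
    have e3 := abs_add_le ξ ζ
    have e4 := lt_abs_of_symS_ne_zero hφ hk
    have e5 : (2 : ℝ) ^ (a + 2) ≤ 2 ^ (max a b + 2) :=
      pow_le_pow_right₀ (by norm_num) (by omega)
    have e6 : (2 : ℝ) ^ (b + 2) ≤ 2 ^ (max a b + 2) :=
      pow_le_pow_right₀ (by norm_num) (by omega)
    have e7 : (2 : ℝ) ^ k < 2 ^ (max a b + 3) := by
      rw [pow_succ _ (max a b + 2)]; linarith
    have := lt_of_two_pow_lt e7
    omega

theorem symbols_lowS_eq_zero {a b : ℕ} (h : b + 5 ≤ a) (ξ ζ : ℝ) :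
    fatS hφ a ξ * fatS hφ b ζ * lowS hφ (a - 4) (ξ + ζ) = 0 := by
  by_contra h0
  obtain ⟨h1, hk⟩ := mul_ne_zero_iff.1 h0
  obtain ⟨hξ, hζ⟩ := mul_ne_zero_iff.1 h1
  obtain ⟨c, rfl⟩ : ∃ c, a = c + 3 := ⟨a - 3, by omega⟩
  have h2 := (high_low_freq hφ (by omega) hξ hζ).1
  have h3 := abs_lt_of_lowS_ne_zero hφ hk
  have := lt_of_two_pow_lt (h2.trans h3)
  omega

/-- Functions with frequencies in the support of `fatS a`. -/
structure IsBlock (a : ℕ) (u : ℝ → ℂ) : Prop where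
  w1 : W1 u
  self : u =ᵐ[volume] cvC (𝓕⁻ (fatS hφ a) : 𝓢(ℝ, ℂ)) u

omit hφ in
theorem cvC_zero (K : ℝ → ℂ) : cvC K (fun _ => 0) = fun _ => 0 := by
  funext x; simp [cvC]

theorem IsBlock.zero (a : ℕ) : IsBlock hφ a (fun _ => 0) :=
  ⟨W1.zero, by rw [cvC_zero]⟩

variable {hφ}

theorem IsBlock.integral_eq_zero {a b k : ℕ} {u v : ℝ → ℂ} (hu : IsBlock hφ a u) (hub : Bdd u)
    (hv : IsBlock hφ b v) (h : ¬ Contrib k (a, b)) (η : 𝓢(ℝ, ℂ)) :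
    ∫ x, u x * v x * (𝓕 (SchwartzMap.smulLeftCLM ℂ (symS hφ k) η) : 𝓢(ℝ, ℂ)) x = 0 := by
  refine integral_mul_fourier_eq_zero hu.w1 hub hv.w1 hu.self hv.self fun ξ ζ => ?_
  rw [SchwartzMap.smulLeftCLM_apply_apply (SchwartzMap.hasTemperateGrowth _), smul_eq_mul,
    ← mul_assoc, symbols_eq_zero_of_not_contrib hφ h, zero_mul]

end Frequencies

/-! ### Bounds for the interaction -/

/-- The norm of `L²(ℝ)`. -/
noncomputable def nL2 (u : ℝ → ℂ) : ℝ≥0∞ := (∫⁻ x, ‖u x‖ₑ ^ 2) ^ (1 / 2 : ℝ)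

theorem nL2_sq (u : ℝ → ℂ) : nL2 u ^ 2 = ∫⁻ x, ‖u x‖ₑ ^ 2 := rpow_half_sq _

theorem lintegral_mul_le_nL2 {u v : ℝ → ℂ} (hu : AEStronglyMeasurable u volume)
    (hv : AEStronglyMeasurable v volume) : ∫⁻ x, ‖u x‖ₑ * ‖v x‖ₑ ≤ nL2 u * nL2 v := by
  refine le_of_sq_le_sq ?_
  rw [mul_pow, nL2_sq, nL2_sq]
  exact lintegral_mul_sq_le hu.enorm hv.enorm

/-- The weighted integral `∫ (1 + |ξ|)^M |η|`. -/
noncomputable def wInt (M : ℕ) (η : ℝ → ℂ) : ℝ≥0∞ :=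
  ∫⁻ ξ, ENNReal.ofReal ((1 + ‖ξ‖) ^ M) * ‖η ξ‖ₑ

theorem lintegral_le_wInt (M : ℕ) (η : ℝ → ℂ) : ∫⁻ ξ, ‖η ξ‖ₑ ≤ wInt M η := by
  refine lintegral_mono fun ξ => le_mul_of_one_le_left (zero_le) ?_
  rw [ENNReal.one_le_ofReal]
  exact one_le_pow₀ (by linarith [norm_nonneg ξ])

theorem wInt_le (M : ℕ) (η : 𝓢(ℝ, ℂ)) :
    wInt M η ≤ 4 * ENNReal.ofReal
      (2 ^ (M + 2) * ((Finset.Iic (M + 2, 0)).sup (schwartzSeminormFamily ℂ ℝ ℂ)) η) := by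
  set c := 2 ^ (M + 2) * ((Finset.Iic (M + 2, 0)).sup (schwartzSeminormFamily ℂ ℝ ℂ)) η
  have hc : ∀ ξ, (1 + ‖ξ‖) ^ (M + 2) * ‖η ξ‖ ≤ c := fun ξ => by
    have h := SchwartzMap.one_add_le_sup_seminorm_apply (𝕜 := ℂ) (m := (M + 2, 0)) (k := M + 2)
      (n := 0) le_rfl le_rfl η ξ
    rw [norm_iteratedFDeriv_zero] at h
    exact h
  have hc0 : 0 ≤ c := (by positivity : (0 : ℝ) ≤ (1 + ‖(0 : ℝ)‖) ^ (M + 2) * ‖η 0‖).trans (hc 0)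
  calc wInt M η ≤ ∫⁻ ξ, ENNReal.ofReal c * kap 0 ξ := by
        refine lintegral_mono fun ξ => ?_
        rw [kap_zero, ← ofReal_norm, ← ENNReal.ofReal_mul (by positivity), ← ENNReal.ofReal_mul hc0]
        refine ENNReal.ofReal_le_ofReal ?_
        rw [← div_eq_mul_inv, le_div_iff₀ (by positivity)]
        calc _ ≤ (1 + ‖ξ‖) ^ M * ‖η ξ‖ * (1 + ‖ξ‖) ^ 2 := by
              gcongr
              exact one_add_sq_le ξ
          _ = (1 + ‖ξ‖) ^ (M + 2) * ‖η ξ‖ := by ring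
          _ ≤ c := hc ξ
    _ = ENNReal.ofReal c * ∫⁻ ξ, kap 0 ξ := lintegral_const_mul _ (measurable_kap 0)
    _ ≤ ENNReal.ofReal c * 4 := by gcongr; exact lintegral_kap_le 0
    _ = _ := mul_comm _ _

theorem enorm_fourier_le (η : 𝓢(ℝ, ℂ)) (x : ℝ) :
    ‖(𝓕 η : 𝓢(ℝ, ℂ)) x‖ₑ ≤ ∫⁻ ξ, ‖η ξ‖ₑ := by
  rw [schwartz_fourier_apply]
  refine (enorm_integral_le_lintegral_enorm _).trans (lintegral_mono fun ξ => ?_)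
  rw [enorm_mul, ← ofReal_norm, norm_exp_real_mul_I]
  simp

/-- The product of two `L²` functions lies in `L¹`, and `𝓕 η` is bounded by the integral of `|η|`.
No decay in the frequencies is used; comparable blocks have to be summed with this bound alone. -/
theorem enorm_integral_mul_fourier_le {u v : ℝ → ℂ} (hu : AEStronglyMeasurable u volume)
    (hv : AEStronglyMeasurable v volume) (η : 𝓢(ℝ, ℂ)) :
    ‖∫ x, u x * v x * (𝓕 η : 𝓢(ℝ, ℂ)) x‖ₑ ≤ nL2 u * nL2 v * ∫⁻ ξ, ‖η ξ‖ₑ := by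
  refine (enorm_integral_le_lintegral_enorm _).trans ?_
  have hm : AEMeasurable (fun x => ‖u x‖ₑ * ‖v x‖ₑ) volume := hu.enorm.mul hv.enorm
  calc _ ≤ ∫⁻ x, ‖u x‖ₑ * ‖v x‖ₑ * ∫⁻ ξ, ‖η ξ‖ₑ := by
        refine lintegral_mono fun x => ?_
        rw [enorm_mul, enorm_mul]
        gcongr
        exact enorm_fourier_le η x
    _ = (∫⁻ x, ‖u x‖ₑ * ‖v x‖ₑ) * ∫⁻ ξ, ‖η ξ‖ₑ := lintegral_mul_const'' _ hm
    _ ≤ _ := by gcongr; exact lintegral_mul_le_nL2 hu hv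

/-- The weight for the interaction of the frequencies `2 ^ a` and `2 ^ b`. -/
noncomputable def bandWeight (M : ℕ) (a b : ℕ) : ℝ≥0∞ :=
  if a ≤ b + 4 ∧ b ≤ a + 4 then 1 else p2 (M * (4 - (max a b : ℕ)))

theorem bandWeight_comm (M a b : ℕ) : bandWeight M a b = bandWeight M b a := by
  unfold bandWeight
  exact if_congr and_comm rfl (by rw [max_comm])

section Decay

variable {φ₀ : ℝ → ℝ} {hφ : IsCutoff φ₀}

/-- The product has no frequencies below `2^(a-4)`, so the part `η₀` of the test function in that
range can be subtracted for free. The rest lives on `|ξ| ≥ 2^(a-4)`, where `(1 + |ξ|)^M` yields any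
power of `2^(-a)`. -/
theorem IsBlock.enorm_integral_le_of_lt {a b : ℕ} (h : b + 5 ≤ a) {u v : ℝ → ℂ}
    (hu : IsBlock hφ a u)
    (hub : Bdd u) (hv : IsBlock hφ b v) (M : ℕ) (η : 𝓢(ℝ, ℂ)) :
    ‖∫ x, u x * v x * (𝓕 η : 𝓢(ℝ, ℂ)) x‖ₑ ≤ nL2 u * nL2 v * (bandWeight M a b * wInt M η) := by
  let η₀ : 𝓢(ℝ, ℂ) := SchwartzMap.smulLeftCLM ℂ (lowS hφ (a - 4)) η
  have hη₀ : ∀ ξ, η₀ ξ = lowS hφ (a - 4) ξ * η ξ := fun ξ =>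
    SchwartzMap.smulLeftCLM_apply_apply (SchwartzMap.hasTemperateGrowth _) η ξ
  have hi : ∀ θ : 𝓢(ℝ, ℂ), Integrable (fun x => u x * v x * θ x) := fun θ => by
    obtain ⟨C, hC⟩ := hub
    exact (hv.w1.bdd_mul hu.w1.meas hC).integrable_mul θ
  have h0 : ∫ x, u x * v x * (𝓕 η₀ : 𝓢(ℝ, ℂ)) x = 0 := by
    refine integral_mul_fourier_eq_zero hu.w1 hub hv.w1 hu.self hv.self fun ξ ζ => ?_
    rw [hη₀, ← mul_assoc, symbols_lowS_eq_zero hφ h, zero_mul]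
  have e : ∫ x, u x * v x * (𝓕 η : 𝓢(ℝ, ℂ)) x =
      ∫ x, u x * v x * (𝓕 (η - η₀) : 𝓢(ℝ, ℂ)) x := by
    have e1 : (𝓕 (η - η₀) : 𝓢(ℝ, ℂ)) = 𝓕 η - 𝓕 η₀ :=
      map_sub (FourierTransform.fourierCLM ℂ 𝓢(ℝ, ℂ)) _ _
    simp_rw [e1, _root_.sub_apply, mul_sub]
    rw [integral_sub (hi _) (hi _), h0, sub_zero]
  rw [e]
  refine (enorm_integral_mul_fourier_le hu.w1.meas hv.w1.meas _).trans ?_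
  gcongr
  have hw : bandWeight M a b = ENNReal.ofReal ((2 ^ (a - 4))⁻¹ ^ M) := by
    rw [bandWeight, if_neg (by omega), max_eq_left (by omega), p2_eq_ofReal, inv_pow,
      ← pow_mul, ← Real.rpow_natCast, ← Real.rpow_neg (by norm_num)]
    congr 2
    push_cast [Nat.cast_sub (by omega : 4 ≤ a)]
    ring
  rw [hw, wInt, ← lintegral_const_mul' _ _ (by simp)]
  refine lintegral_mono fun ξ => ?_
  rw [_root_.sub_apply, hη₀, lowS_apply]
  -- For low `ξ` the difference `η - η₀` vanishes; for high `ξ` the weight `(2^(-(a-4)) (1 +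
  -- |ξ|))^M` is at least `1`.
  rcases le_total |ξ| (2 ^ (a - 4)) with h' | h'
  · rw [cutoff_eq_one hφ h']
    simp
  · rw [← mul_assoc, ← ENNReal.ofReal_mul (by positivity)]
    have h1 : ‖η ξ - ((φ₀ (ξ / 2 ^ (a - 4)) : ℝ) : ℂ) * η ξ‖ₑ ≤ ‖η ξ‖ₑ := by
      rw [← one_sub_mul, enorm_mul]
      refine mul_le_of_le_one_left (zero_le) ?_
      rw [← Complex.ofReal_one, ← Complex.ofReal_sub, ← ofReal_norm, Complex.norm_real,
        ENNReal.ofReal_le_one, Real.norm_eq_abs, abs_le]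
      have := hφ.mem_Icc (ξ / 2 ^ (a - 4))
      constructor <;> linarith [this.1, this.2]
    refine h1.trans (le_mul_of_one_le_left (zero_le) ?_)
    rw [ENNReal.one_le_ofReal, ← mul_pow]
    refine one_le_pow₀ ?_
    rw [inv_mul_eq_div, one_le_div (by positivity), Real.norm_eq_abs]
    linarith

theorem IsBlock.enorm_integral_le {a b : ℕ} {u v : ℝ → ℂ} (hu : IsBlock hφ a u)
    (hub : Bdd u) (hv : IsBlock hφ b v) (hvb : Bdd v) (M : ℕ) (η : 𝓢(ℝ, ℂ)) :
    ‖∫ x, u x * v x * (𝓕 η : 𝓢(ℝ, ℂ)) x‖ₑ ≤ nL2 u * nL2 v * (bandWeight M a b * wInt M η) := by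
  by_cases h : b + 5 ≤ a
  · exact hu.enorm_integral_le_of_lt h hub hv M η
  by_cases h' : a + 5 ≤ b
  · rw [bandWeight_comm, mul_comm (nL2 u)]
    simp_rw [mul_comm (u _)]
    exact hv.enorm_integral_le_of_lt h' hvb hu M η
  · rw [bandWeight, if_pos (by omega), one_mul]
    refine (enorm_integral_mul_fourier_le hu.w1.meas hv.w1.meas η).trans ?_
    gcongr
    exact lintegral_le_wInt M η

end Decay

/-! ### Tempered distributions from series of functions -/

/-- A single Schwartz seminorm dominating the absolutely convergent series gives continuity of the
limit. The operator `A` is the Fourier transform when the terms are controlled through the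
frequencies of the test function, and the identity when they are controlled in space. -/
theorem exists_functional {ι : Type*} (w : ι → ℝ → ℂ) (hw : ∀ i, W1 (w i))
    (A : 𝓢(ℝ, ℂ) →L[ℂ] 𝓢(ℝ, ℂ)) (S : NNReal) (M : ℕ)
    (h : ∀ η, ∑' i, ‖∫ x, w i x * A η x‖ₑ ≤
      S * ENNReal.ofReal (((Finset.Iic (M, 0)).sup (schwartzSeminormFamily ℂ ℝ ℂ)) η)) :
    ∃ L : 𝓢(ℝ, ℂ) →L[ℂ] ℂ, ∀ η, HasSum (fun i => ∫ x, w i x * A η x) (L η) := by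
  have hs : ∀ η, Summable (fun i => ∫ x, w i x * A η x) := fun η => by
    refine Summable.of_nnnorm (ENNReal.tsum_coe_ne_top_iff_summable.1 ?_)
    exact ne_top_of_le_ne_top (by finiteness) (h η)
  refine ⟨SchwartzMap.mkCLMtoNormedSpace (σ := RingHom.id ℂ)
    (fun η => ∑' i, ∫ x, w i x * A η x) ?_ ?_ ?_, fun η => (hs η).hasSum⟩
  · intro f g
    rw [← (hs f).tsum_add (hs g)]
    refine tsum_congr fun i => ?_
    rw [← integral_add ((hw i).integrable_mul _) ((hw i).integrable_mul _), map_add]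
    simp_rw [_root_.add_apply, mul_add]
  · intro c f
    rw [smul_eq_mul, RingHom.id_apply, ← tsum_mul_left]
    refine tsum_congr fun i => ?_
    rw [← integral_const_mul, map_smul]
    refine integral_congr_ae (ae_of_all _ fun x => ?_)
    dsimp only
    rw [_root_.smul_apply, smul_eq_mul]
    ring
  · refine ⟨Finset.Iic (M, 0), S, S.coe_nonneg, fun η => ?_⟩
    have h1 := enorm_tsum_le_tsum_enorm.trans (h η)
    rw [← ENNReal.ofReal_coe_nnreal, ← ENNReal.ofReal_mul S.coe_nonneg, ← ofReal_norm] at h1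
    exact (ENNReal.ofReal_le_ofReal_iff (mul_nonneg S.coe_nonneg (apply_nonneg _ _))).1 h1

theorem exists_dist_of_fourier_bound {ι : Type*} (w : ι → ℝ → ℂ) (hw : ∀ i, W1 (w i))
    (S : NNReal) (M : ℕ)
    (h : ∀ η : 𝓢(ℝ, ℂ), ∑' i, ‖∫ x, w i x * (𝓕 η : 𝓢(ℝ, ℂ)) x‖ₑ ≤ S * wInt M η) :
    ∃ T : 𝓢'(ℝ, ℂ), ∀ ψ : 𝓢(ℝ, ℂ), HasSum (fun i => ∫ x, w i x * ψ x) (T ψ) := by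
  obtain ⟨L, hL⟩ := exists_functional w hw (FourierTransform.fourierCLM ℂ 𝓢(ℝ, ℂ))
    (S * (4 * 2 ^ (M + 2))) (M + 2) fun η => by
      refine (h η).trans ?_
      rw [ENNReal.coe_mul, mul_assoc]
      gcongr
      refine (wInt_le M η).trans (le_of_eq ?_)
      rw [ENNReal.ofReal_mul (by positivity), ← mul_assoc]
      congr 1
      push_cast
      rw [ENNReal.ofReal_pow (by norm_num)]
      simp
  refine ⟨ContinuousLinearMap.toPointwiseConvergenceCLM _ _ _ _
    (L ∘L FourierTransform.fourierInvCLM ℂ 𝓢(ℝ, ℂ)), fun ψ => ?_⟩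
  have := hL (𝓕⁻ ψ)
  simp only [FourierTransform.fourierCLM_apply, FourierTransform.fourier_fourierInv_eq] at this
  exact this

theorem enorm_le_seminorm_mul_kap (ψ : 𝓢(ℝ, ℂ)) (x : ℝ) :
    ‖ψ x‖ₑ ≤ 4 * ENNReal.ofReal (((Finset.Iic (2, 0)).sup (schwartzSeminormFamily ℂ ℝ ℂ)) ψ) *
      kap 0 x := by
  set c := ((Finset.Iic (2, 0)).sup (schwartzSeminormFamily ℂ ℝ ℂ)) ψ
  have hc : 0 ≤ 2 ^ 2 * c := mul_nonneg (by positivity) (apply_nonneg _ _)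
  have h := enorm_le_mul_kap (ψ := ψ) (C := (2 ^ 2 * c).toNNReal) (fun x => by
    have h := SchwartzMap.one_add_le_sup_seminorm_apply (𝕜 := ℂ) (m := (2, 0)) (k := 2)
      (n := 0) le_rfl le_rfl ψ x
    rw [norm_iteratedFDeriv_zero] at h
    rw [Real.coe_toNNReal _ hc]
    exact h) x
  refine h.trans (le_of_eq ?_)
  congr 1
  change ENNReal.ofReal (2 ^ 2 * c) = _
  rw [ENNReal.ofReal_mul (by positivity), ENNReal.ofReal_pow (by norm_num)]
  norm_num

theorem exists_dist_of_lintegral {ι : Type*} (w : ι → ℝ → ℂ) (hw : ∀ i, W1 (w i))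
    (h : ∑' i, ∫⁻ x, ‖w i x‖ₑ * kap 0 x ≠ ⊤) :
    ∃ T : 𝓢'(ℝ, ℂ), ∀ ψ : 𝓢(ℝ, ℂ), HasSum (fun i => ∫ x, w i x * ψ x) (T ψ) := by
  obtain ⟨L, hL⟩ := exists_functional w hw (ContinuousLinearMap.id ℂ 𝓢(ℝ, ℂ))
    ((∑' i, ∫⁻ x, ‖w i x‖ₑ * kap 0 x).toNNReal * 4) 2 fun η => by
      rw [ENNReal.coe_mul, ENNReal.coe_toNNReal h, mul_assoc, ← ENNReal.tsum_mul_right]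
      refine ENNReal.tsum_le_tsum fun i => ?_
      refine (enorm_integral_le_lintegral_enorm _).trans ?_
      rw [← lintegral_mul_const'' _ (hw i).aemeasurable]
      refine lintegral_mono fun x => ?_
      dsimp only
      rw [enorm_mul, mul_assoc, mul_comm (kap 0 x)]
      gcongr
      exact enorm_le_seminorm_mul_kap η x
  exact ⟨ContinuousLinearMap.toPointwiseConvergenceCLM _ _ _ _ L, hL⟩

/-! ### Bounded functions -/

theorem Bdd.zero : Bdd (fun _ => 0) := ⟨0, by simp⟩

theorem Bdd.add {u v : ℝ → ℂ} (hu : Bdd u) (hv : Bdd v) : Bdd (fun x => u x + v x) := by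
  obtain ⟨C, hC⟩ := hu
  obtain ⟨D, hD⟩ := hv
  refine ⟨C + D, ?_⟩
  filter_upwards [hC, hD] with x h1 h2
  rw [ENNReal.coe_add]
  exact (enorm_add_le _ _).trans (add_le_add h1 h2)

theorem Bdd.neg {u : ℝ → ℂ} (hu : Bdd u) : Bdd (fun x => -u x) := by
  simpa only [Bdd, enorm_neg] using hu

theorem Bdd.sum {ι : Type*} {s : Finset ι} {u : ι → ℝ → ℂ} (h : ∀ i ∈ s, Bdd (u i)) :
    Bdd (fun x => ∑ i ∈ s, u i x) := by
  classical
  induction s using Finset.induction_on with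
  | empty => simpa using Bdd.zero
  | insert i s hi ih =>
    simp_rw [Finset.sum_insert hi]
    exact (h i (Finset.mem_insert_self _ _)).add
      (ih fun j hj => h j (Finset.mem_insert_of_mem hj))

theorem Bdd.convolution {u : ℝ → ℂ} (hu : Bdd u) (K : 𝓢(ℝ, ℂ)) : Bdd (cvC K u) := by
  obtain ⟨C, hC⟩ := hu
  have hK : ∫⁻ y, ‖K y‖ₑ ≠ ⊤ := K.integrable.2.ne
  have hKm : Measurable fun x => ‖K x‖ₑ := K.continuous.measurable.enorm
  have hKx : ∀ x, Measurable fun y => ‖K (x - y)‖ₑ := fun x =>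
    hKm.comp (measurable_const.sub measurable_id)
  refine ⟨(∫⁻ y, ‖K y‖ₑ).toNNReal * C, ae_of_all _ fun x => (enorm_cvC_le K u x).trans ?_⟩
  rw [ENNReal.coe_mul, ENNReal.coe_toNNReal hK, ← lintegral_comp_sub (fun y => ‖K y‖ₑ) x,
    ← lintegral_mul_const _ (hKx x)]
  exact lintegral_mono_ae (hC.mono fun y hy => by gcongr)

theorem W1.neg {u : ℝ → ℂ} (hu : W1 u) : W1 (fun x => -u x) :=
  ⟨hu.meas.neg, by simpa only [enorm_neg] using hu.fin⟩

theorem W1.of_nL2 {u : ℝ → ℂ} (hu : AEStronglyMeasurable u volume) (h : nL2 u ≠ ⊤) : W1 u := by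
  refine W1.of_sq hu ?_
  rw [← nL2_sq]
  exact ENNReal.pow_ne_top h

/-! ### Distributions as sums of functions localised in frequency -/

section Blocks

variable {φ₀ : ℝ → ℝ} {hφ : IsCutoff φ₀}

/-- Bernstein's inequality at a fixed time, from the reproducing identity and Cauchy-Schwarz. Only
finiteness of the bound is wanted, so its dependence on `a` is not recorded. -/
theorem IsBlock.bdd {a : ℕ} {u : ℝ → ℂ} (hu : IsBlock hφ a u) (h : nL2 u ≠ ⊤) : Bdd u := by
  let K : 𝓢(ℝ, ℂ) := 𝓕⁻ (fatS hφ a)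
  obtain ⟨C, hC⟩ := schwartz_enorm_le K
  have hKm : Measurable fun x => ‖K x‖ₑ := K.continuous.measurable.enorm
  have hK : ∫⁻ y, ‖K y‖ₑ ^ 2 ≠ ⊤ := by
    refine ne_top_of_le_ne_top (b := C ^ 2 * (4 * p2 (0 : ℕ)))
      (ENNReal.mul_ne_top (by finiteness) (ENNReal.mul_ne_top (by simp) (p2_ne_top _))) ?_
    calc _ ≤ ∫⁻ y, C ^ 2 * kap 0 y ^ 2 := lintegral_mono fun y => by
          rw [← mul_pow]; gcongr; exact hC y
      _ = C ^ 2 * ∫⁻ y, kap 0 y ^ 2 := lintegral_const_mul _ ((measurable_kap 0).pow_const 2)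
      _ ≤ _ := by gcongr; exact lintegral_kap_sq_le 0
  have hD : ∀ x, (∫⁻ y, ‖K (x - y)‖ₑ * ‖u y‖ₑ) ^ 2 ≤ (∫⁻ y, ‖K y‖ₑ ^ 2) * nL2 u ^ 2 := fun x => by
    rw [nL2_sq, ← lintegral_comp_sub (fun y => ‖K y‖ₑ ^ 2) x]
    exact lintegral_mul_sq_le (hKm.comp (measurable_const.sub measurable_id)).aemeasurable
      hu.w1.meas.enorm
  have hfin : (∫⁻ y, ‖K y‖ₑ ^ 2) * nL2 u ^ 2 ≠ ⊤ := ENNReal.mul_ne_top hK (ENNReal.pow_ne_top h)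
  refine ⟨(((∫⁻ y, ‖K y‖ₑ ^ 2) * nL2 u ^ 2) ^ (1 / 2 : ℝ)).toNNReal, hu.self.mono fun x hx => ?_⟩
  rw [ENNReal.coe_toNNReal (ENNReal.rpow_ne_top_of_nonneg (by norm_num) hfin), hx]
  refine (enorm_cvC_le K u x).trans (le_of_sq_le_sq ?_)
  rw [rpow_half_sq]
  exact hD x

variable (hφ)

/-- `f` is the sum of the functions `u a` with frequencies about `2 ^ a`. -/
structure Blocks (f : 𝓢'(ℝ, ℂ)) (u : ℕ → ℝ → ℂ) : Prop where
  repr : ∀ N, ∃ F, IsRepr (lpLT φ₀ N f) F ∧ W1 F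
  ev : ∀ᶠ N in atTop, IsRepr (lpLT φ₀ N f) (fun x => ∑ a ∈ Finset.range N, u a x)
  block : ∀ a, IsBlock hφ a (u a)

/-- `f` is the sum of the bounded functions `u a` with frequencies about `2 ^ a`. -/
structure BddBlocks (f : 𝓢'(ℝ, ℂ)) (u : ℕ → ℝ → ℂ) : Prop extends Blocks hφ f u where
  bdd : ∀ a, Bdd (u a)
  bdd_repr : ∀ N, ∃ F, IsRepr (lpLT φ₀ N f) F ∧ W1 F ∧ Bdd F

variable {hφ}

theorem Blocks.of_repr {f : 𝓢'(ℝ, ℂ)} {u : ℕ → ℝ → ℂ} (h : ∀ a, IsRepr (lpProj φ₀ a f) (u a))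
    (hw : ∀ a, W1 (u a)) : Blocks hφ f u where
  repr _ := ⟨_, IsRepr.sum fun a _ => h a, W1.sum fun a _ => hw a⟩
  ev := Eventually.of_forall fun _ => IsRepr.sum fun a _ => h a
  block a := ⟨hw a, (h a).self_reproducing hφ (hw a)⟩

theorem BddBlocks.of_repr {f : 𝓢'(ℝ, ℂ)} {u : ℕ → ℝ → ℂ} (h : ∀ a, IsRepr (lpProj φ₀ a f) (u a))
    (hw : ∀ a, W1 (u a)) (hb : ∀ a, Bdd (u a)) : BddBlocks hφ f u where
  toBlocks := Blocks.of_repr h hw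
  bdd := hb
  bdd_repr _ := ⟨_, IsRepr.sum fun a _ => h a, W1.sum fun a _ => hw a, Bdd.sum fun a _ => hb a⟩

variable (hφ) in
theorem IsRepr.lpLT {f : 𝓢'(ℝ, ℂ)} {F : ℝ → ℂ} (h : IsRepr f F) (hw : W1 F) (N : ℕ) :
    IsRepr (lpLT φ₀ N f)
      (fun x => ∑ k ∈ Finset.range N, cvC (𝓕⁻ (symS hφ k) : 𝓢(ℝ, ℂ)) F x) :=
  IsRepr.sum fun k _ => h.lpProj hφ hw k

/-- For a truncated distribution `S_{<N} f` need not be a partial sum of the blocks when `N` is near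
the truncation, because neighbouring projections overlap. Therefore `ev` holds only for large `N`,
and for the other `N` mere representability is provided. -/
theorem Blocks.of_finite {f : 𝓢'(ℝ, ℂ)} {u : ℕ → ℝ → ℂ} {n : ℕ}
    (h : IsRepr f (fun x => ∑ a ∈ Finset.range n, u a x)) (hu : ∀ a, IsBlock hφ a (u a))
    (h0 : ∀ a, n ≤ a → ∀ x, u a x = 0) (hf : ∀ᶠ N in atTop, BilinearKdV.lpLT φ₀ N f = f) :
    Blocks hφ f u where
  repr N := ⟨_, h.lpLT hφ (W1.sum fun a _ => (hu a).w1) N,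
    W1.sum fun _ _ => (W1.sum fun a _ => (hu a).w1).convolution _⟩
  ev := by
    filter_upwards [hf, eventually_ge_atTop n] with N h1 h2
    rw [h1]
    convert h using 2 with x
    refine (Finset.sum_subset (Finset.range_mono h2) fun a _ ha => h0 a ?_ x).symm
    simpa using ha
  block := hu

theorem BddBlocks.of_finite {f : 𝓢'(ℝ, ℂ)} {u : ℕ → ℝ → ℂ} {n : ℕ}
    (h : IsRepr f (fun x => ∑ a ∈ Finset.range n, u a x)) (hu : ∀ a, IsBlock hφ a (u a))
    (hb : ∀ a, Bdd (u a))
    (h0 : ∀ a, n ≤ a → ∀ x, u a x = 0) (hf : ∀ᶠ N in atTop, BilinearKdV.lpLT φ₀ N f = f) :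
    BddBlocks hφ f u where
  toBlocks := Blocks.of_finite h hu h0 hf
  bdd := hb
  bdd_repr N := ⟨_, h.lpLT hφ (W1.sum fun a _ => (hu a).w1) N,
    W1.sum fun _ _ => (W1.sum fun a _ => (hu a).w1).convolution _,
    Bdd.sum fun _ _ => (Bdd.sum fun a _ => hb a).convolution _⟩

theorem lpLT_sub (N : ℕ) (f g : 𝓢'(ℝ, ℂ)) : lpLT φ₀ N (f - g) = lpLT φ₀ N f - lpLT φ₀ N g := by
  simp [lpLT, Finset.sum_sub_distrib]

theorem lpLT_add (N : ℕ) (f g : 𝓢'(ℝ, ℂ)) : lpLT φ₀ N (f + g) = lpLT φ₀ N f + lpLT φ₀ N g := by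
  simp [lpLT, Finset.sum_add_distrib]

theorem BddBlocks.lpLT {f : 𝓢'(ℝ, ℂ)} {u : ℕ → ℝ → ℂ} (h : ∀ a, IsRepr (lpProj φ₀ a f) (u a))
    (hw : ∀ a, W1 (u a)) (hb : ∀ a, Bdd (u a)) (n : ℕ) :
    BddBlocks hφ (lpLT φ₀ n f) (fun a x => if a < n then u a x else 0) := by
  refine BddBlocks.of_finite (n := n) ?_ (fun a => ?_) (fun a => ?_)
    (fun a ha x => if_neg (not_lt.2 ha)) ?_
  · have : IsRepr (BilinearKdV.lpLT φ₀ n f) _ := IsRepr.sum fun a _ => h a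
    convert this using 2 with x
    exact Finset.sum_congr rfl fun a ha => if_pos (Finset.mem_range.1 ha)
  · by_cases ha : a < n
    · simpa only [ha, if_true] using
        (⟨hw a, (h a).self_reproducing hφ (hw a)⟩ : IsBlock hφ a (u a))
    · simpa only [ha, if_false] using IsBlock.zero hφ a
  · by_cases ha : a < n
    · simpa only [ha, if_true] using hb a
    · simpa only [ha, if_false] using Bdd.zero
  · filter_upwards [eventually_ge_atTop (n + 1)] with N hN using lpLT_lpLT hφ hN f

theorem BddBlocks.lpGE {f : 𝓢'(ℝ, ℂ)} {u : ℕ → ℝ → ℂ} (h : ∀ a, IsRepr (lpProj φ₀ a f) (u a))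
    (hw : ∀ a, W1 (u a)) (hb : ∀ a, Bdd (u a)) (n : ℕ) :
    BddBlocks hφ (lpGE φ₀ n f) (fun a x => if n ≤ a then u a x else 0) := by
  have h1 := BddBlocks.of_repr (hφ := hφ) h hw hb
  have h2 := BddBlocks.lpLT (hφ := hφ) h hw hb n
  have h3 : ∀ N, ∃ F, IsRepr (BilinearKdV.lpLT φ₀ N (BilinearKdV.lpGE φ₀ n f)) F ∧ W1 F ∧ Bdd F :=
    fun N => by
      obtain ⟨F, hF, hF', hF''⟩ := h1.bdd_repr N
      obtain ⟨G, hG, hG', hG''⟩ := h2.bdd_repr N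
      rw [BilinearKdV.lpGE, lpLT_sub, sub_eq_add_neg]
      exact ⟨_, hF.add hG.neg, hF'.add hG'.neg, hF''.add hG''.neg⟩
  refine { repr := fun N => ?_, ev := ?_, block := fun a => ?_, bdd := fun a => ?_, bdd_repr := h3 }
  · obtain ⟨F, hF, hF', -⟩ := h3 N
    exact ⟨F, hF, hF'⟩
  · filter_upwards [h1.ev, h2.ev] with N h4 h5
    rw [BilinearKdV.lpGE, lpLT_sub]
    convert h4.sub h5 using 2 with x
    rw [← Finset.sum_sub_distrib]
    refine Finset.sum_congr rfl fun a _ => ?_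
    by_cases ha : a < n
    · simp [ha, not_le.2 ha]
    · simp [ha, not_lt.1 ha]
  · by_cases ha : n ≤ a
    · simpa only [ha, if_true] using h1.block a
    · simpa only [ha, if_false] using IsBlock.zero hφ a
  · by_cases ha : n ≤ a
    · simpa only [ha, if_true] using hb a
    · simpa only [ha, if_false] using Bdd.zero

theorem Blocks.lpProj {f : 𝓢'(ℝ, ℂ)} {j : ℕ} {v : ℝ → ℂ} (h : IsRepr (lpProj φ₀ j f) v)
    (hw : W1 v) : Blocks hφ (lpProj φ₀ j f) (fun a x => if a = j then v x else 0) := by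
  refine Blocks.of_finite (n := j + 1) ?_ (fun a => ?_) (fun a ha x => if_neg (by omega)) ?_
  · convert h using 2 with x
    simp
  · by_cases ha : a = j
    · subst ha
      simpa only [if_true] using (⟨hw, h.self_reproducing hφ hw⟩ : IsBlock hφ a v)
    · simpa only [ha, if_false] using IsBlock.zero hφ a
  · filter_upwards [eventually_ge_atTop (j + 2)] with N hN using lpLT_lpProj hφ hN f

/-! ### The product at a fixed time -/

omit hφ in
theorem tendsto_range_prod_range :
    Tendsto (fun N : ℕ => Finset.range N ×ˢ Finset.range N) atTop atTop := by
  refine Monotone.tendsto_atTop_finset (fun m n h => Finset.product_subset_product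
    (Finset.range_mono h) (Finset.range_mono h)) fun p => ⟨p.1 + p.2 + 1, ?_⟩
  simp only [Finset.mem_product, Finset.mem_range]
  omega

/-- For large `N` the product `S_{<N} f · S_{<N} g` is the partial sum over the square `a, b < N` of
the double series. The series converges unconditionally, and the squares exhaust all pairs. -/
theorem BddBlocks.isProduct {f g w : 𝓢'(ℝ, ℂ)} {u v : ℕ → ℝ → ℂ} (hf : BddBlocks hφ f u)
    (hg : Blocks hφ g v)
    (h : ∀ ψ : 𝓢(ℝ, ℂ), HasSum (fun p : ℕ × ℕ => ∫ x, u p.1 x * v p.2 x * ψ x) (w ψ)) :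
    IsProduct φ₀ f g w := by
  choose F hF hF' hF'' using hf.bdd_repr
  choose G hG hG' using hg.repr
  refine ⟨F, G, hF, hG, fun ψ => ⟨fun N => ?_, ?_⟩⟩
  · obtain ⟨C, hC⟩ := hF'' N
    exact ((hG' N).bdd_mul (hF' N).meas hC).integrable_mul ψ
  · refine ((h ψ).comp tendsto_range_prod_range).congr' ?_
    filter_upwards [hf.ev, hg.ev] with N h1 h2
    have hi : ∀ p : ℕ × ℕ, Integrable (fun x => u p.1 x * v p.2 x * ψ x) := fun p => by
      obtain ⟨C, hC⟩ := hf.bdd p.1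
      exact ((hg.block p.2).w1.bdd_mul (hf.block p.1).w1.meas hC).integrable_mul ψ
    simp only [Function.comp]
    rw [← integral_finsetSum _ fun p _ => hi p]
    refine integral_congr_ae ?_
    filter_upwards [(hF N).ae_eq h1, (hG N).ae_eq h2] with x e1 e2
    rw [e1, e2, Finset.sum_mul_sum, Finset.sum_product, Finset.sum_mul]
    refine Finset.sum_congr rfl fun a _ => ?_
    rw [Finset.sum_mul]

instance (k : ℕ) : DecidablePred (Contrib k) := fun p => by unfold Contrib; infer_instance

/-- The interactions of `u` and `v` to the frequency `2 ^ k`. -/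
noncomputable def interaction (k : ℕ) (u v : ℕ → ℝ → ℂ) (x : ℝ) : ℂ :=
  ∑' p : ℕ × ℕ, if Contrib k p then u p.1 x * v p.2 x else 0

theorem aestronglyMeasurable_ite {q : Prop} [Decidable q] {u v : ℝ → ℂ}
    (hu : AEStronglyMeasurable u volume)
    (hv : AEStronglyMeasurable v volume) :
    AEStronglyMeasurable (fun x => if q then u x * v x else 0) volume := by
  by_cases h : q
  · simp only [h, if_true]
    exact hu.mul hv
  · simpa only [h, if_false] using aestronglyMeasurable_const

theorem W1.interaction {k : ℕ} {u v : ℕ → ℝ → ℂ} (hu : ∀ a, W1 (u a)) (hv : ∀ a, W1 (v a))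
    (h : ∑' p : ℕ × ℕ, (if Contrib k p then ∫⁻ x, ‖u p.1 x‖ₑ * ‖v p.2 x‖ₑ * kap 0 x else 0) ≠ ⊤) :
    W1 (interaction k u v) := by
  have hm : ∀ p : ℕ × ℕ, AEStronglyMeasurable
      (fun x => if Contrib k p then u p.1 x * v p.2 x else 0) volume :=
    fun p => aestronglyMeasurable_ite (hu _).meas (hv _).meas
  refine ⟨AEStronglyMeasurable.tsum hm, ne_top_of_le_ne_top h ?_⟩
  calc ∫⁻ x, ‖BilinearKdV.interaction k u v x‖ₑ * kap 0 x
      ≤ ∫⁻ x, ∑' p : ℕ × ℕ, ‖if Contrib k p then u p.1 x * v p.2 x else 0‖ₑ * kap 0 x := by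
        refine lintegral_mono fun x => ?_
        rw [ENNReal.tsum_mul_right]
        gcongr
        exact enorm_tsum_le_tsum_enorm
    _ = ∑' p : ℕ × ℕ, ∫⁻ x, ‖if Contrib k p then u p.1 x * v p.2 x else 0‖ₑ * kap 0 x :=
        lintegral_tsum fun p => (hm p).enorm.mul (measurable_kap 0).aemeasurable
    _ ≤ _ := by
        refine ENNReal.tsum_le_tsum fun p => ?_
        by_cases hp : Contrib k p
        · simp [hp, enorm_mul]
        · simp [hp]

/-- Testing `S_k w` with `ψ` means testing the double series with a function whose inverse Fourier
transform carries the symbol of `S_k`; noncontributing pairs then integrate to zero. Over the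
remaining pairs the sum and the integral may be exchanged by `hfin`. -/
theorem BddBlocks.isRepr_lpProj {f g w : 𝓢'(ℝ, ℂ)} {u v : ℕ → ℝ → ℂ} (hf : BddBlocks hφ f u)
    (hg : Blocks hφ g v)
    (h : ∀ ψ : 𝓢(ℝ, ℂ), HasSum (fun p : ℕ × ℕ => ∫ x, u p.1 x * v p.2 x * ψ x) (w ψ)) (k : ℕ)
    (hfin : ∑' p : ℕ × ℕ,
      (if Contrib k p then ∫⁻ x, ‖u p.1 x‖ₑ * ‖v p.2 x‖ₑ * kap 0 x else 0) ≠ ⊤) :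
    IsRepr (BilinearKdV.lpProj φ₀ k w)
      (cvC (𝓕⁻ (symS hφ k) : 𝓢(ℝ, ℂ)) (interaction k u v)) := by
  have hW : W1 (interaction k u v) :=
    W1.interaction (fun a => (hf.block a).w1) (fun a => (hg.block a).w1) hfin
  intro ψ
  refine ⟨hW.integrable_cvC_mul _ ψ, ?_⟩
  rw [← hW.integral_multiplier, BilinearKdV.lpProj,
    TemperedDistribution.fourierMultiplierCLM_apply_apply, ← coe_symS hφ]
  set η : 𝓢(ℝ, ℂ) := 𝓕 (SchwartzMap.smulLeftCLM ℂ (symS hφ k) (𝓕⁻ ψ : 𝓢(ℝ, ℂ))) with hη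
  rw [← (h η).tsum_eq]
  have e1 : ∀ p : ℕ × ℕ, ∫ x, u p.1 x * v p.2 x * η x =
      ∫ x, (if Contrib k p then u p.1 x * v p.2 x else 0) * η x := fun p => by
    by_cases hp : Contrib k p
    · simp only [hp, if_true]
    · simp only [hp, if_false, zero_mul, integral_zero]
      exact (hf.block p.1).integral_eq_zero (hf.bdd p.1) (hg.block p.2) hp _
  obtain ⟨C, hC⟩ := schwartz_enorm_le η
  have hm : ∀ p : ℕ × ℕ, AEStronglyMeasurable
      (fun x => if Contrib k p then u p.1 x * v p.2 x else 0) volume :=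
    fun p => aestronglyMeasurable_ite (hf.block _).w1.meas (hg.block _).w1.meas
  have hm₂ : ∀ p : ℕ × ℕ, AEStronglyMeasurable
      (fun x => (if Contrib k p then u p.1 x * v p.2 x else 0) * η x) volume :=
    fun p => (hm p).mul η.continuous.aestronglyMeasurable
  rw [tsum_congr e1, ← integral_tsum hm₂]
  · simp_rw [interaction, tsum_mul_right]
  · refine ne_top_of_le_ne_top (ENNReal.mul_ne_top (ENNReal.coe_ne_top (r := C)) hfin) ?_
    rw [← ENNReal.tsum_mul_left]
    refine ENNReal.tsum_le_tsum fun p => ?_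
    by_cases hp : Contrib k p
    · simp only [hp, if_true]
      have hm' : AEMeasurable (fun x => ‖u p.1 x‖ₑ * ‖v p.2 x‖ₑ * kap 0 x) volume :=
        ((hf.block _).w1.meas.enorm.mul (hg.block _).w1.meas.enorm).mul
          (measurable_kap 0).aemeasurable
      rw [← lintegral_const_mul'' _ hm']
      refine lintegral_mono fun x => ?_
      rw [enorm_mul, enorm_mul, mul_left_comm]
      gcongr
      exact hC x
    · simp [hp]

end Blocks

/-! ### Sums over neighbouring frequencies -/

theorem tsum_band_le (n a : ℕ) :
    ∑' b : ℕ, (if a ≤ b + n ∧ b ≤ a + n then (1 : ℝ≥0∞) else 0) ≤ 2 * n + 1 := by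
  rw [tsum_eq_sum (s := Finset.Icc (a - n) (a + n)) fun b hb => if_neg fun h => hb (by
    rw [Finset.mem_Icc]; omega)]
  calc _ ≤ ∑ b ∈ Finset.Icc (a - n) (a + n), (1 : ℝ≥0∞) :=
        Finset.sum_le_sum fun b _ => by split_ifs <;> simp
    _ ≤ _ := by
        rw [Finset.sum_const, nsmul_one, Nat.card_Icc]
        exact_mod_cast (by omega : a + n + 1 - (a - n) ≤ 2 * n + 1)

theorem tsum_p2_neg_ne_top {δ : ℝ} (hδ : 0 < δ) : ∑' k : ℕ, p2 (-(δ * k)) ≠ ⊤ := by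
  have e : ∀ k : ℕ, p2 (-(δ * k)) = p2 (-δ) ^ k := fun k => by
    rw [p2, p2, ← ENNReal.rpow_mul_natCast]; ring_nf
  simp_rw [e]
  rw [ENNReal.tsum_geometric, ENNReal.inv_ne_top, Ne, tsub_eq_zero_iff_le, not_le]
  exact (ENNReal.rpow_lt_one_of_one_lt_of_neg (by norm_num) (by linarith))

/-- For frequencies at distance at most `4` the weights `2^(aα)` and `2^(bβ)` nearly compensate
since `α + β ≥ 0`, and Schur's test for a band matrix applies. Away from the band the decay of order
`M` beats any growth from negative `α` or `β`. -/
theorem tsum_bandWeight_ne_top {α β : ℝ} (h : 0 ≤ α + β) {M : ℕ} (hM : |α| + |β| + 2 ≤ M)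
    {x y : ℕ → ℝ≥0∞} (hx : ∑' a : ℕ, p2 (2 * a * α) * x a ^ 2 ≠ ⊤)
    (hy : ∑' b : ℕ, p2 (2 * b * β) * y b ^ 2 ≠ ⊤) :
    ∑' p : ℕ × ℕ, x p.1 * y p.2 * bandWeight M p.1 p.2 ≠ ⊤ := by
  -- A band matrix plus a matrix decaying in both indices; all row and column sums are at most `9 +
  -- S`.
  let w : ℕ → ℕ → ℝ≥0∞ := fun a b =>
    (if a ≤ b + 4 ∧ b ≤ a + 4 then 1 else 0) + p2 (-(1 * b)) * p2 (-(1 * a))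
  let X : ℕ → ℝ≥0∞ := fun a => p2 (a * α) * x a
  let Y : ℕ → ℝ≥0∞ := fun b => p2 (b * β) * y b
  have hX : ∑' a, X a ^ 2 ≠ ⊤ := by
    simpa only [X, mul_pow, p2_sq, mul_assoc] using hx
  have hY : ∑' a, Y a ^ 2 ≠ ⊤ := by
    simpa only [Y, mul_pow, p2_sq, mul_assoc] using hy
  set S := ∑' k : ℕ, p2 (-(1 * (k : ℝ)))
  have hS : S ≠ ⊤ := tsum_p2_neg_ne_top one_pos
  have hone : ∀ a : ℕ, p2 (-(1 * (a : ℝ))) ≤ 1 := fun a => by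
    rw [← p2_zero]; exact p2_mono (by simp)
  have hA : ∀ a, ∑' b, w a b ≤ 9 + S := fun a => by
    rw [ENNReal.tsum_add, ENNReal.tsum_mul_right]
    refine add_le_add ((tsum_band_le 4 a).trans (by norm_num)) ?_
    exact mul_le_of_le_one_right (zero_le) (hone a)
  have hB : ∀ b, ∑' a, w a b ≤ 9 + S := fun b => by
    simp only [w]
    rw [ENNReal.tsum_add, ENNReal.tsum_mul_left]
    refine add_le_add (le_trans ?_ ((tsum_band_le 4 b).trans (by norm_num)))
      (mul_le_of_le_one_left (zero_le) (hone b))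
    exact ENNReal.tsum_le_tsum fun a => by simp only [and_comm]; rfl
  have hmain := schur_bilin w X Y hA hB
  have hfin : ∑' a, ∑' b, w a b * (X a * Y b) ≠ ⊤ := fun htop => by
    rw [htop] at hmain
    refine ENNReal.mul_ne_top (ENNReal.mul_ne_top (ENNReal.mul_ne_top ?_ ?_) hX) hY
      (top_le_iff.1 (by simpa using hmain)) <;> finiteness
  rw [ENNReal.tsum_prod' (f := fun p : ℕ × ℕ => x p.1 * y p.2 * bandWeight M p.1 p.2)]
  refine ne_top_of_le_ne_top (ENNReal.mul_ne_top (p2_ne_top (4 * M)) hfin) ?_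
  rw [← ENNReal.tsum_mul_left]
  refine ENNReal.tsum_le_tsum fun a => ?_
  rw [← ENNReal.tsum_mul_left]
  refine ENNReal.tsum_le_tsum fun b => ?_
  dsimp only
  have e : x a * y b = p2 (-(a * α + b * β)) * (X a * Y b) := by
    simp only [X, Y]
    calc _ = (p2 (a * α) * p2 (-(a * α))) * (p2 (b * β) * p2 (-(b * β))) * (x a * y b) := by
          rw [p2_mul_neg, p2_mul_neg, one_mul, one_mul]
      _ = _ := by rw [neg_add, p2_add]; ring
  rw [e]
  suffices h' : p2 (-(a * α + b * β)) * bandWeight M a b ≤ p2 (4 * M) * w a b by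
    calc _ = p2 (-(a * α + b * β)) * bandWeight M a b * (X a * Y b) := by ring
      _ ≤ p2 (4 * M) * w a b * (X a * Y b) := by gcongr
      _ = _ := by ring
  have ha := neg_abs_le α
  have hb := neg_abs_le β
  have hb' := le_abs_self β
  have ha0 : (0 : ℝ) ≤ a := Nat.cast_nonneg a
  have hb0 : (0 : ℝ) ≤ b := Nat.cast_nonneg b
  by_cases hab : a ≤ b + 4 ∧ b ≤ a + 4
  · simp only [bandWeight, w, if_pos hab, mul_one]
    refine le_trans ?_ (mul_le_mul_right (le_self_add (a := (1 : ℝ≥0∞))) _)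
    rw [mul_one]
    refine p2_mono ?_
    have h1 : (a : ℝ) ≤ b + 4 := by exact_mod_cast hab.1
    have h2 : (b : ℝ) ≤ a + 4 := by exact_mod_cast hab.2
    have : -(a * α + b * β) = -(a * (α + β)) + (a - b) * β := by ring
    rw [this]
    have h3 : (a - b) * β ≤ 4 * |β| := by
      have h4 : |(a : ℝ) - b| ≤ 4 := abs_le.2 ⟨by linarith, by linarith⟩
      calc _ ≤ |((a : ℝ) - b) * β| := le_abs_self _
        _ = |(a : ℝ) - b| * |β| := abs_mul _ _
        _ ≤ _ := by gcongr
    nlinarith [abs_nonneg α, mul_nonneg ha0 h]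
  -- With `m = max a b`, the weights lose at most `2^(m(|α| + |β|))`, and the condition on `M`
  -- leaves `2^(-2m) ≤ 2^(-a) 2^(-b)`. The factor `2^(4M)` comes from the shift by `4` in
  -- `bandWeight`.
  · simp only [bandWeight, w, if_neg hab, zero_add]
    rw [← p2_add, ← p2_add, ← p2_add]
    refine p2_mono ?_
    have hm1 : (a : ℝ) ≤ (max a b : ℕ) := by exact_mod_cast le_max_left a b
    have hm2 : (b : ℝ) ≤ (max a b : ℕ) := by exact_mod_cast le_max_right a b
    set m : ℝ := ((max a b : ℕ) : ℝ)
    have hm0 : 0 ≤ m := ha0.trans hm1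
    have h1 : -(a * α) ≤ m * |α| := by nlinarith [abs_nonneg α]
    have h2 : -(b * β) ≤ m * |β| := by nlinarith [abs_nonneg β]
    nlinarith [mul_le_mul_of_nonneg_left hM hm0]

/-! ### Data for a product -/

section ProdData

variable {φ₀ : ℝ → ℝ} (hφ : IsCutoff φ₀)

/-- The distributions `f`, `g` with blocks `u`, `v` have a product which can be computed from the
interactions of the blocks. -/
structure ProdData (f g : 𝓢'(ℝ, ℂ)) (u v : ℕ → ℝ → ℂ) : Prop where
  bu : BddBlocks hφ f u
  bv : Blocks hφ g v
  dist : ∃ w : 𝓢'(ℝ, ℂ), ∀ ψ : 𝓢(ℝ, ℂ),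
    HasSum (fun p : ℕ × ℕ => ∫ x, u p.1 x * v p.2 x * ψ x) (w ψ)
  fin : ∀ k, ∑' p : ℕ × ℕ,
    (if Contrib k p then ∫⁻ x, ‖u p.1 x‖ₑ * ‖v p.2 x‖ₑ * kap 0 x else 0) ≠ ⊤

variable {hφ}

/-- For separated contributing frequencies the larger index is at most `k + 3`, so the weight is
bounded below in terms of `k`. Hence summability with `bandWeight` implies summability of the
contributing terms for each fixed `k`. -/
theorem one_le_bandWeight {k : ℕ} {p : ℕ × ℕ} (h : Contrib k p) (M : ℕ) :
    1 ≤ p2 (M * k) * bandWeight M p.1 p.2 := by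
  by_cases hp : p.1 ≤ p.2 + 4 ∧ p.2 ≤ p.1 + 4
  · rw [bandWeight, if_pos hp, mul_one]
    exact one_le_p2 (by positivity)
  · rw [bandWeight, if_neg hp, ← p2_add]
    refine one_le_p2 ?_
    have h1 : max p.1 p.2 ≤ k + 3 := by unfold Contrib at h; omega
    have h2 : ((max p.1 p.2 : ℕ) : ℝ) ≤ k + 3 := by exact_mod_cast h1
    have h3 : (0 : ℝ) ≤ M := Nat.cast_nonneg M
    nlinarith

theorem ProdData.of_nL2 {f g : 𝓢'(ℝ, ℂ)} {u v : ℕ → ℝ → ℂ} (hf : BddBlocks hφ f u)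
    (hg : BddBlocks hφ g v) {α β : ℝ} (h : 0 ≤ α + β)
    (hx : ∑' a : ℕ, p2 (2 * a * α) * nL2 (u a) ^ 2 ≠ ⊤)
    (hy : ∑' b : ℕ, p2 (2 * b * β) * nL2 (v b) ^ 2 ≠ ⊤) : ProdData hφ f g u v := by
  obtain ⟨M, hM⟩ := exists_nat_ge (|α| + |β| + 2)
  have hS := tsum_bandWeight_ne_top h hM hx hy
  refine ⟨hf, hg.toBlocks, ?_, fun k => ?_⟩
  · refine exists_dist_of_fourier_bound (fun p : ℕ × ℕ => fun x => u p.1 x * v p.2 x) (fun p => ?_)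
      (∑' p : ℕ × ℕ, nL2 (u p.1) * nL2 (v p.2) * bandWeight M p.1 p.2).toNNReal M fun η => ?_
    · obtain ⟨C, hC⟩ := hf.bdd p.1
      exact (hg.block p.2).w1.bdd_mul (hf.block p.1).w1.meas hC
    · rw [ENNReal.coe_toNNReal hS, ← ENNReal.tsum_mul_right]
      refine ENNReal.tsum_le_tsum fun p => ?_
      rw [mul_assoc]
      exact (hf.block p.1).enorm_integral_le (hf.bdd p.1) (hg.block p.2) (hg.bdd p.2) M η
  · refine ne_top_of_le_ne_top (ENNReal.mul_ne_top (p2_ne_top (M * k)) hS) ?_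
    rw [← ENNReal.tsum_mul_left]
    refine ENNReal.tsum_le_tsum fun p => ?_
    split_ifs with hp
    · calc _ ≤ ∫⁻ x, ‖u p.1 x‖ₑ * ‖v p.2 x‖ₑ := lintegral_mono fun x =>
            mul_le_of_le_one_right (zero_le) ((kap_le 0 x).trans (by simp [p2_zero]))
        _ ≤ nL2 (u p.1) * nL2 (v p.2) :=
            lintegral_mul_le_nL2 (hf.block _).w1.meas (hg.block _).w1.meas
        _ ≤ nL2 (u p.1) * nL2 (v p.2) * (p2 (M * k) * bandWeight M p.1 p.2) :=
            le_mul_of_one_le_right (zero_le) (one_le_bandWeight hp M)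
        _ = _ := by ring
    · exact zero_le

/-- Only finitely many pairs are nonzero, so no summability in the frequencies is required. In
particular the block of `g` need not lie in `L²`, as is the case when it is only controlled in `Y`.
-/
theorem ProdData.of_finite {f g : 𝓢'(ℝ, ℂ)} {u v : ℕ → ℝ → ℂ} (hf : BddBlocks hφ f u)
    (hg : Blocks hφ g v) {n m : ℕ} (hu : ∀ a, n ≤ a → ∀ x, u a x = 0)
    (hv : ∀ b, m ≤ b → ∀ x, v b x = 0) : ProdData hφ f g u v := by
  have hW : ∀ p : ℕ × ℕ, W1 (fun x => u p.1 x * v p.2 x) := fun p => by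
    obtain ⟨C, hC⟩ := hf.bdd p.1
    exact (hg.block p.2).w1.bdd_mul (hf.block p.1).w1.meas hC
  have hS : ∑' p : ℕ × ℕ, ∫⁻ x, ‖u p.1 x * v p.2 x‖ₑ * kap 0 x ≠ ⊤ := by
    rw [tsum_eq_sum (s := Finset.range n ×ˢ Finset.range m) fun p hp => ?_]
    · exact ENNReal.sum_ne_top.2 fun p _ => (hW p).fin
    · rw [Finset.mem_product, Finset.mem_range, Finset.mem_range] at hp
      by_cases h1 : n ≤ p.1
      · simp [hu p.1 h1]
      · simp [hv p.2 (by omega)]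
  refine ⟨hf, hg, exists_dist_of_lintegral (fun p : ℕ × ℕ => fun x => u p.1 x * v p.2 x) hW hS,
    fun k => ne_top_of_le_ne_top hS (ENNReal.tsum_le_tsum fun p => ?_)⟩
  split_ifs
  · simp_rw [enorm_mul]; rfl
  · exact zero_le

/-! ### The product on `[0,1] × ℝ` -/

theorem exists_productST {C : NNReal} (hC : ∀ k x, ‖(𝓕⁻ (symS hφ k) : 𝓢(ℝ, ℂ)) x‖ₑ ≤ C * kap k x)
    {f g : ℝ → 𝓢'(ℝ, ℂ)} {U V : ℕ → ℝ × ℝ → ℂ}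
    (hU : ∀ a, Measurable (U a)) (hV : ∀ b, Measurable (V b))
    (h : ∀ᵐ t ∂timeMeasure,
      ProdData hφ (f t) (g t) (fun a x => U a (t, x)) (fun b x => V b (t, x))) :
    ∃ (w : ℝ → 𝓢'(ℝ, ℂ)) (W : ℕ → ℝ × ℝ → ℂ), IsProductST φ₀ f g w ∧ (∀ k, Measurable (W k)) ∧
      (∀ k, IsReprST (fun t => lpProj φ₀ k (w t)) (W k)) ∧
      (∀ k, ∀ᵐ t ∂timeMeasure, W1 (fun x => W k (t, x))) ∧
      ∀ k p, ‖W k p‖ₑ ≤ C * ∑' q : ℕ × ℕ,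
        if Contrib k q then cv (kap k) (fun p => ‖U q.1 p‖ₑ * ‖V q.2 p‖ₑ) p else 0 := by
  -- The distribution is chosen separately for each `t`, with `0` on the exceptional null set. No
  -- measurability in `t` is lost: the representatives `W k` of the projections are given by an
  -- explicit jointly measurable formula.
  have hw : ∀ t, ∃ w : 𝓢'(ℝ, ℂ),
      ProdData hφ (f t) (g t) (fun a x => U a (t, x)) (fun b x => V b (t, x)) →
      ∀ ψ : 𝓢(ℝ, ℂ), HasSum (fun p : ℕ × ℕ => ∫ x, U p.1 (t, x) * V p.2 (t, x) * ψ x) (w ψ) :=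
    fun t => by
      by_cases ht : ProdData hφ (f t) (g t) (fun a x => U a (t, x)) (fun b x => V b (t, x))
      · obtain ⟨w, hw⟩ := ht.dist
        exact ⟨w, fun _ => hw⟩
      · exact ⟨0, fun h => absurd h ht⟩
  choose w hw using hw
  let W : ℕ → ℝ × ℝ → ℂ := fun k p => cvC (𝓕⁻ (symS hφ k) : 𝓢(ℝ, ℂ))
    (interaction k (fun a x => U a (p.1, x)) (fun b x => V b (p.1, x))) p.2
  have hWm : ∀ k, Measurable (W k) := fun k => by
    have h1 : Measurable fun q : (ℝ × ℝ) × ℝ =>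
        interaction k (fun a x => U a (q.1.1, x)) (fun b x => V b (q.1.1, x)) q.2 := by
      refine Measurable.tsum fun p => ?_
      have hu : Measurable fun q : (ℝ × ℝ) × ℝ => U p.1 (q.1.1, q.2) :=
        (hU p.1).comp (by fun_prop)
      have hv : Measurable fun q : (ℝ × ℝ) × ℝ => V p.2 (q.1.1, q.2) :=
        (hV p.2).comp (by fun_prop)
      split_ifs
      · exact hu.mul hv
      · exact measurable_const
    have h2 : Measurable fun q : (ℝ × ℝ) × ℝ => (𝓕⁻ (symS hφ k) : 𝓢(ℝ, ℂ)) (q.1.2 - q.2) :=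
      (𝓕⁻ (symS hφ k) : 𝓢(ℝ, ℂ)).continuous.measurable.comp (by fun_prop)
    exact (StronglyMeasurable.integral_prod_right (f := fun (p : ℝ × ℝ) (y : ℝ) =>
      (𝓕⁻ (symS hφ k) : 𝓢(ℝ, ℂ)) (p.2 - y) *
      interaction k (fun a x => U a (p.1, x)) (fun b x => V b (p.1, x)) y) (ν := volume)
      (h2.mul h1).stronglyMeasurable).measurable
  refine ⟨w, W, ?_, hWm, fun k => ⟨(hWm k).aestronglyMeasurable, ?_⟩, fun k => ?_, fun k p => ?_⟩
  · exact h.mono fun t ht => ht.bu.isProduct ht.bv (hw t ht)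
  · exact h.mono fun t ht => ht.bu.isRepr_lpProj ht.bv (hw t ht) k (ht.fin k)
  · exact h.mono fun t ht => (W1.interaction (fun a => (ht.bu.block a).w1)
      (fun a => (ht.bv.block a).w1) (ht.fin k)).convolution _
  · refine (enorm_cvC_le _ _ _).trans ?_
    have hm : ∀ q : ℕ × ℕ, Measurable fun y =>
        kap k (p.2 - y) * (‖U q.1 (p.1, y)‖ₑ * ‖V q.2 (p.1, y)‖ₑ) := fun q => by
      have hu : Measurable fun y => U q.1 (p.1, y) := (hU q.1).comp (by fun_prop)
      have hv : Measurable fun y => V q.2 (p.1, y) := (hV q.2).comp (by fun_prop)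
      exact ((measurable_kap k).comp (by fun_prop)).mul (hu.enorm.mul hv.enorm)
    calc _ ≤ ∫⁻ y, C * ∑' q : ℕ × ℕ, (if Contrib k q then
          kap k (p.2 - y) * (‖U q.1 (p.1, y)‖ₑ * ‖V q.2 (p.1, y)‖ₑ) else 0) := by
          refine lintegral_mono fun y => ?_
          calc _ ≤ C * kap k (p.2 - y) * ∑' q : ℕ × ℕ,
                ‖if Contrib k q then U q.1 (p.1, y) * V q.2 (p.1, y) else 0‖ₑ :=
                mul_le_mul' (hC k _) enorm_tsum_le_tsum_enorm
            _ = _ := by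
                rw [mul_assoc, ← ENNReal.tsum_mul_left]
                congr 2
                funext q
                split_ifs <;> simp [enorm_mul]
      _ = C * ∑' q : ℕ × ℕ, ∫⁻ y, (if Contrib k q then
          kap k (p.2 - y) * (‖U q.1 (p.1, y)‖ₑ * ‖V q.2 (p.1, y)‖ₑ) else 0) := by
          rw [lintegral_const_mul' _ _ (by simp), lintegral_tsum]
          intro q
          split_ifs
          · exact (hm q).aemeasurable
          · exact aemeasurable_const
      _ ≤ _ := by
          gcongr with q
          split_ifs
          · exact le_rfl
          · simp

end ProdData

/-! ### Summation of the interactions -/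

/-- The gain in the interaction `Contrib k q`: it is in the lowest of the three frequencies. -/
noncomputable def gain (δ : ℝ) (k : ℕ) (q : ℕ × ℕ) : ℝ≥0∞ :=
  if q.2 + 5 ≤ q.1 then p2 (-(δ * q.2)) else if q.1 + 5 ≤ q.2 then p2 (-(δ * q.1))
    else p2 (-(δ * k))

theorem tsum_band_mul_sq_le (n : ℕ) (X : ℕ → ℝ≥0∞) :
    ∑' k : ℕ, (∑' a : ℕ, (if k ≤ a + n ∧ a ≤ k + n then (1 : ℝ≥0∞) else 0) * X a) ^ 2 ≤
      (2 * n + 1) * (2 * n + 1) * ∑' a, X a ^ 2 := by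
  refine schur_sq _ X (fun k => tsum_band_le n k) fun a => ?_
  refine le_trans (ENNReal.tsum_le_tsum fun k => ?_) (tsum_band_le n a)
  simp only [and_comm]; rfl

theorem sq_tsum_p2_mul_le {δ : ℝ} (hδ : 0 < δ) (Y : ℕ → ℝ≥0∞) :
    (∑' b : ℕ, p2 (-(δ * b)) * Y b) ^ 2 ≤ (∑' b : ℕ, p2 (-(δ * b))) * ∑' b, Y b ^ 2 := by
  refine (tsum_weight_mul_sq_le _ _).trans ?_
  gcongr with b
  refine mul_le_of_le_one_left (zero_le) ?_
  rw [← p2_zero]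
  exact p2_mono (neg_nonpos.2 (by positivity))

theorem tsum_highLow_sq_le {δ : ℝ} (hδ : 0 < δ) (X Y : ℕ → ℝ≥0∞) :
    ∑' k : ℕ, ((∑' a : ℕ, (if k ≤ a + 3 ∧ a ≤ k + 3 then (1 : ℝ≥0∞) else 0) * X a) *
      ∑' b : ℕ, p2 (-(δ * b)) * Y b) ^ 2 ≤
      49 * (∑' b : ℕ, p2 (-(δ * b))) * ((∑' a, X a ^ 2) * ∑' b, Y b ^ 2) := by
  simp_rw [mul_pow]
  rw [ENNReal.tsum_mul_right]
  calc _ ≤ ((2 * (3 : ℕ) + 1) * (2 * (3 : ℕ) + 1) * ∑' a, X a ^ 2) *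
        ((∑' b : ℕ, p2 (-(δ * b))) * ∑' b, Y b ^ 2) :=
        mul_le_mul' (tsum_band_mul_sq_le 3 X) (sq_tsum_p2_mul_le hδ Y)
    _ = _ := by
        have : (2 * ((3 : ℕ) : ℝ≥0∞) + 1) * (2 * ((3 : ℕ) : ℝ≥0∞) + 1) = 49 := by norm_num
        rw [this]; ring

/-- In the high-low cases the sum over the low index converges by the gain, and the high index stays
within `3` of `k`, so the squares sum. In the high-high case the sum over all comparable pairs is
bounded by the `ℓ²` norms, and the gain `2^(-δk)` sums over `k`. -/
theorem tsum_interaction_sq_le {δ : ℝ} (hδ : 0 < δ) (X Y : ℕ → ℝ≥0∞) :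
    ∑' k : ℕ, (∑' q : ℕ × ℕ, if Contrib k q then gain δ k q * (X q.1 * Y q.2) else 0) ^ 2 ≤
      618 * (∑' b : ℕ, p2 (-(δ * b))) * ((∑' a, X a ^ 2) * ∑' b, Y b ^ 2) := by
  set S := ∑' b : ℕ, p2 (-(δ * b)) with hS
  let A : ℕ → ℝ≥0∞ := fun k =>
    (∑' a : ℕ, (if k ≤ a + 3 ∧ a ≤ k + 3 then (1 : ℝ≥0∞) else 0) * X a) *
      ∑' b : ℕ, p2 (-(δ * b)) * Y b
  let B : ℕ → ℝ≥0∞ := fun k =>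
    (∑' a : ℕ, (if k ≤ a + 3 ∧ a ≤ k + 3 then (1 : ℝ≥0∞) else 0) * Y a) *
      ∑' b : ℕ, p2 (-(δ * b)) * X b
  let T := ∑' a : ℕ, ∑' b : ℕ, (if a ≤ b + 4 ∧ b ≤ a + 4 then (1 : ℝ≥0∞) else 0) * (X a * Y b)
  have hsplit : ∀ k, (∑' q : ℕ × ℕ, if Contrib k q then gain δ k q * (X q.1 * Y q.2) else 0) ≤
      A k + (B k + p2 (-(δ * k)) * T) := fun k => by
    rw [ENNReal.tsum_prod'
      (f := fun q : ℕ × ℕ => if Contrib k q then gain δ k q * (X q.1 * Y q.2) else 0)]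
    have eA : A k = ∑' a : ℕ, ∑' b : ℕ,
        ((if k ≤ a + 3 ∧ a ≤ k + 3 then (1 : ℝ≥0∞) else 0) * X a) * (p2 (-(δ * b)) * Y b) := by
      simp only [A]
      simp_rw [ENNReal.tsum_mul_left, ENNReal.tsum_mul_right]
    have eB : B k = ∑' a : ℕ, ∑' b : ℕ,
        ((if k ≤ b + 3 ∧ b ≤ k + 3 then (1 : ℝ≥0∞) else 0) * Y b) * (p2 (-(δ * a)) * X a) := by
      simp only [B]
      simp_rw [ENNReal.tsum_mul_right]
      rw [ENNReal.tsum_mul_left]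
    have eT : p2 (-(δ * k)) * T = ∑' a : ℕ, ∑' b : ℕ, p2 (-(δ * k)) *
        ((if a ≤ b + 4 ∧ b ≤ a + 4 then (1 : ℝ≥0∞) else 0) * (X a * Y b)) := by
      simp only [T]
      simp_rw [ENNReal.tsum_mul_left]
    rw [eA, eB, eT, ← ENNReal.tsum_add, ← ENNReal.tsum_add]
    refine ENNReal.tsum_le_tsum fun a => ?_
    rw [← ENNReal.tsum_add, ← ENNReal.tsum_add]
    refine ENNReal.tsum_le_tsum fun b => ?_
    dsimp only
    by_cases hc : Contrib k (a, b)
    · rw [if_pos hc]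
      unfold Contrib at hc
      dsimp only at hc
      unfold gain
      by_cases h1 : b + 5 ≤ a
      · rw [if_pos h1, if_pos (by omega)]
        refine le_trans (le_of_eq ?_) le_self_add
        ring
      · by_cases h2 : a + 5 ≤ b
        · rw [if_neg h1, if_pos h2]
          refine le_trans (le_trans (le_of_eq ?_) le_self_add) le_add_self
          rw [if_pos (by omega)]
          ring
        · rw [if_neg h1, if_neg h2]
          refine le_trans (le_trans (le_of_eq ?_) le_add_self) le_add_self
          rw [if_pos (by omega), one_mul]
    · rw [if_neg hc]
      exact zero_le
  have hT : T ^ 2 ≤ 81 * ((∑' a, X a ^ 2) * ∑' b, Y b ^ 2) := by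
    refine (schur_bilin _ X Y (fun a => tsum_band_le 4 a) fun b =>
      le_trans (ENNReal.tsum_le_tsum fun a => ?_) (tsum_band_le 4 b)).trans (le_of_eq ?_)
    · simp only [and_comm]; rfl
    · have : (2 * ((4 : ℕ) : ℝ≥0∞) + 1) * (2 * ((4 : ℕ) : ℝ≥0∞) + 1) = 81 := by norm_num
      rw [this, mul_assoc]
  have hp : ∀ k : ℕ, p2 (-(δ * k)) ^ 2 ≤ p2 (-(δ * k)) := fun k => by
    rw [p2_sq]
    refine p2_mono ?_
    have : 0 ≤ δ * k := by positivity
    linarith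
  -- The constant `618` is `2 · 49 + 4 · 49 + 4 · 81`: the factors `2, 4, 4` come from squaring a
  -- sum of three terms, `49 = 7²` from bands of half-width `3`, and `81 = 9²` from bands of
  -- half-width `4`.
  calc _ ≤ ∑' k : ℕ, (2 * A k ^ 2 + (4 * B k ^ 2 + 4 * (p2 (-(δ * k)) * T ^ 2))) := by
        refine ENNReal.tsum_le_tsum fun k => ?_
        calc _ ≤ (A k + (B k + p2 (-(δ * k)) * T)) ^ 2 := by gcongr; exact hsplit k
          _ ≤ 2 * (A k ^ 2 + 2 * (B k ^ 2 + (p2 (-(δ * k)) * T) ^ 2)) :=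
              (add_sq_le_two _ _).trans (by gcongr; exact add_sq_le_two _ _)
          _ = 2 * A k ^ 2 + (4 * B k ^ 2 + 4 * (p2 (-(δ * k)) ^ 2 * T ^ 2)) := by ring
          _ ≤ _ := by gcongr; exact hp k
    _ = 2 * ∑' k, A k ^ 2 + (4 * ∑' k, B k ^ 2 + 4 * (S * T ^ 2)) := by
        simp_rw [ENNReal.tsum_add, ENNReal.tsum_mul_left, ENNReal.tsum_mul_right]
        rfl
    _ ≤ 2 * (49 * S * ((∑' a, X a ^ 2) * ∑' b, Y b ^ 2)) +
        (4 * (49 * S * ((∑' a, Y a ^ 2) * ∑' b, X b ^ 2)) +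
          4 * (S * (81 * ((∑' a, X a ^ 2) * ∑' b, Y b ^ 2)))) := by
        gcongr
        · exact tsum_highLow_sq_le hδ X Y
        · exact tsum_highLow_sq_le hδ Y X
    _ = _ := by ring

/-! ### Functions on `[0,1] × ℝ` representing distributions -/

theorem ae_st_of_ae_ae {p : ℝ × ℝ → Prop} (hp : MeasurableSet {z | p z})
    (h : ∀ᵐ t ∂timeMeasure, ∀ᵐ x, p (t, x)) : ∀ᵐ z ∂stMeasure, p z :=
  (Measure.ae_prod_mem_iff_ae_ae_mem hp).2 h

theorem IsReprST.congr {u : ℝ → 𝓢'(ℝ, ℂ)} {g h : ℝ × ℝ → ℂ} (hg : IsReprST u g)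
    (e : g =ᵐ[stMeasure] h) : IsReprST u h := by
  refine ⟨hg.1.congr e, ?_⟩
  filter_upwards [hg.2, ae_ae_of_ae_st e] with t h1 h2
  exact h1.congr h2

theorem IsReprST.exists_measurable {u : ℝ → 𝓢'(ℝ, ℂ)} {g : ℝ × ℝ → ℂ} (hg : IsReprST u g) :
    ∃ h, Measurable h ∧ g =ᵐ[stMeasure] h ∧ IsReprST u h :=
  ⟨hg.1.mk g, hg.1.stronglyMeasurable_mk.measurable, hg.1.ae_eq_mk, hg.congr hg.1.ae_eq_mk⟩

theorem IsReprST.ae_eq {u : ℝ → 𝓢'(ℝ, ℂ)} {g h : ℝ × ℝ → ℂ} (hg : IsReprST u g)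
    (hh : IsReprST u h) : g =ᵐ[stMeasure] h := by
  obtain ⟨g', hg1, hg2, hg3⟩ := hg.exists_measurable
  obtain ⟨h', hh1, hh2, hh3⟩ := hh.exists_measurable
  have : g' =ᵐ[stMeasure] h' := by
    refine ae_st_of_ae_ae (p := fun z => g' z = h' z) (measurableSet_eq_fun hg1 hh1) ?_
    filter_upwards [hg3.2, hh3.2] with t h1 h2
    exact h1.ae_eq h2
  exact hg2.trans (this.trans hh2.symm)

theorem IsReprST.congr_left {u v : ℝ → 𝓢'(ℝ, ℂ)} {g : ℝ × ℝ → ℂ} (hg : IsReprST u g)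
    (e : ∀ᵐ t ∂timeMeasure, u t = v t) : IsReprST v g := by
  refine ⟨hg.1, ?_⟩
  filter_upwards [hg.2, e] with t h1 h2
  exact h2 ▸ h1

theorem IsReprST.sum {ι : Type*} {s : Finset ι} {u : ι → ℝ → 𝓢'(ℝ, ℂ)} {g : ι → ℝ × ℝ → ℂ}
    (h : ∀ i ∈ s, IsReprST (u i) (g i)) :
    IsReprST (fun t => ∑ i ∈ s, u i t) (fun p => ∑ i ∈ s, g i p) := by
  refine ⟨Finset.aestronglyMeasurable_fun_sum s fun i hi => (h i hi).1, ?_⟩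
  have : ∀ᵐ t ∂timeMeasure, ∀ i ∈ s, IsRepr (u i t) (fun x => g i (t, x)) :=
    (ae_ball_iff s.countable_toSet).2 fun i hi => (h i hi).2
  exact this.mono fun t ht => IsRepr.sum ht

theorem IsReprST.zero : IsReprST (fun _ => 0) (fun _ => 0) :=
  ⟨aestronglyMeasurable_const, Eventually.of_forall fun _ => IsRepr.zero⟩

/-- `N` is a family of norms which is equivalent to the family of lattice norms `E`. -/
structure NormPair (N : ℕ → (ℝ × ℝ → ℂ) → ℝ≥0∞) (E : ℕ → (ℝ × ℝ → ℝ≥0∞) → ℝ≥0∞)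
    (C : NNReal) : Prop where
  lat : ∀ k, LatNorm (E k) 4
  upper : ∀ k g, Measurable g → N k g ≤ C * E k (fun p => ‖g p‖ₑ)
  lower : ∀ k g, Measurable g → E k (fun p => ‖g p‖ₑ) ≤ C * N k g
  congr : ∀ k g h, g =ᵐ[stMeasure] h → N k g = N k h
  scale : ∀ k a G, Measurable G → k ≤ a + 1 → a ≤ k + 1 → E k G ≤ C * E a G

/-- The norm `(∑_j 2^{2js} ‖S_j u‖²_{N j})^{1/2}`. -/
noncomputable def l2N (φ₀ : ℝ → ℝ) (N : ℕ → (ℝ × ℝ → ℂ) → ℝ≥0∞) (s : ℝ) (u : ℝ → 𝓢'(ℝ, ℂ)) :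
    ℝ≥0∞ :=
  (∑' j : ℕ, (2 : ℝ≥0∞) ^ (2 * j * s) * normST (N j) (fun t => lpProj φ₀ j (u t)) ^ 2) ^
    (1 / 2 : ℝ)

/-- The norm `(∑_j 2^{2js} ‖U j‖²_{E j})^{1/2}`. -/
noncomputable def seqN (E : ℕ → (ℝ × ℝ → ℝ≥0∞) → ℝ≥0∞) (s : ℝ) (U : ℕ → ℝ × ℝ → ℂ) : ℝ≥0∞ :=
  (∑' j : ℕ, (p2 (j * s) * E j (fun p => ‖U j p‖ₑ)) ^ 2) ^ (1 / 2 : ℝ)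

theorem p2_mul_sq (j : ℕ) (s : ℝ) (x : ℝ≥0∞) :
    (p2 (j * s) * x) ^ 2 = (2 : ℝ≥0∞) ^ (2 * j * s) * x ^ 2 := by
  rw [mul_pow, p2_sq, p2, mul_assoc]

theorem seqN_sq (E : ℕ → (ℝ × ℝ → ℝ≥0∞) → ℝ≥0∞) (s : ℝ) (U : ℕ → ℝ × ℝ → ℂ) :
    seqN E s U ^ 2 = ∑' j : ℕ, (p2 (j * s) * E j (fun p => ‖U j p‖ₑ)) ^ 2 := rpow_half_sq _

theorem l2N_sq (φ₀ : ℝ → ℝ) (N : ℕ → (ℝ × ℝ → ℂ) → ℝ≥0∞) (s : ℝ) (u : ℝ → 𝓢'(ℝ, ℂ)) :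
    l2N φ₀ N s u ^ 2 =
      ∑' j : ℕ, (p2 (j * s) * normST (N j) (fun t => lpProj φ₀ j (u t))) ^ 2 := by
  simp_rw [p2_mul_sq]
  exact rpow_half_sq _

theorem le_l2N (φ₀ : ℝ → ℝ) (N : ℕ → (ℝ × ℝ → ℂ) → ℝ≥0∞) (s : ℝ) (u : ℝ → 𝓢'(ℝ, ℂ)) (j : ℕ) :
    p2 (j * s) * normST (N j) (fun t => lpProj φ₀ j (u t)) ≤ l2N φ₀ N s u := by
  refine le_of_sq_le_sq ?_
  rw [l2N_sq]
  exact ENNReal.le_tsum (f := fun j : ℕ =>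
    (p2 (j * s) * normST (N j) (fun t => lpProj φ₀ j (u t))) ^ 2) j

theorem normST_ne_top_of_l2N {φ₀ : ℝ → ℝ} {N : ℕ → (ℝ × ℝ → ℂ) → ℝ≥0∞} {s : ℝ}
    {u : ℝ → 𝓢'(ℝ, ℂ)} (h : l2N φ₀ N s u < ⊤) (j : ℕ) :
    normST (N j) (fun t => lpProj φ₀ j (u t)) ≠ ⊤ := fun htop => by
  have := le_l2N φ₀ N s u j
  rw [htop, ENNReal.mul_top (p2_ne_zero _)] at this
  exact h.ne (top_le_iff.1 this)

section

variable {φ₀ : ℝ → ℝ} {N : ℕ → (ℝ × ℝ → ℂ) → ℝ≥0∞}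
  {E : ℕ → (ℝ × ℝ → ℝ≥0∞) → ℝ≥0∞} {C : NNReal}

theorem NormPair.normST_le (hN : NormPair N E C) (k : ℕ) {u : ℝ → 𝓢'(ℝ, ℂ)} {g : ℝ × ℝ → ℂ}
    (h : IsReprST u g) (hg : Measurable g) :
    normST (N k) u ≤ C * E k (fun p => ‖g p‖ₑ) :=
  (iInf₂_le g h).trans (hN.upper k g hg)

/-- Every representative gives the same norm, since two of them agree almost everywhere. So any
measurable one is as good as the infimum. -/
theorem NormPair.exists_repr (hN : NormPair N E C) (k : ℕ) {u : ℝ → 𝓢'(ℝ, ℂ)}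
    (h : normST (N k) u ≠ ⊤) :
    ∃ g, Measurable g ∧ IsReprST u g ∧ E k (fun p => ‖g p‖ₑ) ≤ C * normST (N k) u := by
  have : ∃ g, IsReprST u g := by
    by_contra hno
    push Not at hno
    exact h (by simp [normST, hno])
  obtain ⟨g₀, hg₀⟩ := this
  obtain ⟨g, h1, -, h3⟩ := hg₀.exists_measurable
  refine ⟨g, h1, h3, (hN.lower k g h1).trans ?_⟩
  gcongr
  refine le_iInf₂ fun g' hg' => (hN.congr k g g' (h3.ae_eq hg')).le

theorem NormPair.exists_blocks (hN : NormPair N E C) {s : ℝ} {u : ℝ → 𝓢'(ℝ, ℂ)}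
    (h : l2N φ₀ N s u < ⊤) :
    ∃ U : ℕ → ℝ × ℝ → ℂ, (∀ a, Measurable (U a)) ∧
      (∀ a, IsReprST (fun t => lpProj φ₀ a (u t)) (U a)) ∧
      seqN E s U ≤ C * l2N φ₀ N s u := by
  choose U hU using fun a => hN.exists_repr a (normST_ne_top_of_l2N h a)
  refine ⟨U, fun a => (hU a).1, fun a => (hU a).2.1, le_of_sq_le_sq ?_⟩
  rw [seqN_sq, mul_pow, l2N_sq, ← ENNReal.tsum_mul_left]
  refine ENNReal.tsum_le_tsum fun a => ?_
  rw [← mul_pow, mul_left_comm]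
  gcongr
  exact (hU a).2.2

theorem NormPair.l2N_le (hN : NormPair N E C) {s : ℝ} {w : ℝ → 𝓢'(ℝ, ℂ)} {W : ℕ → ℝ × ℝ → ℂ}
    (hW : ∀ k, Measurable (W k)) (h : ∀ k, IsReprST (fun t => lpProj φ₀ k (w t)) (W k)) :
    l2N φ₀ N s w ≤ C * seqN E s W := by
  refine le_of_sq_le_sq ?_
  rw [l2N_sq, mul_pow, seqN_sq, ← ENNReal.tsum_mul_left]
  refine ENNReal.tsum_le_tsum fun a => ?_
  rw [← mul_pow, mul_left_comm]
  gcongr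
  exact hN.normST_le a (h a) (hW a)

theorem LatNorm.finset_sum {V : (ℝ × ℝ → ℝ≥0∞) → ℝ≥0∞} {A : ℝ≥0∞} (hV : LatNorm V A) {ι : Type*}
    (s : Finset ι) {G : ι → ℝ × ℝ → ℝ≥0∞} (hG : ∀ i, Measurable (G i)) :
    V (fun p => ∑ i ∈ s, G i p) ≤ ∑ i ∈ s, V (G i) := by
  classical
  induction s using Finset.induction_on with
  | empty => simpa using hV.zero.le
  | insert i s hi ih =>
    simp_rw [Finset.sum_insert hi]
    exact (hV.add (hG i) (Finset.measurable_sum s fun j _ => hG j)).trans (by gcongr)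

/-- The norm of `S_j v` only controls the functions `S_k S_j v` for each `k`. A function giving `S_j
v` is recovered as the sum over the three neighbouring `k`, at the cost of changing frequency by
one. -/
theorem NormPair.exists_block (hφ : IsCutoff φ₀) (hN : NormPair N E C) {s : ℝ} {v : ℝ → 𝓢'(ℝ, ℂ)} {j : ℕ}
    (h : l2N φ₀ N s (fun t => lpProj φ₀ j (v t)) < ⊤) :
    ∃ V : ℝ × ℝ → ℂ, Measurable V ∧ IsReprST (fun t => lpProj φ₀ j (v t)) V ∧
      p2 (j * s) * E j (fun p => ‖V p‖ₑ) ≤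
        3 * (C * p2 |s| * C) * l2N φ₀ N s (fun t => lpProj φ₀ j (v t)) := by
  choose U hU using fun a => hN.exists_repr a (normST_ne_top_of_l2N h a)
  have hUm := fun a => (hU a).1
  refine ⟨fun p => ∑ k ∈ Finset.Icc (j - 1) (j + 1), U k p,
    Finset.measurable_sum _ fun k _ => hUm k, ?_, ?_⟩
  · have := IsReprST.sum (s := Finset.Icc (j - 1) (j + 1)) fun k _ => (hU k).2.1
    simpa only [sum_Icc_lpProj_lpProj hφ] using this
  · calc _ ≤ p2 (j * s) * ∑ k ∈ Finset.Icc (j - 1) (j + 1), E j (fun p => ‖U k p‖ₑ) := by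
          gcongr
          refine ((hN.lat j).mono ?_ ?_ (ae_of_all _ fun p => enorm_sum_le _ _)).trans
            ((hN.lat j).finset_sum _ fun k => (hUm k).enorm)
          · exact (Finset.measurable_sum _ fun k _ => hUm k).enorm
          · exact Finset.measurable_sum _ fun k _ => (hUm k).enorm
      _ ≤ ∑ k ∈ Finset.Icc (j - 1) (j + 1),
          C * p2 |s| * C * l2N φ₀ N s (fun t => lpProj φ₀ j (v t)) := by
          rw [Finset.mul_sum]
          refine Finset.sum_le_sum fun k hk => ?_
          rw [Finset.mem_Icc] at hk
          have h1 : p2 (j * s) ≤ p2 |s| * p2 (k * s) := by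
            rw [← p2_add]
            refine p2_mono ?_
            have hk1 : (k : ℝ) ≤ j + 1 := by exact_mod_cast hk.2
            have hk2 : (j : ℝ) ≤ k + 1 := by exact_mod_cast (by omega : j ≤ k + 1)
            have h4 : |(j : ℝ) - k| ≤ 1 := abs_le.2 ⟨by linarith, by linarith⟩
            have h5 : ((j : ℝ) - k) * s ≤ |s| := by
              calc _ ≤ |((j : ℝ) - k) * s| := le_abs_self _
                _ = |(j : ℝ) - k| * |s| := abs_mul _ _
                _ ≤ 1 * |s| := by gcongr
                _ = _ := one_mul _
            linarith
          calc _ ≤ (p2 |s| * p2 (k * s)) * (C * (C * normST (N k) fun t =>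
                lpProj φ₀ k (lpProj φ₀ j (v t)))) := by
                gcongr
                exact (hN.scale j k _ (hUm k).enorm (by omega) (by omega)).trans
                  (by gcongr; exact (hU k).2.2)
            _ = C * p2 |s| * C * (p2 (k * s) * normST (N k) fun t =>
                lpProj φ₀ k (lpProj φ₀ j (v t))) := by ring
            _ ≤ _ := by
                gcongr
                exact le_l2N φ₀ N s (fun t => lpProj φ₀ j (v t)) k
      _ ≤ 3 • (C * p2 |s| * C * l2N φ₀ N s (fun t => lpProj φ₀ j (v t))) := by
          rw [Finset.sum_const]
          refine nsmul_le_nsmul_left (zero_le) ?_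
          rw [Nat.card_Icc]; omega
      _ = _ := by rw [nsmul_eq_mul]; push_cast; ring

end

section

variable {φ₀ : ℝ → ℝ} {hφ : IsCutoff φ₀}

/-! ### Estimates for the product -/

theorem LatNorm.interaction_le {V : (ℝ × ℝ → ℝ≥0∞) → ℝ≥0∞} {A : ℝ≥0∞} (hV : LatNorm V A)
    {C : NNReal} {k : ℕ} {W : ℝ × ℝ → ℝ≥0∞} (hW : Measurable W) {G : ℕ × ℕ → ℝ × ℝ → ℝ≥0∞}
    (hG : ∀ q, Measurable (G q))
    (h : ∀ p, W p ≤ C * ∑' q : ℕ × ℕ, if Contrib k q then G q p else 0) :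
    V W ≤ C * ∑' q : ℕ × ℕ, if Contrib k q then V (G q) else 0 := by
  have hm : ∀ q : ℕ × ℕ, Measurable fun p => if Contrib k q then G q p else 0 := fun q => by
    split_ifs
    · exact hG q
    · exact measurable_const
  refine (hV.mono hW ((Measurable.tsum hm).const_mul _) (ae_of_all _ h)).trans
    ((hV.smul (by simp) (Measurable.tsum hm)).trans ?_)
  gcongr
  refine (hV.sum _ hm).trans (ENNReal.tsum_le_tsum fun q => ?_)
  split_ifs
  · exact le_rfl
  · exact hV.zero.le

/-- The analytic input is `hb` for a single pair of blocks. The rest is subadditivity of `E k` over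
the contributing pairs followed by the summation with the gain. The norms `E₁`, `E₂` of the two
factors are kept apart for the case of a factor in `Y`. -/
theorem product_estimate {C₀ : NNReal}
    (hC₀ : ∀ k x, ‖(𝓕⁻ (symS hφ k) : 𝓢(ℝ, ℂ)) x‖ₑ ≤ C₀ * kap k x) {s α β δ : ℝ} (hδ : 0 < δ)
    {E E₁ E₂ : ℕ → (ℝ × ℝ → ℝ≥0∞) → ℝ≥0∞} (hE : ∀ k, LatNorm (E k) 4)
    {f g : ℝ → 𝓢'(ℝ, ℂ)} {U V : ℕ → ℝ × ℝ → ℂ}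
    (hU : ∀ a, Measurable (U a)) (hV : ∀ b, Measurable (V b))
    (h : ∀ᵐ t ∂timeMeasure,
      ProdData hφ (f t) (g t) (fun a x => U a (t, x)) (fun b x => V b (t, x))) {D : ℝ≥0∞}
    (hb : ∀ k a b, Contrib k (a, b) →
      p2 (k * s) * E k (cv (kap k) fun p => ‖U a p‖ₑ * ‖V b p‖ₑ) ≤
        D * (gain δ k (a, b) * ((p2 (a * α) * E₁ a (fun p => ‖U a p‖ₑ)) *
          (p2 (b * β) * E₂ b (fun p => ‖V b p‖ₑ))))) :
    ∃ (w : ℝ → 𝓢'(ℝ, ℂ)) (W : ℕ → ℝ × ℝ → ℂ), IsProductST φ₀ f g w ∧ (∀ k, Measurable (W k)) ∧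
      (∀ k, IsReprST (fun t => lpProj φ₀ k (w t)) (W k)) ∧
      seqN E s W ≤ C₀ * D * (618 * ∑' b : ℕ, p2 (-(δ * b))) ^ (1 / 2 : ℝ) *
        (seqN E₁ α U * seqN E₂ β V) := by
  obtain ⟨w, W, h1, h2, h3, -, h5⟩ := exists_productST hC₀ hU hV h
  refine ⟨w, W, h1, h2, h3, le_of_sq_le_sq ?_⟩
  have hm : ∀ (k : ℕ) (q : ℕ × ℕ), Measurable (cv (kap k) fun p => ‖U q.1 p‖ₑ * ‖V q.2 p‖ₑ) :=
    fun k q => measurable_cv (measurable_kap k) ((hU q.1).enorm.mul (hV q.2).enorm)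
  rw [seqN_sq]
  set X : ℕ → ℝ≥0∞ := fun a => p2 (a * α) * E₁ a (fun p => ‖U a p‖ₑ)
  set Y : ℕ → ℝ≥0∞ := fun b => p2 (b * β) * E₂ b (fun p => ‖V b p‖ₑ)
  calc _ ≤ ∑' k : ℕ, (C₀ * D * ∑' q : ℕ × ℕ,
        if Contrib k q then gain δ k q * (X q.1 * Y q.2) else 0) ^ 2 := by
        refine ENNReal.tsum_le_tsum fun k => pow_le_pow_left' ?_ 2
        calc _ ≤ p2 (k * s) * (C₀ * ∑' q : ℕ × ℕ,
              if Contrib k q then E k (cv (kap k) fun p => ‖U q.1 p‖ₑ * ‖V q.2 p‖ₑ) else 0) := by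
              exact mul_le_mul' le_rfl ((hE k).interaction_le (h2 k).enorm (hm k) (h5 k))
          _ = C₀ * ∑' q : ℕ × ℕ, p2 (k * s) * (if Contrib k q then
              E k (cv (kap k) fun p => ‖U q.1 p‖ₑ * ‖V q.2 p‖ₑ) else 0) := by
              rw [ENNReal.tsum_mul_left]; ring
          _ ≤ C₀ * ∑' q : ℕ × ℕ, D * (if Contrib k q then
              gain δ k q * (X q.1 * Y q.2) else 0) := by
              refine mul_le_mul' le_rfl (ENNReal.tsum_le_tsum fun q => ?_)
              split_ifs with hq
              · exact hb k q.1 q.2 hq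
              · simp
          _ = _ := by rw [ENNReal.tsum_mul_left, mul_assoc]
    _ = (C₀ * D) ^ 2 * ∑' k : ℕ, (∑' q : ℕ × ℕ,
        if Contrib k q then gain δ k q * (X q.1 * Y q.2) else 0) ^ 2 := by
        simp_rw [mul_pow (C₀ * D)]
        rw [ENNReal.tsum_mul_left]
    _ ≤ (C₀ * D) ^ 2 * (618 * (∑' b : ℕ, p2 (-(δ * b))) *
        ((∑' a, X a ^ 2) * ∑' b, Y b ^ 2)) := by
        gcongr
        exact tsum_interaction_sq_le hδ X Y
    _ = _ := by
        have e1 : seqN E₁ α U ^ 2 = ∑' a, X a ^ 2 := seqN_sq _ _ _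
        have e2 : seqN E₂ β V ^ 2 = ∑' b, Y b ^ 2 := seqN_sq _ _ _
        simp only [mul_pow, rpow_half_sq, e1, e2]
        ring

/-- With one fixed output frequency no gain is required: the indices of the two factors are within
`7` of each other, and Schur's test on this band gives the constant `15 = 2 · 7 + 1`. -/
theorem product_estimate_single {C₀ : NNReal}
    (hC₀ : ∀ k x, ‖(𝓕⁻ (symS hφ k) : 𝓢(ℝ, ℂ)) x‖ₑ ≤ C₀ * kap k x) {s α β γ : ℝ}
    {E E₁ E₂ : ℕ → (ℝ × ℝ → ℝ≥0∞) → ℝ≥0∞} (j : ℕ) (hE : LatNorm (E j) 4)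
    {f g : ℝ → 𝓢'(ℝ, ℂ)} {U V : ℕ → ℝ × ℝ → ℂ}
    (hU : ∀ a, Measurable (U a)) (hV : ∀ b, Measurable (V b))
    (h : ∀ᵐ t ∂timeMeasure,
      ProdData hφ (f t) (g t) (fun a x => U a (t, x)) (fun b x => V b (t, x))) {D : ℝ≥0∞}
    (hb : ∀ a b, Contrib j (a, b) →
      p2 (j * s) * E j (cv (kap j) fun p => ‖U a p‖ₑ * ‖V b p‖ₑ) ≤
        D * p2 (γ * j) * ((if a ≤ b + 7 ∧ b ≤ a + 7 then 1 else 0) *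
          ((p2 (a * α) * E₁ a (fun p => ‖U a p‖ₑ)) *
          (p2 (b * β) * E₂ b (fun p => ‖V b p‖ₑ))))) :
    ∃ (w : ℝ → 𝓢'(ℝ, ℂ)) (W : ℝ × ℝ → ℂ), IsProductST φ₀ f g w ∧ Measurable W ∧
      IsReprST (fun t => lpProj φ₀ j (w t)) W ∧ (∀ᵐ t ∂timeMeasure, W1 (fun x => W (t, x))) ∧
      p2 (j * s) * E j (fun p => ‖W p‖ₑ) ≤ C₀ * (D * p2 (γ * j)) *
        (15 * (seqN E₁ α U * seqN E₂ β V)) := by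
  obtain ⟨w, W, h1, h2, h3, h4, h5⟩ := exists_productST hC₀ hU hV h
  refine ⟨w, W j, h1, h2 j, h3 j, h4 j, ?_⟩
  have hm : ∀ q : ℕ × ℕ, Measurable (cv (kap j) fun p => ‖U q.1 p‖ₑ * ‖V q.2 p‖ₑ) :=
    fun q => measurable_cv (measurable_kap j) ((hU q.1).enorm.mul (hV q.2).enorm)
  set X : ℕ → ℝ≥0∞ := fun a => p2 (a * α) * E₁ a (fun p => ‖U a p‖ₑ)
  set Y : ℕ → ℝ≥0∞ := fun b => p2 (b * β) * E₂ b (fun p => ‖V b p‖ₑ)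
  calc _ ≤ p2 (j * s) * (C₀ * ∑' q : ℕ × ℕ,
        if Contrib j q then E j (cv (kap j) fun p => ‖U q.1 p‖ₑ * ‖V q.2 p‖ₑ) else 0) := by
        exact mul_le_mul' le_rfl (hE.interaction_le (h2 j).enorm hm (h5 j))
    _ = C₀ * ∑' q : ℕ × ℕ, p2 (j * s) * (if Contrib j q then
        E j (cv (kap j) fun p => ‖U q.1 p‖ₑ * ‖V q.2 p‖ₑ) else 0) := by
        rw [ENNReal.tsum_mul_left]; ring
    _ ≤ C₀ * ∑' q : ℕ × ℕ, D * p2 (γ * j) *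
        ((if q.1 ≤ q.2 + 7 ∧ q.2 ≤ q.1 + 7 then 1 else 0) * (X q.1 * Y q.2)) := by
        refine mul_le_mul' le_rfl (ENNReal.tsum_le_tsum fun q => ?_)
        split_ifs with hq hq' hq'
        · have := hb q.1 q.2 hq
          rwa [if_pos hq'] at this
        · have := hb q.1 q.2 hq
          rwa [if_neg hq'] at this
        · simp
        · simp
    _ = C₀ * (D * p2 (γ * j)) * ∑' q : ℕ × ℕ,
        ((if q.1 ≤ q.2 + 7 ∧ q.2 ≤ q.1 + 7 then 1 else 0) * (X q.1 * Y q.2)) := by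
        rw [ENNReal.tsum_mul_left]; ring
    _ ≤ _ := by
        gcongr
        rw [ENNReal.tsum_prod' (f := fun q : ℕ × ℕ =>
          ((if q.1 ≤ q.2 + 7 ∧ q.2 ≤ q.1 + 7 then 1 else 0) * (X q.1 * Y q.2)))]
        refine le_of_sq_le_sq ?_
        refine (schur_bilin _ X Y (fun a => tsum_band_le 7 a) fun b =>
          le_trans (ENNReal.tsum_le_tsum fun a => ?_) (tsum_band_le 7 b)).trans (le_of_eq ?_)
        · simp only [and_comm]; rfl
        · rw [mul_pow, mul_pow, seqN_sq, seqN_sq]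
          have : (2 * ((7 : ℕ) : ℝ≥0∞) + 1) * (2 * ((7 : ℕ) : ℝ≥0∞) + 1) = 15 ^ 2 := by norm_num
          rw [this, mul_assoc]

theorem p2_mul_le_of_abs_sub_le {j k : ℕ} (h : j ≤ k + 1) (h' : k ≤ j + 1) (s : ℝ) :
    p2 (j * s) ≤ p2 |s| * p2 (k * s) := by
  rw [← p2_add]
  refine p2_mono ?_
  have hk1 : (k : ℝ) ≤ j + 1 := by exact_mod_cast h'
  have hk2 : (j : ℝ) ≤ k + 1 := by exact_mod_cast h
  have h4 : |(j : ℝ) - k| ≤ 1 := abs_le.2 ⟨by linarith, by linarith⟩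
  have h5 : ((j : ℝ) - k) * s ≤ |s| := by
    calc _ ≤ |((j : ℝ) - k) * s| := le_abs_self _
      _ = |(j : ℝ) - k| * |s| := abs_mul _ _
      _ ≤ 1 * |s| := by gcongr
      _ = _ := one_mul _
  linarith

variable {N : ℕ → (ℝ × ℝ → ℂ) → ℝ≥0∞} {E : ℕ → (ℝ × ℝ → ℝ≥0∞) → ℝ≥0∞} {C : NNReal}

/-- Only the three terms `k = j - 1, j, j + 1` of the norm are nonzero. In each of them `S_k` is a
convolution, whose cost `16` is the constant `4` of the lattice norm times the mass `4` of the
kernel. -/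
theorem NormPair.l2N_lpProj_le (hN : NormPair N E C) {C₀ : NNReal}
    (hC₀ : ∀ k x, ‖(𝓕⁻ (symS hφ k) : 𝓢(ℝ, ℂ)) x‖ₑ ≤ C₀ * kap k x) (s : ℝ) {j : ℕ}
    {w : ℝ → 𝓢'(ℝ, ℂ)} {W : ℝ × ℝ → ℂ} (hW : Measurable W)
    (h : IsReprST (fun t => lpProj φ₀ j (w t)) W)
    (hw : ∀ᵐ t ∂timeMeasure, W1 (fun x => W (t, x))) :
    l2N φ₀ N s (fun t => lpProj φ₀ j (w t)) ≤
      3 * (p2 |s| * C * C₀ * 16 * C) * (p2 (j * s) * E j (fun p => ‖W p‖ₑ)) := by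
  set B := (p2 |s| * C * C₀ * 16 * C) * (p2 (j * s) * E j (fun p => ‖W p‖ₑ)) with hB
  have hnear : ∀ k ∈ Finset.Icc (j - 1) (j + 1),
      p2 (k * s) * normST (N k) (fun t => lpProj φ₀ k (lpProj φ₀ j (w t))) ≤ B := fun k hk => by
    rw [Finset.mem_Icc] at hk
    let Wk : ℝ × ℝ → ℂ := fun p => cvC (𝓕⁻ (symS hφ k) : 𝓢(ℝ, ℂ)) (fun x => W (p.1, x)) p.2
    have hWk : Measurable Wk := by
      have h1 : Measurable fun q : (ℝ × ℝ) × ℝ => W (q.1.1, q.2) := hW.comp (by fun_prop)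
      have h2 : Measurable fun q : (ℝ × ℝ) × ℝ => (𝓕⁻ (symS hφ k) : 𝓢(ℝ, ℂ)) (q.1.2 - q.2) :=
        (𝓕⁻ (symS hφ k) : 𝓢(ℝ, ℂ)).continuous.measurable.comp (by fun_prop)
      exact (StronglyMeasurable.integral_prod_right (f := fun (p : ℝ × ℝ) (y : ℝ) =>
        (𝓕⁻ (symS hφ k) : 𝓢(ℝ, ℂ)) (p.2 - y) * W (p.1, y)) (ν := volume)
        (h2.mul h1).stronglyMeasurable).measurable
    have hr : IsReprST (fun t => lpProj φ₀ k (lpProj φ₀ j (w t))) Wk := by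
      refine ⟨hWk.aestronglyMeasurable, ?_⟩
      filter_upwards [h.2, hw] with t h1 h2
      exact h1.lpProj hφ h2 k
    have hle : ∀ p, ‖Wk p‖ₑ ≤ C₀ * cv (kap k) (fun p => ‖W p‖ₑ) p := fun p => by
      refine (enorm_cvC_le _ _ _).trans ?_
      rw [cv, ← lintegral_const_mul' _ _ (by simp)]
      refine lintegral_mono fun y => ?_
      rw [← mul_assoc]
      gcongr
      exact hC₀ k _
    have hm : Measurable (cv (kap k) fun p => ‖W p‖ₑ) := measurable_cv (measurable_kap k) hW.enorm
    calc _ ≤ (p2 |s| * p2 (j * s)) * (C * (C₀ * (4 * 4 * (C * E j (fun p => ‖W p‖ₑ))))) := by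
          gcongr
          · exact p2_mul_le_of_abs_sub_le (by omega) (by omega) s
          · refine (hN.normST_le k hr hWk).trans ?_
            gcongr
            refine ((hN.lat k).mono hWk.enorm (hm.const_mul _) (ae_of_all _ hle)).trans
              (((hN.lat k).smul (by simp) hm).trans ?_)
            gcongr
            refine ((hN.lat k).conv (measurable_kap k) (lintegral_kap_ne_top k) hW.enorm).trans ?_
            gcongr
            · exact lintegral_kap_le k
            · exact hN.scale k j _ hW.enorm (by omega) (by omega)
      _ = B := by rw [hB]; ring
  have hfar : ∀ k ∉ Finset.Icc (j - 1) (j + 1),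
      (p2 (k * s) * normST (N k) (fun t => lpProj φ₀ k (lpProj φ₀ j (w t)))) ^ 2 = 0 :=
    fun k hk => by
      have hz : ∀ t, lpProj φ₀ k (lpProj φ₀ j (w t)) = 0 := fun t => by
        rw [Finset.mem_Icc] at hk
        rcases le_total k j with h' | h'
        · exact lpProj_lpProj_eq_zero' hφ (by by_contra; omega) _
        · exact lpProj_lpProj_eq_zero hφ (by by_contra; omega) _
      simp_rw [hz]
      have := hN.normST_le k IsReprST.zero measurable_const
      simp only [enorm_zero, (hN.lat k).zero, mul_zero, nonpos_iff_eq_zero] at this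
      rw [this]; simp
  refine le_of_sq_le_sq ?_
  rw [l2N_sq, tsum_eq_sum hfar]
  calc _ ≤ ∑ k ∈ Finset.Icc (j - 1) (j + 1), B ^ 2 :=
        Finset.sum_le_sum fun k hk => by gcongr; exact hnear k hk
    _ ≤ 3 • B ^ 2 := by
        rw [Finset.sum_const]
        refine nsmul_le_nsmul_left (zero_le) ?_
        rw [Nat.card_Icc]; omega
    _ ≤ 9 * B ^ 2 := by
        rw [nsmul_eq_mul]
        gcongr
        norm_num
    _ = _ := by rw [hB]; ring

/-! ### Blocks on `[0,1] × ℝ` -/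

theorem ae_enorm_le_cv {C₁ : NNReal}
    (hC₁ : ∀ a x, ‖(𝓕⁻ (fatS hφ a) : 𝓢(ℝ, ℂ)) x‖ₑ ≤ C₁ * kap a x) {a : ℕ}
    {u : ℝ → 𝓢'(ℝ, ℂ)} {U : ℝ × ℝ → ℂ} (hU : Measurable U)
    (h : IsReprST (fun t => lpProj φ₀ a (u t)) U)
    (hw : ∀ᵐ t ∂timeMeasure, W1 (fun x => U (t, x))) :
    ∀ᵐ p ∂stMeasure, ‖U p‖ₑ ≤ C₁ * cv (kap a) (fun p => ‖U p‖ₑ) p := by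
  have hm : Measurable (cv (kap a) fun p => ‖U p‖ₑ) := measurable_cv (measurable_kap a) hU.enorm
  refine ae_st_of_ae_ae (measurableSet_le hU.enorm (hm.const_mul _)) ?_
  filter_upwards [h.2, hw] with t h1 h2
  filter_upwards [h1.self_reproducing hφ h2] with x hx
  rw [hx]
  refine (enorm_cvC_le _ _ _).trans ?_
  rw [cv, ← lintegral_const_mul' _ _ (by simp)]
  refine lintegral_mono fun y => ?_
  rw [← mul_assoc]
  gcongr
  exact hC₁ a _

theorem ae_nL2_le_NH (U : ℝ × ℝ → ℂ) :
    ∀ᵐ t ∂timeMeasure, nL2 (fun x => U (t, x)) ≤ NH (fun p => ‖U p‖ₑ) := by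
  filter_upwards [ae_lintegral_sq_le_NH fun p => ‖U p‖ₑ] with t ht
  exact le_of_sq_le_sq (by rwa [nL2_sq])

theorem ae_W1_of_NH {U : ℝ × ℝ → ℂ} (hU : Measurable U) (h : NH (fun p => ‖U p‖ₑ) ≠ ⊤) :
    ∀ᵐ t ∂timeMeasure, W1 (fun x => U (t, x)) := by
  filter_upwards [ae_nL2_le_NH U] with t ht
  exact W1.of_nL2 (hU.comp (by fun_prop)).aestronglyMeasurable (ne_top_of_le_ne_top h ht)

theorem ae_blocks (hφ : IsCutoff φ₀) {u : ℝ → 𝓢'(ℝ, ℂ)} {U : ℕ → ℝ × ℝ → ℂ}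
    (hU : ∀ a, Measurable (U a))
    (h : ∀ a, IsReprST (fun t => lpProj φ₀ a (u t)) (U a))
    (hfin : ∀ a, NH (fun p => ‖U a p‖ₑ) ≠ ⊤) :
    ∀ᵐ t ∂timeMeasure, ∀ a, IsRepr (lpProj φ₀ a (u t)) (fun x => U a (t, x)) ∧
      W1 (fun x => U a (t, x)) ∧ Bdd (fun x => U a (t, x)) ∧
      nL2 (fun x => U a (t, x)) ≤ NH (fun p => ‖U a p‖ₑ) := by
  refine ae_all_iff.2 fun a => ?_
  filter_upwards [(h a).2, ae_W1_of_NH (hU a) (hfin a), ae_nL2_le_NH (U a)] with t h1 h2 h3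
  exact ⟨h1, h2, (⟨h2, h1.self_reproducing hφ h2⟩ : IsBlock hφ a _).bdd
    (ne_top_of_le_ne_top (hfin a) h3), h3⟩

theorem seqN_term_ne_top {E : ℕ → (ℝ × ℝ → ℝ≥0∞) → ℝ≥0∞} {s : ℝ} {U : ℕ → ℝ × ℝ → ℂ}
    (h : seqN E s U ≠ ⊤) (a : ℕ) : E a (fun p => ‖U a p‖ₑ) ≠ ⊤ := fun htop => by
  have h1 : (p2 (a * s) * E a (fun p => ‖U a p‖ₑ)) ^ 2 ≤ seqN E s U ^ 2 := by
    rw [seqN_sq]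
    exact ENNReal.le_tsum (f := fun j : ℕ => (p2 (j * s) * E j (fun p => ‖U j p‖ₑ)) ^ 2) a
  rw [htop, ENNReal.mul_top (p2_ne_zero _)] at h1
  exact h (by simpa using h1)

theorem tsum_nL2_ne_top {s : ℝ} {U : ℕ → ℝ × ℝ → ℂ} (h : seqN (fun _ => NH) s U ≠ ⊤)
    {u : ℕ → ℝ → ℂ} (hu : ∀ a, nL2 (u a) ≤ NH (fun p => ‖U a p‖ₑ)) :
    ∑' a : ℕ, p2 (2 * a * s) * nL2 (u a) ^ 2 ≠ ⊤ := by
  refine ne_top_of_le_ne_top (ENNReal.pow_ne_top h (n := 2)) ?_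
  rw [seqN_sq]
  refine ENNReal.tsum_le_tsum fun a => ?_
  rw [mul_pow, p2_sq, mul_assoc]
  gcongr
  exact hu a

/-- The sequence `U`, with the terms for which `q` fails replaced by `0`. -/
noncomputable def trunc (q : ℕ → Prop) [DecidablePred q] (U : ℕ → ℝ × ℝ → ℂ) :
    ℕ → ℝ × ℝ → ℂ := fun a p => if q a then U a p else 0

theorem trunc_of_pos {q : ℕ → Prop} [DecidablePred q] {U : ℕ → ℝ × ℝ → ℂ} {a : ℕ} (h : q a) :
    trunc q U a = U a := by funext p; simp [trunc, h]

theorem trunc_of_neg {q : ℕ → Prop} [DecidablePred q] {U : ℕ → ℝ × ℝ → ℂ} {a : ℕ} (h : ¬ q a) :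
    trunc q U a = fun _ => 0 := by funext p; simp [trunc, h]

theorem measurable_trunc {q : ℕ → Prop} [DecidablePred q] {U : ℕ → ℝ × ℝ → ℂ}
    (hU : ∀ a, Measurable (U a)) (a : ℕ) : Measurable (trunc q U a) := by
  by_cases h : q a
  · rw [trunc_of_pos h]; exact hU a
  · rw [trunc_of_neg h]; exact measurable_const

theorem ae_prodData {α β : ℝ} (hαβ : 0 ≤ α + β) {u v : ℝ → 𝓢'(ℝ, ℂ)} {U V : ℕ → ℝ × ℝ → ℂ}
    (hU : ∀ a, Measurable (U a)) (hV : ∀ a, Measurable (V a))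
    (hu : ∀ a, IsReprST (fun t => lpProj φ₀ a (u t)) (U a))
    (hv : ∀ a, IsReprST (fun t => lpProj φ₀ a (v t)) (V a))
    (hx : seqN (fun _ => NH) α U ≠ ⊤) (hy : seqN (fun _ => NH) β V ≠ ⊤) :
    ∀ᵐ t ∂timeMeasure,
      ProdData hφ (u t) (v t) (fun a x => U a (t, x)) (fun b x => V b (t, x)) := by
  filter_upwards [ae_blocks hφ hU hu (seqN_term_ne_top hx),
    ae_blocks hφ hV hv (seqN_term_ne_top hy)] with t h1 h2
  exact ProdData.of_nL2 (.of_repr (fun a => (h1 a).1) (fun a => (h1 a).2.1) fun a => (h1 a).2.2.1)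
    (.of_repr (fun a => (h2 a).1) (fun a => (h2 a).2.1) fun a => (h2 a).2.2.1) hαβ
    (tsum_nL2_ne_top hx fun a => (h1 a).2.2.2) (tsum_nL2_ne_top hy fun a => (h2 a).2.2.2)

theorem ae_prodData_lpGE {α β : ℝ} (hαβ : 0 ≤ α + β) {u v : ℝ → 𝓢'(ℝ, ℂ)} {U V : ℕ → ℝ × ℝ → ℂ}
    (hU : ∀ a, Measurable (U a)) (hV : ∀ a, Measurable (V a))
    (hu : ∀ a, IsReprST (fun t => lpProj φ₀ a (u t)) (U a))
    (hv : ∀ a, IsReprST (fun t => lpProj φ₀ a (v t)) (V a))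
    (hx : seqN (fun _ => NH) α U ≠ ⊤) (hy : seqN (fun _ => NH) β V ≠ ⊤) (n : ℕ) :
    ∀ᵐ t ∂timeMeasure, ProdData hφ (lpGE φ₀ n (u t)) (lpGE φ₀ n (v t))
      (fun a x => trunc (n ≤ ·) U a (t, x)) (fun b x => trunc (n ≤ ·) V b (t, x)) := by
  filter_upwards [ae_blocks hφ hU hu (seqN_term_ne_top hx),
    ae_blocks hφ hV hv (seqN_term_ne_top hy)] with t h1 h2
  have hle : ∀ (W : ℕ → ℝ × ℝ → ℂ) a,
      nL2 (fun x => trunc (n ≤ ·) W a (t, x)) ≤ nL2 (fun x => W a (t, x)) := fun W a => by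
    by_cases ha : n ≤ a
    · rw [trunc_of_pos ha]
    · rw [trunc_of_neg ha]; simp [nL2]
  exact ProdData.of_nL2
    (.lpGE (fun a => (h1 a).1) (fun a => (h1 a).2.1) (fun a => (h1 a).2.2.1) n)
    (.lpGE (fun a => (h2 a).1) (fun a => (h2 a).2.1) (fun a => (h2 a).2.2.1) n) hαβ
    (tsum_nL2_ne_top hx fun a => (hle U a).trans (h1 a).2.2.2)
    (tsum_nL2_ne_top hy fun a => (hle V a).trans (h2 a).2.2.2)

theorem ae_prodData_lpLT {u v : ℝ → 𝓢'(ℝ, ℂ)} {U : ℕ → ℝ × ℝ → ℂ} {V : ℝ × ℝ → ℂ}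
    (hU : ∀ a, Measurable (U a))
    (hu : ∀ a, IsReprST (fun t => lpProj φ₀ a (u t)) (U a)) {j : ℕ}
    (hv : IsReprST (fun t => lpProj φ₀ j (v t)) V)
    (hx : ∀ a, NH (fun p => ‖U a p‖ₑ) ≠ ⊤) (hw : ∀ᵐ t ∂timeMeasure, W1 (fun x => V (t, x)))
    (n : ℕ) :
    ∀ᵐ t ∂timeMeasure, ProdData hφ (lpLT φ₀ n (u t)) (lpProj φ₀ j (v t))
      (fun a x => trunc (· < n) U a (t, x)) (fun b x => trunc (· = j) (fun _ => V) b (t, x)) := by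
  filter_upwards [ae_blocks hφ hU hu hx, hv.2, hw] with t h1 h2 h3
  exact ProdData.of_finite (n := n) (m := j + 1)
    (.lpLT (fun a => (h1 a).1) (fun a => (h1 a).2.1) (fun a => (h1 a).2.2.1) n)
    (.lpProj h2 h3) (fun a ha x => if_neg (not_lt.2 ha)) (fun b hb x => if_neg (by omega))

end

/-! ### The norms of the statement as functionals of the absolute value -/

theorem eLpNorm_two {α : Type*} [MeasurableSpace α] (μ : Measure α) (g : α → ℂ) :
    eLpNorm g 2 μ = (∫⁻ x, ‖g x‖ₑ ^ 2 ∂μ) ^ (1 / 2 : ℝ) := by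
  rw [eLpNorm_eq_lintegral_rpow_enorm_toReal (by norm_num) (by norm_num)]
  simp

theorem eLpNorm_two_sq {α : Type*} [MeasurableSpace α] (μ : Measure α) (g : α → ℂ) :
    eLpNorm g 2 μ ^ 2 = ∫⁻ x, ‖g x‖ₑ ^ 2 ∂μ := by rw [eLpNorm_two, rpow_half_sq]

section

variable (P : SpacePartition)

theorem prod_restrict_Q (l : ℕ) (m : ℤ) :
    timeMeasure.prod (volume.restrict (P.Q l m)) =
      stMeasure.restrict (Set.univ ×ˢ P.Q l m) := by
  rw [stMeasure, ← Measure.prod_restrict, Measure.restrict_univ]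

theorem lintegral_cut (l : ℕ) (m : ℤ) (H : ℝ × ℝ → ℝ≥0∞) :
    ∫⁻ p, cut P l m H p ∂stMeasure =
      ∫⁻ p, H p ∂(timeMeasure.prod (volume.restrict (P.Q l m))) := by
  rw [prod_restrict_Q, ← lintegral_indicator (MeasurableSet.univ.prod (measurableSet_Q P l m))]
  refine lintegral_congr fun p => ?_
  by_cases h : p.2 ∈ P.Q l m <;> simp [cut, h, Set.indicator]

theorem normX_eq (g : ℝ × ℝ → ℂ) : normX P g = quad (VX P) (fun p => ‖g p‖ₑ) := by
  have key : ∀ (l : ℕ) (m : ℤ), ((2 : ℝ≥0∞) ^ (-(l : ℝ) / 2) *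
      eLpNorm g 2 (timeMeasure.prod (volume.restrict (P.Q l m)))) ^ 2 =
      p2 (-l) * ∫⁻ p, cut P l m (fun p => ‖g p‖ₑ ^ 2) p ∂stMeasure := fun l m => by
    rw [mul_pow, eLpNorm_two_sq, lintegral_cut]
    congr 1
    rw [← p2, p2_sq]
    congr 1; ring
  refine le_antisymm (iSup₂_le fun l m => le_of_sq_le_sq ?_) (le_of_sq_le_sq ?_)
  · rw [key, quad_sq]
    exact le_iSup₂ (f := fun (l : ℕ) (m : ℤ) =>
      p2 (-l) * ∫⁻ p, cut P l m (fun p => ‖g p‖ₑ ^ 2) p ∂stMeasure) l m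
  · rw [quad_sq]
    refine iSup₂_le fun l m => ?_
    rw [← key]
    refine pow_le_pow_left' ?_ 2
    exact le_iSup₂ (f := fun (l : ℕ) (m : ℤ) => (2 : ℝ≥0∞) ^ (-(l : ℝ) / 2) *
      eLpNorm g 2 (timeMeasure.prod (volume.restrict (P.Q l m)))) l m

theorem normLinfL2_eq (g : ℝ × ℝ → ℂ) : normLinfL2 g = quad VI (fun p => ‖g p‖ₑ) := by
  refine le_antisymm ?_ (le_of_sq_le_sq ?_)
  · refine essSup_le_of_ae_le _ ?_
    filter_upwards [ae_le_essSup (f := fun t => ∫⁻ x, ‖g (t, x)‖ₑ ^ 2) (μ := timeMeasure)] with t ht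
    refine le_of_sq_le_sq ?_
    rw [eLpNorm_two_sq, quad_sq]
    exact ht
  · rw [quad_sq]
    refine essSup_le_of_ae_le _ ?_
    filter_upwards [ae_le_essSup (f := fun t => eLpNorm (fun x => g (t, x)) 2 volume)
      (μ := timeMeasure)] with t ht
    rw [← eLpNorm_two_sq]
    exact pow_le_pow_left' ht 2

theorem normL1L2_eq (g : ℝ × ℝ → ℂ) : normL1L2 g = NL (fun p => ‖g p‖ₑ) :=
  lintegral_congr fun _ => eLpNorm_two _ _

theorem normXj_eq (j : ℕ) (g : ℝ × ℝ → ℂ) :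
    normXj P j g = p2 j * quad (VX P) (fun p => ‖g p‖ₑ) + quad VI (fun p => ‖g p‖ₑ) := by
  rw [normXj, normX_eq, normLinfL2_eq, p2_natCast]

theorem normXj_sq_le (j : ℕ) (g : ℝ × ℝ → ℂ) :
    normXj P j g ^ 2 ≤ 2 * VXI P j (fun p => ‖g p‖ₑ ^ 2) := by
  rw [normXj_eq]
  refine (add_sq_le_two _ _).trans (le_of_eq ?_)
  rw [mul_pow, quad_sq, quad_sq, p2_sq, VXI]

theorem VXI_le_normXj_sq (j : ℕ) (g : ℝ × ℝ → ℂ) :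
    VXI P j (fun p => ‖g p‖ₑ ^ 2) ≤ normXj P j g ^ 2 := by
  rw [normXj_eq, VXI, ← p2_sq, ← quad_sq (VX P) (fun p => ‖g p‖ₑ),
    ← quad_sq VI (fun p => ‖g p‖ₑ), add_sq, mul_pow]
  gcongr
  exact le_self_add

theorem normX_congr {g h : ℝ × ℝ → ℂ} (e : g =ᵐ[stMeasure] h) : normX P g = normX P h := by
  refine iSup_congr fun l => iSup_congr fun m => ?_
  rw [prod_restrict_Q, eLpNorm_congr_ae (ae_restrict_of_ae e)]

theorem normLinfL2_congr {g h : ℝ × ℝ → ℂ} (e : g =ᵐ[stMeasure] h) :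
    normLinfL2 g = normLinfL2 h := by
  refine essSup_congr_ae ?_
  filter_upwards [ae_ae_of_ae_st e] with t ht
  exact eLpNorm_congr_ae ht

theorem normXj_congr (j : ℕ) {g h : ℝ × ℝ → ℂ} (e : g =ᵐ[stMeasure] h) :
    normXj P j g = normXj P j h := by
  rw [normXj, normXj, normX_congr P e, normLinfL2_congr e]

theorem normYj_congr (j : ℕ) {g h : ℝ × ℝ → ℂ} (e : g =ᵐ[stMeasure] h) :
    normYj P j g = normYj P j h := by
  unfold normYj
  refine iInf_congr fun f₁ => iInf_congr fun f₂ => iInf_congr_Prop ?_ fun _ => rfl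
  exact and_congr_right fun _ => and_congr_right fun _ => ⟨e.symm.trans, e.trans⟩

theorem l2Sum_congr {N : (ℝ × ℝ → ℂ) → ℝ≥0∞}
    (hN : ∀ g h, g =ᵐ[stMeasure] h → N g = N h) (j : ℕ) {g h : ℝ × ℝ → ℂ}
    (e : g =ᵐ[stMeasure] h) : l2Sum P j N g = l2Sum P j N h := by
  unfold l2Sum
  refine congrArg (· ^ (1 / 2 : ℝ)) (tsum_congr fun m => congrArg (· ^ 2) ?_)
  exact hN _ _ (e.mono fun p hp => by dsimp only; rw [hp])

/-! ### Passing from the partition of unity to sharp cut-offs -/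

/-- The indicator function of neighbouring intervals. -/
noncomputable def nbr (m m' : ℤ) : ℝ≥0∞ := if m ≤ m' + 1 ∧ m' ≤ m + 1 then 1 else 0

theorem nbr_comm (m m' : ℤ) : nbr m m' = nbr m' m := by
  unfold nbr; simp only [and_comm]

theorem nbr_ne_top (m m' : ℤ) : nbr m m' ≠ ⊤ := by unfold nbr; split_ifs <;> simp

theorem tsum_nbr_le (m : ℤ) : ∑' m', nbr m m' ≤ 3 := by
  rw [tsum_eq_sum (s := Finset.Icc (m - 1) (m + 1)) fun m' hm' => ?_]
  · calc _ ≤ ∑ _m' ∈ Finset.Icc (m - 1) (m + 1), (1 : ℝ≥0∞) :=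
          Finset.sum_le_sum fun m' _ => by unfold nbr; split_ifs <;> simp
      _ = 3 := by
          rw [Finset.sum_const, Int.card_Icc, show (m + 1 + 1 - (m - 1)).toNat = 3 by omega]
          simp
  · rw [Finset.mem_Icc] at hm'
    exact if_neg (by omega)

theorem χ_sq_le (j : ℕ) (m : ℤ) (x : ℝ) : P.χ j m x ^ 2 ≤ 1 :=
  le_hasSum (P.sum_sq j x) m fun _ _ => sq_nonneg _

theorem enorm_χ_le (j : ℕ) (m : ℤ) (x : ℝ) : ‖(P.χ j m x : ℂ)‖ₑ ≤ 1 := by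
  rw [← ofReal_norm, Complex.norm_real, ← ENNReal.ofReal_one]
  refine ENNReal.ofReal_le_ofReal ?_
  rw [Real.norm_eq_abs]
  exact abs_le_one_iff_mul_self_le_one.2 (by simpa [sq] using χ_sq_le P j m x)

theorem measurable_χ (j : ℕ) (m : ℤ) : Measurable fun x => (P.χ j m x : ℂ) :=
  Complex.measurable_ofReal.comp (P.smooth j m).continuous.measurable

/-- The intervals have length at least `1`, so the neighbourhood of radius `1/2` of one of them
meets at most its two neighbours. -/
theorem near_of_χ_ne_zero {j : ℕ} {m m' : ℤ} {x : ℝ} (h : P.χ j m x ≠ 0)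
    (hx : x ∈ P.Q (2 * j) m') : nbr m m' = 1 := by
  have h1 := P.supp j m (subset_tsupport _ (Function.mem_support.2 h))
  obtain ⟨y, hy, hd⟩ := Metric.mem_thickening_iff.1 h1
  have hL : (1 : ℝ) ≤ 2 ^ (2 * j) := one_le_pow₀ (by norm_num)
  rw [Real.dist_eq, abs_lt] at hd
  simp only [SpacePartition.Q, gridInterval, Set.mem_Ico] at hx hy
  have e1 : ((m : ℝ) - m' - 2) * 2 ^ (2 * j) < 0 := by nlinarith
  have e2 : ((m' : ℝ) - m - 2) * 2 ^ (2 * j) < 0 := by nlinarith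
  have f1 : (m : ℝ) - m' - 2 < 0 := by
    by_contra hc; push Not at hc; nlinarith
  have f2 : (m' : ℝ) - m - 2 < 0 := by
    by_contra hc; push Not at hc; nlinarith
  refine if_pos ⟨?_, ?_⟩
  · have : (m : ℝ) < (m' + 2 : ℤ) := by push_cast; linarith
    have := Int.cast_lt.1 this
    omega
  · have : (m' : ℝ) < (m + 2 : ℤ) := by push_cast; linarith
    have := Int.cast_lt.1 this
    omega

/-- The weight `w` is `|χ|` for norms of `|u|` and `|χ|²` for functionals of `|u|²`; both are at
most `1` and vanish with `χ`. -/
theorem χ_mul_le (j : ℕ) (m : ℤ) {w : ℝ → ℝ≥0∞} (hw : ∀ x, w x ≤ 1)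
    (h0 : ∀ x, P.χ j m x = 0 → w x = 0) (F : ℝ × ℝ → ℝ≥0∞) (p : ℝ × ℝ) :
    w p.2 * F p ≤ ∑' m', nbr m m' * cut P (2 * j) m' F p := by
  by_cases h : P.χ j m p.2 = 0
  · simp [h0 _ h]
  · set m' := ⌊(p.2 - P.base (2 * j)) / 2 ^ (2 * j)⌋ with hm'
    have hx : p.2 ∈ P.Q (2 * j) m' := (mem_Q_iff P _ _ _).2 rfl
    refine le_trans ?_ (ENNReal.le_tsum m')
    rw [near_of_χ_ne_zero P h hx, one_mul, cut, Set.indicator_of_mem hx]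
    exact mul_le_mul' (hw _) le_rfl

theorem LatNorm.χ_mul_le {V : (ℝ × ℝ → ℝ≥0∞) → ℝ≥0∞} {A : ℝ≥0∞} (hV : LatNorm V A)
    (j : ℕ) (m : ℤ) {w : ℝ → ℝ≥0∞} (hwm : Measurable w) (hw : ∀ x, w x ≤ 1)
    (h0 : ∀ x, P.χ j m x = 0 → w x = 0) {F : ℝ × ℝ → ℝ≥0∞} (hF : Measurable F) :
    V (fun p => w p.2 * F p) ≤ ∑' m', nbr m m' * V (cut P (2 * j) m' F) := by
  have hc := fun m' => measurable_cut P (2 * j) m' hF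
  refine (hV.mono_tsum (by fun_prop) (fun m' => (hc m').const_mul _)
    (ae_of_all _ fun p => BilinearKdV.χ_mul_le P j m hw h0 F p)).trans
    (ENNReal.tsum_le_tsum fun m' => hV.smul (nbr_ne_top _ _) (hc m'))

theorem LatNorm.cut_le_χ {V : (ℝ × ℝ → ℝ≥0∞) → ℝ≥0∞} {A : ℝ≥0∞} (hV : LatNorm V A)
    (l : ℕ) (m : ℤ) {w : ℝ → ℝ≥0∞} (hwm : Measurable w) {c : ℝ≥0∞} (hc : c ≠ ⊤)
    (h : ∀ x ∈ P.Q l m, 1 ≤ c * w x) {F : ℝ × ℝ → ℝ≥0∞} (hF : Measurable F) :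
    V (cut P l m F) ≤ c * V (fun p => w p.2 * F p) := by
  refine (hV.mono (measurable_cut P l m hF) (by fun_prop) (ae_of_all _ fun p => ?_)).trans
    (hV.smul hc (by fun_prop))
  by_cases hp : p.2 ∈ P.Q l m
  · rw [cut, Set.indicator_of_mem hp, ← mul_assoc]
    exact mul_le_mul' (h _ hp) le_rfl
  · simp [cut, hp]

theorem exists_χ_lower : ∃ c : NNReal, ∀ j m, ∀ x ∈ P.Q (2 * j) m,
    1 ≤ (c : ℝ≥0∞) * ‖(P.χ j m x : ℂ)‖ₑ := by
  obtain ⟨c, hc, h⟩ := P.lower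
  refine ⟨(c⁻¹).toNNReal, fun j m x hx => ?_⟩
  have h1 := h j m x hx
  rw [← ofReal_norm, Complex.norm_real, Real.norm_of_nonneg (hc.le.trans h1)]
  change 1 ≤ ENNReal.ofReal c⁻¹ * _
  rw [← ENNReal.ofReal_mul (by positivity), ENNReal.one_le_ofReal, inv_mul_eq_div,
    le_div_iff₀ hc]
  linarith

/-! ### Equivalence of norms -/

theorem exists_normPair_X :
    ∃ C : NNReal, NormPair (fun j => l2Sum P j (normXj P j)) (NX P) C := by
  obtain ⟨c, hc⟩ := exists_χ_lower P
  have hsq : ∀ (j : ℕ) (g : ℝ × ℝ → ℂ), l2Sum P j (normXj P j) g ^ 2 =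
      ∑' m : ℤ, normXj P j (fun p => (P.χ j m p.2 : ℂ) * g p) ^ 2 := fun j g => rpow_half_sq _
  have hE : ∀ (j : ℕ) (g : ℝ × ℝ → ℂ), NX P j (fun p => ‖g p‖ₑ) ^ 2 =
      ∑' m : ℤ, VXI P j (cut P (2 * j) m fun p => ‖g p‖ₑ ^ 2) := fun j g => quad_sq _ _
  have hw : ∀ (j : ℕ) (m : ℤ), Measurable fun x => ‖(P.χ j m x : ℂ)‖ₑ ^ 2 := fun j m =>
    (measurable_χ P j m).enorm.pow_const 2
  have he : ∀ (j : ℕ) (m : ℤ) (g : ℝ × ℝ → ℂ), (fun p : ℝ × ℝ => ‖(P.χ j m p.2 : ℂ) * g p‖ₑ ^ 2) =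
      fun p => ‖(P.χ j m p.2 : ℂ)‖ₑ ^ 2 * ‖g p‖ₑ ^ 2 := fun j m g => by
    funext p; rw [enorm_mul, mul_pow]
  obtain ⟨D, hD⟩ : ∃ D : NNReal, (D : ℝ≥0∞) = p2 15 * p2 1 :=
    ⟨_, ENNReal.coe_toNNReal (ENNReal.mul_ne_top (p2_ne_top _) (p2_ne_top _))⟩
  refine ⟨3 + c + D, latNorm_NX P, fun j g hg => le_of_sq_le_sq ?_, fun j g hg => le_of_sq_le_sq ?_,
    fun j g h e => l2Sum_congr P (fun _ _ => normXj_congr P j) j e, fun k a G hG h1 h2 => ?_⟩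
  · rw [hsq, mul_pow, hE]
    have hm : Measurable fun p => ‖g p‖ₑ ^ 2 := hg.enorm.pow_const 2
    calc _ ≤ ∑' m : ℤ, 2 * ∑' m', nbr m m' * VXI P j (cut P (2 * j) m' fun p => ‖g p‖ₑ ^ 2) := by
          refine ENNReal.tsum_le_tsum fun m => (normXj_sq_le P j _).trans ?_
          gcongr
          rw [he]
          exact (latNorm_VXI P j).χ_mul_le P j m (hw j m)
            (fun x => pow_le_one' (enorm_χ_le P j m x) 2) (fun x hx => by simp [hx]) hm
      _ ≤ 2 * (3 * ∑' m, VXI P j (cut P (2 * j) m fun p => ‖g p‖ₑ ^ 2)) := by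
          rw [ENNReal.tsum_mul_left]
          gcongr
          exact schur_one _ _ fun m => by simp_rw [fun i => nbr_comm i m]; exact tsum_nbr_le m
      _ ≤ _ := by
          rw [← mul_assoc]
          gcongr
          -- The `2` comes from squaring the sum in `X_j` and the `3` from the neighbouring
          -- intervals.
          calc (2 * 3 : ℝ≥0∞) ≤ 3 ^ 2 := by norm_num
            _ ≤ _ := by
              gcongr; push_cast; rw [add_assoc]; exact le_self_add
  · rw [hE, mul_pow, hsq, ← ENNReal.tsum_mul_left]
    have hm : Measurable fun p => ‖g p‖ₑ ^ 2 := hg.enorm.pow_const 2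
    refine ENNReal.tsum_le_tsum fun m => ?_
    calc _ ≤ (c : ℝ≥0∞) ^ 2 * VXI P j (fun p => ‖(P.χ j m p.2 : ℂ)‖ₑ ^ 2 * ‖g p‖ₑ ^ 2) :=
          (latNorm_VXI P j).cut_le_χ P _ m (hw j m) (by simp) (fun x hx => by
            rw [← mul_pow]; exact one_le_pow_of_one_le' (hc j m x hx) 2) hm
      _ ≤ _ := by
          rw [← he]
          gcongr
          · rw [add_right_comm]; exact le_add_self
          · exact VXI_le_normXj_sq P j _
  · refine (NX_scale P (show k ≤ a + 7 by omega) hG).trans ?_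
    gcongr
    push_cast
    rw [hD]
    refine le_trans ?_ le_add_self
    gcongr
    refine p2_mono ?_
    have : (a : ℝ) ≤ k + 1 := by exact_mod_cast h2
    linarith

/-! ### The atomic norm of `Y` and its version for absolute values -/

theorem NY_le_normY {f : ℝ × ℝ → ℂ} : NY P (fun p => ‖f p‖ₑ) ≤ normY P f := by
  refine le_iInf fun c => le_iInf fun a => le_iInf fun ⟨ha, hs⟩ => ?_
  have hatom : ∀ k, NY P (fun p => ‖a k p‖ₑ) ≤ 1 := fun k => by
    obtain ⟨hm, l, m, h0, hn⟩ := ha k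
    have hmm := hm.stronglyMeasurable_mk.measurable
    have e := hm.ae_eq_mk
    refine (NY_mono P (H := cut P l m fun p => ‖hm.mk _ p‖ₑ) ?_).trans
      ((NY_le_of_supp P (measurable_cut P l m hmm.enorm) l m fun p hp => by simp [cut, hp]).trans ?_)
    · filter_upwards [e] with p hp
      by_cases h : p.2 ∈ P.Q l m
      · simp [cut, h, hp]
      · rw [h0 p fun hp' => h hp'.2]; simp
    · calc _ ≤ p2 (l / 2) * p2 (-(l : ℝ) / 2) := by
            gcongr
            refine (n2_mono (G := fun p => ‖a k p‖ₑ) ?_).trans ?_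
            · filter_upwards [e] with p hp
              rw [hp]; exact cut_le P _ _ _ _
            · rw [n2, ← eLpNorm_two]; exact hn
        _ = 1 := by rw [neg_div, p2_mul_neg]
  refine (NY_mono P (H := fun p => ∑' k, ‖c k‖ₑ * ‖a k p‖ₑ) ?_).trans
    ((NY_sum P _).trans (ENNReal.tsum_le_tsum fun k => ?_))
  · filter_upwards [hs] with p hp
    rw [← hp.tsum_eq]
    simp_rw [← enorm_mul]
    exact enorm_tsum_le_tsum_enorm
  · obtain ⟨hm, -⟩ := ha k
    have e := hm.ae_eq_mk
    calc _ ≤ NY P (fun p => ‖c k‖ₑ * ‖hm.mk _ p‖ₑ) := NY_mono P (e.mono fun p hp => by rw [hp])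
      _ ≤ ‖c k‖ₑ * NY P (fun p => ‖hm.mk _ p‖ₑ) :=
          (latNorm_NY P).smul (by simp) hm.stronglyMeasurable_mk.measurable.enorm
      _ ≤ ‖c k‖ₑ * NY P (fun p => ‖a k p‖ₑ) := by
          gcongr
          exact NY_mono P (e.mono fun p hp => by rw [hp])
      _ ≤ _ := mul_le_of_le_one_right (zero_le) (hatom k)

theorem NYj_le_normYj (j : ℕ) (f : ℝ × ℝ → ℂ) : NYj P j (fun p => ‖f p‖ₑ) ≤ normYj P j f := by
  refine le_iInf fun f₁ => le_iInf fun f₂ => le_iInf fun ⟨h1, h2, e⟩ => ?_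
  have m1 := h1.stronglyMeasurable_mk.measurable
  have m2 := h2.stronglyMeasurable_mk.measurable
  refine (NYj_le P j m1.enorm m2.enorm ?_).trans ?_
  · filter_upwards [e, h1.ae_eq_mk, h2.ae_eq_mk] with p hp hp1 hp2
    rw [hp, ← hp1, ← hp2]
    exact enorm_add_le _ _
  · rw [normL1L2_eq]
    refine add_le_add (mul_le_mul' le_rfl
      ((NY_mono P (h1.ae_eq_mk.mono fun p hp => by rw [hp])).trans (NY_le_normY P))) ?_
    refine lintegral_mono_ae ?_
    filter_upwards [ae_ae_of_ae_st h2.ae_eq_mk] with t ht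
    refine ENNReal.rpow_le_rpow (lintegral_mono_ae ?_) (by norm_num)
    filter_upwards [ht] with x hx
    rw [hx]

end

section

variable (P : SpacePartition)

/-- The normalised pieces of `f` in an atomic decomposition which is proportional to `F`. -/
noncomputable def pieceOf (f : ℝ × ℝ → ℂ) (F : ℕ × ℤ → ℝ × ℝ → ℝ≥0∞) (i : ℕ × ℤ) (p : ℝ × ℝ) : ℂ :=
  (Set.Icc (0 : ℝ) 1 ×ˢ P.Q i.1 i.2).indicator
    (fun p => (((F i p).toReal / (∑' i, F i p).toReal / (p2 (i.1 / 2) * n2 (F i)).toReal : ℝ) : ℂ) *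
      f p) p

/-- The piece is `f` times the proportion `F_i / ∑ F`, divided by the coefficient `2^(l/2) ‖F_i‖`.
Since `|f| ≤ ∑ F`, its absolute value is at most `F_i` divided by this coefficient, which is the
normalisation of an atom. -/
theorem isAtom_pieceOf {f : ℝ × ℝ → ℂ} (hf : Measurable f) {F : ℕ × ℤ → ℝ × ℝ → ℝ≥0∞}
    (hF : IsDecomp P (fun p => ‖f p‖ₑ) F) (hfin : ∀ᵐ p ∂stMeasure, ∑' i, F i p ≠ ⊤)
    (i : ℕ × ℤ) (hi : n2 (F i) ≠ ⊤) : IsAtom P (pieceOf P f F i) := by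
  have hS : Measurable fun p => ∑' i, F i p := Measurable.tsum hF.meas
  have hFi := hF.meas i
  have hmeas : Measurable (pieceOf P f F i) := by
    refine Measurable.indicator ?_ (measurableSet_Icc.prod (measurableSet_Q P _ _))
    exact (Complex.measurable_ofReal.comp
      (((hFi.ennreal_toReal).div hS.ennreal_toReal).div_const _)).mul hf
  refine ⟨hmeas.aestronglyMeasurable, i.1, i.2, fun p hp => Set.indicator_of_notMem hp _, ?_⟩
  set c := p2 (i.1 / 2) * n2 (F i) with hc
  have hctop : c ≠ ⊤ := ENNReal.mul_ne_top (p2_ne_top _) hi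
  by_cases hc0 : c = 0
  · have : pieceOf P f F i = fun _ => 0 := by
      funext p
      simp [pieceOf, ← hc, hc0]
    rw [this]
    simp
  have hle : ∀ᵐ p ∂stMeasure, ‖pieceOf P f F i p‖ₑ ≤ c⁻¹ * F i p := by
    filter_upwards [hF.le, hfin] with p h1 h2
    have h3 : F i p ≤ ∑' i, F i p := ENNReal.le_tsum i
    refine (enorm_indicator_le_enorm_self _ _).trans ?_
    rw [enorm_mul]
    have h4 : ‖(((F i p).toReal / (∑' i, F i p).toReal / c.toReal : ℝ) : ℂ)‖ₑ =
        ENNReal.ofReal ((F i p).toReal / (∑' i, F i p).toReal / c.toReal) := by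
      rw [← ofReal_norm, Complex.norm_real, Real.norm_of_nonneg (by positivity)]
    rw [h4]
    by_cases h0 : ∑' i, F i p = 0
    · rw [h0]; simp
    have hSpos : 0 < (∑' i, F i p).toReal := ENNReal.toReal_pos h0 h2
    have hcpos : 0 < c.toReal := ENNReal.toReal_pos hc0 hctop
    rw [ENNReal.ofReal_div_of_pos hcpos, ENNReal.ofReal_div_of_pos hSpos, ENNReal.ofReal_toReal h2,
      ENNReal.ofReal_toReal (ne_top_of_le_ne_top h2 h3), ENNReal.ofReal_toReal hctop]
    calc _ ≤ F i p / (∑' i, F i p) / c * ∑' i, F i p := by gcongr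
      _ = c⁻¹ * F i p * ((∑' i, F i p)⁻¹ * ∑' i, F i p) := by
        simp only [div_eq_mul_inv]; ring
      _ = _ := by rw [ENNReal.inv_mul_cancel h0 h2, mul_one]
  rw [eLpNorm_two]
  change n2 (fun p => ‖pieceOf P f F i p‖ₑ) ≤ _
  refine (n2_mono hle).trans ?_
  rw [n2_const_mul _ hFi]
  have hn0 : n2 (F i) ≠ 0 := fun h => hc0 (by rw [hc, h, mul_zero])
  rw [hc, ENNReal.mul_inv (Or.inl (p2_ne_zero _)) (Or.inl (p2_ne_top _)), mul_assoc,
    ENNReal.inv_mul_cancel hn0 hi, mul_one]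
  rw [p2, ← ENNReal.rpow_neg, neg_div]

theorem ae_mem_Icc : ∀ᵐ p ∂stMeasure, p.1 ∈ Set.Icc (0 : ℝ) 1 :=
  ae_st_of_ae_time (ae_restrict_mem measurableSet_Icc)

/-- The proportions `F_i / ∑ F` add up to `1` wherever `0 < ∑ F < ∞`, and `f = 0` where `∑ F = 0`.
-/
theorem hasSum_pieceOf {f : ℝ × ℝ → ℂ} {F : ℕ × ℤ → ℝ × ℝ → ℝ≥0∞}
    (hF : IsDecomp P (fun p => ‖f p‖ₑ) F) (hfin : ∀ᵐ p ∂stMeasure, ∑' i, F i p ≠ ⊤)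
    (hn : ∀ i, n2 (F i) ≠ ⊤) :
    ∀ᵐ p ∂stMeasure, HasSum (fun i : ℕ × ℤ =>
      (((p2 (i.1 / 2) * n2 (F i)).toReal : ℝ) : ℂ) * pieceOf P f F i p) (f p) := by
  -- If `‖F_i‖ = 0`, the coefficient of the piece is zero and its contribution is lost; this is
  -- harmless because then `F_i = 0` almost everywhere.
  have h0 : ∀ᵐ p ∂stMeasure, ∀ i, n2 (F i) = 0 → F i p = 0 := by
    refine ae_all_iff.2 fun i => ?_
    by_cases h : n2 (F i) = 0
    · have h1 : ∫⁻ p, F i p ^ 2 ∂stMeasure = 0 := by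
        rw [← rpow_half_sq (∫⁻ p, F i p ^ 2 ∂stMeasure), ← n2, h, zero_pow two_ne_zero]
      rw [lintegral_eq_zero_iff ((hF.meas i).pow_const 2)] at h1
      filter_upwards [h1] with p hp _
      simpa using hp
    · exact Eventually.of_forall fun p hp => absurd hp h
  filter_upwards [hF.le, hfin, h0, ae_mem_Icc] with p h1 h2 h3 h4
  have hsum : HasSum (fun i => (F i p).toReal) (∑' i, F i p).toReal :=
    ENNReal.tsum_toReal_eq (fun i h => h2 (ENNReal.tsum_eq_top_of_eq_top ⟨i, h⟩)) ▸
      ENNReal.hasSum_toReal h2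
  have hterm : ∀ i : ℕ × ℤ, (((p2 (i.1 / 2) * n2 (F i)).toReal : ℝ) : ℂ) * pieceOf P f F i p =
      (((F i p).toReal : ℝ) : ℂ) * ((((∑' i, F i p).toReal⁻¹ : ℝ) : ℂ) * f p) := fun i => by
    by_cases hi : n2 (F i) = 0
    · rw [h3 i hi, hi]; simp
    by_cases hq : p.2 ∈ P.Q i.1 i.2
    · have hc : (p2 (i.1 / 2) * n2 (F i)).toReal ≠ 0 :=
        (ENNReal.toReal_pos (mul_ne_zero (p2_ne_zero _) hi)
          (ENNReal.mul_ne_top (p2_ne_top _) (hn i))).ne'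
      have hc' : (((p2 (i.1 / 2) * n2 (F i)).toReal : ℝ) : ℂ) ≠ 0 := by exact_mod_cast hc
      have hmem : p ∈ Set.Icc (0 : ℝ) 1 ×ˢ P.Q i.1 i.2 := ⟨h4, hq⟩
      rw [pieceOf, Set.indicator_of_mem hmem, Complex.ofReal_div, Complex.ofReal_div,
        Complex.ofReal_inv, ← mul_assoc, mul_div_cancel₀ _ hc', div_eq_mul_inv, mul_assoc]
    · rw [hF.supp i p hq, pieceOf, Set.indicator_of_notMem (fun h => hq h.2)]; simp
  simp_rw [hterm]
  have h5 := (Complex.hasSum_ofReal.2 hsum).mul_right ((((∑' i, F i p).toReal⁻¹ : ℝ) : ℂ) * f p)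
  refine (congrArg (HasSum _) ?_).mp h5
  by_cases hz : ∑' i, F i p = 0
  · rw [hz] at h1
    have : f p = 0 := by simpa using h1
    rw [this]; simp
  · have hc : (((∑' i, F i p).toReal : ℝ) : ℂ) ≠ 0 := by
      exact_mod_cast (ENNReal.toReal_pos hz h2).ne'
    rw [Complex.ofReal_inv, mul_inv_cancel_left₀ hc]

theorem normY_le {f : ℝ × ℝ → ℂ} {c : ℕ → ℂ} {a : ℕ → ℝ × ℝ → ℂ} (ha : ∀ k, IsAtom P (a k))
    (h : ∀ᵐ p ∂stMeasure, HasSum (fun k => c k * a k p) (f p)) : normY P f ≤ ∑' k, ‖c k‖ₑ :=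
  iInf_le_of_le c (iInf_le_of_le a (iInf_le_of_le ⟨ha, h⟩ le_rfl))

theorem normYj_le (j : ℕ) {f f₁ f₂ : ℝ × ℝ → ℂ} (h₁ : AEStronglyMeasurable f₁ stMeasure)
    (h₂ : AEStronglyMeasurable f₂ stMeasure) (h : f =ᵐ[stMeasure] f₁ + f₂) :
    normYj P j f ≤ p2 (-j) * normY P f₁ + normL1L2 f₂ :=
  iInf_le_of_le f₁ (iInf_le_of_le f₂ (iInf_le_of_le ⟨h₁, h₂, h⟩ le_rfl))

/-- A decomposition which only dominates `|f|` becomes an exact atomic decomposition of `f` by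
distributing `f` in proportion to the pieces. Hence the complex valued atomic norm depends on `|f|`
alone. -/
theorem normY_le_NY {f : ℝ × ℝ → ℂ} (hf : Measurable f) : normY P f ≤ NY P (fun p => ‖f p‖ₑ) := by
  rw [← one_mul (NY P _)]
  refine le_mul_NY P hf.enorm (by simp) fun F hF => ?_
  rw [one_mul]
  by_cases htop : ∑' i : ℕ × ℤ, p2 (i.1 / 2) * n2 (F i) = ⊤
  · rw [htop]; exact le_top
  have hn : ∀ i, n2 (F i) ≠ ⊤ := fun i h => by
    refine htop (top_le_iff.1 (le_trans (le_of_eq ?_) (ENNReal.le_tsum i)))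
    rw [h, ENNReal.mul_top (p2_ne_zero _)]
  have hS : Measurable fun p => ∑' i, F i p := Measurable.tsum hF.meas
  -- The weights `2^(l/2)` are at least `1`, so the sum of the pieces is in `L²` and finite almost
  -- everywhere.
  have hfin : ∀ᵐ p ∂stMeasure, ∑' i, F i p ≠ ⊤ := by
    have h1 : n2 (fun p => ∑' i, F i p) ≠ ⊤ := by
      refine ne_top_of_le_ne_top htop ((n2_tsum_le _ hF.meas).trans
        (ENNReal.tsum_le_tsum fun i => ?_))
      exact le_mul_of_one_le_left (zero_le) (one_le_p2 (by positivity))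
    have h2 : ∫⁻ p, (∑' i, F i p) ^ 2 ∂stMeasure ≠ ⊤ := fun h => h1 (by simp [n2, h])
    filter_upwards [ae_lt_top (hS.pow_const 2) h2] with p hp h
    simp [h] at hp
  let e : ℕ ≃ ℕ × ℤ := (Denumerable.eqv (ℕ × ℤ)).symm
  refine (normY_le P (c := fun k => (((p2 ((e k).1 / 2) * n2 (F (e k))).toReal : ℝ) : ℂ))
    (a := fun k => pieceOf P f F (e k))
    (fun k => isAtom_pieceOf P hf hF hfin _ (hn _)) ?_).trans ?_
  · filter_upwards [hasSum_pieceOf P hF hfin hn] with p hp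
    exact (e.hasSum_iff (f := fun i : ℕ × ℤ =>
      (((p2 (i.1 / 2) * n2 (F i)).toReal : ℝ) : ℂ) * pieceOf P f F i p)).2 hp
  · rw [← e.tsum_eq (fun i : ℕ × ℤ => p2 (i.1 / 2) * n2 (F i))]
    refine ENNReal.tsum_le_tsum fun k => ?_
    rw [← ofReal_norm, Complex.norm_real, Real.norm_of_nonneg ENNReal.toReal_nonneg]
    exact ENNReal.ofReal_toReal_le

/-- A bound `|f| ≤ F₁ + F₂` is turned into a splitting of `f` itself by restricting `f` to the set
where `F₁` is the larger and to its complement; on each set `|f|` is at most twice the larger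
function. -/
theorem normYj_le_NYj (j : ℕ) {f : ℝ × ℝ → ℂ} (hf : Measurable f) :
    normYj P j f ≤ 2 * NYj P j (fun p => ‖f p‖ₑ) := by
  refine le_mul_NYj P j hf.enorm (by simp) fun F₁ F₂ h₁ h₂ h => ?_
  have hs : MeasurableSet {p | F₂ p ≤ F₁ p} := measurableSet_le h₂ h₁
  set f₁ := {p | F₂ p ≤ F₁ p}.indicator f with hf₁
  set f₂ := {p | F₂ p ≤ F₁ p}ᶜ.indicator f with hf₂
  have m₁ : Measurable f₁ := hf.indicator hs
  have m₂ : Measurable f₂ := hf.indicator hs.compl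
  refine (normYj_le P j m₁.aestronglyMeasurable m₂.aestronglyMeasurable (.of_eq ?_)).trans ?_
  · rw [hf₁, hf₂, Set.indicator_self_add_compl]
  rw [mul_add, ← mul_assoc, mul_comm 2 (p2 _), mul_assoc]
  refine add_le_add (mul_le_mul' le_rfl ((normY_le_NY P m₁).trans ?_)) ?_
  · refine ((latNorm_NY P).mono m₁.enorm (h₁.const_mul 2) ?_).trans
      ((latNorm_NY P).smul (by simp) h₁)
    filter_upwards [h] with p hp
    by_cases hx : F₂ p ≤ F₁ p
    · rw [hf₁, Set.indicator_of_mem (show p ∈ {p | F₂ p ≤ F₁ p} from hx), two_mul]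
      exact hp.trans (by gcongr)
    · rw [hf₁, Set.indicator_of_notMem (show p ∉ {p | F₂ p ≤ F₁ p} from hx)]; simp
  · rw [normL1L2_eq]
    refine (latNorm_NL.mono m₂.enorm (h₂.const_mul 2) ?_).trans
      (latNorm_NL.smul (by simp) h₂)
    filter_upwards [h] with p hp
    by_cases hx : F₂ p ≤ F₁ p
    · rw [hf₂, Set.indicator_of_notMem (show p ∉ {p | F₂ p ≤ F₁ p}ᶜ from fun h' => h' hx)]; simp
    · rw [hf₂, Set.indicator_of_mem (show p ∈ {p | F₂ p ≤ F₁ p}ᶜ from hx), two_mul]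
      exact hp.trans (by gcongr; exact (not_le.1 hx).le)

theorem exists_normPair_Y :
    ∃ C : NNReal, NormPair (fun j => l2Sum P j (normYj P j)) (NYb P) C := by
  obtain ⟨c, hc⟩ := exists_χ_lower P
  have hsq : ∀ (j : ℕ) (g : ℝ × ℝ → ℂ), l2Sum P j (normYj P j) g ^ 2 =
      ∑' m : ℤ, normYj P j (fun p => (P.χ j m p.2 : ℂ) * g p) ^ 2 := fun j g => rpow_half_sq _
  have hE : ∀ (j : ℕ) (g : ℝ × ℝ → ℂ), NYb P j (fun p => ‖g p‖ₑ) ^ 2 =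
      ∑' m : ℤ, NYj P j (cut P (2 * j) m fun p => ‖g p‖ₑ) ^ 2 := fun j g => l2cut_sq P _ _ _
  have hw : ∀ (j : ℕ) (m : ℤ), Measurable fun x => ‖(P.χ j m x : ℂ)‖ₑ := fun j m =>
    (measurable_χ P j m).enorm
  have he : ∀ (j : ℕ) (m : ℤ) (g : ℝ × ℝ → ℂ), (fun p : ℝ × ℝ => ‖(P.χ j m p.2 : ℂ) * g p‖ₑ) =
      fun p => ‖(P.χ j m p.2 : ℂ)‖ₑ * ‖g p‖ₑ := fun j m g => by
    funext p; rw [enorm_mul]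
  obtain ⟨D, hD⟩ : ∃ D : NNReal, (D : ℝ≥0∞) = p2 11 :=
    ⟨_, ENNReal.coe_toNNReal (p2_ne_top _)⟩
  refine ⟨6 + c + D, latNorm_NYb P, fun j g hg => le_of_sq_le_sq ?_,
    fun j g hg => le_of_sq_le_sq ?_,
    fun j g h e => l2Sum_congr P (fun _ _ => normYj_congr P j) j e, fun k a G hG h1 h2 => ?_⟩
  · rw [hsq, mul_pow, hE]
    have hm : Measurable fun p => ‖g p‖ₑ := hg.enorm
    calc _ ≤ ∑' m : ℤ, (2 * ∑' m', nbr m m' * NYj P j (cut P (2 * j) m' fun p => ‖g p‖ₑ)) ^ 2 := by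
          refine ENNReal.tsum_le_tsum fun m => pow_le_pow_left' ?_ 2
          refine (normYj_le_NYj P j (f := fun p => (P.χ j m p.2 : ℂ) * g p) (((measurable_χ P j m).comp measurable_snd).mul hg)).trans ?_
          gcongr
          rw [he]
          exact (latNorm_NYj P j).χ_mul_le P j m (hw j m)
            (fun x => enorm_χ_le P j m x) (fun x hx => by simp [hx]) hm
      _ ≤ 2 ^ 2 * (3 * 3 * ∑' m, NYj P j (cut P (2 * j) m fun p => ‖g p‖ₑ) ^ 2) := by
          simp_rw [mul_pow]
          rw [ENNReal.tsum_mul_left]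
          gcongr
          exact schur_sq _ _ tsum_nbr_le
            fun m => by simp_rw [fun i => nbr_comm i m]; exact tsum_nbr_le m
      _ ≤ _ := by
          rw [← mul_assoc]
          gcongr
          calc (2 ^ 2 * (3 * 3) : ℝ≥0∞) = 6 ^ 2 := by norm_num
            _ ≤ _ := by
              gcongr; push_cast; rw [add_assoc]; exact le_self_add
  · rw [hE, mul_pow, hsq, ← ENNReal.tsum_mul_left]
    have hm : Measurable fun p => ‖g p‖ₑ := hg.enorm
    refine ENNReal.tsum_le_tsum fun m => ?_
    rw [← mul_pow]
    refine pow_le_pow_left' ?_ 2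
    calc _ ≤ (c : ℝ≥0∞) * NYj P j (fun p => ‖(P.χ j m p.2 : ℂ)‖ₑ * ‖g p‖ₑ) :=
          (latNorm_NYj P j).cut_le_χ P _ m (hw j m) (by simp) (hc j m) hm
      _ ≤ _ := by
          rw [← he]
          gcongr
          · rw [add_right_comm]; exact le_add_self
          · exact NYj_le_normYj P j _
  · refine (NYb_scale P (show k ≤ a + 3 by omega) (by omega) hG).trans ?_
    gcongr
    push_cast
    rw [hD]
    exact le_add_self

end

theorem normPair_H : NormPair (fun _ g => NH fun p => ‖g p‖ₑ) (fun _ => NH) 1 where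
  lat _ := latNorm_NH
  upper _ _ _ := by simp
  lower _ _ _ := by simp
  congr _ g h e := by
    have : ∀ g h : ℝ × ℝ → ℂ, g =ᵐ[stMeasure] h →
        NH (fun p => ‖g p‖ₑ) ≤ NH (fun p => ‖h p‖ₑ) := fun g h e => by
      rw [NH, ← normLinfL2_eq, ← normLinfL2_eq, normLinfL2_congr e]
    exact le_antisymm (this g h e) (this h g e.symm)
  scale _ _ _ _ _ _ := by simp

/-! ### Bilinear estimates for frequency localised functions -/

/-- `G` is reproduced, up to a constant, by averaging at scale `2 ^ (-a)`. -/
def SelfRep (c : NNReal) (a : ℕ) (G : ℝ × ℝ → ℝ≥0∞) : Prop :=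
  ∀ᵐ p ∂stMeasure, G p ≤ c * cv (kap a) G p

/-- The factor of lower frequency is bounded by Bernstein's inequality and taken out of any lattice
norm. The constant is `4 · 4 · 2`: the lattice constant, the mass of the kernel, and the factor in
Bernstein's inequality. -/
theorem LatNorm.cv_kap_mul_le {V : (ℝ × ℝ → ℝ≥0∞) → ℝ≥0∞} (hV : LatNorm V 4) (k : ℕ) {b : ℕ}
    {c : NNReal} {G H : ℝ × ℝ → ℝ≥0∞} (hG : Measurable G) (hH : Measurable H)
    (h : SelfRep c b H) (hfin : NH H ≠ ⊤) :
    V (cv (kap k) fun p => G p * H p) ≤ 32 * c * (p2 (b / 2) * (V G * NH H)) := by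
  refine (hV.cv_mul_le (measurable_kap k) (lintegral_kap_ne_top k) hG hH (ENNReal.mul_ne_top
    (by simp) (ENNReal.mul_ne_top (ENNReal.mul_ne_top (by simp) (p2_ne_top _)) hfin))
    (ae_le_of_le_cv hH h)).trans ?_
  calc _ ≤ 4 * 4 * (c * (2 * p2 (b / 2) * NH H)) * V G := by
        gcongr; exact lintegral_kap_le k
    _ = _ := by ring

/-- The case distinction in `Contrib`: the first frequency, the second frequency, or none of them
dominates. -/
noncomputable def byCase (x y z : ℕ → ℕ → ℕ → ℝ) (k a b : ℕ) : ℝ :=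
  if b + 5 ≤ a then x k a b else if a + 5 ≤ b then y k a b else z k a b

/-- Bilinear estimates for the contribution of two frequencies to a third one. -/
def PairBound (c K : NNReal) (E E₁ : ℕ → (ℝ × ℝ → ℝ≥0∞) → ℝ≥0∞) (x y z : ℕ → ℕ → ℕ → ℝ) : Prop :=
  ∀ k a b G H, Measurable G → Measurable H → SelfRep c a G → SelfRep c b H → NH G ≠ ⊤ →
    NH H ≠ ⊤ → Contrib k (a, b) →
    E k (cv (kap k) fun p => G p * H p) ≤ K * (p2 (byCase x y z k a b) * (E₁ a G * E₁ b H))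

theorem exists_pairBound_H (c : NNReal) : ∃ K : NNReal,
    PairBound c K (fun _ => NH) (fun _ => NH) (fun _ _ b => b / 2) (fun _ a _ => a / 2)
      (fun k _ _ => k / 2) := by
  refine ⟨32 * c + 4, fun k a b G H hG hH sG sH fG fH hc => ?_⟩
  unfold byCase
  push_cast
  split_ifs with h1 h2
  · refine (latNorm_NH.cv_kap_mul_le k hG hH sH fH).trans ?_
    gcongr
    exact le_self_add
  · simp_rw [mul_comm (G _)]
    refine (latNorm_NH.cv_kap_mul_le k hH hG sG fG).trans ?_
    rw [mul_comm (NH H)]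
    gcongr
    exact le_self_add
  · refine (NH_highHigh k hG hH fH).trans ?_
    rw [mul_assoc, mul_assoc]
    gcongr
    exact le_add_self

variable (P : SpacePartition)

theorem exists_pairBound_X (c : NNReal) : ∃ K : NNReal,
    PairBound c K (NX P) (NX P) (fun _ _ b => b / 2) (fun _ a _ => a / 2)
      (fun k a _ => k / 2 + (a - k)) := by
  obtain ⟨D, hD⟩ : ∃ D : NNReal, (D : ℝ≥0∞) = p2 15 * p2 3 :=
    ⟨_, ENNReal.coe_toNNReal (ENNReal.mul_ne_top (p2_ne_top _) (p2_ne_top _))⟩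
  obtain ⟨D', hD'⟩ : ∃ D : NNReal, (D : ℝ≥0∞) = p2 17 := ⟨_, ENNReal.coe_toNNReal (p2_ne_top _)⟩
  have key : ∀ k a b G H, Measurable G → Measurable H → SelfRep c b H → NH H ≠ ⊤ → a ≤ k + 3 →
      k ≤ a + 3 → NX P k (cv (kap k) fun p => G p * H p) ≤
        32 * c * D * (p2 (b / 2) * (NX P a G * NX P b H)) :=
      fun k a b G H hG hH sH fH h1 h2 => by
    refine ((latNorm_NX P k).cv_kap_mul_le k hG hH sH fH).trans ?_
    calc _ ≤ 32 * c * (p2 (b / 2) * ((D * NX P a G) * NX P b H)) := by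
          gcongr
          · refine (NX_scale P (show k ≤ a + 7 by omega) hG).trans ?_
            rw [hD]
            gcongr
            refine p2_mono ?_
            have : (a : ℝ) ≤ k + 3 := by exact_mod_cast h1
            linarith
          · exact NH_le_NX P b hH
      _ = _ := by ring
  refine ⟨32 * c * D + D', fun k a b G H hG hH sG sH fG fH hc => ?_⟩
  unfold Contrib at hc
  dsimp only at hc
  unfold byCase
  push_cast
  split_ifs with h1 h2
  · refine (key k a b G H hG hH sH fH (by omega) (by omega)).trans ?_
    gcongr
    exact le_self_add
  · simp_rw [mul_comm (G _)]
    refine (key k b a H G hH hG sG fG (by omega) (by omega)).trans ?_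
    rw [mul_comm (NX P b H)]
    gcongr
    exact le_self_add
  · refine (NX_highHigh P (show k ≤ a + 7 by omega) hG hH fH).trans ?_
    rw [hD', mul_assoc, mul_assoc]
    gcongr
    · exact le_add_self
    · exact NH_le_NX P b hH

/-- Separated frequencies use the atoms and gain the inverse of the larger frequency; comparable
ones use `L¹ L²` and the bounds in `L^∞ L²` alone. -/
theorem exists_pairBound_Y (c : NNReal) : ∃ K : NNReal,
    PairBound c K (NYb P) (NX P) (fun _ a b => 3 / 2 * b - a) (fun _ a b => 3 / 2 * a - b)
      (fun k _ _ => k / 2) := by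
  obtain ⟨D, hD⟩ : ∃ D : NNReal, (D : ℝ≥0∞) = (p2 22 * c ^ 2 * sumInv) ^ (1 / 2 : ℝ) :=
    ⟨_, ENNReal.coe_toNNReal (ENNReal.rpow_ne_top_of_nonneg (by norm_num) (ENNReal.mul_ne_top
      (ENNReal.mul_ne_top (p2_ne_top _) (by simp)) sumInv_ne_top))⟩
  refine ⟨D + 4, fun k a b G H hG hH sG sH fG fH hc => ?_⟩
  unfold Contrib at hc
  dsimp only at hc
  unfold byCase
  push_cast
  split_ifs with h1 h2
  · refine (NYb_lowHigh P (show b ≤ k by omega) (show a ≤ k + 3 by omega) (by omega) hG hH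
      sH).trans ?_
    rw [hD, mul_assoc, mul_assoc]
    gcongr
    exact le_self_add
  · simp_rw [mul_comm (G _)]
    refine (NYb_lowHigh P (show a ≤ k by omega) (show b ≤ k + 3 by omega) (by omega) hH hG
      sG).trans ?_
    rw [hD, mul_assoc, mul_assoc, mul_comm (NX P b H)]
    gcongr
    exact le_self_add
  · refine (NYb_highHigh P k hG hH fH).trans ?_
    rw [mul_assoc, mul_assoc]
    gcongr
    · exact le_add_self
    · exact NH_le_NX P a hG
    · exact NH_le_NX P b hH

/-- Only the low factor has to be localised in frequency and in `L²`; the high one may be any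
function, so that a factor measured in `Y` is allowed. -/
theorem exists_lowHigh_XY (c : NNReal) : ∃ K : NNReal, ∀ k a b G H, Measurable G → Measurable H →
    SelfRep c a G → NH G ≠ ⊤ → b ≤ k + 3 → k ≤ b + 3 →
    NYb P k (cv (kap k) fun p => G p * H p) ≤ K * (p2 (a / 2) * (NX P a G * NYb P b H)) := by
  obtain ⟨D, hD⟩ : ∃ D : NNReal, (D : ℝ≥0∞) = p2 11 := ⟨_, ENNReal.coe_toNNReal (p2_ne_top _)⟩
  refine ⟨32 * c * D, fun k a b G H hG hH sG fG h1 h2 => ?_⟩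
  simp_rw [mul_comm (G _)]
  refine ((latNorm_NYb P k).cv_kap_mul_le k hH hG sG fG).trans ?_
  push_cast
  calc _ ≤ 32 * c * (p2 (a / 2) * ((D * NYb P b H) * NX P a G)) := by
        gcongr
        · rw [hD]
          exact NYb_scale P (show k ≤ b + 3 by omega) (by omega) hH
        · exact NH_le_NX P a hG
    _ = _ := by ring

/-- Weights, gain and block norms combine into one inequality between exponents, so that each
estimate ends in linear arithmetic. -/
theorem p2_mul_weighted_le {K : NNReal} {e : ℝ} {N₁ N₂ B : ℝ≥0∞} (h : B ≤ K * (p2 e * (N₁ * N₂))) {x r g y z : ℝ}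
    (hx : x + e ≤ r + g + y + z) :
    p2 x * B ≤ K * p2 r * (p2 g * ((p2 y * N₁) * (p2 z * N₂))) := by
  calc _ ≤ p2 x * (K * (p2 e * (N₁ * N₂))) := by gcongr
    _ = K * (N₁ * N₂) * p2 (x + e) := by rw [p2_add]; ring
    _ ≤ K * (N₁ * N₂) * p2 (r + g + y + z) := by gcongr; exact p2_mono hx
    _ = _ := by rw [p2_add, p2_add, p2_add]; ring

theorem gain_eq (δ : ℝ) (k a b : ℕ) :
    gain δ k (a, b) = p2 (byCase (fun _ _ b => -(δ * b)) (fun _ a _ => -(δ * a))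
      (fun k _ _ => -(δ * k)) k a b) := by
  unfold gain byCase
  split_ifs <;> rfl

/-! ### Local integrability of functions with finite norms -/

theorem lintegral_cut_le_n2 (l : ℕ) (m : ℤ) {F : ℝ × ℝ → ℝ≥0∞} (hF : Measurable F) :
    ∫⁻ p, cut P l m F p ∂stMeasure ≤ p2 (l / 2) * n2 F := by
  refine le_of_sq_le_sq ?_
  rw [mul_pow, n2, rpow_half_sq, p2_sq]
  have h1 : ∫⁻ p : ℝ × ℝ, (P.Q l m).indicator (1 : ℝ → ℝ≥0∞) p.2 ^ 2 ∂stMeasure = p2 l := by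
    have : ∀ p : ℝ × ℝ, (P.Q l m).indicator (1 : ℝ → ℝ≥0∞) p.2 ^ 2 =
        (P.Q l m).indicator (1 : ℝ → ℝ≥0∞) p.2 := fun p => by
      by_cases h : p.2 ∈ P.Q l m <;> simp [h]
    simp_rw [this]
    rw [lintegral_st (by fun_prop)]
    simp only [lintegral_indicator_one (measurableSet_Q P l m), lintegral_const, measure_univ,
      mul_one]
    rw [SpacePartition.Q, gridInterval, Real.volume_Ico, ← ofReal_two_pow]
    congr 1; ring
  refine (lintegral_mul_sq_le (by fun_prop) hF.aemeasurable).trans ?_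
  rw [h1]
  gcongr
  exact p2_mono (by linarith)

theorem lintegral_cut_le_NY (l : ℕ) (m : ℤ) {F : ℝ × ℝ → ℝ≥0∞} (hF : Measurable F) :
    ∫⁻ p, cut P l m F p ∂stMeasure ≤ p2 (l / 2) * NY P F := by
  refine le_mul_NY P hF (p2_ne_top _) fun D hD => ?_
  calc _ ≤ ∫⁻ p, ∑' i, cut P l m (D i) p ∂stMeasure := by
        refine lintegral_mono_ae ?_
        filter_upwards [hD.le] with p hp
        simp only [cut]
        rw [ENNReal.tsum_mul_left]
        gcongr
    _ = ∑' i, ∫⁻ p, cut P l m (D i) p ∂stMeasure :=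
        lintegral_tsum fun i => (measurable_cut P l m (hD.meas i)).aemeasurable
    _ ≤ ∑' i : ℕ × ℤ, p2 (l / 2) * (p2 (i.1 / 2) * n2 (D i)) := by
        refine ENNReal.tsum_le_tsum fun i => (lintegral_cut_le_n2 P l m (hD.meas i)).trans ?_
        gcongr
        exact le_mul_of_one_le_left (zero_le) (one_le_p2 (by positivity))
    _ = _ := ENNReal.tsum_mul_left

theorem lintegral_cut_le_NL (l : ℕ) (m : ℤ) {F : ℝ × ℝ → ℝ≥0∞} (hF : Measurable F) :
    ∫⁻ p, cut P l m F p ∂stMeasure ≤ p2 (l / 2) * NL F := by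
  rw [lintegral_st (measurable_cut P l m hF), NL, ← lintegral_const_mul' _ _ (p2_ne_top _)]
  refine lintegral_mono fun t => le_of_sq_le_sq ?_
  rw [mul_pow, rpow_half_sq, p2_sq]
  have h1 : ∫⁻ x, (P.Q l m).indicator (1 : ℝ → ℝ≥0∞) x ^ 2 = p2 l := by
    have : ∀ x, (P.Q l m).indicator (1 : ℝ → ℝ≥0∞) x ^ 2 =
        (P.Q l m).indicator (1 : ℝ → ℝ≥0∞) x := fun x => by
      by_cases h : x ∈ P.Q l m <;> simp [h]
    simp_rw [this]
    rw [lintegral_indicator_one (measurableSet_Q P l m), SpacePartition.Q, gridInterval,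
      Real.volume_Ico, ← ofReal_two_pow]
    congr 1; ring
  refine (lintegral_mul_sq_le (by fun_prop)
    (hF.comp (measurable_prodMk_left (x := t))).aemeasurable).trans ?_
  rw [h1]
  gcongr
  · exact p2_mono (by linarith)
  · rfl

/-- On every interval both parts of a decomposition in `Y_j` are integrable: pieces of atoms through
`L²` with weight at least `1`, and the `L¹ L²` part by Cauchy-Schwarz in `x`. -/
theorem ae_lt_top_of_NYb {j : ℕ} {G : ℝ × ℝ → ℝ≥0∞} (hG : Measurable G) (h : NYb P j G ≠ ⊤) :
    ∀ᵐ p ∂stMeasure, G p < ⊤ := by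
  have h1 : ∀ m, NYj P j (cut P (2 * j) m G) ≠ ⊤ := fun m hm => by
    have h2 : NYj P j (cut P (2 * j) m G) ^ 2 ≤ NYb P j G ^ 2 := by
      rw [NYb, l2cut_sq]
      exact ENNReal.le_tsum m
    exact h (by simpa [hm] using h2)
  have h2 : ∀ᵐ p ∂stMeasure, ∀ m, cut P (2 * j) m G p < ⊤ := by
    refine ae_all_iff.2 fun m => ?_
    have hm := measurable_cut P (2 * j) m hG
    refine ae_lt_top hm (ne_top_of_le_ne_top (ENNReal.mul_ne_top (p2_ne_top (2 * j)) (h1 m))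
      (le_mul_NYj P j hm (p2_ne_top _) fun F₁ F₂ m₁ m₂ hle => ?_))
    calc _ ≤ ∫⁻ p, cut P (2 * j) m F₁ p + cut P (2 * j) m F₂ p ∂stMeasure := by
          refine lintegral_mono_ae ?_
          filter_upwards [hle] with p hp
          by_cases hq : p.2 ∈ P.Q (2 * j) m
          · simpa [cut, hq] using hp
          · simp [cut, hq]
      _ ≤ p2 ((2 * j : ℕ) / 2) * NY P F₁ + p2 ((2 * j : ℕ) / 2) * NL F₂ := by
          rw [lintegral_add_left (measurable_cut P _ m m₁)]
          exact add_le_add (lintegral_cut_le_NY P _ m m₁) (lintegral_cut_le_NL P _ m m₂)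
      _ ≤ _ := by
          rw [mul_add, ← mul_assoc, ← p2_add]
          gcongr <;> refine p2_mono ?_ <;> push_cast <;> linarith [Nat.cast_nonneg (α := ℝ) j]
  filter_upwards [h2] with p hp
  have := hp ⌊(p.2 - P.base (2 * j)) / 2 ^ (2 * j)⌋
  rwa [cut, Set.indicator_of_mem ((mem_Q_iff P _ _ _).2 rfl), Pi.one_apply, one_mul] at this

theorem kap_zero_le_translate (x y : ℝ) :
    kap 0 y ≤ ENNReal.ofReal (2 * (1 + x ^ 2)) * kap 0 (x - y) := by
  rw [kap_zero, kap_zero, ← ENNReal.ofReal_mul (by positivity)]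
  refine ENNReal.ofReal_le_ofReal ?_
  rw [inv_eq_one_div, ← div_eq_mul_inv, div_le_div_iff₀ (by positivity) (by positivity)]
  nlinarith [sq_nonneg (x + y), mul_nonneg (sq_nonneg x) (sq_nonneg y)]

/-- The average `kap 0 * |V|` again has a finite norm and is therefore finite almost everywhere.
Finiteness at a single point `x` is integrability against a translate of the weight `1 / (1 + y²)`,
which is comparable to the weight itself. -/
theorem ae_W1_of_NYb {j : ℕ} {V : ℝ × ℝ → ℂ} (hV : Measurable V)
    (h : NYb P j (fun p => ‖V p‖ₑ) ≠ ⊤) : ∀ᵐ t ∂timeMeasure, W1 (fun x => V (t, x)) := by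
  have h1 : NYb P j (cv (kap 0) fun p => ‖V p‖ₑ) ≠ ⊤ :=
    ne_top_of_le_ne_top (ENNReal.mul_ne_top (ENNReal.mul_ne_top (by simp) (lintegral_kap_ne_top 0)) h)
      ((latNorm_NYb P j).conv (measurable_kap 0) (lintegral_kap_ne_top 0) hV.enorm)
  filter_upwards [ae_ae_of_ae_st
    (ae_lt_top_of_NYb P (measurable_cv (measurable_kap 0) hV.enorm) h1)] with t ht
  obtain ⟨x, hx⟩ := ht.exists
  refine ⟨(hV.comp (measurable_prodMk_left (x := t))).aestronglyMeasurable, ?_⟩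
  refine ne_top_of_le_ne_top (ENNReal.mul_ne_top
    (ENNReal.ofReal_ne_top (r := 2 * (1 + x ^ 2))) hx.ne) ?_
  rw [cv, ← lintegral_const_mul' _ _ ENNReal.ofReal_ne_top]
  refine lintegral_mono fun y => ?_
  rw [← mul_assoc, mul_comm (‖_‖ₑ)]
  gcongr
  exact kap_zero_le_translate x y

/-! ### From bounds for pairs of blocks to estimates of products -/

section

variable {φ₀ : ℝ → ℝ} {N N₁ N₂ : ℕ → (ℝ × ℝ → ℂ) → ℝ≥0∞}
  {E E₁ E₂ : ℕ → (ℝ × ℝ → ℝ≥0∞) → ℝ≥0∞} {C C₁ C₂ : NNReal}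

theorem seqN_mono {s : ℝ} {U V : ℕ → ℝ × ℝ → ℂ}
    (h : ∀ a, E a (fun p => ‖U a p‖ₑ) ≤ E₁ a (fun p => ‖V a p‖ₑ)) : seqN E s U ≤ seqN E₁ s V := by
  refine le_of_sq_le_sq ?_
  rw [seqN_sq, seqN_sq]
  exact ENNReal.tsum_le_tsum fun a => pow_le_pow_left' (mul_le_mul' le_rfl (h a)) 2

theorem seqN_trunc_le (hE : ∀ k, LatNorm (E k) 4) (s : ℝ) (q : ℕ → Prop) [DecidablePred q]
    (U : ℕ → ℝ × ℝ → ℂ) : seqN E s (trunc q U) ≤ seqN E s U :=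
  seqN_mono fun a => by
    by_cases h : q a
    · rw [trunc_of_pos h]
    · rw [trunc_of_neg h]; simp [(hE a).zero]

theorem seqN_single_le (hE : ∀ k, LatNorm (E k) 4) (s : ℝ) (j : ℕ) (V : ℝ × ℝ → ℂ) :
    seqN E s (trunc (· = j) fun _ => V) ≤ p2 (j * s) * E j (fun p => ‖V p‖ₑ) := by
  refine le_of_sq_le_sq ?_
  rw [seqN_sq, tsum_eq_single j]
  · rw [trunc_of_pos (q := (· = j)) rfl]
  · intro a ha
    rw [trunc_of_neg (q := (· = j)) ha]
    simp [(hE a).zero]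

/-- Functions representing the dyadic pieces of a time-dependent distribution. -/
structure BlockSeq (φ₀ : ℝ → ℝ) (c : NNReal) (s : ℝ) (u : ℝ → 𝓢'(ℝ, ℂ)) (U : ℕ → ℝ × ℝ → ℂ) :
    Prop where
  meas : ∀ a, Measurable (U a)
  repr : ∀ a, IsReprST (fun t => lpProj φ₀ a (u t)) (U a)
  self : ∀ a, SelfRep c a (fun p => ‖U a p‖ₑ)
  fin : seqN (fun _ => NH) s U ≠ ⊤

theorem BlockSeq.ne_top {c : NNReal} {s : ℝ} {u : ℝ → 𝓢'(ℝ, ℂ)} {U : ℕ → ℝ × ℝ → ℂ}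
    (h : BlockSeq φ₀ c s u U) (a : ℕ) : NH (fun p => ‖U a p‖ₑ) ≠ ⊤ := seqN_term_ne_top h.fin a

theorem NormPair.exists_blockSeq (hφ : IsCutoff φ₀) (hN₁ : NormPair N₁ E₁ C₁)
    (hE₁ : ∀ a G, Measurable G → NH G ≤ E₁ a G) {c : NNReal}
    (hc : ∀ a x, ‖(𝓕⁻ (fatS hφ a) : 𝓢(ℝ, ℂ)) x‖ₑ ≤ c * kap a x) {s : ℝ} {u : ℝ → 𝓢'(ℝ, ℂ)}
    (h : l2N φ₀ N₁ s u < ⊤) :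
    ∃ U, BlockSeq φ₀ c s u U ∧ seqN E₁ s U ≤ C₁ * l2N φ₀ N₁ s u := by
  obtain ⟨U, h1, h2, h3⟩ := hN₁.exists_blocks h
  have hfin : seqN (fun _ => NH) s U ≠ ⊤ :=
    ne_top_of_le_ne_top (ENNReal.mul_ne_top (by simp) h.ne)
      ((seqN_mono fun a => hE₁ a _ (h1 a).enorm).trans h3)
  exact ⟨U, ⟨h1, h2, fun a => ae_enorm_le_cv hc (h1 a) (h2 a)
    (ae_W1_of_NH (h1 a) (seqN_term_ne_top hfin a)), hfin⟩, h3⟩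

theorem cv_zero (κ : ℝ → ℝ≥0∞) : cv κ (fun _ => 0) = fun _ => 0 := by
  funext p; simp [cv]

/-- All estimates for full products are instances: `hp` is the bound for pairs, and `hexp` compares
its exponents with the weights, leaving the gain `δ` in the lowest frequency. The condition `0 ≤ α +
β` serves the existence of the product. -/
theorem exists_product (hφ : IsCutoff φ₀) (hN : NormPair N E C) (hN₁ : NormPair N₁ E₁ C₁)
    (hE₁ : ∀ a G, Measurable G → NH G ≤ E₁ a G) {x y z : ℕ → ℕ → ℕ → ℝ}
    (hp : ∀ c, ∃ K, PairBound c K E E₁ x y z) {s α β δ r : ℝ} (hδ : 0 < δ) (hαβ : 0 ≤ α + β)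
    (hexp : ∀ k a b : ℕ, Contrib k (a, b) → k * s + byCase x y z k a b ≤
      r + byCase (fun _ _ b => -(δ * b)) (fun _ a _ => -(δ * a)) (fun k _ _ => -(δ * k)) k a b +
        a * α + b * β) :
    ∃ K : NNReal, ∀ u v : ℝ → 𝓢'(ℝ, ℂ), l2N φ₀ N₁ α u < ⊤ → l2N φ₀ N₁ β v < ⊤ →
      ∃ w, IsProductST φ₀ u v w ∧
        l2N φ₀ N s w ≤ K * l2N φ₀ N₁ α u * l2N φ₀ N₁ β v := by
  obtain ⟨c₀, hc₀⟩ := exists_symS_kernel_bound (hφ := hφ)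
  obtain ⟨c, hc⟩ := exists_fatS_kernel_bound (hφ := hφ)
  obtain ⟨K, hK⟩ := hp c
  set S := (618 * ∑' b : ℕ, p2 (-(δ * b))) ^ (1 / 2 : ℝ) with hS
  have hStop : S ≠ ⊤ := ENNReal.rpow_ne_top_of_nonneg (by norm_num)
    (ENNReal.mul_ne_top (by simp) (tsum_p2_neg_ne_top hδ))
  obtain ⟨M, hM⟩ : ∃ M : NNReal, (M : ℝ≥0∞) = C * (c₀ * (K * p2 r) * S * (C₁ * C₁)) := by
    refine ⟨_, ENNReal.coe_toNNReal ?_⟩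
    have := p2_ne_top r
    finiteness
  refine ⟨M, fun u v hu hv => ?_⟩
  obtain ⟨U, bU, sU⟩ := hN₁.exists_blockSeq hφ hE₁ hc hu
  obtain ⟨V, bV, sV⟩ := hN₁.exists_blockSeq hφ hE₁ hc hv
  obtain ⟨w, W, h1, h2, h3, h4⟩ := product_estimate (hφ := hφ) hc₀ (s := s) (α := α) (β := β) hδ
    hN.lat (E₁ := E₁) (E₂ := E₁) bU.meas bV.meas
    (ae_prodData hαβ bU.meas bV.meas bU.repr bV.repr bU.fin bV.fin) (D := K * p2 r)
    fun k a b hcon => by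
      rw [gain_eq]
      exact p2_mul_weighted_le (hK k a b _ _ (bU.meas a).enorm (bV.meas b).enorm (bU.self a)
        (bV.self b) (bU.ne_top a) (bV.ne_top b) hcon) (hexp k a b hcon)
  refine ⟨w, h1, (hN.l2N_le h2 h3).trans ?_⟩
  calc _ ≤ C * (c₀ * (K * p2 r) * S * ((C₁ * l2N φ₀ N₁ α u) * (C₁ * l2N φ₀ N₁ β v))) := by
        refine mul_le_mul' le_rfl (h4.trans ?_)
        gcongr
    _ = _ := by rw [hM]; ring

/-- The second factor is a single block measured in a norm `E₂` that need not control `L²`; `hW`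
provides the little integrability that the product requires. No condition on `α + β` is imposed for
existence, since only finitely many blocks occur. -/
theorem exists_product_lowHigh (hφ : IsCutoff φ₀) (hN : NormPair N E C) (hN₁ : NormPair N₁ E₁ C₁)
    (hN₂ : NormPair N₂ E₂ C₂) (hE₁ : ∀ a G, Measurable G → NH G ≤ E₁ a G)
    (hW : ∀ (j : ℕ) (V : ℝ × ℝ → ℂ), Measurable V → E₂ j (fun p => ‖V p‖ₑ) ≠ ⊤ →
      ∀ᵐ t ∂timeMeasure, W1 (fun x => V (t, x)))
    {x : ℕ → ℕ → ℝ} (hp : ∀ c : NNReal, ∃ K : NNReal, ∀ k a b G H, Measurable G → Measurable H →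
      SelfRep c a G → SelfRep c b H → NH G ≠ ⊤ → E₂ b H ≠ ⊤ → a + 5 ≤ b → b ≤ k + 3 → k ≤ b + 3 →
      E k (cv (kap k) fun p => G p * H p) ≤ K * (p2 (x a b) * (E₁ a G * E₂ b H)))
    {s α β δ r : ℝ} (hδ : 0 < δ)
    (hexp : ∀ k a b : ℕ, a + 5 ≤ b → b ≤ k + 3 → k ≤ b + 3 →
      k * s + x a b ≤ r + -(δ * a) + a * α + b * β) :
    ∃ K : NNReal, ∀ (j : ℕ) (u v : ℝ → 𝓢'(ℝ, ℂ)), l2N φ₀ N₁ α u < ⊤ →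
      l2N φ₀ N₂ β (fun t => lpProj φ₀ j (v t)) < ⊤ →
      ∃ w, IsProductST φ₀ (fun t => lpLT φ₀ (j - 4) (u t)) (fun t => lpProj φ₀ j (v t)) w ∧
        l2N φ₀ N s w ≤ K * l2N φ₀ N₁ α u * l2N φ₀ N₂ β (fun t => lpProj φ₀ j (v t)) := by
  obtain ⟨c₀, hc₀⟩ := exists_symS_kernel_bound (hφ := hφ)
  obtain ⟨c, hc⟩ := exists_fatS_kernel_bound (hφ := hφ)
  obtain ⟨K, hK⟩ := hp c
  set S := (618 * ∑' b : ℕ, p2 (-(δ * b))) ^ (1 / 2 : ℝ) with hS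
  have hStop : S ≠ ⊤ := ENNReal.rpow_ne_top_of_nonneg (by norm_num)
    (ENNReal.mul_ne_top (by simp) (tsum_p2_neg_ne_top hδ))
  obtain ⟨M, hM⟩ : ∃ M : NNReal, (M : ℝ≥0∞) =
      C * (c₀ * (K * p2 r) * S * (C₁ * (3 * (C₂ * p2 |β| * C₂)))) := by
    refine ⟨_, ENNReal.coe_toNNReal ?_⟩
    have := p2_ne_top r
    have := p2_ne_top |β|
    finiteness
  refine ⟨M, fun j u v hu hv => ?_⟩
  obtain ⟨U, bU, sU⟩ := hN₁.exists_blockSeq hφ hE₁ hc hu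
  obtain ⟨V, mV, rV, sV⟩ := hN₂.exists_block hφ hv
  have hVtop : E₂ j (fun p => ‖V p‖ₑ) ≠ ⊤ := fun h => by
    rw [h, ENNReal.mul_top (p2_ne_zero _), top_le_iff] at sV
    have := p2_ne_top |β|
    have := hv.ne
    exact absurd sV (by finiteness)
  have hV1 := hW j V mV hVtop
  obtain ⟨w, W, h1, h2, h3, h4⟩ := product_estimate (hφ := hφ) hc₀ (s := s) (α := α) (β := β) hδ
    hN.lat (E₁ := E₁) (E₂ := E₂) (measurable_trunc (q := (· < j - 4)) bU.meas)
    (measurable_trunc (q := (· = j)) fun _ => mV)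
    (ae_prodData_lpLT bU.meas bU.repr rV bU.ne_top hV1 (j - 4)) (D := K * p2 r)
    fun k a b hcon => by
      by_cases ha : a < j - 4
      swap
      · rw [trunc_of_neg (q := (· < j - 4)) ha]
        simp [cv_zero, (hN.lat k).zero]
      by_cases hb : b = j
      swap
      · rw [trunc_of_neg (q := (· = j)) hb]
        simp [cv_zero, (hN.lat k).zero]
      rw [trunc_of_pos (q := (· < j - 4)) ha, trunc_of_pos (q := (· = j)) hb, gain_eq]
      subst hb
      unfold Contrib at hcon
      dsimp only at hcon
      have e1 : ¬ b + 5 ≤ a := by omega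
      -- In `ℕ` the inequality `a < j - 4` forces `a + 5 ≤ j`, so only the case of a dominating
      -- second frequency remains; for `j ≤ 4` the first factor is zero.
      have e2 : a + 5 ≤ b := by omega
      refine p2_mul_weighted_le (hK k a b _ _ (bU.meas a).enorm mV.enorm (bU.self a)
        (ae_enorm_le_cv hc mV rV hV1) (bU.ne_top a) hVtop e2 (by omega) (by omega)) ?_
      rw [byCase, if_neg e1, if_pos e2]
      exact hexp k a b e2 (by omega) (by omega)
  refine ⟨w, h1, (hN.l2N_le h2 h3).trans ?_⟩
  calc _ ≤ C * (c₀ * (K * p2 r) * S * ((C₁ * l2N φ₀ N₁ α u) *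
        (3 * (C₂ * p2 |β| * C₂) * l2N φ₀ N₂ β (fun t => lpProj φ₀ j (v t))))) := by
        refine mul_le_mul' le_rfl (h4.trans ?_)
        gcongr
        · exact (seqN_trunc_le hN₁.lat _ _ _).trans sU
        · exact (seqN_single_le hN₂.lat _ _ _).trans sV
    _ = _ := by rw [hM]; ring

theorem exists_product_highHigh (hφ : IsCutoff φ₀) (hN : NormPair N E C) (hN₁ : NormPair N₁ E₁ C₁)
    (hE₁ : ∀ a G, Measurable G → NH G ≤ E₁ a G) {x y z : ℕ → ℕ → ℕ → ℝ}
    (hp : ∀ c, ∃ K, PairBound c K E E₁ x y z) {s α β γ r : ℝ} (hαβ : 0 ≤ α + β)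
    (hexp : ∀ k a b : ℕ, Contrib k (a, b) → k ≤ a + 4 → k ≤ b + 4 →
      k * s + byCase x y z k a b ≤ r + γ * k + a * α + b * β) :
    ∃ K : NNReal, ∀ (j : ℕ) (u v : ℝ → 𝓢'(ℝ, ℂ)), l2N φ₀ N₁ α u < ⊤ → l2N φ₀ N₁ β v < ⊤ →
      ∃ w, IsProductST φ₀ (fun t => lpGE φ₀ (j - 4) (u t)) (fun t => lpGE φ₀ (j - 4) (v t)) w ∧
        l2N φ₀ N s (fun t => lpProj φ₀ j (w t)) ≤
          K * p2 (γ * j) * l2N φ₀ N₁ α u * l2N φ₀ N₁ β v := by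
  obtain ⟨c₀, hc₀⟩ := exists_symS_kernel_bound (hφ := hφ)
  obtain ⟨c, hc⟩ := exists_fatS_kernel_bound (hφ := hφ)
  obtain ⟨K, hK⟩ := hp c
  obtain ⟨M, hM⟩ : ∃ M : NNReal, (M : ℝ≥0∞) =
      3 * (p2 |s| * C * c₀ * 16 * C) * (c₀ * (K * p2 r) * (15 * (C₁ * C₁))) := by
    refine ⟨_, ENNReal.coe_toNNReal ?_⟩
    have := p2_ne_top r
    have := p2_ne_top |s|
    finiteness
  refine ⟨M, fun j u v hu hv => ?_⟩
  obtain ⟨U, bU, sU⟩ := hN₁.exists_blockSeq hφ hE₁ hc hu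
  obtain ⟨V, bV, sV⟩ := hN₁.exists_blockSeq hφ hE₁ hc hv
  obtain ⟨w, W, h1, h2, h3, h4, h5⟩ := product_estimate_single (hφ := hφ) hc₀ (s := s) (α := α)
    (β := β) (γ := γ) j (hN.lat j) (E₁ := E₁) (E₂ := E₁)
    (measurable_trunc (q := (j - 4 ≤ ·)) bU.meas) (measurable_trunc (q := (j - 4 ≤ ·)) bV.meas)
    (ae_prodData_lpGE hαβ bU.meas bV.meas bU.repr bV.repr bU.fin bV.fin (j - 4)) (D := K * p2 r)
    fun a b hcon => by
      by_cases ha : j - 4 ≤ a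
      swap
      · rw [trunc_of_neg (q := (j - 4 ≤ ·)) ha]
        simp [cv_zero, (hN.lat j).zero]
      by_cases hb : j - 4 ≤ b
      swap
      · rw [trunc_of_neg (q := (j - 4 ≤ ·)) hb]
        simp [cv_zero, (hN.lat j).zero]
      have hcon' := hcon
      unfold Contrib at hcon'
      dsimp only at hcon'
      -- Both indices are at least `j - 4`; if they are not comparable, the larger is at most `j +
      -- 3`. In all cases they differ by at most `7`.
      rw [trunc_of_pos (q := (j - 4 ≤ ·)) ha, trunc_of_pos (q := (j - 4 ≤ ·)) hb,
        if_pos (by omega), one_mul, mul_assoc]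
      exact p2_mul_weighted_le (hK j a b _ _ (bU.meas a).enorm (bV.meas b).enorm (bU.self a)
        (bV.self b) (bU.ne_top a) (bV.ne_top b) hcon) (hexp j a b hcon (by omega) (by omega))
  refine ⟨w, h1, (hN.l2N_lpProj_le (hφ := hφ) hc₀ s h2 h3 h4).trans ?_⟩
  calc _ ≤ 3 * (p2 |s| * C * c₀ * 16 * C) * (c₀ * (K * p2 r * p2 (γ * j)) *
        (15 * ((C₁ * l2N φ₀ N₁ α u) * (C₁ * l2N φ₀ N₁ β v)))) := by
        refine mul_le_mul' le_rfl (h5.trans ?_)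
        gcongr
        · exact (seqN_trunc_le hN₁.lat _ _ _).trans sU
        · exact (seqN_trunc_le hN₁.lat _ _ _).trans sV
    _ = _ := by rw [hM]; ring

end

/-! ### Functions which do not depend on time -/

theorem nL2_add_le {g h : ℝ → ℂ} (hg : AEStronglyMeasurable g volume)
    (hh : AEStronglyMeasurable h volume) : nL2 (fun x => g x + h x) ≤ nL2 g + nL2 h := by
  simp only [nL2, ← eLpNorm_two]
  exact eLpNorm_add_le hg hh (by norm_num)

theorem nL2_congr {g h : ℝ → ℂ} (e : g =ᵐ[volume] h) : nL2 g = nL2 h := by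
  simp only [nL2, ← eLpNorm_two]
  exact eLpNorm_congr_ae e

section

variable {φ₀ : ℝ → ℝ} (P : SpacePartition)

theorem tsum_enorm_χ_sq (j : ℕ) (x : ℝ) : ∑' m : ℤ, ‖(P.χ j m x : ℂ)‖ₑ ^ 2 = 1 := by
  have h1 : ∀ m : ℤ, ‖(P.χ j m x : ℂ)‖ₑ ^ 2 = ENNReal.ofReal (P.χ j m x ^ 2) := fun m => by
    rw [← ofReal_norm, Complex.norm_real, ← ENNReal.ofReal_pow (norm_nonneg _), Real.norm_eq_abs,
      sq_abs]
  simp_rw [h1]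
  rw [← ENNReal.ofReal_tsum_of_nonneg (fun m => sq_nonneg _) (P.sum_sq j x).summable,
    (P.sum_sq j x).tsum_eq, ENNReal.ofReal_one]

theorem tsum_eLpNorm_χ_sq (j : ℕ) {g : ℝ → ℂ} (hg : AEStronglyMeasurable g volume) :
    (∑' m : ℤ, eLpNorm (fun x => (P.χ j m x : ℂ) * g x) 2 volume ^ 2) ^ (1 / 2 : ℝ) = nL2 g := by
  simp_rw [eLpNorm_two_sq, enorm_mul, mul_pow]
  rw [← lintegral_tsum (f := fun m x => ‖(P.χ j m x : ℂ)‖ₑ ^ 2 * ‖g x‖ₑ ^ 2) fun m =>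
    (((measurable_χ P j m).enorm.pow_const 2).aemeasurable).mul (hg.enorm.pow_const 2)]
  simp_rw [ENNReal.tsum_mul_right, tsum_enorm_χ_sq, one_mul]
  rfl

/-- The squares of the cut-offs add up to `1`, so the localised `L²` norm is the `L²` norm exactly.
-/
theorem l2SumL2_eq (j : ℕ) {f : 𝓢'(ℝ, ℂ)} {g : ℝ → ℂ} (h : IsRepr f g) :
    l2SumL2 P j f = nL2 g := by
  have key : ∀ g', IsRepr f g' →
      (∑' m : ℤ, eLpNorm (fun x => (P.χ j m x : ℂ) * g' x) 2 volume ^ 2) ^ (1 / 2 : ℝ) =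
        nL2 g := fun g' h' => by
    rw [tsum_eLpNorm_χ_sq P j h'.locallyIntegrable.aestronglyMeasurable, nL2_congr (h'.ae_eq h)]
  exact le_antisymm ((iInf₂_le g h).trans (key g h).le) (le_iInf₂ fun g' h' => (key g' h').ge)

theorem l2SumL2_add_le (j : ℕ) (f g : 𝓢'(ℝ, ℂ)) :
    l2SumL2 P j (f + g) ≤ l2SumL2 P j f + l2SumL2 P j g := by
  by_cases hf : ∃ F, IsRepr f F
  · by_cases hg : ∃ G, IsRepr g G
    · obtain ⟨F, hF⟩ := hf
      obtain ⟨G, hG⟩ := hg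
      rw [l2SumL2_eq P j hF, l2SumL2_eq P j hG, l2SumL2_eq P j (hF.add hG)]
      exact nL2_add_le hF.locallyIntegrable.aestronglyMeasurable
        hG.locallyIntegrable.aestronglyMeasurable
    · push Not at hg
      simp [l2SumL2, hg]
  · push Not at hf
    simp [l2SumL2, hf]

theorem l2H_sq (s : ℝ) (f : 𝓢'(ℝ, ℂ)) :
    l2H φ₀ P s f ^ 2 = ∑' j : ℕ, (p2 (j * s) * l2SumL2 P j (lpProj φ₀ j f)) ^ 2 := by
  simp_rw [p2_mul_sq]
  exact rpow_half_sq _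

theorem l2H_add_le (s : ℝ) (f g : 𝓢'(ℝ, ℂ)) :
    l2H φ₀ P s (f + g) ≤ 2 * (l2H φ₀ P s f + l2H φ₀ P s g) := by
  refine le_of_sq_le_sq ?_
  calc _ ≤ ∑' j : ℕ, 2 * ((p2 (j * s) * l2SumL2 P j (lpProj φ₀ j f)) ^ 2 +
        (p2 (j * s) * l2SumL2 P j (lpProj φ₀ j g)) ^ 2) := by
        rw [l2H_sq]
        refine ENNReal.tsum_le_tsum fun j => le_trans ?_ (add_sq_le_two _ _)
        rw [map_add, ← mul_add]
        exact pow_le_pow_left' (mul_le_mul' le_rfl (l2SumL2_add_le P j _ _)) 2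
    _ = 2 * (l2H φ₀ P s f ^ 2 + l2H φ₀ P s g ^ 2) := by
        rw [ENNReal.tsum_mul_left, ENNReal.tsum_add, ← l2H_sq, ← l2H_sq]
    _ ≤ 4 * (l2H φ₀ P s f ^ 2 + 2 * l2H φ₀ P s f * l2H φ₀ P s g + l2H φ₀ P s g ^ 2) := by
        gcongr
        · norm_num
        · exact le_self_add
    _ = _ := by ring

/-- The norms of `L^∞_t L²_x`. -/
noncomputable def normsH : ℕ → (ℝ × ℝ → ℂ) → ℝ≥0∞ := fun _ g => NH fun p => ‖g p‖ₑ

theorem NH_const_le (g : ℝ → ℂ) : NH (fun p : ℝ × ℝ => ‖g p.2‖ₑ) ≤ nL2 g := by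
  refine le_of_sq_le_sq ?_
  rw [NH, quad_sq, nL2_sq]
  exact essSup_le_of_ae_le _ (ae_of_all _ fun t => le_rfl)

theorem normST_const_le (j : ℕ) (f : 𝓢'(ℝ, ℂ)) : normST (normsH j) (fun _ => f) ≤ l2SumL2 P j f := by
  refine le_iInf₂ fun g hg => ?_
  have hm := hg.locallyIntegrable.aestronglyMeasurable
  rw [tsum_eLpNorm_χ_sq P j hm, nL2_congr hm.ae_eq_mk]
  have hmm := hm.stronglyMeasurable_mk.measurable
  exact (iInf₂_le (fun p : ℝ × ℝ => hm.mk g p.2)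
    ⟨(hmm.comp measurable_snd).aestronglyMeasurable,
      Eventually.of_forall fun _ => hg.congr hm.ae_eq_mk⟩).trans (NH_const_le _)

theorem l2N_const_le (s : ℝ) (f : 𝓢'(ℝ, ℂ)) : l2N φ₀ normsH s (fun _ => f) ≤ l2H φ₀ P s f := by
  refine le_of_sq_le_sq ?_
  rw [l2N_sq, l2H_sq]
  exact ENNReal.tsum_le_tsum fun j =>
    pow_le_pow_left' (mul_le_mul' le_rfl (normST_const_le P j _)) 2

/-- An essential supremum in time for each block bounds that block at almost every time, and
countably many null sets can be discarded together. As the time interval has positive measure, an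
estimate for constant functions of time can then be read off at a suitable `t`. -/
theorem ae_l2H_le {s : ℝ} {w : ℝ → 𝓢'(ℝ, ℂ)} :
    ∀ᵐ t ∂timeMeasure, l2H φ₀ P s (w t) ≤ l2N φ₀ normsH s w := by
  by_cases htop : l2N φ₀ normsH s w < ⊤
  swap
  · rw [not_lt, top_le_iff] at htop
    rw [htop]
    exact ae_of_all _ fun _ => le_top
  obtain ⟨W, -, h2, h3⟩ := normPair_H.exists_blocks htop
  rw [ENNReal.coe_one, one_mul] at h3
  filter_upwards [ae_all_iff.2 fun k => (h2 k).2, ae_all_iff.2 fun k => ae_nL2_le_NH (W k)]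
    with t h4 h5
  refine le_trans (le_of_sq_le_sq ?_) h3
  rw [l2H_sq, seqN_sq]
  refine ENNReal.tsum_le_tsum fun k => pow_le_pow_left' (mul_le_mul' le_rfl ?_) 2
  rw [l2SumL2_eq P k (h4 k)]
  exact h5 k

theorem l2N_congr {N : ℕ → (ℝ × ℝ → ℂ) → ℝ≥0∞} {s : ℝ} {u v : ℝ → 𝓢'(ℝ, ℂ)}
    (e : ∀ᵐ t ∂timeMeasure, u t = v t) : l2N φ₀ N s u = l2N φ₀ N s v := by
  have key : ∀ j, normST (N j) (fun t => lpProj φ₀ j (u t)) =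
      normST (N j) (fun t => lpProj φ₀ j (v t)) := fun j => by
    refine iInf_congr fun g => iInf_congr_Prop ⟨fun h => h.congr_left ?_, fun h =>
      h.congr_left ?_⟩ fun _ => rfl
    · exact e.mono fun t ht => by rw [ht]
    · exact e.mono fun t ht => by rw [ht]
  simp only [l2N, key]

/-! ### Uniqueness and additivity of products -/

theorem IsProduct.symm {f g w : 𝓢'(ℝ, ℂ)} (h : IsProduct φ₀ f g w) : IsProduct φ₀ g f w := by
  obtain ⟨F, G, hF, hG, h⟩ := h
  refine ⟨G, F, hG, hF, fun ψ => ?_⟩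
  simpa only [mul_comm (G _ _)] using h ψ

theorem IsProduct.add {f f' g w w' : 𝓢'(ℝ, ℂ)} (h : IsProduct φ₀ f g w)
    (h' : IsProduct φ₀ f' g w') : IsProduct φ₀ (f + f') g (w + w') := by
  obtain ⟨F, G, hF, hG, h⟩ := h
  obtain ⟨F', G', hF', hG', h'⟩ := h'
  refine ⟨fun N x => F N x + F' N x, G, fun N => by rw [lpLT_add]; exact (hF N).add (hF' N), hG,
    fun ψ => ?_⟩
  have e : ∀ N, (fun x => F' N x * G' N x * ψ x) =ᵐ[volume] fun x => F' N x * G N x * ψ x :=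
    fun N => ((hG' N).ae_eq (hG N)).mono fun x hx => by dsimp only; rw [hx]
  have hi : ∀ N, Integrable fun x => F' N x * G N x * ψ x := fun N => ((h' ψ).1 N).congr (e N)
  have e2 : ∀ N, (fun x => (F N x + F' N x) * G N x * ψ x) =
      fun x => F N x * G N x * ψ x + F' N x * G N x * ψ x := fun N => by funext x; ring
  refine ⟨fun N => by rw [e2]; exact ((h ψ).1 N).add (hi N), ?_⟩
  have h3 := (h ψ).2.add (h' ψ).2
  refine (h3.congr fun N => ?_)
  rw [e2, integral_add ((h ψ).1 N) (hi N), integral_congr_ae (e N)]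

theorem IsProduct.unique {f g w w' : 𝓢'(ℝ, ℂ)} (h : IsProduct φ₀ f g w)
    (h' : IsProduct φ₀ f g w') : w = w' := by
  obtain ⟨F, G, hF, hG, h⟩ := h
  obtain ⟨F', G', hF', hG', h'⟩ := h'
  ext ψ
  refine tendsto_nhds_unique (h ψ).2 ((h' ψ).2.congr fun N => integral_congr_ae ?_)
  filter_upwards [(hF' N).ae_eq (hF N), (hG' N).ae_eq (hG N)] with x h1 h2
  rw [h1, h2]

/-- Additivity in each factor and uniqueness yield `uv - u₀v₀ = (u - u₀)v + u₀(v - v₀)` for products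
defined as limits. -/
theorem IsProduct.sub_eq {u v u₀ v₀ w w₀ z₁ z₂ : 𝓢'(ℝ, ℂ)} (h : IsProduct φ₀ u v w)
    (h₀ : IsProduct φ₀ u₀ v₀ w₀) (h₁ : IsProduct φ₀ (u - u₀) v z₁)
    (h₂ : IsProduct φ₀ u₀ (v - v₀) z₂) : w - w₀ = z₁ + z₂ := by
  have h3 : IsProduct φ₀ u₀ v (z₂ + w₀) := by
    have := (h₂.symm.add h₀.symm).symm
    rwa [sub_add_cancel] at this
  have h4 : IsProduct φ₀ u v (z₁ + (z₂ + w₀)) := by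
    have := h₁.add h3
    rwa [sub_add_cancel] at this
  rw [h.unique h4]
  abel

/-- The estimate for the product in `l²H^s` implies continuity of the product. -/
theorem continuousInH_product {s : ℝ} {C : NNReal}
    (hC : ∀ f g : 𝓢'(ℝ, ℂ), l2H φ₀ P s f < ⊤ → l2H φ₀ P s g < ⊤ →
      ∃ w, IsProduct φ₀ f g w ∧ l2H φ₀ P s w ≤ C * l2H φ₀ P s f * l2H φ₀ P s g)
    {u v w : ℝ → 𝓢'(ℝ, ℂ)} (hu : ContinuousInH φ₀ P s u) (hv : ContinuousInH φ₀ P s v)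
    (hw : ∀ t, (∃ z, IsProduct φ₀ (u t) (v t) z) → IsProduct φ₀ (u t) (v t) (w t)) :
    ContinuousInH φ₀ P s w := by
  have hprod : ∀ t ∈ Set.Icc (0 : ℝ) 1, IsProduct φ₀ (u t) (v t) (w t) ∧ l2H φ₀ P s (w t) < ⊤ :=
    fun t ht => by
      obtain ⟨z, hz1, hz2⟩ := hC (u t) (v t) (hu t ht).1 (hv t ht).1
      have h1 := hw t ⟨z, hz1⟩
      refine ⟨h1, ?_⟩
      rw [h1.unique hz1]
      exact hz2.trans_lt (ENNReal.mul_lt_top (ENNReal.mul_lt_top (by simp) (hu t ht).1)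
        (hv t ht).1)
  intro t₀ ht₀
  refine ⟨(hprod t₀ ht₀).2, ?_⟩
  have hu₀ := (hu t₀ ht₀).1
  have hv₀ := (hv t₀ ht₀).1
  -- The first term needs a bound for `v t` near `t₀`, which is obtained from `v t₀` and the
  -- difference. The factors `2` of the crude triangle inequality do not affect the limit.
  have hbound : ∀ᶠ t in 𝓝[Set.Icc 0 1] t₀, l2H φ₀ P s (w t - w t₀) ≤
      2 * (C * l2H φ₀ P s (u t - u t₀) * (2 * (l2H φ₀ P s (v t - v t₀) + l2H φ₀ P s (v t₀))) +
        C * l2H φ₀ P s (u t₀) * l2H φ₀ P s (v t - v t₀)) := by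
    filter_upwards [self_mem_nhdsWithin, (hu t₀ ht₀).2.eventually_lt_const (show (0 : ℝ≥0∞) < ⊤ by simp),
      (hv t₀ ht₀).2.eventually_lt_const (show (0 : ℝ≥0∞) < ⊤ by simp)] with t ht h1 h2
    obtain ⟨z₁, hz₁, hz₁'⟩ := hC _ _ h1 (hv t ht).1
    obtain ⟨z₂, hz₂, hz₂'⟩ := hC _ _ hu₀ h2
    rw [(hprod t ht).1.sub_eq (hprod t₀ ht₀).1 hz₁ hz₂]
    refine (l2H_add_le P s _ _).trans ?_
    gcongr
    refine hz₁'.trans ?_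
    gcongr
    have := l2H_add_le (φ₀ := φ₀) P s (v t - v t₀) (v t₀)
    rwa [sub_add_cancel] at this
  refine tendsto_of_tendsto_of_tendsto_of_le_of_le' tendsto_const_nhds ?_
    (Eventually.of_forall fun _ => zero_le) hbound
  have l1 : Tendsto (fun t => C * l2H φ₀ P s (u t - u t₀)) (𝓝[Set.Icc 0 1] t₀) (𝓝 (C * 0)) :=
    ENNReal.Tendsto.const_mul (hu t₀ ht₀).2 (Or.inr (by simp))
  have l2 : Tendsto (fun t => 2 * (l2H φ₀ P s (v t - v t₀) + l2H φ₀ P s (v t₀)))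
      (𝓝[Set.Icc 0 1] t₀) (𝓝 (2 * (0 + l2H φ₀ P s (v t₀)))) :=
    ENNReal.Tendsto.const_mul ((hv t₀ ht₀).2.add tendsto_const_nhds) (Or.inr (by simp))
  have l3 : Tendsto (fun t => C * l2H φ₀ P s (u t₀) * l2H φ₀ P s (v t - v t₀))
      (𝓝[Set.Icc 0 1] t₀) (𝓝 (C * l2H φ₀ P s (u t₀) * 0)) :=
    ENNReal.Tendsto.const_mul (hv t₀ ht₀).2 (Or.inr (ENNReal.mul_ne_top (by simp) hu₀.ne))
  have l4 := ENNReal.Tendsto.mul l1 (Or.inr (ENNReal.mul_ne_top (by simp)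
    (ENNReal.add_ne_top.2 ⟨by simp, hv₀.ne⟩))) l2 (Or.inr (by simp))
  have l5 := ENNReal.Tendsto.const_mul (a := 2) (l4.add l3) (Or.inr (by simp))
  simpa using l5

end

/-! ### Comparison of the exponents -/

theorem mul_le_mul_add_abs {x y c : ℝ} (h : x ≤ y + c) (h' : y ≤ x + c) (s : ℝ) :
    x * s ≤ y * s + c * |s| := by
  have h1 : |x - y| ≤ c := abs_le.2 ⟨by linarith, by linarith⟩
  have h2 : (x - y) * s ≤ c * |s| :=
    (le_abs_self _).trans ((abs_mul _ _).le.trans (by gcongr))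
  linarith

/-- The gain is `δ = s - 1/2`: a low factor costs `2^(b/2)` against its weight `2^(bs)`. For
comparable frequencies with the loss `2^(a-k)`, the inequality is `(2s - 1) k ≤ (2s - 1) a` up to
constants, and this is where `s > 1/2` enters again. -/
theorem exponents_HX {s : ℝ} (hs : 1 / 2 < s) {z : ℕ → ℕ → ℕ → ℝ}
    (hz : ∀ k a b : ℕ, k ≤ a + 7 → z k a b ≤ k / 2 + (a - k) ∨ z k a b ≤ k / 2) (k a b : ℕ)
    (h : Contrib k (a, b)) :
    k * s + byCase (fun _ _ b => b / 2) (fun _ a _ => a / 2) z k a b ≤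
      40 * s + byCase (fun _ _ b => -((s - 1 / 2) * b)) (fun _ a _ => -((s - 1 / 2) * a))
        (fun k _ _ => -((s - 1 / 2) * k)) k a b + a * s + b * s := by
  have hs0 : 0 < s := by linarith
  unfold Contrib at h
  dsimp only at h
  unfold byCase
  split_ifs with h1 h2
  · have e : (k : ℝ) ≤ a + 3 := by exact_mod_cast (by omega : k ≤ a + 3)
    nlinarith
  · have e : (k : ℝ) ≤ b + 3 := by exact_mod_cast (by omega : k ≤ b + 3)
    nlinarith
  · have e1 : (k : ℝ) ≤ a + 7 := by exact_mod_cast (by omega : k ≤ a + 7)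
    have e2 : (a : ℝ) ≤ b + 4 := by exact_mod_cast (by omega : a ≤ b + 4)
    have f2 := mul_le_mul_of_nonneg_left e2 hs0.le
    rcases hz k a b (by omega) with hz | hz
    · have f1 := mul_le_mul_of_nonneg_left e1 (show 0 ≤ 2 * s - 1 by linarith)
      linarith
    · have f1 := mul_le_mul_of_nonneg_left e1 hs0.le
      linarith

/-- With `δ = α + β - s - 1/2`, the high-low case amounts to `(a - b)(α - (s - 1)) ≥ 0`, and
symmetrically for `β`. The high-high case amounts to `(α + β) k ≤ (α + β) a` up to constants, hence
uses `α + β ≥ 0`. -/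
theorem exponents_Y {s α β : ℝ} (h0 : 0 ≤ α + β) (hα : s - 1 ≤ α) (hβ : s - 1 ≤ β) (k a b : ℕ)
    (h : Contrib k (a, b)) :
    k * s + byCase (fun _ a b => 3 / 2 * b - a) (fun _ a b => 3 / 2 * a - b) (fun k _ _ => k / 2)
        k a b ≤
      3 * |s| + 7 * (α + β) + 4 * |β| +
        byCase (fun _ _ b => -((α + β - s - 1 / 2) * b)) (fun _ a _ => -((α + β - s - 1 / 2) * a))
        (fun k _ _ => -((α + β - s - 1 / 2) * k)) k a b + a * α + b * β := by
  have g1 := abs_nonneg s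
  have g2 := abs_nonneg β
  unfold Contrib at h
  dsimp only at h
  unfold byCase
  split_ifs with h1 h2
  · have e1 : (k : ℝ) ≤ a + 3 := by exact_mod_cast (by omega : k ≤ a + 3)
    have e2 : (a : ℝ) ≤ k + 3 := by exact_mod_cast (by omega : a ≤ k + 3)
    have e3 : (0 : ℝ) ≤ a - b := sub_nonneg.2 (by exact_mod_cast (by omega : b ≤ a))
    have f1 := mul_le_mul_add_abs e1 e2 s
    have f2 := mul_nonneg e3 (show 0 ≤ α - (s - 1) by linarith)
    linarith
  · have e1 : (k : ℝ) ≤ b + 3 := by exact_mod_cast (by omega : k ≤ b + 3)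
    have e2 : (b : ℝ) ≤ k + 3 := by exact_mod_cast (by omega : b ≤ k + 3)
    have e3 : (0 : ℝ) ≤ b - a := sub_nonneg.2 (by exact_mod_cast (by omega : a ≤ b))
    have f1 := mul_le_mul_add_abs e1 e2 s
    have f2 := mul_nonneg e3 (show 0 ≤ β - (s - 1) by linarith)
    linarith
  · have e1 : (k : ℝ) ≤ a + 7 := by exact_mod_cast (by omega : k ≤ a + 7)
    have e2 : (a : ℝ) ≤ b + 4 := by exact_mod_cast (by omega : a ≤ b + 4)
    have e3 : (b : ℝ) ≤ a + 4 := by exact_mod_cast (by omega : b ≤ a + 4)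
    have f1 := mul_le_mul_of_nonneg_left e1 h0
    have f2 := mul_le_mul_add_abs e2 e3 β
    linarith

theorem exponents_lowHigh_Y {s α β : ℝ} (hβ : s - 1 ≤ β) (k a b : ℕ) (h1 : a + 5 ≤ b)
    (h2 : b ≤ k + 3) (h3 : k ≤ b + 3) :
    k * s + (3 / 2 * a - b) ≤ 3 * |s| + -((α + β - s - 1 / 2) * a) + a * α + b * β := by
  have e1 : (k : ℝ) ≤ b + 3 := by exact_mod_cast h3
  have e2 : (b : ℝ) ≤ k + 3 := by exact_mod_cast h2
  have e3 : (0 : ℝ) ≤ b - a := sub_nonneg.2 (by exact_mod_cast (by omega : a ≤ b))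
  have f1 := mul_le_mul_add_abs e1 e2 s
  have f2 := mul_nonneg e3 (show 0 ≤ β - (s - 1) by linarith)
  linarith

theorem exponents_lowHigh {s σ : ℝ} (k a b : ℕ) (_ : a + 5 ≤ b) (h2 : b ≤ k + 3)
    (h3 : k ≤ b + 3) :
    k * s + (a : ℝ) / 2 ≤ 3 * |s| + -((σ - 1 / 2) * a) + a * σ + b * s := by
  have e1 : (k : ℝ) ≤ b + 3 := by exact_mod_cast h3
  have e2 : (b : ℝ) ≤ k + 3 := by exact_mod_cast h2
  have f1 := mul_le_mul_add_abs e1 e2 s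
  linarith

/-- Since both indices are at least `k - 4` and `α, β ≥ 0`, the weights `2^(aα)` and `2^(bβ)` can be
exchanged for `2^((α+β)k)`. There is nothing left to sum, so no gain is asked for. -/
theorem exponents_highHigh_Y {s α β : ℝ} (hα : 0 ≤ α) (hβ : 0 ≤ β) (k a b : ℕ)
    (h : Contrib k (a, b)) (ha : k ≤ a + 4) (hb : k ≤ b + 4) :
    k * s + byCase (fun _ a b => 3 / 2 * b - a) (fun _ a b => 3 / 2 * a - b) (fun k _ _ => k / 2)
        k a b ≤
      4 * α + 4 * β + 10 + (s + 1 / 2 - α - β) * k + a * α + b * β := by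
  have ea : (k : ℝ) ≤ a + 4 := by exact_mod_cast ha
  have eb : (k : ℝ) ≤ b + 4 := by exact_mod_cast hb
  have fa := mul_le_mul_of_nonneg_left ea hα
  have fb := mul_le_mul_of_nonneg_left eb hβ
  unfold Contrib at h
  dsimp only at h
  unfold byCase
  split_ifs with h1 h2
  · have e1 : (a : ℝ) ≤ k + 3 := by exact_mod_cast (by omega : a ≤ k + 3)
    have e2 : (b : ℝ) ≤ a := by exact_mod_cast (by omega : b ≤ a)
    linarith
  · have e1 : (b : ℝ) ≤ k + 3 := by exact_mod_cast (by omega : b ≤ k + 3)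
    have e2 : (a : ℝ) ≤ b := by exact_mod_cast (by omega : a ≤ b)
    linarith
  · linarith

/-- In the comparable case the loss `2^(a-k)` is absorbed because `2σ - 1 ≥ 0` and `k ≤ a + 4`. -/
theorem exponents_highHigh_X {s σ : ℝ} (hσ : 1 / 2 < σ) (k a b : ℕ)
    (h : Contrib k (a, b)) (ha : k ≤ a + 4) (hb : k ≤ b + 4) :
    k * s + byCase (fun _ _ b => b / 2) (fun _ a _ => a / 2) (fun k a _ => k / 2 + (a - k)) k a b ≤
      20 * σ + 10 + (s + 1 / 2 - 2 * σ) * k + a * σ + b * σ := by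
  have ea : (k : ℝ) ≤ a + 4 := by exact_mod_cast ha
  have eb : (k : ℝ) ≤ b + 4 := by exact_mod_cast hb
  have fa := mul_le_mul_of_nonneg_left ea (show 0 ≤ σ by linarith)
  have fb := mul_le_mul_of_nonneg_left eb (show 0 ≤ σ by linarith)
  unfold Contrib at h
  dsimp only at h
  unfold byCase
  split_ifs with h1 h2
  · have e2 : (b : ℝ) ≤ k := by exact_mod_cast (by omega : b ≤ k)
    linarith
  · have e2 : (a : ℝ) ≤ k := by exact_mod_cast (by omega : a ≤ k)
    linarith
  · have e2 : (a : ℝ) ≤ b + 4 := by exact_mod_cast (by omega : a ≤ b + 4)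
    have f2 := mul_le_mul_of_nonneg_left e2 (show 0 ≤ σ by linarith)
    have f3 := mul_le_mul_of_nonneg_left ea (show 0 ≤ 2 * σ - 1 by linarith)
    linarith

/-! ### The algebra property -/

section

variable {φ₀ : ℝ → ℝ}

/-- The distributions are regarded as constant in time, with the norm of `L^∞ L²`. The product
obtained on `[0,1] × ℝ` is evaluated at one of the almost all good times. -/
theorem exists_product_l2H (hφ : IsCutoff φ₀) (P : SpacePartition) {s : ℝ} (hs : 1 / 2 < s) :
    ∃ C : NNReal, ∀ f g : 𝓢'(ℝ, ℂ), l2H φ₀ P s f < ∞ → l2H φ₀ P s g < ∞ →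
      ∃ w, IsProduct φ₀ f g w ∧ l2H φ₀ P s w ≤ C * l2H φ₀ P s f * l2H φ₀ P s g := by
  obtain ⟨K, hK⟩ := exists_product (N := normsH) (N₁ := normsH) hφ normPair_H normPair_H
    (fun _ _ _ => le_rfl) exists_pairBound_H (s := s) (sub_pos.2 hs) (by linarith)
    (exponents_HX hs fun _ _ _ _ => Or.inr le_rfl)
  refine ⟨K, fun f g hf hg => ?_⟩
  obtain ⟨w, h1, h2⟩ := hK _ _ ((l2N_const_le P s f).trans_lt hf) ((l2N_const_le P s g).trans_lt hg)
  obtain ⟨t, h3, h4⟩ := (h1.and (ae_l2H_le P (s := s) (w := w))).exists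
  refine ⟨w t, h3, h4.trans (h2.trans ?_)⟩
  gcongr
  · exact l2N_const_le P s f
  · exact l2N_const_le P s g

end

theorem exists_product_lowHigh_l2H {φ₀ : ℝ → ℝ} (hφ : IsCutoff φ₀) (P : SpacePartition) {s σ : ℝ}
    (hσ : 1 / 2 < σ) :
    ∃ C : NNReal, ∀ (j : ℕ) (f g : 𝓢'(ℝ, ℂ)),
      l2H φ₀ P σ f < ∞ → l2H φ₀ P s (lpProj φ₀ j g) < ∞ →
      ∃ w, IsProduct φ₀ (lpLT φ₀ (j - 4) f) (lpProj φ₀ j g) w ∧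
        l2H φ₀ P s w ≤ C * l2H φ₀ P σ f * l2H φ₀ P s (lpProj φ₀ j g) := by
  obtain ⟨K, hK⟩ := exists_product_lowHigh (N := normsH) (N₁ := normsH) (N₂ := normsH) hφ
    normPair_H normPair_H normPair_H (fun _ _ _ => le_rfl) (fun _ _ => ae_W1_of_NH)
    (x := fun a _ => a / 2) (s := s) (α := σ) (β := s)
    (fun c => by
      obtain ⟨K, hK⟩ := exists_pairBound_H c
      refine ⟨K, fun k a b G H hG hH sG sH fG fH h1 h2 h3 => ?_⟩
      have := hK k a b G H hG hH sG sH fG fH (Or.inr (Or.inl ⟨h1, h2, h3⟩))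
      rwa [byCase, if_neg (by omega), if_pos h1] at this)
    (sub_pos.2 hσ) exponents_lowHigh
  refine ⟨K, fun j f g hf hg => ?_⟩
  obtain ⟨w, h1, h2⟩ := hK j (fun _ => f) (fun _ => g) ((l2N_const_le P σ f).trans_lt hf)
    ((l2N_const_le P s _).trans_lt hg)
  obtain ⟨t, h3, h4⟩ := (h1.and (ae_l2H_le P (s := s) (w := w))).exists
  refine ⟨w t, h3, h4.trans (h2.trans ?_)⟩
  gcongr
  · exact l2N_const_le P σ f
  · exact l2N_const_le P s _

end BilinearKdV

open BilinearKdV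

/-! ### Assembly of the estimates -/

theorem mainTheorem5 (φ₀ : ℝ → ℝ) (hφ₀ : IsCutoff φ₀) (P : SpacePartition) :
    -- a) algebra estimates
    (∀ s : ℝ, 1 / 2 < s → ∃ C : NNReal, ∀ f g : 𝓢'(ℝ, ℂ),
      l2H φ₀ P s f < ∞ → l2H φ₀ P s g < ∞ →
      ∃ w, IsProduct φ₀ f g w ∧
        l2H φ₀ P s w ≤
          C * l2H φ₀ P s f * l2H φ₀ P s g) ∧
    (∀ s : ℝ, 1 / 2 < s → ∃ C : NNReal, ∀ u v : ℝ → 𝓢'(ℝ, ℂ),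
      l2X φ₀ P s u < ∞ → l2X φ₀ P s v < ∞ →
      ∃ w, IsProductST φ₀ u v w ∧
        l2X φ₀ P s w ≤
          C * l2X φ₀ P s u * l2X φ₀ P s v ∧
        (ContinuousInH φ₀ P s u → ContinuousInH φ₀ P s v →
          ContinuousInH φ₀ P s w)) ∧
    -- b) bilinear estimate
    (∀ s α β : ℝ, s + 1 / 2 < α + β → s - 1 ≤ α → s - 1 ≤ β → 0 ≤ α + β →
      ∃ C : NNReal, ∀ u v : ℝ → 𝓢'(ℝ, ℂ),
      l2X φ₀ P α u < ∞ → l2X φ₀ P β v < ∞ →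
      ∃ w, IsProductST φ₀ u v w ∧
        l2Y φ₀ P s w ≤
          C * l2X φ₀ P α u * l2X φ₀ P β v) ∧
    -- c) frequency localised bilinear estimates, I
    (∀ s α β : ℝ, s + 1 / 2 < α + β → s - 1 ≤ β →
      ∃ C : NNReal, ∀ (j : ℕ) (u v : ℝ → 𝓢'(ℝ, ℂ)),
      l2X φ₀ P α u < ∞ →
      l2X φ₀ P β (fun t => lpProj φ₀ j (v t)) < ∞ →
      ∃ w, IsProductST φ₀ (fun t => lpLT φ₀ (j - 4) (u t))
          (fun t => lpProj φ₀ j (v t)) w ∧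
        l2Y φ₀ P s w ≤
          C * l2X φ₀ P α u *
            l2X φ₀ P β (fun t => lpProj φ₀ j (v t))) ∧
    (∀ s α β : ℝ, s + 1 / 2 < α + β → 0 ≤ α → 0 ≤ β →
      ∃ C : NNReal, ∀ (j : ℕ) (u v : ℝ → 𝓢'(ℝ, ℂ)),
      l2X φ₀ P α u < ∞ → l2X φ₀ P β v < ∞ →
      ∃ w, IsProductST φ₀ (fun t => lpGE φ₀ (j - 4) (u t))
          (fun t => lpGE φ₀ (j - 4) (v t)) w ∧
        l2Y φ₀ P s (fun t => lpProj φ₀ j (w t)) ≤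
          C * (2 : ℝ≥0∞) ^ ((s + 1 / 2 - α - β) * j) *
            l2X φ₀ P α u * l2X φ₀ P β v) ∧
    -- d) frequency localised bilinear estimates, II
    (∀ s σ : ℝ, 0 ≤ s → 1 / 2 < σ → ∃ C : NNReal, ∀ (j : ℕ) (f g : 𝓢'(ℝ, ℂ)),
      l2H φ₀ P σ f < ∞ → l2H φ₀ P s (lpProj φ₀ j g) < ∞ →
      ∃ w, IsProduct φ₀ (lpLT φ₀ (j - 4) f) (lpProj φ₀ j g) w ∧
        l2H φ₀ P s w ≤
          C * l2H φ₀ P σ f * l2H φ₀ P s (lpProj φ₀ j g)) ∧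
    (∀ s σ : ℝ, 0 ≤ s → 1 / 2 < σ → ∃ C : NNReal, ∀ (j : ℕ) (u v : ℝ → 𝓢'(ℝ, ℂ)),
      l2X φ₀ P σ u < ∞ →
      l2X φ₀ P s (fun t => lpProj φ₀ j (v t)) < ∞ →
      ∃ w, IsProductST φ₀ (fun t => lpLT φ₀ (j - 4) (u t))
          (fun t => lpProj φ₀ j (v t)) w ∧
        l2X φ₀ P s w ≤
          C * l2X φ₀ P σ u *
            l2X φ₀ P s (fun t => lpProj φ₀ j (v t))) ∧
    (∀ s σ : ℝ, 0 ≤ s → 1 / 2 < σ → ∃ C : NNReal, ∀ (j : ℕ) (u v : ℝ → 𝓢'(ℝ, ℂ)),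
      l2X φ₀ P σ u < ∞ → l2X φ₀ P σ v < ∞ →
      ∃ w, IsProductST φ₀ (fun t => lpGE φ₀ (j - 4) (u t))
          (fun t => lpGE φ₀ (j - 4) (v t)) w ∧
        l2X φ₀ P s (fun t => lpProj φ₀ j (w t)) ≤
          C * (2 : ℝ≥0∞) ^ ((s + 1 / 2 - 2 * σ) * j) *
            l2X φ₀ P σ u * l2X φ₀ P σ v) ∧
    (∀ s σ : ℝ, 0 ≤ s → 1 / 2 < σ → ∃ C : NNReal, ∀ (j : ℕ) (u v : ℝ → 𝓢'(ℝ, ℂ)),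
      l2X φ₀ P σ u < ∞ →
      l2Y φ₀ P s (fun t => lpProj φ₀ j (v t)) < ∞ →
      ∃ w, IsProductST φ₀ (fun t => lpLT φ₀ (j - 4) (u t))
          (fun t => lpProj φ₀ j (v t)) w ∧
        l2Y φ₀ P s w ≤
          C * l2X φ₀ P σ u *
            l2Y φ₀ P s (fun t => lpProj φ₀ j (v t))) := by
  obtain ⟨CX, hX⟩ := exists_normPair_X P
  obtain ⟨CY, hY⟩ := exists_normPair_Y P
  have hHX : ∀ a G, Measurable G → NH G ≤ NX P a G := fun a G hG => NH_le_NX P a hG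
  have hWX : ∀ (j : ℕ) (V : ℝ × ℝ → ℂ), Measurable V → NX P j (fun p => ‖V p‖ₑ) ≠ ⊤ →
      ∀ᵐ t ∂timeMeasure, W1 (fun x => V (t, x)) := fun j V hV h =>
    ae_W1_of_NH hV (ne_top_of_le_ne_top h (NH_le_NX P j hV.enorm))
  refine ⟨fun s hs => exists_product_l2H hφ₀ P hs, fun s hs => ?_, fun s α β h h1 h2 h0 => ?_,
    fun s α β h h1 => ?_, fun s α β h h1 h2 => ?_,
    fun s σ _ hσ => exists_product_lowHigh_l2H hφ₀ P hσ, fun s σ _ hσ => ?_, fun s σ _ hσ => ?_,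
    fun s σ _ hσ => ?_⟩
  · obtain ⟨K, hK⟩ := exists_product hφ₀ hX hX hHX (exists_pairBound_X P) (s := s)
      (sub_pos.2 hs) (by linarith) (exponents_HX hs fun _ _ _ _ => Or.inl le_rfl)
    obtain ⟨C, hC⟩ := exists_product_l2H hφ₀ P hs
    refine ⟨K, fun u v hu hv => ?_⟩
    obtain ⟨w₀, h1, h2⟩ := hK u v hu hv
    classical
    -- The product from the estimate is only determined at almost every time. It is replaced by the
    -- product at every time where one exists; by uniqueness this changes nothing almost everywhere,
    -- and continuity then holds at all times of `[0,1]`.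
    let w : ℝ → 𝓢'(ℝ, ℂ) := fun t =>
      if h : ∃ z, IsProduct φ₀ (u t) (v t) z then h.choose else 0
    have hw : ∀ t, (∃ z, IsProduct φ₀ (u t) (v t) z) → IsProduct φ₀ (u t) (v t) (w t) :=
      fun t h => by
        simp only [w, dif_pos h]
        exact h.choose_spec
    have h3 : IsProductST φ₀ u v w := h1.mono fun t ht => hw t ⟨_, ht⟩
    refine ⟨w, h3, (le_of_eq ?_).trans h2, fun cu cv => continuousInH_product P hC cu cv hw⟩
    exact l2N_congr (by filter_upwards [h1, h3] with t e1 e2 using e2.unique e1)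
  · exact exists_product hφ₀ hY hX hHX (exists_pairBound_Y P)
      -- The strict inequality between the exponents is exactly the positivity of the gain `δ`.
      (show 0 < α + β - s - 1 / 2 by linarith) h0 (exponents_Y h0 h1 h2)
  · exact exists_product_lowHigh hφ₀ hY hX hX hHX hWX (x := fun a b => 3 / 2 * a - b)
      (fun c => by
        obtain ⟨K, hK⟩ := exists_pairBound_Y P c
        refine ⟨K, fun k a b G H hG hH sG sH fG fH h1 h2 h3 => ?_⟩
        have := hK k a b G H hG hH sG sH fG (ne_top_of_le_ne_top fH (NH_le_NX P b hH))
          (Or.inr (Or.inl ⟨h1, h2, h3⟩))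
        rwa [byCase, if_neg (by omega), if_pos h1] at this)
      (show 0 < α + β - s - 1 / 2 by linarith) (exponents_lowHigh_Y h1)
  · exact exists_product_highHigh hφ₀ hY hX hHX (exists_pairBound_Y P) (by linarith)
      (exponents_highHigh_Y h1 h2)
  · exact exists_product_lowHigh hφ₀ hX hX hX hHX hWX (x := fun a _ => a / 2)
      (fun c => by
        obtain ⟨K, hK⟩ := exists_pairBound_X P c
        refine ⟨K, fun k a b G H hG hH sG sH fG fH h1 h2 h3 => ?_⟩
        have := hK k a b G H hG hH sG sH fG (ne_top_of_le_ne_top fH (NH_le_NX P b hH))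
          (Or.inr (Or.inl ⟨h1, h2, h3⟩))
        rwa [byCase, if_neg (by omega), if_pos h1] at this)
      (sub_pos.2 hσ) exponents_lowHigh
  · exact exists_product_highHigh hφ₀ hX hX hHX (exists_pairBound_X P) (by linarith)
      (exponents_highHigh_X hσ)
  -- The high factor is measured in `Y`, so its integrability against the weight comes from
  -- `ae_W1_of_NYb` instead of an `L²` bound.
  · exact exists_product_lowHigh hφ₀ hY hX hY hHX (fun _ _ => ae_W1_of_NYb P)
      (x := fun a _ => a / 2)
      (fun c => by
        obtain ⟨K, hK⟩ := exists_lowHigh_XY P c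
        exact ⟨K, fun k a b G H hG hH sG _ fG _ _ h2 h3 => hK k a b G H hG hH sG fG h2 h3⟩)
      (sub_pos.2 hσ) exponents_lowHigh
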